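/- Let $k$ be a field of characteristic $0$, regarded as discrete (e.g. $k=\mathbb C$). Let $\mathfrak g$ be a Tate Lie algebra over $k$: a complete Hausdorff topological vector space with a base of neighbourhoods of $0$ consisting of mutually commensurable subspaces, with a continuous Lie bracket. Let $\mathfrak b\subset\mathfrak g$ be a Lie subalgebra that is a c-lattice (an open bounded subspace), put $\mathfrak c=\mathfrak g/\mathfrak b$, and fix a linear section $s$ of $\mathfrak g\to\mathfrak c$, i.e. a decomposition $\mathfrak g=\mathfrak b\oplus\mathfrak c$. Duals are Tate (continuous) duals and tensor products with them are completed. *The critical extension.* For $x\in\mathfrak g$ write $x_{\mathfrak{cb}}:\mathfrak b\to\mathfrak c$ and $x_{\mathfrak{bc}}:\mathfrak c\to\mathfrak b$ for the blocks of $\operatorname{ad}x$. The critical cocycle is $\omega(x,y)=\operatorname{tr}_{\mathfrak c}(x_{\mathfrak{cb}}y_{\mathfrak{bc}}-y_{\mathfrak{cb}}x_{\mathfrak{bc}})$ (the trace of an operator of finite rank), and $\mathfrak g^\sharp=\mathfrak g\oplus kK$ is the central extension with bracket $[x,y]^\sharp=[x,y]+\omega(x,y)K$. Let $M^\sharp$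 be a discrete $\mathfrak g^\sharp$-module on which $K$ acts by $1$. *The standard semiinfinite complex.* Let $R=\Lambda(\mathfrak c^*)$, with $R_p=(\Lambda^p\mathfrak c)^*$, and $A=\mathfrak b\otimes\Lambda(\mathfrak c^*)$, with $A_p=\operatorname{Hom}(\Lambda^p\mathfrak c,\mathfrak b)$. Then $A$ is a graded Lie algebroid over $R$, with $b\in\mathfrak b$ acting on $R$ by the coadjoint action on $\mathfrak c^*=(\mathfrak g/\mathfrak b)^*$ and $[rb,r'b']=rr'[b,b']+r\,b(r')b'-(-1)^{|r||r'|}r'\,b'(r)b$. It carries the degree-one derivations $d_R$, generated by $(d_Rf)(x,y)=-f([sx,sy]_{\mathfrak c})$ for $f\in\mathfrak c^*$, and $d_A$, where $d_A(rb)=d_R(r)b+(-1)^{|r|}r\,d_{\mathfrak b}(b)$ and $d_{\mathfrak b}(b)(x)=[sx,b]_{\mathfrak b}$, and the curvature $h\in A_2$, $h(x,y)=[sx,sy]_{\mathfrak b}$. Let $N=M^\sharp\otimes\Lambda(\mathfrak c)$, with $M^\sharp\otimes\Lambda^j(\mathfrak c)$ in degree $-j$; $R$ acts on $N$ by contraction,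 $b\in\mathfrak b$ acts by the tensor product of its actions on $M^\sharp$ and $\Lambda(\mathfrak c)$, $r\otimes b\in A$ acts by $n\mapsto r(bn)$ (extended by continuity), and $d_N(m\otimes x_1\wedge\dots\wedge x_n)=\sum_i(-1)^{n-i}(sx_i)m\otimes x_1\wedge\dots\hat x_i\dots\wedge x_n+(-1)^n\sum_{i<j}(-1)^{i+j}m\otimes[sx_i,sx_j]_{\mathfrak c}\wedge x_1\wedge\dots\hat x_i\dots\hat x_j\dots\wedge x_n$. The standard semiinfinite complex $C^{\frac\infty2+\bullet}(\mathfrak g,M^\sharp)=\operatorname{Hom}_R(\Lambda_R(A),N)$ has as its component of degree $n$ the direct sum over $m\ge 0$ of the spaces of continuous, super-alternating, $R$-multilinear maps $f$ of degree $n-m$ of $m$ arguments in $A$. Its differential is $d_1+d_2$, where, with $|f|=n-m$, $$(d_1f)(a_1,\dots,a_{m+1})=\sum_i\pm a_if(\dots\hat a_i\dots)+\sum_{i<j}\pm f([a_i,a_j],\dots\hat a_i\dots\hat a_j\dots)$$ in arity $m+1$, with signs $(-1)^{i+|a_i|(|f|+|a_1|+\dots+|a_{i-1}|)}$ and $(-1)^{i+j+1+|a_i|\sum_{l<i}|a_l|+|a_j|\sum_{l<j,\,l\ne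 i}|a_l|}$ respectively, plus $(-1)^m\big(d_Nf(a_1,\dots,a_m)-\sum_i(-1)^{|f|+|a_1|+\dots+|a_{i-1}|}f(\dots,d_Aa_i,\dots)\big)$ in arity $m$; and $(d_2f)(a_1,\dots,a_{m-1})=f(h,a_1,\dots,a_{m-1})$. *The Beilinson–Drinfeld complex.* Let $F=\mathrm{Cl}/\mathrm{Cl}\cdot(\mathfrak b\oplus\mathfrak b^\perp)$, where $\mathrm{Cl}$ is the Clifford algebra of $\mathfrak g\oplus\mathfrak g^*$ with the quadratic form $(x,f)\mapsto f(x)$ and $\mathfrak b^\perp\subset\mathfrak g^*$ is the annihilator of $\mathfrak b$. Let $\iota_x$ ($x\in\mathfrak g$, degree $-1$) and $\varepsilon_f$ ($f\in\mathfrak g^*$, degree $1$) be the Clifford operators, the vacuum $v$ (the class of $1$) being of degree $0$. For $x\in\mathfrak g$ let $\theta_x$ be the operator on $F$ with $[\theta_x,\iota_y]=\iota_{[x,y]}$, $[\theta_x,\varepsilon_f]=\varepsilon_{x\cdot f}$ (coadjoint action) and $\theta_xv\in\sum_{c\in\mathfrak c}\iota_{s c}F$. The complex is $M^\sharp\otimes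 F$, with $M^\sharp$ in degree $0$, and its differential $d$ is the operator of degree $1$ with $d\iota_x+\iota_xd=x|_{M^\sharp}\otimes1+1\otimes\theta_x$ for all $x\in\mathfrak g$. Its cohomology is the semiinfinite cohomology of $\mathfrak g$ with coefficients in $M^\sharp$ in the sense of Beilinson and Drinfeld. **Theorem.** The differential of $C^{\frac\infty2+\bullet}(\mathfrak g,M^\sharp)$ is well defined, of degree $1$ and of square zero, and: (i) as a graded vector space, $C^{\frac\infty2+\bullet}(\mathfrak g,M^\sharp)\cong\Lambda^\bullet(\mathfrak b^*)\otimes\Lambda^\bullet(\mathfrak g/\mathfrak b)\otimes M^\sharp$, where $\mathfrak b^*$, $\mathfrak g/\mathfrak b$ and $M^\sharp$ are of degrees $1$, $-1$ and $0$; (ii) the operators $\theta_x$ and the differential $d$ of $M^\sharp\otimes F$ exist and are unique, $d^2=0$, and the cohomology of $C^{\frac\infty2+\bullet}(\mathfrak g,M^\sharp)$ coincides with the Beilinson–Drinfeld semiinfinite cohomology of $\mathfrak g$ with coefficients in $M^\sharp$; more precisely, there is an isomorphism of complexes $C^{\frac\infty2+\bullet}(\mathfrak g,M^\sharp)\cong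 M^\sharp\otimes F$, and it induces isomorphisms of the cohomology spaces in all degrees. -/

import Mathlib

open TensorProduct Topology

namespace SemiInf

/-! ## Tate spaces -/

section Tate

variable (k : Type*) [Field k]

/-- A Tate space: a complete (Hausdorff) topological vector space over the discrete field `k` which
has a base of neighbourhoods of `0` consisting of pairwise commensurable subspaces. -/
structure IsTateSpace (V : Type*) [AddCommGroup V] [Module k V] [UniformSpace V]
    [IsUniformAddGroup V] : Prop where
  complete : CompleteSpace V
  t2 : T2Space V
  exists_basis : ∃ B : Set (Submodule k V),
    (𝓝 (0 : V)).HasBasis (fun U => U ∈ B) (fun U => (U : Set V)) ∧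
    ∀ U₁ ∈ B, ∀ U₂ ∈ B, FiniteDimensional k (U₁ ⧸ U₂.submoduleOf U₁)

/-- A Tate Lie algebra: a Tate space with a continuous Lie bracket. -/
structure IsTateLieAlgebra (𝔤 : Type*) [LieRing 𝔤] [LieAlgebra k 𝔤] [UniformSpace 𝔤]
    [IsUniformAddGroup 𝔤] : Prop extends IsTateSpace k 𝔤 where
  continuous_lie : Continuous fun p : 𝔤 × 𝔤 => ⁅p.1, p.2⁆

variable {k}

/-- A c-lattice: an open bounded subspace. -/
structure IsCLattice {V : Type*} [AddCommGroup V] [Module k V] [TopologicalSpace V]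
    (P : Submodule k V) : Prop where
  isOpen : IsOpen (P : Set V)
  bounded : ∀ U : Submodule k V, IsOpen (U : Set V) →
    ∃ F : Finset V, P ≤ U ⊔ Submodule.span k (F : Set V)

variable (k)

/-- The space of continuous linear functionals on `V` (with `k` discrete), i.e. of the functionals
that vanish on a neighbourhood of `0`. -/
def tateDual (V : Type*) [AddCommGroup V] [Module k V] [TopologicalSpace V] :
    Submodule k (Module.Dual k V) where
  carrier := {f | ∀ᶠ v in 𝓝 (0 : V), f v = 0}
  add_mem' {f g} hf hg := by
    filter_upwards [hf, hg] with v h₁ h₂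
    simp [h₁, h₂]
  zero_mem' := by simp
  smul_mem' c f hf := by
    filter_upwards [hf] with v h
    simp [h]

end Tate

/-! ## The trace of an endomorphism of finite rank -/

section Trace

variable {k : Type*} [Field k] {V : Type*} [AddCommGroup V] [Module k V]

/-- The trace of an endomorphism of finite rank: the trace of its restriction to its range. -/
noncomputable def finTrace (T : Module.End k V) : k :=
  LinearMap.trace k (LinearMap.range T) (T.rangeRestrict ∘ₗ (LinearMap.range T).subtype)

theorem finTrace_eq_of_range_le (T : Module.End k V) (W : Submodule k V) [FiniteDimensional k W]
    (h : ∀ v, T v ∈ W) :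
    finTrace T = LinearMap.trace k W ((T.codRestrict W h) ∘ₗ W.subtype) := by
  have hle : LinearMap.range T ≤ W := by
    rintro _ ⟨v, rfl⟩
    exact h v
  have : FiniteDimensional k (LinearMap.range T) := Submodule.finiteDimensional_of_le hle
  have key := LinearMap.trace_comp_comm' (R := k) (Submodule.inclusion hle)
    (T.rangeRestrict ∘ₗ W.subtype)
  unfold finTrace
  exact key

theorem finTrace_add (S T : Module.End k V) (hS : FiniteDimensional k (LinearMap.range S))
    (hT : FiniteDimensional k (LinearMap.range T)) :
    finTrace (S + T) = finTrace S + finTrace T := by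
  let W := LinearMap.range S ⊔ LinearMap.range T
  have h₁ : ∀ v, S v ∈ W := fun v => Submodule.mem_sup_left ⟨v, rfl⟩
  have h₂ : ∀ v, T v ∈ W := fun v => Submodule.mem_sup_right ⟨v, rfl⟩
  have h₃ : ∀ v, (S + T) v ∈ W := fun v => W.add_mem (h₁ v) (h₂ v)
  rw [finTrace_eq_of_range_le S W h₁, finTrace_eq_of_range_le T W h₂,
    finTrace_eq_of_range_le (S + T) W h₃, ← map_add]
  congr 1

theorem finTrace_smul (c : k) (T : Module.End k V)
    (hT : FiniteDimensional k (LinearMap.range T)) :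
    finTrace (c • T) = c * finTrace T := by
  have h₂ : ∀ v, T v ∈ LinearMap.range T := fun v => ⟨v, rfl⟩
  have h₃ : ∀ v, (c • T) v ∈ LinearMap.range T :=
    fun v => (LinearMap.range T).smul_mem c (h₂ v)
  rw [finTrace_eq_of_range_le T _ h₂, finTrace_eq_of_range_le (c • T) _ h₃, ← smul_eq_mul,
    ← map_smul]
  congr 1

theorem finTrace_comm (F G : Module.End k V) (hF : FiniteDimensional k (LinearMap.range F)) :
    finTrace (F ∘ₗ G) = finTrace (G ∘ₗ F) := by
  let W := LinearMap.range F
  let W' := W.map G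
  have h₁ : ∀ v, (F ∘ₗ G) v ∈ W := fun v => ⟨G v, rfl⟩
  have h₂ : ∀ v, (G ∘ₗ F) v ∈ W' := fun v => ⟨F v, ⟨v, rfl⟩, rfl⟩
  rw [finTrace_eq_of_range_le _ W h₁, finTrace_eq_of_range_le _ W' h₂]
  let p : W →ₗ[k] W' := (G ∘ₗ W.subtype).codRestrict W' fun w => ⟨w, w.2, rfl⟩
  let q : W' →ₗ[k] W := F.rangeRestrict ∘ₗ W'.subtype
  have key := LinearMap.trace_comp_comm' (R := k) p q
  exact key

end Trace


/-! ## The coalgebra structure of the exterior algebra -/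

section Exterior

variable (k : Type*) [Field k] (V : Type*) [AddCommGroup V] [Module k V]

/-- The operator of multiplication by `x ⊗ 1 + 1 ⊗ x` on the super tensor product `Λ(V) ⊗ Λ(V)`;
by the sign rule, `(1 ⊗ x) (u ⊗ v) = (-1) ^ |u| u ⊗ x v`. -/
noncomputable def comulStep :
    V →ₗ[k] Module.End k (ExteriorAlgebra k V ⊗[k] ExteriorAlgebra k V) :=
  ((TensorProduct.mapBilinear (RingHom.id k) (ExteriorAlgebra k V) (ExteriorAlgebra k V)
      (ExteriorAlgebra k V) (ExteriorAlgebra k V)).flip LinearMap.id +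
    TensorProduct.mapBilinear (RingHom.id k) (ExteriorAlgebra k V) (ExteriorAlgebra k V)
      (ExteriorAlgebra k V) (ExteriorAlgebra k V)
      (CliffordAlgebra.involute (Q := (0 : QuadraticForm k V))).toLinearMap) ∘ₗ
    LinearMap.mul k (ExteriorAlgebra k V) ∘ₗ ExteriorAlgebra.ι k

theorem comulStep_tmul (x : V) (u v : ExteriorAlgebra k V) :
    comulStep k V x (u ⊗ₜ v) = (ExteriorAlgebra.ι k x * u) ⊗ₜ v +
      CliffordAlgebra.involute u ⊗ₜ (ExteriorAlgebra.ι k x * v) := rfl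

theorem comulStep_comulStep (x : V) (t : ExteriorAlgebra k V ⊗[k] ExteriorAlgebra k V) :
    comulStep k V x (comulStep k V x t) = (0 : QuadraticForm k V) x • t := by
  rw [zero_apply, zero_smul]
  induction t with
  | zero => simp
  | add a b ha hb => rw [map_add, map_add, ha, hb, add_zero]
  | tmul u v =>
    have h : ExteriorAlgebra.ι k x * ExteriorAlgebra.ι k x = 0 := ExteriorAlgebra.ι_sq_zero x
    have hi : CliffordAlgebra.involute (ExteriorAlgebra.ι k x) = -ExteriorAlgebra.ι k x :=
      CliffordAlgebra.involute_ι x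
    rw [comulStep_tmul, map_add, comulStep_tmul, comulStep_tmul, ← mul_assoc, ← mul_assoc, h,
      zero_mul, zero_mul, map_mul, hi, neg_mul, TensorProduct.neg_tmul, TensorProduct.zero_tmul,
      TensorProduct.tmul_zero]
    abel

/-- The comultiplication of `Λ(V)`: the morphism of superalgebras `Λ(V) → Λ(V) ⊗ Λ(V)` with
`x ↦ x ⊗ 1 + 1 ⊗ x` for `x ∈ V`. -/
noncomputable def comul :
    ExteriorAlgebra k V →ₗ[k] ExteriorAlgebra k V ⊗[k] ExteriorAlgebra k V :=
  CliffordAlgebra.foldr (0 : QuadraticForm k V) (comulStep k V) (comulStep_comulStep k V)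
    (1 ⊗ₜ 1)

theorem comul_one : comul k V 1 = 1 ⊗ₜ 1 := CliffordAlgebra.foldr_one _ _ _ _

theorem comul_ι_mul (x : V) (w : ExteriorAlgebra k V) :
    comul k V (ExteriorAlgebra.ι k x * w) = comulStep k V x (comul k V w) := by
  unfold comul
  rw [CliffordAlgebra.foldr_mul]
  exact CliffordAlgebra.foldr_ι _ _ _ _ _

variable {k V}

/-- For `F : Λ(V) → X`, `G : Λ(V) → Y` and a bilinear map `m : X × Y → Z`, the convolution
`w ↦ ∑ m (F w₁, G w₂)`, where `∑ w₁ ⊗ w₂` is the comultiplication of `w`. -/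
noncomputable def conv {X Y Z : Type*} [AddCommGroup X] [Module k X] [AddCommGroup Y] [Module k Y]
    [AddCommGroup Z] [Module k Z] (m : X →ₗ[k] Y →ₗ[k] Z) (F : ExteriorAlgebra k V →ₗ[k] X)
    (G : ExteriorAlgebra k V →ₗ[k] Y) : ExteriorAlgebra k V →ₗ[k] Z :=
  TensorProduct.lift m ∘ₗ TensorProduct.map F G ∘ₗ comul k V

/-- The extension of a `p`-form on `V` to a linear map on `Λ(V)`, by zero outside `Λᵖ(V)`. -/
noncomputable def extendForm {X : Type*} [AddCommGroup X] [Module k X] {p : ℕ}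
    (f : V [⋀^Fin p]→ₗ[k] X) : ExteriorAlgebra k V →ₗ[k] X :=
  ExteriorAlgebra.liftAlternating (Pi.single (M := fun i => V [⋀^Fin i]→ₗ[k] X) p f)

/-- The component of degree `p` of a linear map on `Λ(V)`, as a `p`-form on `V`. -/
noncomputable def formPart {X : Type*} [AddCommGroup X] [Module k X] (p : ℕ)
    (F : ExteriorAlgebra k V →ₗ[k] X) : V [⋀^Fin p]→ₗ[k] X :=
  F.compAlternatingMap (ExteriorAlgebra.ιMulti k p)

/-- The derivation of `Λ(V)` that extends an endomorphism `T` of `V`: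
`x₁ ∧ ⋯ ∧ xₙ ↦ ∑ᵢ x₁ ∧ ⋯ ∧ T xᵢ ∧ ⋯ ∧ xₙ`. -/
noncomputable def derExt : Module.End k V →ₗ[k] Module.End k (ExteriorAlgebra k V) where
  toFun T := conv (LinearMap.mul k (ExteriorAlgebra k V))
    (ExteriorAlgebra.ι k ∘ₗ T ∘ₗ ExteriorAlgebra.ιInv) LinearMap.id
  map_add' S T := by
    simp only [conv, LinearMap.add_comp, LinearMap.comp_add, TensorProduct.map_add_left]
  map_smul' c T := by
    simp only [conv, LinearMap.smul_comp, LinearMap.comp_smul, TensorProduct.map_smul_left,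
      RingHom.id_apply]

/-- For a bilinear alternating map `β` on `V` with values in `V`, the operator
`x₁ ∧ ⋯ ∧ xₙ ↦ ∑_{i < j} (-1) ^ (i + j + 1) β(xᵢ, xⱼ) ∧ x₁ ∧ ⋯ x̂ᵢ ⋯ x̂ⱼ ⋯ ∧ xₙ` on `Λ(V)`. -/
noncomputable def coderExt (β : V [⋀^Fin 2]→ₗ[k] V) : Module.End k (ExteriorAlgebra k V) :=
  conv (LinearMap.mul k (ExteriorAlgebra k V)) (ExteriorAlgebra.ι k ∘ₗ extendForm β) LinearMap.id

end Exterior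

/-! ## Split Tate Lie algebras, the critical cocycle and the critical extension -/

/-- A Tate Lie algebra `𝔤` with a Lie subalgebra `𝔟` which is a c-lattice and a linear section of
the projection `𝔤 → 𝔠 = 𝔤 / 𝔟`, i.e. a decomposition `𝔤 = 𝔟 ⊕ 𝔠`. -/
structure SplitTate (k : Type*) [Field k] (𝔤 : Type*) [LieRing 𝔤] [LieAlgebra k 𝔤]
    [UniformSpace 𝔤] [IsUniformAddGroup 𝔤] where
  isTate : IsTateLieAlgebra k 𝔤
  𝔟 : LieSubalgebra k 𝔤
  isCLattice : IsCLattice 𝔟.toSubmodule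
  sec : (𝔤 ⧸ 𝔟.toSubmodule) →ₗ[k] 𝔤
  mkQ_comp_sec : 𝔟.toSubmodule.mkQ ∘ₗ sec = LinearMap.id

namespace SplitTate

section Extension

variable {k : Type*} [Field k] {𝔤 : Type*} [LieRing 𝔤] [LieAlgebra k 𝔤] [UniformSpace 𝔤]
  [IsUniformAddGroup 𝔤] (D : SplitTate k 𝔤)

/-- The discrete space `𝔠 = 𝔤 / 𝔟`. -/
abbrev 𝔠 : Type _ := 𝔤 ⧸ D.𝔟.toSubmodule

/-- The projection `𝔤 → 𝔠`. -/
abbrev pr𝔠 : 𝔤 →ₗ[k] D.𝔠 := D.𝔟.toSubmodule.mkQ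

/-- The inclusion `𝔟 → 𝔤`. -/
abbrev in𝔟 : D.𝔟 →ₗ[k] 𝔤 := D.𝔟.toSubmodule.subtype

theorem pr𝔠_sec (x : D.𝔠) : D.pr𝔠 (D.sec x) = x := LinearMap.congr_fun D.mkQ_comp_sec x

/-- The projection `𝔤 → 𝔟` along the image of the section. -/
def pr𝔟 : 𝔤 →ₗ[k] D.𝔟 :=
  (LinearMap.id - D.sec ∘ₗ D.pr𝔠).codRestrict D.𝔟.toSubmodule fun x => by
    rw [← Submodule.Quotient.mk_eq_zero, ← Submodule.mkQ_apply]
    simp only [LinearMap.sub_apply, LinearMap.id_apply, LinearMap.comp_apply, map_sub]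
    rw [D.pr𝔠_sec, sub_self]

theorem in𝔟_pr𝔟 (x : 𝔤) : D.in𝔟 (D.pr𝔟 x) = x - D.sec (D.pr𝔠 x) := rfl

/-- The block `𝔟 → 𝔠` of an endomorphism of `𝔤 = 𝔟 ⊕ 𝔠`. -/
def block𝔟𝔠 (X : Module.End k 𝔤) : D.𝔟 →ₗ[k] D.𝔠 := D.pr𝔠 ∘ₗ X ∘ₗ D.in𝔟

/-- The block `𝔠 → 𝔟` of an endomorphism of `𝔤 = 𝔟 ⊕ 𝔠`. -/
def block𝔠𝔟 (X : Module.End k 𝔤) : D.𝔠 →ₗ[k] D.𝔟 := D.pr𝔟 ∘ₗ X ∘ₗ D.sec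

/-- The block `𝔠 → 𝔠` of an endomorphism of `𝔤 = 𝔟 ⊕ 𝔠`. -/
def block𝔠𝔠 (X : Module.End k 𝔤) : Module.End k D.𝔠 := D.pr𝔠 ∘ₗ X ∘ₗ D.sec

/-- The endomorphism of `𝔠` whose trace is the critical cocycle. -/
def criticalEnd (X Y : Module.End k 𝔤) : Module.End k D.𝔠 :=
  D.block𝔟𝔠 X ∘ₗ D.block𝔠𝔟 Y - D.block𝔟𝔠 Y ∘ₗ D.block𝔠𝔟 X

/-- The critical `2`-cocycle on continuous endomorphisms of the Tate space `𝔤 = 𝔟 ⊕ 𝔠`. -/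
noncomputable def criticalCocycleEnd (X Y : Module.End k 𝔤) : k := finTrace (D.criticalEnd X Y)

/-- The critical `2`-cocycle of `𝔤`: the pull-back along the adjoint action. -/
noncomputable def criticalCocycle (x y : 𝔤) : k :=
  D.criticalCocycleEnd (LieAlgebra.ad k 𝔤 x) (LieAlgebra.ad k 𝔤 y)

theorem continuous_ad (D : SplitTate k 𝔤) (x : 𝔤) : Continuous (LieAlgebra.ad k 𝔤 x) :=
  D.isTate.continuous_lie.comp (continuous_const.prodMk continuous_id)

/-- A linear map from `𝔟` that vanishes on an open subspace has finite rank. -/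
theorem finite_range_of_open {V : Type*} [AddCommGroup V] [Module k V] (f : D.𝔟 →ₗ[k] V)
    (U : Submodule k 𝔤) (hU : IsOpen (U : Set 𝔤)) (h : ∀ b : D.𝔟, (b : 𝔤) ∈ U → f b = 0) :
    FiniteDimensional k (LinearMap.range f) := by
  obtain ⟨F, hF⟩ := D.isCLattice.bounded (U ⊓ D.𝔟.toSubmodule)
    (hU.inter D.isCLattice.isOpen)
  have : FiniteDimensional k (Submodule.map (f ∘ₗ D.pr𝔟) (Submodule.span k (F : Set 𝔤))) := by
    have : FiniteDimensional k (Submodule.span k (F : Set 𝔤)) :=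
      FiniteDimensional.span_finset k F
    infer_instance
  refine Submodule.finiteDimensional_of_le
    (S₂ := Submodule.map (f ∘ₗ D.pr𝔟) (Submodule.span k (F : Set 𝔤))) ?_
  rintro _ ⟨b, rfl⟩
  obtain ⟨u, ⟨hu, hub⟩, v, hv, huv⟩ := Submodule.mem_sup.1 (hF b.2)
  have pb : ∀ z : D.𝔟, D.pr𝔟 (z : 𝔤) = z := fun z => by
    apply Subtype.ext
    have := D.in𝔟_pr𝔟 (z : 𝔤)
    rw [show D.pr𝔠 (z : 𝔤) = 0 from (Submodule.Quotient.mk_eq_zero _).2 z.2, map_zero,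
      sub_zero] at this
    exact this
  refine ⟨v, hv, ?_⟩
  have hb : b = D.pr𝔟 u + D.pr𝔟 v := by rw [← map_add, huv, pb]
  have h0 : f (D.pr𝔟 u) = 0 := by
    rw [pb ⟨u, hub⟩]
    exact h _ hu
  rw [hb, map_add, h0, zero_add]
  rfl

theorem finite_range_block (X : Module.End k 𝔤) (hX : Continuous X) :
    FiniteDimensional k (LinearMap.range (D.block𝔟𝔠 X)) :=
  D.finite_range_of_open _ (D.𝔟.toSubmodule.comap X) (D.isCLattice.isOpen.preimage hX)
    fun _ hb => (Submodule.Quotient.mk_eq_zero _).2 hb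

theorem finite_range_criticalEnd (X Y : Module.End k 𝔤) (hX : Continuous X) (hY : Continuous Y) :
    FiniteDimensional k (LinearMap.range (D.criticalEnd X Y)) := by
  have := D.finite_range_block X hX
  have := D.finite_range_block Y hY
  refine Submodule.finiteDimensional_of_le
    (S₂ := LinearMap.range (D.block𝔟𝔠 X) ⊔ LinearMap.range (D.block𝔟𝔠 Y)) ?_
  rintro _ ⟨v, rfl⟩
  exact Submodule.sub_mem _ (Submodule.mem_sup_left ⟨_, rfl⟩) (Submodule.mem_sup_right ⟨_, rfl⟩)

theorem criticalEnd_eq (X Y : Module.End k 𝔤) :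
    D.criticalEnd X Y = D.block𝔠𝔠 (X ∘ₗ Y - Y ∘ₗ X) -
      (D.block𝔠𝔠 X ∘ₗ D.block𝔠𝔠 Y - D.block𝔠𝔠 Y ∘ₗ D.block𝔠𝔠 X) := by
  ext v
  simp only [criticalEnd, block𝔟𝔠, block𝔠𝔟, block𝔠𝔠, LinearMap.sub_apply, LinearMap.comp_apply,
    in𝔟_pr𝔟, map_sub]
  abel

theorem finite_range_ad (x y : 𝔤) : FiniteDimensional k
    (LinearMap.range (D.criticalEnd (LieAlgebra.ad k 𝔤 x) (LieAlgebra.ad k 𝔤 y))) :=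
  D.finite_range_criticalEnd _ _ (D.continuous_ad x) (D.continuous_ad y)

theorem criticalCocycle_add_left (x x' y : 𝔤) :
    D.criticalCocycle (x + x') y = D.criticalCocycle x y + D.criticalCocycle x' y := by
  unfold criticalCocycle criticalCocycleEnd
  rw [← finTrace_add _ _ (D.finite_range_ad x y) (D.finite_range_ad x' y)]
  congr 1
  ext v
  simp [criticalEnd, block𝔟𝔠, block𝔠𝔟]
  abel

theorem criticalCocycle_self (x : 𝔤) : D.criticalCocycle x x = 0 := by
  have := finTrace_smul (0 : k) _ (D.finite_range_ad x x)
  rw [zero_smul, zero_mul] at this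
  rw [criticalCocycle, criticalCocycleEnd, criticalEnd, sub_self]
  exact this

theorem criticalCocycle_skew (x y : 𝔤) : D.criticalCocycle x y = -D.criticalCocycle y x := by
  unfold criticalCocycle criticalCocycleEnd
  rw [← neg_one_mul, ← finTrace_smul _ _ (D.finite_range_ad y x)]
  congr 1
  refine LinearMap.ext fun v => ?_
  rw [LinearMap.smul_apply, neg_smul, one_smul]
  simp only [criticalEnd, LinearMap.sub_apply, neg_sub]

theorem criticalCocycle_add_right (x y y' : 𝔤) :
    D.criticalCocycle x (y + y') = D.criticalCocycle x y + D.criticalCocycle x y' := by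
  rw [criticalCocycle_skew, criticalCocycle_add_left, D.criticalCocycle_skew x y,
    D.criticalCocycle_skew x y']
  ring

theorem criticalCocycle_smul_right (c : k) (x y : 𝔤) :
    D.criticalCocycle x (c • y) = c * D.criticalCocycle x y := by
  unfold criticalCocycle criticalCocycleEnd
  rw [← finTrace_smul _ _ (D.finite_range_ad x y)]
  congr 1
  ext v
  simp [criticalEnd, block𝔟𝔠, block𝔠𝔟, smul_sub]

theorem criticalCocycle_jacobi (x y z : 𝔤) :
    D.criticalCocycle ⁅x, y⁆ z + D.criticalCocycle ⁅y, z⁆ x + D.criticalCocycle ⁅z, x⁆ y = 0 := by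
  let N : 𝔤 → Module.End k D.𝔠 := fun x => D.block𝔠𝔠 (LieAlgebra.ad k 𝔤 x)
  let F : 𝔤 → 𝔤 → Module.End k D.𝔠 := fun x y =>
    D.criticalEnd (LieAlgebra.ad k 𝔤 x) (LieAlgebra.ad k 𝔤 y)
  have hfin : ∀ x y, FiniteDimensional k (LinearMap.range (F x y)) := D.finite_range_ad
  have hF : ∀ x y, F x y = N ⁅x, y⁆ - (N x * N y - N y * N x) := fun x y => by
    have : LieAlgebra.ad k 𝔤 ⁅x, y⁆ = LieAlgebra.ad k 𝔤 x ∘ₗ LieAlgebra.ad k 𝔤 y -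
        LieAlgebra.ad k 𝔤 y ∘ₗ LieAlgebra.ad k 𝔤 x := by
      ext v
      simp
    simp only [F, N]
    rw [criticalEnd_eq, this]
    rfl
  have hNadd : ∀ x y, N (x + y) = N x + N y := fun x y => by
    ext v
    simp [N, block𝔠𝔠]
  have hN0 : N 0 = 0 := by
    ext v
    simp [N, block𝔠𝔠]
  have hjac : N ⁅⁅x, y⁆, z⁆ + N ⁅⁅y, z⁆, x⁆ + N ⁅⁅z, x⁆, y⁆ = 0 := by
    rw [← hNadd, ← hNadd, ← hN0]
    congr 1
    have := lie_jacobi x y z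
    rw [← lie_skew ⁅x, y⁆ z, ← lie_skew ⁅y, z⁆ x, ← lie_skew ⁅z, x⁆ y, ← neg_eq_zero, ← this]
    abel
  have hN3 : ∀ a b, N ⁅a, b⁆ = F a b + (N a * N b - N b * N a) := fun a b => by rw [hF]; abel
  have hsum : F ⁅x, y⁆ z + F ⁅y, z⁆ x + F ⁅z, x⁆ y =
      (N z * F x y + -(F x y * N z)) + (N x * F y z + -(F y z * N x)) +
        (N y * F z x + -(F z x * N y)) := by
    rw [hF ⁅x, y⁆ z, hF ⁅y, z⁆ x, hF ⁅z, x⁆ y]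
    rw [show ∀ a b c d e f : Module.End k D.𝔠, a - b + (c - d) + (e - f) =
      (a + c + e) - (b + d + f) from fun a b c d e f => by abel, hjac, hN3 x y, hN3 y z, hN3 z x]
    simp only [mul_add, mul_sub, add_mul, sub_mul, mul_assoc]
    abel
  have hl : ∀ (A B : Module.End k D.𝔠), FiniteDimensional k (LinearMap.range B) →
      FiniteDimensional k (LinearMap.range (A * B)) := fun A B hB => by
    rw [Module.End.mul_eq_comp, LinearMap.range_comp]
    infer_instance
  have hr : ∀ (A B : Module.End k D.𝔠), FiniteDimensional k (LinearMap.range B) →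
      FiniteDimensional k (LinearMap.range (-(B * A))) := fun A B hB => by
    rw [LinearMap.range_neg]
    exact Submodule.finiteDimensional_of_le (LinearMap.range_comp_le_range A B)
  have hadd : ∀ (A B : Module.End k D.𝔠), FiniteDimensional k (LinearMap.range A) →
      FiniteDimensional k (LinearMap.range B) →
      FiniteDimensional k (LinearMap.range (A + B)) := fun A B hA hB =>
    Submodule.finiteDimensional_of_le (LinearMap.range_add_le A B)
  have hc : ∀ (A B : Module.End k D.𝔠), FiniteDimensional k (LinearMap.range B) →
      finTrace (A * B + -(B * A)) = 0 := fun A B hB => by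
    have h1 := hr A B hB
    have h2 : FiniteDimensional k (LinearMap.range (B * A)) := by
      rwa [LinearMap.range_neg] at h1
    rw [finTrace_add _ _ (hl A B hB) h1, ← neg_one_smul k (B * A), finTrace_smul _ _ h2]
    have := finTrace_comm B A hB
    simp only [Module.End.mul_eq_comp]
    rw [this]
    ring
  change finTrace (F ⁅x, y⁆ z) + finTrace (F ⁅y, z⁆ x) + finTrace (F ⁅z, x⁆ y) = 0
  rw [← finTrace_add _ _ (hfin _ _) (hfin _ _),
    ← finTrace_add _ _ (hadd _ _ (hfin _ _) (hfin _ _)) (hfin _ _), hsum]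
  have g := fun A B hB => hadd _ _ (hl A B hB) (hr A B hB)
  rw [finTrace_add _ _ (hadd _ _ (g _ _ (hfin _ _)) (g _ _ (hfin _ _))) (g _ _ (hfin _ _)),
    finTrace_add _ _ (g _ _ (hfin _ _)) (g _ _ (hfin _ _)), hc _ _ (hfin _ _), hc _ _ (hfin _ _),
    hc _ _ (hfin _ _)]
  simp

theorem criticalCocycle_leibniz (x y z : 𝔤) : D.criticalCocycle x ⁅y, z⁆ =
    D.criticalCocycle ⁅x, y⁆ z + D.criticalCocycle y ⁅x, z⁆ := by
  have h1 := D.criticalCocycle_jacobi x y z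
  rw [D.criticalCocycle_skew ⁅y, z⁆, ← lie_skew z x, D.criticalCocycle_skew _ y,
    ← neg_one_smul k ⁅x, z⁆, D.criticalCocycle_smul_right (-1) y ⁅x, z⁆] at h1
  linear_combination -h1

/-- The critical central extension `𝔤♯ = 𝔤 ⊕ k K` of `𝔤`, i.e. `𝔤♯ = 𝔟 ⊕ 𝔠 ⊕ k K`. -/
def Sharp (_ : SplitTate k 𝔤) : Type _ := 𝔤 × k

noncomputable instance : AddCommGroup D.Sharp := inferInstanceAs (AddCommGroup (𝔤 × k))

noncomputable instance : Module k D.Sharp := inferInstanceAs (Module k (𝔤 × k))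

/-- The bracket of `𝔤♯`: the bracket of `𝔤` corrected by the critical cocycle. -/
noncomputable instance : Bracket D.Sharp D.Sharp where
  bracket u v := ((⁅u.1, v.1⁆, D.criticalCocycle u.1 v.1) : 𝔤 × k)

noncomputable instance : LieRing D.Sharp where
  add_lie u v w := Prod.ext (add_lie u.1 v.1 w.1) (D.criticalCocycle_add_left u.1 v.1 w.1)
  lie_add u v w := Prod.ext (lie_add u.1 v.1 w.1) (D.criticalCocycle_add_right u.1 v.1 w.1)
  lie_self u := Prod.ext (lie_self u.1) (D.criticalCocycle_self u.1)
  leibniz_lie u v w := Prod.ext (leibniz_lie u.1 v.1 w.1) (by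
    exact D.criticalCocycle_leibniz u.1 v.1 w.1)

noncomputable instance : LieAlgebra k D.Sharp where
  lie_smul c u v := Prod.ext (lie_smul c u.1 v.1) (D.criticalCocycle_smul_right c u.1 v.1)

/-- The linear embedding `𝔤 → 𝔤♯` of the decomposition `𝔤♯ = 𝔤 ⊕ k K`. -/
def lift : 𝔤 →ₗ[k] D.Sharp := LinearMap.inl k 𝔤 k

/-- The central element of `𝔤♯`. -/
def K : D.Sharp := ((0, 1) : 𝔤 × k)

end Extension

/-! ## The CDG Lie algebroid `(A, R)` -/

section Algebroid

variable {k : Type*} [Field k] {𝔤 : Type*} [LieRing 𝔤] [LieAlgebra k 𝔤] [UniformSpace 𝔤]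
  [IsUniformAddGroup 𝔤] (D : SplitTate k 𝔤)

/-- The discrete coalgebra `Λ(𝔠)`. -/
abbrev Λ𝔠 : Type _ := ExteriorAlgebra k D.𝔠

/-- The component of degree `p` of `R = Λ(𝔠*)` (completed): the dual space of `Λᵖ(𝔠)`. -/
abbrev R (p : ℕ) : Type _ := D.𝔠 [⋀^Fin p]→ₗ[k] k

/-- The component of degree `p` of `A = 𝔟 ⊗ Λ(𝔠*)` (completed): the Tate dual of `𝔟* ⊗ Λᵖ(𝔠)`,
i.e. the space of linear maps `Λᵖ(𝔠) → 𝔟`. -/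
abbrev A (p : ℕ) : Type _ := D.𝔠 [⋀^Fin p]→ₗ[k] D.𝔟

/-- The bracket `𝔠 ∧ 𝔠 → 𝔤`, where `𝔠` is embedded in `𝔤` by the section. -/
def bracket𝔠 : D.𝔠 [⋀^Fin 2]→ₗ[k] 𝔤 where
  toFun v := ⁅D.sec (v 0), D.sec (v 1)⁆
  map_update_add' v i x y := by fin_cases i <;> simp
  map_update_smul' v i c x := by fin_cases i <;> simp
  map_eq_zero_of_eq' v i j h hij := by
    fin_cases i <;> fin_cases j <;> simp_all

/-- `μ_𝔠 : 𝔠 ∧ 𝔠 → 𝔠`. -/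
def μ𝔠 : D.𝔠 [⋀^Fin 2]→ₗ[k] D.𝔠 := D.pr𝔠.compAlternatingMap D.bracket𝔠

/-- `μ₁ : 𝔟 ⊗ 𝔠 → 𝔠`, the action of `𝔟` on `𝔠 = 𝔤 / 𝔟`. -/
def μ₁ : D.𝔟 →ₗ[k] Module.End k D.𝔠 where
  toFun b := D.block𝔠𝔠 (LieAlgebra.ad k 𝔤 b)
  map_add' b b' := by
    ext v
    simp [block𝔠𝔠]
  map_smul' c b := by
    ext v
    simp [block𝔠𝔠]

/-- `μ₂ : 𝔟 ⊗ 𝔠 → 𝔟`. -/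
def μ₂ : D.𝔟 →ₗ[k] D.𝔠 →ₗ[k] D.𝔟 where
  toFun b := D.block𝔠𝔟 (LieAlgebra.ad k 𝔤 b)
  map_add' b b' := by
    ext v
    simp [block𝔠𝔟]
  map_smul' c b := by
    ext v
    simp [block𝔠𝔟]

/-- The action of `𝔟` on `Λ(𝔠)` by derivations. -/
noncomputable def actΛ : D.𝔟 →ₗ[k] Module.End k D.Λ𝔠 := derExt ∘ₗ D.μ₁

/-- The coderivation of `Λ(𝔠)` dual to `d_R`:
`x₁ ∧ ⋯ ∧ xₙ ↦ ∑_{i < j} (-1) ^ (i + j) μ_𝔠(xᵢ, xⱼ) ∧ x₁ ∧ ⋯ x̂ᵢ ⋯ x̂ⱼ ⋯ ∧ xₙ`. -/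
noncomputable def boundary : Module.End k D.Λ𝔠 := coderExt (-D.μ𝔠)

/-- The product of `R`. -/
noncomputable def mulR {p q : ℕ} (r : D.R p) (s : D.R q) : D.R (p + q) :=
  formPart (p + q) (conv (LinearMap.mul k k) (extendForm r) (extendForm s))

/-- The `R`-module structure of `A`. -/
noncomputable def smulA {p q : ℕ} (r : D.R p) (a : D.A q) : D.A (p + q) :=
  formPart (p + q) (conv (LinearMap.lsmul k D.𝔟) (extendForm r) (extendForm a))

/-- The derivation `f ↦ r · b(f)` for `a = r ⊗ b`, where `b` acts on linear maps `f` on `Λ(𝔠)` by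
`b(f)(w) = -f(b w)`. In other words, it takes `f` to `w ↦ -∑ f (a(w₁) w₂)`. -/
noncomputable def derForm {X : Type*} [AddCommGroup X] [Module k X] (a : D.Λ𝔠 →ₗ[k] D.𝔟)
    (f : D.Λ𝔠 →ₗ[k] X) : D.Λ𝔠 →ₗ[k] X :=
  -(f ∘ₗ conv D.actΛ a LinearMap.id)

/-- The action of `A` on `R` (the anchor of the Lie algebroid): `(r ⊗ b)(s) = r · b(s)`. -/
noncomputable def anchor {p q : ℕ} (a : D.A p) (s : D.R q) : D.R (p + q) :=
  formPart (p + q) (D.derForm (extendForm a) (extendForm s))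

/-- The bracket of the Lie algebroid `A`:
`[r b, r' b'] = r r' [b, b'] + r b(r') b' - (-1) ^ (|r| |r'|) r' b'(r) b`. -/
noncomputable def bracketA {p q : ℕ} (a : D.A p) (a' : D.A q) : D.A (p + q) :=
  formPart (p + q)
    (conv (LieAlgebra.ad k D.𝔟 : D.𝔟 →ₗ[k] Module.End k D.𝔟) (extendForm a) (extendForm a') +
      D.derForm (extendForm a) (extendForm a') -
      (-1 : k) ^ (p * q) • D.derForm (extendForm a') (extendForm a))

/-- The derivation `d_R` of `R`. -/
noncomputable def dR {p : ℕ} (r : D.R p) : D.R (p + 1) :=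
  formPart (p + 1) (extendForm r ∘ₗ D.boundary)

/-- The derivation `d_A` of `A`: `d_A (r b) = d_R(r) b + (-1) ^ |r| r d_𝔟(b)`, where
`d_𝔟 : 𝔟 → 𝔟 ⊗ 𝔠*` is given by `d_𝔟(b)(x) = -μ₂(b, x)`. -/
noncomputable def dA {p : ℕ} (a : D.A p) : D.A (p + 1) :=
  formPart (p + 1) (extendForm a ∘ₗ D.boundary -
    conv D.μ₂ (extendForm a ∘ₗ (CliffordAlgebra.involute
      (Q := (0 : QuadraticForm k D.𝔠))).toLinearMap) ExteriorAlgebra.ιInv)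

/-- The curvature `h ∈ A₂ = 𝔟 ⊗ Λ²(𝔠*)`: the component `h* : 𝔠 ∧ 𝔠 → 𝔟` of the bracket. -/
def curvature : D.A 2 := D.pr𝔟.compAlternatingMap D.bracket𝔠

theorem finite_range_actΛ (w : D.Λ𝔠) :
    FiniteDimensional k (LinearMap.range (D.actΛ.flip w)) := by
  have h𝔠 : ∀ x : D.𝔠, FiniteDimensional k (LinearMap.range (D.μ₁.flip x)) := fun x => by
    refine D.finite_range_of_open _
      (D.𝔟.toSubmodule.comap (LieAlgebra.ad k 𝔤 (D.sec x)))
      (D.isCLattice.isOpen.preimage (D.continuous_ad _)) fun b hb => ?_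
    refine (Submodule.Quotient.mk_eq_zero _).2 ?_
    have hb' : ⁅D.sec x, (b : 𝔤)⁆ ∈ D.𝔟.toSubmodule := hb
    rw [← lie_skew] at hb'
    exact (Submodule.neg_mem_iff _).1 hb'
  have key : ∀ t : D.Λ𝔠 ⊗[k] D.Λ𝔠, ∃ W : Submodule k D.Λ𝔠, FiniteDimensional k W ∧
      ∀ b, TensorProduct.lift (LinearMap.mul k D.Λ𝔠) (TensorProduct.map
        (ExteriorAlgebra.ι k ∘ₗ D.μ₁ b ∘ₗ ExteriorAlgebra.ιInv) LinearMap.id t) ∈ W := by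
    intro t
    induction t with
    | zero => exact ⟨⊥, inferInstance, fun b => by simp⟩
    | add s t hs ht =>
      obtain ⟨W, hW, h⟩ := hs
      obtain ⟨W', hW', h'⟩ := ht
      refine ⟨W ⊔ W', inferInstance, fun b => ?_⟩
      rw [map_add, map_add]
      exact Submodule.add_mem _ (Submodule.mem_sup_left (h b)) (Submodule.mem_sup_right (h' b))
    | tmul u v =>
      have := h𝔠 (ExteriorAlgebra.ιInv u)
      exact ⟨(LinearMap.range (D.μ₁.flip (ExteriorAlgebra.ιInv u))).map
        (LinearMap.mulRight k v ∘ₗ ExteriorAlgebra.ι k), inferInstance,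
        fun b => ⟨_, ⟨b, rfl⟩, rfl⟩⟩
  obtain ⟨W, hW, h⟩ := key (comul k D.𝔠 w)
  refine Submodule.finiteDimensional_of_le (S₂ := W) ?_
  rintro _ ⟨b, rfl⟩
  exact h b

theorem finite_range_actΛ_comp (a : D.Λ𝔠 →ₗ[k] D.𝔟) (w : D.Λ𝔠) :
    FiniteDimensional k (LinearMap.range (D.actΛ.flip w ∘ₗ a)) := by
  have := D.finite_range_actΛ w
  exact Submodule.finiteDimensional_of_le (LinearMap.range_comp_le_range a (D.actΛ.flip w))

/-- For `a = r ⊗ b`, the functional `w ↦ r(b w)` on `Λ(𝔠)`, that is, `-b(r)`. In general it takes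
`w` to the trace of the operator `w' ↦ a(w') w` on `Λ(𝔠)`, which has finite rank. -/
noncomputable def divergence (a : D.Λ𝔠 →ₗ[k] D.𝔟) : D.Λ𝔠 →ₗ[k] k where
  toFun w := finTrace (D.actΛ.flip w ∘ₗ a)
  map_add' w w' := by
    rw [map_add, LinearMap.add_comp, finTrace_add _ _ (D.finite_range_actΛ_comp a w)
      (D.finite_range_actΛ_comp a w')]
  map_smul' c w := by
    rw [map_smul, LinearMap.smul_comp, finTrace_smul _ _ (D.finite_range_actΛ_comp a w)]
    rfl

end Algebroid

/-! ## The left CDG-module `M♯ ⊗ Λ(𝔠)` over `(A, R)` -/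

section Module

variable {k : Type*} [Field k] {𝔤 : Type*} [LieRing 𝔤] [LieAlgebra k 𝔤] [UniformSpace 𝔤]
  [IsUniformAddGroup 𝔤] (D : SplitTate k 𝔤)
  (M : Type*) [AddCommGroup M] [Module k M] [LieRingModule D.Sharp M] [LieModule k D.Sharp M]

/-- `M` is a discrete `𝔤♯`-module on which `K` acts by `1`. -/
structure IsDiscreteLevelOne : Prop where
  discrete : ∀ m : M, ∀ᶠ x in 𝓝 (0 : 𝔤), ⁅D.lift x, m⁆ = 0
  K_lie : ∀ m : M, ⁅D.K, m⁆ = m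

/-- The space `M ⊗ Λ(𝔠)`. -/
abbrev N : Type _ := M ⊗[k] D.Λ𝔠

/-- The component of degree `i` of `M ⊗ Λ(𝔠)`, where `M ⊗ Λʲ(𝔠)` is of degree `-j`. -/
def gradeN (i : ℤ) : Submodule k (D.N M) :=
  Submodule.span k {n | ∃ (j : ℕ) (m : M) (w : D.Λ𝔠), i = -j ∧ w ∈ ⋀[k]^j D.𝔠 ∧ n = m ⊗ₜ[k] w}

/-- The action on `M` of the subspace `𝔤` of `𝔤♯ = 𝔤 ⊕ k K`. -/
noncomputable def actM : 𝔤 →ₗ[k] Module.End k M :=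
  (LieModule.toEnd k D.Sharp M : D.Sharp →ₗ[k] Module.End k M) ∘ₗ D.lift

/-- The operator `n ⊗ w ↦ ∑ F(w₂) (n ⊗ w₁)` on `M ⊗ Λ(𝔠)`. -/
noncomputable def slotAct (F : D.Λ𝔠 →ₗ[k] Module.End k (D.N M)) : Module.End k (D.N M) :=
  TensorProduct.lift F.flip ∘ₗ (TensorProduct.assoc k M D.Λ𝔠 D.Λ𝔠).symm.toLinearMap ∘ₗ
    LinearMap.lTensor M (comul k D.𝔠)

/-- The action of `R` on `M ⊗ Λ(𝔠)` by contraction: `r (m ⊗ w) = ∑ r(w₂) m ⊗ w₁`. -/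
noncomputable def contractN (r : D.Λ𝔠 →ₗ[k] k) : Module.End k (D.N M) :=
  LinearMap.lTensor M (conv (LinearMap.lsmul k D.Λ𝔠).flip LinearMap.id r)

/-- The action of `𝔟` on `M ⊗ Λ(𝔠)`, the tensor product of its actions on `M` and on `Λ(𝔠)`. -/
noncomputable def act𝔟N : D.𝔟 →ₗ[k] Module.End k (D.N M) :=
  LinearMap.rTensorHom D.Λ𝔠 ∘ₗ D.actM M ∘ₗ D.in𝔟 + LinearMap.lTensorHom M ∘ₗ D.actΛ

/-- The right action of `A♯` on `M ⊗ Λ(𝔠)`, with the sign changed: for `a = b ⊗ r` it is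
`n ↦ b (r n)`, i.e. one contracts with `r` first and lets `b` act afterwards. -/
noncomputable def rightAct (a : D.Λ𝔠 →ₗ[k] D.𝔟) : Module.End k (D.N M) :=
  D.slotAct M (D.act𝔟N M ∘ₗ a)

/-- The left action of `A` on `M ⊗ Λ(𝔠)`: for `a = r ⊗ b` it is `n ↦ r (b n)`, i.e. `b` acts
first and one contracts with `r` afterwards. Since `r (b n) = b (r n) - b(r) n`, it differs from
the right action by the contraction with `-b(r)`; this is the isomorphism of `A♯` with the opposite
of `A`. -/
noncomputable def leftAct (a : D.Λ𝔠 →ₗ[k] D.𝔟) : Module.End k (D.N M) :=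
  D.rightAct M a + D.contractN M (D.divergence a)

/-- The derivation of the CDG-module `M ⊗ Λ(𝔠)`: up to the sign of the numeration, the Chevalley
differential
`m ⊗ x₁ ∧ ⋯ ∧ xₙ ↦ ∑ᵢ (-1) ^ (n - i) xᵢ m ⊗ x₁ ∧ ⋯ x̂ᵢ ⋯ ∧ xₙ
  + (-1) ^ n ∑_{i < j} (-1) ^ (i + j) m ⊗ μ_𝔠(xᵢ, xⱼ) ∧ x₁ ∧ ⋯ x̂ᵢ ⋯ x̂ⱼ ⋯ ∧ xₙ`. -/
noncomputable def dN : Module.End k (D.N M) :=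
  D.slotAct M (LinearMap.rTensorHom D.Λ𝔠 ∘ₗ D.actM M ∘ₗ D.sec ∘ₗ ExteriorAlgebra.ιInv) +
    LinearMap.lTensor M (D.boundary ∘ₗ (CliffordAlgebra.involute
      (Q := (0 : QuadraticForm k D.𝔠))).toLinearMap)

end Module

/-! ## The standard semiinfinite complex -/

section Standard

variable {k : Type*} [Field k] {𝔤 : Type*} [LieRing 𝔤] [LieAlgebra k 𝔤] [UniformSpace 𝔤]
  [IsUniformAddGroup 𝔤] (D : SplitTate k 𝔤)
  (M : Type*) [AddCommGroup M] [Module k M] [LieRingModule D.Sharp M] [LieModule k D.Sharp M]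

/-- Homogeneous elements of `A`. -/
abbrev HomA : Type _ := Σ p : ℕ, D.A p

/-- The sum of the degrees of the elements of a list. -/
def degSum (l : List D.HomA) : ℤ := (l.map fun a => (a.1 : ℤ)).sum

/-- Functions that assign to each finite list `(a₁, …, aₘ)` of homogeneous elements of `A` an element
of `M ⊗ Λ(𝔠)`; the restriction of such a function to the lists of length `m` is its component of
arity `m`. -/
abbrev PreCochain : Type _ := List D.HomA → D.N M

/-- The component of total degree `n` of `Hom_R(Λ_R(A), M ⊗ Λ(𝔠))`. An element is given by its values
`φ(a₁ ∧ ⋯ ∧ aₘ)` for homogeneous `aᵢ`; its component of arity `m` is an `R`-multilinear,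
super-alternating, continuous map of degree `n - m`, and vanishes for all but finitely many `m`. -/
def cochains (n : ℤ) : Submodule k (D.PreCochain M) where
  carrier := {φ |
    (∀ (l₁ l₂ : List D.HomA) (p : ℕ) (a b : D.A p),
      φ (l₁ ++ ⟨p, a + b⟩ :: l₂) = φ (l₁ ++ ⟨p, a⟩ :: l₂) + φ (l₁ ++ ⟨p, b⟩ :: l₂)) ∧
    (∀ (l₁ l₂ : List D.HomA) (a b : D.HomA),
      φ (l₁ ++ a :: b :: l₂) = -(-1 : k) ^ (a.1 * b.1) • φ (l₁ ++ b :: a :: l₂)) ∧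
    (∀ (l : List D.HomA) (q p : ℕ) (r : D.R q) (a : D.A p),
      φ (⟨q + p, D.smulA r a⟩ :: l) =
        (-1 : k) ^ (q * (n - (l.length + 1))) • D.contractN M (extendForm r) (φ (⟨p, a⟩ :: l))) ∧
    (∀ ps : List ℕ, ∃ (S : ∀ p : ℕ, Finset (Fin p → D.𝔠)) (U : Set 𝔤), U ∈ 𝓝 (0 : 𝔤) ∧
      ∀ l : List D.HomA, l.map Sigma.fst = ps →
        (∃ a ∈ l, ∀ v ∈ S a.1, (a.2 v : 𝔤) ∈ U) → φ l = 0) ∧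
    (∀ l : List D.HomA, φ l ∈ D.gradeN M (n - l.length + D.degSum l)) ∧
    (∃ m : ℕ, ∀ l : List D.HomA, m ≤ l.length → φ l = 0)}
  add_mem' := by
    classical
    rintro φ ψ ⟨h1, h2, h3, h4, h5, m, h6⟩ ⟨g1, g2, g3, g4, g5, m', g6⟩
    refine ⟨fun l₁ l₂ p a b => ?_, fun l₁ l₂ a b => ?_, fun l q p r a => ?_, fun ps => ?_,
      fun l => Submodule.add_mem _ (h5 l) (g5 l), max m m', fun l hl => ?_⟩
    · simp only [Pi.add_apply, h1, g1]
      abel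
    · simp only [Pi.add_apply, smul_add]
      rw [h2, g2]
    · simp only [Pi.add_apply, map_add, smul_add]
      rw [h3, g3]
    · obtain ⟨S, U, hU, h⟩ := h4 ps
      obtain ⟨S', U', hU', h'⟩ := g4 ps
      refine ⟨fun p => S p ∪ S' p, U ∩ U', Filter.inter_mem hU hU', ?_⟩
      rintro l hl ⟨a, ha, hv⟩
      rw [Pi.add_apply, h l hl ⟨a, ha, fun v hS => (hv v (Finset.mem_union_left _ hS)).1⟩,
        h' l hl ⟨a, ha, fun v hS => (hv v (Finset.mem_union_right _ hS)).2⟩, add_zero]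
    · rw [Pi.add_apply, h6 l (le_trans (le_max_left _ _) hl),
        g6 l (le_trans (le_max_right _ _) hl), add_zero]
  zero_mem' := by
    refine ⟨by simp, by simp, by simp, fun ps => ⟨fun _ => ∅, Set.univ, Filter.univ_mem, ?_⟩,
      fun l => Submodule.zero_mem _, 0, ?_⟩ <;> simp
  smul_mem' := by
    rintro c φ ⟨h1, h2, h3, h4, h5, m, h6⟩
    refine ⟨fun l₁ l₂ p a b => ?_, fun l₁ l₂ a b => ?_, fun l q p r a => ?_, fun ps => ?_,
      fun l => Submodule.smul_mem _ c (h5 l), m, fun l hl => ?_⟩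
    · simp only [Pi.smul_apply, h1, smul_add]
    · simp only [Pi.smul_apply]
      rw [h2, smul_comm]
    · simp only [Pi.smul_apply, map_smul]
      rw [h3, smul_comm]
    · obtain ⟨S, U, hU, h⟩ := h4 ps
      refine ⟨S, U, hU, fun l hl ha => ?_⟩
      rw [Pi.smul_apply, h l hl ha, smul_zero]
    · rw [Pi.smul_apply, h6 l hl, smul_zero]

/-- The Chevalley differential `d₁` on elements of total degree `n`. With `i, j` counted from `0`,
its value at `(a₁, …, a_L)` is the sum of the usual terms (the Lie action on the module, the brackets,
the derivation of the module and the derivation of `A`), with the signs given by the Koszul rule. -/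
noncomputable def d₁ (n : ℤ) : D.PreCochain M →ₗ[k] D.PreCochain M :=
  LinearMap.pi fun l =>
    (∑ i : Fin l.length,
      (-1 : k) ^ ((i : ℤ) + 1 + l[i].1 * (n - (l.length - 1) + D.degSum (l.take i))) •
        D.leftAct M (extendForm l[i].2) ∘ₗ LinearMap.proj (l.eraseIdx i)) +
    (∑ i : Fin l.length, ∑ j ∈ Finset.Ioi i,
      (-1 : k) ^ ((i : ℤ) + j + 1 + l[i].1 * D.degSum (l.take i) +
          l[j].1 * (D.degSum (l.take j) - l[i].1)) •
        LinearMap.proj (⟨l[i].1 + l[j].1, D.bracketA l[i].2 l[j].2⟩ ::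
          (l.eraseIdx j).eraseIdx i)) +
    (-1 : k) ^ l.length • (D.dN M ∘ₗ LinearMap.proj l -
      ∑ i : Fin l.length, (-1 : k) ^ (n - l.length + D.degSum (l.take i)) •
        LinearMap.proj (l.set i ⟨l[i].1 + 1, D.dA l[i].2⟩))

/-- The differential `d₂`, `(d₂ φ)(a₁ ∧ ⋯ ∧ aₘ) = φ(h ∧ a₁ ∧ ⋯ ∧ aₘ)`. -/
noncomputable def d₂ : D.PreCochain M →ₗ[k] D.PreCochain M :=
  LinearMap.pi fun l => LinearMap.proj (⟨2, D.curvature⟩ :: l)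

/-- The differential `d = d₁ + d₂` of the standard semiinfinite complex, in degree `n`. -/
noncomputable def differential (n : ℤ) : D.PreCochain M →ₗ[k] D.PreCochain M := D.d₁ M n + D.d₂ M

/-- The cocycles of degree `n` of the standard semiinfinite complex. -/
noncomputable def cocycles (n : ℤ) : Submodule k (D.PreCochain M) :=
  D.cochains M n ⊓ LinearMap.ker (D.differential M n)

/-- The coboundaries of degree `n` of the standard semiinfinite complex. -/
noncomputable def coboundaries (n : ℤ) : Submodule k (D.PreCochain M) :=
  (D.cochains M (n - 1)).map (D.differential M (n - 1))

/-- The cohomology of the standard semiinfinite complex. -/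
abbrev Cohomology (n : ℤ) : Type _ :=
  D.cocycles M n ⧸ (D.coboundaries M n).submoduleOf (D.cocycles M n)

/-- The component of degree `n` of `Λ(𝔟*) ⊗ Λ(𝔤 / 𝔟) ⊗ M`, where `𝔟*` is of degree `1`, `𝔤 / 𝔟` is of
degree `-1` and `M` is of degree `0`. -/
def gradedPiece (n : ℤ) :
    Submodule k (ExteriorAlgebra k (tateDual k D.𝔟) ⊗[k] (D.Λ𝔠 ⊗[k] M)) :=
  Submodule.span k {t | ∃ (p q : ℕ) (ξ : ExteriorAlgebra k (tateDual k D.𝔟)) (w : D.Λ𝔠) (m : M),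
    (p : ℤ) - q = n ∧ ξ ∈ ⋀[k]^p (tateDual k D.𝔟) ∧ w ∈ ⋀[k]^q D.𝔠 ∧ t = ξ ⊗ₜ[k] (w ⊗ₜ[k] m)}

end Standard

/-! ## The Beilinson–Drinfeld semiinfinite complex -/

section BeilinsonDrinfeld

variable {k : Type*} [Field k] {𝔤 : Type*} [LieRing 𝔤] [LieAlgebra k 𝔤] [UniformSpace 𝔤]
  [IsUniformAddGroup 𝔤] (D : SplitTate k 𝔤)

variable (k 𝔤) in
/-- The quadratic form `(f, x) ↦ f(x)` on `𝔤* ⊕ 𝔤`, where `𝔤*` is the Tate dual of `𝔤`. -/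
noncomputable def quadForm : QuadraticForm k (tateDual k 𝔤 × 𝔤) :=
  (QuadraticForm.dualProd k 𝔤).comp ((tateDual k 𝔤).subtype.prodMap LinearMap.id)

variable (k 𝔤) in
/-- The Clifford algebra of `𝔤* ⊕ 𝔤`. -/
abbrev Cl : Type _ := CliffordAlgebra (R := k) (M := tateDual k 𝔤 × 𝔤) (quadForm k 𝔤)

variable (k 𝔤) in
/-- The embedding of `𝔤* ⊕ 𝔤` in its Clifford algebra. -/
noncomputable def gen : (tateDual k 𝔤 × 𝔤) →ₗ[k] Cl k 𝔤 :=
  CliffordAlgebra.ι (R := k) (M := tateDual k 𝔤 × 𝔤) (quadForm k 𝔤)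

/-- The left ideal of the Clifford algebra generated by `𝔟` and its annihilator in `𝔤*`. -/
noncomputable def vacuumIdeal : Submodule (Cl k 𝔤) (Cl k 𝔤) :=
  Submodule.span (Cl k 𝔤) {u | ∃ (f : tateDual k 𝔤) (x : 𝔤), (∀ b ∈ D.𝔟, f.1 b = 0) ∧ x ∈ D.𝔟 ∧
    u = gen k 𝔤 (f, x)}

/-- The irreducible discrete Clifford module (the space of semiinfinite forms) with a vacuum vector
that is annihilated by `𝔟` and by the annihilator of `𝔟` in `𝔤*`. -/
abbrev Fock : Type _ := (Cl k 𝔤) ⧸ D.vacuumIdeal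

/-- The vacuum vector. -/
noncomputable def vac : D.Fock := Submodule.Quotient.mk 1

/-- The operator `ι_x` of interior multiplication by `x ∈ 𝔤`. -/
noncomputable def inter (x : 𝔤) : Module.End k D.Fock :=
  Algebra.lsmul k k D.Fock (gen k 𝔤 (0, x))

/-- The operator `ε_f` of exterior multiplication by `f ∈ 𝔤*`. -/
noncomputable def exter (f : tateDual k 𝔤) : Module.End k D.Fock :=
  Algebra.lsmul k k D.Fock (gen k 𝔤 (f, 0))

/-- The component of degree `n` of the Clifford module, where the vacuum is of degree `0`, the `ε_f`
are of degree `1` and the `ι_x` are of degree `-1`. -/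
noncomputable def gradeFock (n : ℤ) : Submodule k D.Fock :=
  Submodule.span k {v | ∃ (xs : List 𝔤) (fs : List (tateDual k 𝔤)),
    (fs.length : ℤ) - xs.length = n ∧
    v = (xs.map D.inter).prod ((fs.map D.exter).prod D.vac)}

/-- The coadjoint action `(x f)(y) = -f([x, y])` of `𝔤` on `𝔤*`. -/
def coad (D : SplitTate k 𝔤) (x : 𝔤) (f : tateDual k 𝔤) : tateDual k 𝔤 :=
  ⟨-(f.1 ∘ₗ LieAlgebra.ad k 𝔤 x), by
    have h : Filter.Tendsto (LieAlgebra.ad k 𝔤 x) (𝓝 0) (𝓝 0) := by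
      simpa using (D.continuous_ad x).tendsto 0
    filter_upwards [h.eventually f.2] with y hy
    simpa using hy⟩

/-- `θ` is the normally ordered action of `x ∈ 𝔤` on the Clifford module: it has the commutators of
the (co)adjoint action with the Clifford operators, and its vacuum expectation value, with respect to
the decomposition `𝔤 = 𝔟 ⊕ 𝔠`, is zero. These operators define an action of `𝔤♯` with `K = -1`. -/
structure IsNormallyOrdered (x : 𝔤) (θ : Module.End k D.Fock) : Prop where
  comm_inter : ∀ y : 𝔤, θ * D.inter y - D.inter y * θ = D.inter ⁅x, y⁆
  comm_exter : ∀ f : tateDual k 𝔤, θ * D.exter f - D.exter f * θ = D.exter (D.coad x f)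
  vac_mem : θ D.vac ∈ Submodule.span k {v | ∃ (z : D.𝔠) (u : D.Fock), v = D.inter (D.sec z) u}

variable (M : Type*) [AddCommGroup M] [Module k M] [LieRingModule D.Sharp M]
  [LieModule k D.Sharp M]

/-- The component of degree `n` of the Beilinson–Drinfeld complex: the tensor product of `M` (in degree
`0`) and the Clifford module. -/
noncomputable def bdCochains (n : ℤ) : Submodule k (M ⊗[k] D.Fock) :=
  LinearMap.range (LinearMap.lTensor M (D.gradeFock n).subtype)

/-- `d` is the BRST differential on the tensor product of `M` and the Clifford module: it is of degree
`1`, and `d ι_x + ι_x d` is the total action of `x` for every `x ∈ 𝔤`. -/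
structure IsBRST (d : Module.End k (M ⊗[k] D.Fock)) : Prop where
  map_mem : ∀ (n : ℤ), ∀ c ∈ D.bdCochains M n, d c ∈ D.bdCochains M (n + 1)
  cartan : ∀ x : 𝔤, ∃ θ : Module.End k D.Fock, D.IsNormallyOrdered x θ ∧
    d * LinearMap.lTensor M (D.inter x) + LinearMap.lTensor M (D.inter x) * d =
      LinearMap.rTensor D.Fock (D.actM M x) + LinearMap.lTensor M θ

variable {M}

/-- The cocycles of degree `n` with respect to `d`. -/
noncomputable def bdCocycles (d : Module.End k (M ⊗[k] D.Fock)) (n : ℤ) : Submodule k (M ⊗[k] D.Fock) :=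
  D.bdCochains M n ⊓ LinearMap.ker d

/-- The coboundaries of degree `n` with respect to `d`. -/
noncomputable def bdCoboundaries (d : Module.End k (M ⊗[k] D.Fock)) (n : ℤ) : Submodule k (M ⊗[k] D.Fock) :=
  (D.bdCochains M (n - 1)).map d

/-- For the BRST differential `d`: the Beilinson–Drinfeld semiinfinite cohomology of `𝔤` with
coefficients in `M`. -/
abbrev BDCohomology (d : Module.End k (M ⊗[k] D.Fock)) (n : ℤ) : Type _ :=
  D.bdCocycles d n ⧸ (D.bdCoboundaries d n).submoduleOf (D.bdCocycles d n)

end BeilinsonDrinfeld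

end SplitTate

end SemiInf

namespace SemiInf

section ExteriorLemmas

variable {k : Type*} [Field k] {V : Type*} [AddCommGroup V] [Module k V]
variable {X Y Z : Type*} [AddCommGroup X] [Module k X] [AddCommGroup Y] [Module k Y]
  [AddCommGroup Z] [Module k Z]

local notation "Λ" => ExteriorAlgebra k V
local notation "ι" => ExteriorAlgebra.ι k

/-- Linear maps on the exterior algebra are equal if they agree on `1` and their agreement is
preserved by left multiplication with vectors. -/
theorem exterior_ext_left {f g : Λ →ₗ[k] Y} (h1 : f 1 = g 1)
    (h : ∀ (x : V) (w : Λ), f w = g w → f (ι x * w) = g (ι x * w)) : f = g := by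
  refine LinearMap.ext fun w => ?_
  induction w using CliffordAlgebra.left_induction with
  | algebraMap r => rw [Algebra.algebraMap_eq_smul_one, map_smul, map_smul, h1]
  | add x y hx hy => rw [map_add, map_add, hx, hy]
  | ι_mul w x hw => exact h x w hw

theorem exterior_ext_right {f g : Λ →ₗ[k] Y} (h1 : f 1 = g 1)
    (h : ∀ (x : V) (w : Λ), f w = g w → f (w * ι x) = g (w * ι x)) : f = g := by
  refine LinearMap.ext fun w => ?_
  induction w using CliffordAlgebra.right_induction with
  | algebraMap r => rw [Algebra.algebraMap_eq_smul_one, map_smul, map_smul, h1]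
  | add x y hx hy => rw [map_add, map_add, hx, hy]
  | mul_ι x w hw => exact h x w hw

variable (k V) in
/-- The parity involution of the exterior algebra. -/
noncomputable abbrev parity : Λ →ₗ[k] Λ :=
  (CliffordAlgebra.involute (Q := (0 : QuadraticForm k V))).toLinearMap

variable (V) in
/-- The automorphism of the exterior algebra induced by the homothety `t`. -/
noncomputable def scale (t : k) : Λ →ₐ[k] Λ := ExteriorAlgebra.map (t • LinearMap.id)

variable (k V) in
/-- The counit of the exterior algebra. -/
noncomputable abbrev counit : Λ →ₐ[k] k := ExteriorAlgebra.algebraMapInv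

theorem parity_one : parity k V 1 = 1 := by simp

theorem parity_ι_mul (x : V) (w : Λ) : parity k V (ι x * w) = -(ι x * parity k V w) := by
  have hi : CliffordAlgebra.involute (ι x) = -ι x := CliffordAlgebra.involute_ι x
  simp only [AlgHom.toLinearMap_apply, map_mul, hi, neg_mul]

theorem parity_mul_ι (x : V) (w : Λ) : parity k V (w * ι x) = -(parity k V w * ι x) := by
  have hi : CliffordAlgebra.involute (ι x) = -ι x := CliffordAlgebra.involute_ι x
  simp only [AlgHom.toLinearMap_apply, map_mul, hi, mul_neg]

theorem parity_parity (w : Λ) : parity k V (parity k V w) = w :=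
  CliffordAlgebra.involute_involute w

theorem parity_comp_parity : parity k V ∘ₗ parity k V = LinearMap.id :=
  LinearMap.ext parity_parity

theorem scale_ι (t : k) (x : V) : scale V t (ι x) = t • ι x := by
  simp [scale]

theorem scale_neg_one : (scale V (-1 : k)).toLinearMap = parity k V := by
  refine exterior_ext_left (by simp) fun x w h => ?_
  rw [parity_ι_mul, ← h]
  simp [scale_ι]

theorem scale_one : (scale V (1 : k)).toLinearMap = LinearMap.id := by
  refine exterior_ext_left (by simp) fun x w h => ?_
  simp only [AlgHom.toLinearMap_apply, LinearMap.id_apply, map_mul, scale_ι, one_smul] at h ⊢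
  rw [h]

theorem counit_ι (x : V) : counit k V (ι x) = 0 := by
  simp [ExteriorAlgebra.algebraMapInv]

theorem counit_parity (w : Λ) : counit k V (parity k V w) = counit k V w := by
  have : (counit k V).toLinearMap ∘ₗ parity k V = (counit k V).toLinearMap := by
    refine exterior_ext_left (by simp) fun x w _ => ?_
    simp [LinearMap.comp_apply, counit_ι]
  exact LinearMap.congr_fun this w

theorem ιInv_ι (x : V) : ExteriorAlgebra.ιInv (R := k) (ι x) = x :=
  ExteriorAlgebra.ι_leftInverse (R := k) x

theorem ιInv_one : ExteriorAlgebra.ιInv (R := k) (M := V) 1 = 0 := by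
  let _ : Module kᵐᵒᵖ V := Module.compHom _ ((RingHom.id k).fromOpposite mul_comm)
  have _ : IsCentralScalar k V := ⟨fun r m => rfl⟩
  simp [ExteriorAlgebra.ιInv]

theorem ιInv_ι_mul (x : V) (w : Λ) :
    ExteriorAlgebra.ιInv (R := k) (ι x * w) = counit k V w • x := by
  let _ : Module kᵐᵒᵖ V := Module.compHom _ ((RingHom.id k).fromOpposite mul_comm)
  have _ : IsCentralScalar k V := ⟨fun r m => rfl⟩
  have hf : ∀ w : Λ, (ExteriorAlgebra.toTrivSqZeroExt w).fst = counit k V w := fun w => by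
    have : (TrivSqZeroExt.fstHom k k V).comp ExteriorAlgebra.toTrivSqZeroExt = counit k V := by
      ext x
      simp [counit_ι]
    exact AlgHom.congr_fun this w
  simp [ExteriorAlgebra.ιInv, hf]

theorem ι_mul_eq (x : V) (w : Λ) : ι x * w = parity k V w * ι x := by
  have : LinearMap.mulLeft k (ι x) = LinearMap.mulRight k (ι x) ∘ₗ parity k V := by
    refine exterior_ext_left (by simp) fun y w h => ?_
    have hs := ExteriorAlgebra.ι_add_mul_swap (R := k) x y
    simp only [LinearMap.mulLeft_apply, LinearMap.comp_apply, LinearMap.mulRight_apply] at h ⊢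
    rw [parity_ι_mul, neg_mul, mul_assoc, ← h, ← mul_assoc, ← mul_assoc, ← neg_mul]
    rw [eq_neg_of_add_eq_zero_left hs]
  exact LinearMap.congr_fun this w

theorem counit_mul_ι (x : V) (w : Λ) : counit k V (w * ι x) = 0 := by
  rw [map_mul, counit_ι, mul_zero]

theorem ιInv_parity (w : Λ) :
    ExteriorAlgebra.ιInv (R := k) (parity k V w) = -ExteriorAlgebra.ιInv (R := k) w := by
  have : ExteriorAlgebra.ιInv (R := k) ∘ₗ parity k V = -ExteriorAlgebra.ιInv (R := k) := by
    refine exterior_ext_left (by simp [ιInv_one]) fun x w _ => ?_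
    rw [LinearMap.comp_apply, parity_ι_mul, map_neg, ιInv_ι_mul, counit_parity,
      LinearMap.neg_apply, ιInv_ι_mul]
  exact LinearMap.congr_fun this w

theorem ιInv_mul_ι (x : V) (w : Λ) :
    ExteriorAlgebra.ιInv (R := k) (w * ι x) = counit k V w • x := by
  rw [← parity_parity w, ← ι_mul_eq, ιInv_ι_mul, parity_parity, counit_parity]

/-! ### The comultiplication -/

theorem comul_mul_ι (c : V) (w : Λ) : comul k V (w * ι c) =
    TensorProduct.map (LinearMap.mulRight k (ι c)) (parity k V) (comul k V w) +
      TensorProduct.map LinearMap.id (LinearMap.mulRight k (ι c)) (comul k V w) := by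
  have : comul k V ∘ₗ LinearMap.mulRight k (ι c) =
      (TensorProduct.map (LinearMap.mulRight k (ι c)) (parity k V) +
        TensorProduct.map LinearMap.id (LinearMap.mulRight k (ι c))) ∘ₗ comul k V := by
    refine exterior_ext_left ?_ fun x w h => ?_
    · have := comul_ι_mul k V c 1
      rw [mul_one, comul_one, comulStep_tmul] at this
      simp [this, comul_one]
    · simp only [LinearMap.comp_apply, LinearMap.mulRight_apply] at h ⊢
      rw [mul_assoc, comul_ι_mul, comul_ι_mul, h]
      generalize comul k V w = t
      induction t with
      | zero => simp
      | add a b ha hb =>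
        simp only [map_add] at ha hb ⊢
        rw [ha, hb]
      | tmul u v =>
        simp only [LinearMap.add_apply, TensorProduct.map_tmul, LinearMap.mulRight_apply,
          LinearMap.id_apply, map_add, comulStep_tmul, parity_ι_mul]
        have h1 := parity_mul_ι c u
        simp only [AlgHom.toLinearMap_apply] at h1 ⊢
        simp only [h1, TensorProduct.tmul_neg, TensorProduct.neg_tmul, mul_assoc]
        abel
  exact LinearMap.congr_fun this w

theorem comul_scale (t : k) (w : Λ) : comul k V (scale V t w) =
    TensorProduct.map (scale V t).toLinearMap (scale V t).toLinearMap (comul k V w) := by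
  have : comul k V ∘ₗ (scale V t).toLinearMap =
      TensorProduct.map (scale V t).toLinearMap (scale V t).toLinearMap ∘ₗ comul k V := by
    refine exterior_ext_left (by simp [comul_one]) fun x w h => ?_
    simp only [LinearMap.comp_apply, AlgHom.toLinearMap_apply] at h ⊢
    rw [map_mul, scale_ι, smul_mul_assoc, map_smul, comul_ι_mul, comul_ι_mul, h]
    generalize comul k V w = s
    induction s with
    | zero => simp
    | add a b ha hb =>
      simp only [map_add, smul_add] at ha hb ⊢
      rw [ha, hb]
    | tmul u v =>
      have hp : ∀ u : Λ, CliffordAlgebra.involute (scale V t u) =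
          scale V t (CliffordAlgebra.involute u) := fun u => by
        have : parity k V ∘ₗ (scale V t).toLinearMap =
            (scale V t).toLinearMap ∘ₗ parity k V := by
          refine exterior_ext_left (by simp) fun x w h => ?_
          simp only [LinearMap.comp_apply, AlgHom.toLinearMap_apply, map_mul, scale_ι, map_smul,
            smul_mul_assoc] at h ⊢
          rw [h, CliffordAlgebra.involute_ι, map_neg, scale_ι, neg_mul, neg_mul, smul_mul_assoc,
            smul_neg]
        exact LinearMap.congr_fun this u
      simp [comulStep_tmul, scale_ι, hp, TensorProduct.smul_tmul, smul_add]
  exact LinearMap.congr_fun this w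

theorem lid_counit_comul (w : Λ) :
    TensorProduct.lid k Λ ((counit k V).toLinearMap.rTensor Λ (comul k V w)) = w := by
  have : (TensorProduct.lid k Λ).toLinearMap ∘ₗ (counit k V).toLinearMap.rTensor Λ ∘ₗ comul k V =
      LinearMap.id := by
    refine exterior_ext_left (by simp [comul_one]) fun x w h => ?_
    simp only [LinearMap.comp_apply, LinearMap.id_apply] at h ⊢
    rw [comul_ι_mul]
    conv_rhs => rw [← h]
    generalize comul k V w = s
    induction s with
    | zero => simp
    | add a b ha hb =>
      simp only [map_add, mul_add] at ha hb ⊢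
      rw [ha, hb]
    | tmul u v =>
      have h1 := counit_parity u
      simp only [AlgHom.toLinearMap_apply] at h1
      simp [comulStep_tmul, counit_ι, h1]
  exact LinearMap.congr_fun this w

theorem rid_counit_comul (w : Λ) :
    TensorProduct.rid k Λ ((counit k V).toLinearMap.lTensor Λ (comul k V w)) = w := by
  have : (TensorProduct.rid k Λ).toLinearMap ∘ₗ (counit k V).toLinearMap.lTensor Λ ∘ₗ comul k V =
      LinearMap.id := by
    refine exterior_ext_left (by simp [comul_one]) fun x w h => ?_
    simp only [LinearMap.comp_apply, LinearMap.id_apply] at h ⊢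
    rw [comul_ι_mul]
    conv_rhs => rw [← h]
    generalize comul k V w = s
    induction s with
    | zero => simp
    | add a b ha hb =>
      simp only [map_add, mul_add] at ha hb ⊢
      rw [ha, hb]
    | tmul u v =>
      simp [comulStep_tmul, counit_ι]
  exact LinearMap.congr_fun this w

/-! ### Derivations -/

theorem derExt_apply (T : Module.End k V) (w : Λ) : derExt T w =
    TensorProduct.lift (LinearMap.mul k Λ) (TensorProduct.map
      (ExteriorAlgebra.ι k ∘ₗ T ∘ₗ ExteriorAlgebra.ιInv) LinearMap.id (comul k V w)) := rfl

theorem derExt_one (T : Module.End k V) : derExt T (1 : Λ) = 0 := by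
  rw [derExt_apply, comul_one]
  simp [ιInv_one]

theorem derExt_ι_mul (T : Module.End k V) (x : V) (w : Λ) :
    derExt T (ι x * w) = ι (T x) * w + ι x * derExt T w := by
  rw [derExt_apply, derExt_apply, comul_ι_mul]
  nth_rewrite 2 [← lid_counit_comul w]
  generalize comul k V w = s
  induction s with
  | zero => simp
  | add a b ha hb =>
    simp only [map_add, mul_add] at ha hb ⊢
    rw [ha, hb]
    abel
  | tmul u v =>
    have h1 := ιInv_parity u
    simp only [AlgHom.toLinearMap_apply] at h1
    have hs := ExteriorAlgebra.ι_add_mul_swap (R := k) x (T (ExteriorAlgebra.ιInv u))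
    simp only [comulStep_tmul, map_add, TensorProduct.map_tmul, TensorProduct.lift.tmul,
      LinearMap.comp_apply, LinearMap.id_apply, LinearMap.mul_apply', ιInv_ι_mul, h1, map_neg,
      map_smul, LinearMap.rTensor_tmul, TensorProduct.lid_tmul, AlgHom.toLinearMap_apply,
      mul_smul_comm, LinearMap.neg_apply, LinearMap.smul_apply, ← mul_assoc]
    rw [eq_neg_of_add_eq_zero_left hs, neg_mul]

theorem derExt_mul_ι (T : Module.End k V) (c : V) (w : Λ) :
    derExt T (w * ι c) = derExt T w * ι c + w * ι (T c) := by
  have : derExt T ∘ₗ LinearMap.mulRight k (ι c) =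
      LinearMap.mulRight k (ι c) ∘ₗ derExt T + LinearMap.mulRight k (ι (T c)) := by
    refine exterior_ext_left ?_ fun x w h => ?_
    · have := derExt_ι_mul T c 1
      rw [derExt_one] at this
      simp only [mul_one, mul_zero, add_zero] at this
      simp [this, derExt_one]
    · simp only [LinearMap.comp_apply, LinearMap.mulRight_apply, LinearMap.add_apply] at h ⊢
      rw [mul_assoc, derExt_ι_mul, h, derExt_ι_mul]
      simp only [mul_add, add_mul, mul_assoc, add_assoc]
  exact LinearMap.congr_fun this w

theorem derExt_parity (T : Module.End k V) (w : Λ) :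
    derExt T (parity k V w) = parity k V (derExt T w) := by
  have : derExt T ∘ₗ parity k V = parity k V ∘ₗ derExt T := by
    refine exterior_ext_left (by simp [derExt_one]) fun x w h => ?_
    simp only [LinearMap.comp_apply] at h ⊢
    rw [parity_ι_mul, map_neg, derExt_ι_mul, derExt_ι_mul, map_add, parity_ι_mul, parity_ι_mul, h]
    abel
  exact LinearMap.congr_fun this w

theorem comul_derExt (T : Module.End k V) (w : Λ) : comul k V (derExt T w) =
    TensorProduct.map (derExt T) LinearMap.id (comul k V w) +
      TensorProduct.map LinearMap.id (derExt T) (comul k V w) := by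
  have : comul k V ∘ₗ derExt T = (TensorProduct.map (derExt T) LinearMap.id +
      TensorProduct.map LinearMap.id (derExt T)) ∘ₗ comul k V := by
    refine exterior_ext_left (by simp [derExt_one, comul_one]) fun x w h => ?_
    simp only [LinearMap.comp_apply] at h ⊢
    rw [derExt_ι_mul, map_add, comul_ι_mul, comul_ι_mul, comul_ι_mul, h]
    generalize comul k V w = s
    induction s with
    | zero => simp
    | add a b ha hb =>
      simp only [map_add] at ha hb ⊢
      rw [add_add_add_comm, ha, hb]
    | tmul u v =>
      have h1 := derExt_parity T u
      simp only [AlgHom.toLinearMap_apply] at h1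
      simp only [comulStep_tmul, LinearMap.add_apply, map_add, TensorProduct.map_tmul,
        LinearMap.id_apply, derExt_ι_mul, h1, TensorProduct.add_tmul, TensorProduct.tmul_add]
      abel
  exact LinearMap.congr_fun this w

/-! ### Forms -/

theorem extendForm_ιMulti {p : ℕ} (f : V [⋀^Fin p]→ₗ[k] X) (v : Fin p → V) :
    extendForm f (ExteriorAlgebra.ιMulti k p v) = f v := by
  rw [extendForm, ExteriorAlgebra.liftAlternating_apply_ιMulti, Pi.single_eq_same]

theorem extendForm_ιMulti_of_ne {p i : ℕ} (h : i ≠ p) (f : V [⋀^Fin p]→ₗ[k] X) (v : Fin i → V) :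
    extendForm f (ExteriorAlgebra.ιMulti k i v) = 0 := by
  rw [extendForm, ExteriorAlgebra.liftAlternating_apply_ιMulti, Pi.single_eq_of_ne h]
  rfl

theorem extendForm_add {p : ℕ} (f g : V [⋀^Fin p]→ₗ[k] X) :
    extendForm (f + g) = extendForm f + extendForm g := by
  rw [extendForm, extendForm, extendForm, ← map_add, ← Pi.single_add]

theorem extendForm_smul {p : ℕ} (c : k) (f : V [⋀^Fin p]→ₗ[k] X) :
    extendForm (c • f) = c • extendForm f := by
  rw [extendForm, extendForm, ← map_smul, ← Pi.single_smul]

theorem extendForm_two_ι_mul (f : V [⋀^Fin 2]→ₗ[k] X) (x : V) (w : Λ) :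
    extendForm f (ι x * w) = f ![x, ExteriorAlgebra.ιInv w] := by
  have key : extendForm f ∘ₗ LinearMap.mulLeft k (ι x) =
      (f.toMultilinearMap.toLinearMap ![x, 0] 1) ∘ₗ ExteriorAlgebra.ιInv := by
    refine ExteriorAlgebra.lhom_ext fun i => ?_
    ext v
    have h1 : ι x * ExteriorAlgebra.ιMulti k i v =
        ExteriorAlgebra.ιMulti k (i + 1) (Matrix.vecCons x v) := by
      rw [ExteriorAlgebra.ιMulti_succ_apply]
      rfl
    have hup : ∀ y : V, Function.update ![x, 0] 1 y = ![x, y] := fun y => by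
      ext j
      fin_cases j <;> simp
    simp only [LinearMap.compAlternatingMap_apply, LinearMap.comp_apply, LinearMap.mulLeft_apply,
      h1, MultilinearMap.toLinearMap_apply, hup, AlternatingMap.coe_multilinearMap]
    rcases eq_or_ne i 1 with rfl | hi
    · rw [extendForm_ιMulti]
      congr 1
      ext j
      fin_cases j
      · rfl
      · simp [ExteriorAlgebra.ιMulti_apply, ιInv_ι]
    · rw [extendForm_ιMulti_of_ne (by omega)]
      have : ExteriorAlgebra.ιInv (R := k) (ExteriorAlgebra.ιMulti k i v) = 0 := by
        rcases i with _ | _ | i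
        · rw [ExteriorAlgebra.ιMulti_zero_apply, ιInv_one]
        · exact absurd rfl hi
        · rw [ExteriorAlgebra.ιMulti_succ_apply, ιInv_ι_mul, ExteriorAlgebra.ιMulti_succ_apply,
            map_mul, counit_ι, zero_mul, zero_smul]
      rw [this]
      exact (f.map_coord_zero (1 : Fin 2) (by simp)).symm
  have := LinearMap.congr_fun key w
  have hup : ∀ y : V, Function.update ![x, 0] 1 y = ![x, y] := fun y => by
    ext j
    fin_cases j <;> simp
  simpa [MultilinearMap.toLinearMap_apply, hup] using this

theorem extendForm_one {p : ℕ} (hp : p ≠ 0) (f : V [⋀^Fin p]→ₗ[k] X) :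
    extendForm f (1 : Λ) = 0 := by
  rw [← ExteriorAlgebra.ιMulti_zero_apply (R := k) (M := V) (0 : Fin 0 → V),
    extendForm_ιMulti_of_ne hp.symm]

/-- Linear maps on the exterior algebra that are homogeneous of degree `p`, i.e. that vanish outside
of the component of degree `p`. -/
def HomDeg (p : ℤ) (F : Λ →ₗ[k] X) : Prop := ∀ (t : k), t ≠ 0 → ∀ w, F (scale V t w) = t ^ p • F w

theorem scale_ιMulti (t : k) {i : ℕ} (v : Fin i → V) :
    scale V t (ExteriorAlgebra.ιMulti k i v) = t ^ i • ExteriorAlgebra.ιMulti k i v := by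
  rw [scale, ExteriorAlgebra.map_apply_ιMulti]
  have := (ExteriorAlgebra.ιMulti k i).map_smul_univ (fun _ : Fin i => t) v
  rw [Finset.prod_const, Finset.card_univ, Fintype.card_fin] at this
  exact this

theorem homDeg_extendForm {p : ℕ} (f : V [⋀^Fin p]→ₗ[k] X) : HomDeg p (extendForm f) := by
  intro t _ w
  have : extendForm f ∘ₗ (scale V t).toLinearMap = t ^ (p : ℤ) • extendForm f := by
    refine ExteriorAlgebra.lhom_ext fun i => ?_
    ext v
    simp only [LinearMap.compAlternatingMap_apply, LinearMap.comp_apply, LinearMap.smul_apply,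
      AlgHom.toLinearMap_apply, scale_ιMulti, map_smul]
    rcases eq_or_ne i p with rfl | hi
    · rw [zpow_natCast]
    · rw [extendForm_ιMulti_of_ne hi, smul_zero, smul_zero]
  exact LinearMap.congr_fun this w

theorem extendForm_formPart [CharZero k] {p : ℕ} {F : Λ →ₗ[k] X} (hF : HomDeg p F) :
    extendForm (formPart p F) = F := by
  refine ExteriorAlgebra.lhom_ext fun i => ?_
  ext v
  simp only [LinearMap.compAlternatingMap_apply]
  rcases eq_or_ne i p with rfl | hi
  · rw [extendForm_ιMulti]
    rfl
  · rw [extendForm_ιMulti_of_ne hi]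
    have h := hF 2 two_ne_zero (ExteriorAlgebra.ιMulti k i v)
    rw [scale_ιMulti, map_smul, zpow_natCast, ← sub_eq_zero, ← sub_smul] at h
    rcases smul_eq_zero.1 h with h | h
    · exfalso
      rw [sub_eq_zero] at h
      have h' : (2 : ℕ) ^ i = 2 ^ p := by exact_mod_cast h
      exact hi (Nat.pow_right_injective le_rfl h')
    · exact h.symm

theorem HomDeg.conv {p q : ℤ} {m : X →ₗ[k] Y →ₗ[k] Z} {F : Λ →ₗ[k] X} {G : Λ →ₗ[k] Y}
    (hF : HomDeg p F) (hG : HomDeg q G) : HomDeg (p + q) (conv m F G) := by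
  intro t ht w
  simp only [SemiInf.conv, LinearMap.comp_apply, comul_scale]
  generalize comul k V w = s
  induction s with
  | zero => simp
  | add a b ha hb =>
    simp only [map_add, smul_add] at ha hb ⊢
    rw [ha, hb]
  | tmul u v =>
    simp only [TensorProduct.map_tmul, AlgHom.toLinearMap_apply, hF t ht, hG t ht,
      TensorProduct.lift.tmul, map_smul, LinearMap.smul_apply, smul_smul, zpow_add₀ ht, mul_comm]

theorem HomDeg.add {p : ℤ} {F G : Λ →ₗ[k] X} (hF : HomDeg p F) (hG : HomDeg p G) :
    HomDeg p (F + G) := fun t ht w => by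
  rw [LinearMap.add_apply, hF t ht, hG t ht, LinearMap.add_apply, smul_add]

theorem HomDeg.smul {p : ℤ} {F : Λ →ₗ[k] X} (c : k) (hF : HomDeg p F) : HomDeg p (c • F) :=
  fun t ht w => by
  rw [LinearMap.smul_apply, hF t ht, LinearMap.smul_apply, smul_comm]

theorem HomDeg.neg {p : ℤ} {F : Λ →ₗ[k] X} (hF : HomDeg p F) : HomDeg p (-F) :=
  fun t ht w => by
  rw [LinearMap.neg_apply, hF t ht, LinearMap.neg_apply, smul_neg]

theorem HomDeg.sub {p : ℤ} {F G : Λ →ₗ[k] X} (hF : HomDeg p F) (hG : HomDeg p G) :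
    HomDeg p (F - G) := by
  rw [sub_eq_add_neg]
  exact hF.add hG.neg

theorem HomDeg.postcomp {p : ℤ} {F : Λ →ₗ[k] X} (hF : HomDeg p F) (g : X →ₗ[k] Y) :
    HomDeg p (g ∘ₗ F) := fun t ht w => by
  rw [LinearMap.comp_apply, hF t ht, map_smul, LinearMap.comp_apply]

/-- Homogeneity, composed with an operator of degree `q` on the exterior algebra. -/
theorem HomDeg.precomp {p q : ℤ} {F : Λ →ₗ[k] X} (hF : HomDeg p F) {T : Λ →ₗ[k] Λ}
    (hT : ∀ t : k, t ≠ 0 → ∀ w, T (scale V t w) = t ^ q • scale V t (T w)) :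
    HomDeg (p + q) (F ∘ₗ T) := fun t ht w => by
  rw [LinearMap.comp_apply, hT t ht, map_smul, hF t ht, LinearMap.comp_apply, smul_smul,
    zpow_add₀ ht, mul_comm]

theorem homDeg_ιInv : HomDeg 1 (ExteriorAlgebra.ιInv (R := k) (M := V)) := by
  intro t ht w
  have : ExteriorAlgebra.ιInv (R := k) ∘ₗ (scale V t).toLinearMap =
      t ^ (1 : ℤ) • ExteriorAlgebra.ιInv (R := k) := by
    refine exterior_ext_left (by simp [ιInv_one]) fun x w _ => ?_
    have hc : counit k V (scale V t w) = counit k V w := by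
      have : (counit k V).comp (scale V t) = counit k V := by
        ext x
        simp [counit_ι, scale_ι]
      exact AlgHom.congr_fun this w
    simp only [LinearMap.comp_apply, AlgHom.toLinearMap_apply, map_mul, scale_ι, smul_mul_assoc,
      map_smul, ιInv_ι_mul, LinearMap.smul_apply, hc, zpow_one]
  exact LinearMap.congr_fun this w

theorem HomDeg.parity {p : ℤ} {F : Λ →ₗ[k] X} (hF : HomDeg p F) (w : Λ) :
    F (parity k V w) = (-1 : k) ^ p • F w := by
  rw [← hF (-1) (by simp) w, ← scale_neg_one]
  rfl

theorem derExt_scale (T : Module.End k V) (t : k) (w : Λ) :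
    derExt T (scale V t w) = scale V t (derExt T w) := by
  have : derExt T ∘ₗ (scale V t).toLinearMap = (scale V t).toLinearMap ∘ₗ derExt T := by
    refine exterior_ext_left (by simp [derExt_one]) fun x w h => ?_
    simp only [LinearMap.comp_apply, AlgHom.toLinearMap_apply] at h ⊢
    rw [map_mul, scale_ι, smul_mul_assoc, map_smul, derExt_ι_mul, derExt_ι_mul, map_add, map_mul,
      map_mul, scale_ι, scale_ι, h, smul_add, smul_mul_assoc, smul_mul_assoc]
  exact LinearMap.congr_fun this w

/-! ### Coderivations -/

theorem coderExt_apply (β : V [⋀^Fin 2]→ₗ[k] V) (w : Λ) : coderExt β w =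
    TensorProduct.lift (LinearMap.mul k Λ) (TensorProduct.map
      (ExteriorAlgebra.ι k ∘ₗ extendForm β) LinearMap.id (comul k V w)) := rfl

theorem coderExt_one (β : V [⋀^Fin 2]→ₗ[k] V) : coderExt β (1 : Λ) = 0 := by
  rw [coderExt_apply, comul_one]
  simp [extendForm_one]

/-- An alternating bilinear map, with its first argument fixed. -/
def fixLeft (β : V [⋀^Fin 2]→ₗ[k] X) : V →ₗ[k] V →ₗ[k] X :=
  LinearMap.mk₂ k (fun x y => β ![x, y])
    (fun x x' y => by
      have := β.map_vecCons_add ![y] x x'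
      simpa using this)
    (fun c x y => by
      have := β.map_vecCons_smul ![y] c x
      simpa using this)
    (fun x y y' => by
      have := β.map_update_add ![x, 0] 1 y y'
      have hup : ∀ y : V, Function.update ![x, 0] 1 y = ![x, y] := fun y => by
        ext j
        fin_cases j <;> simp
      simpa [hup] using this)
    (fun c x y => by
      have := β.map_update_smul ![x, 0] 1 c y
      have hup : ∀ y : V, Function.update ![x, 0] 1 y = ![x, y] := fun y => by
        ext j
        fin_cases j <;> simp
      simpa [hup] using this)

theorem fixLeft_apply (β : V [⋀^Fin 2]→ₗ[k] X) (x y : V) : fixLeft β x y = β ![x, y] := rfl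

theorem fixLeft_swap (β : V [⋀^Fin 2]→ₗ[k] X) (x y : V) : fixLeft β x y = -fixLeft β y x := by
  have h := β.map_swap ![y, x] (show (0 : Fin 2) ≠ 1 by decide)
  have h' : (![y, x] ∘ Equiv.swap (0 : Fin 2) 1) = ![x, y] := by
    ext j
    fin_cases j <;> rfl
  rw [h'] at h
  exact h

theorem coderExt_ι_mul (β : V [⋀^Fin 2]→ₗ[k] V) (x : V) (w : Λ) :
    coderExt β (ι x * w) = derExt (fixLeft β x) w - ι x * coderExt β w := by
  rw [coderExt_apply, coderExt_apply, derExt_apply, comul_ι_mul]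
  generalize comul k V w = s
  induction s with
  | zero => simp
  | add a b ha hb =>
    simp only [map_add, mul_add] at ha hb ⊢
    rw [ha, hb]
    abel
  | tmul u v =>
    have h1 : extendForm β (CliffordAlgebra.involute u) = extendForm β u := by
      have := (homDeg_extendForm β).parity u
      simpa using this
    have hs := ExteriorAlgebra.ι_add_mul_swap (R := k) x (extendForm β u)
    simp only [comulStep_tmul, map_add, TensorProduct.map_tmul, TensorProduct.lift.tmul,
      LinearMap.comp_apply, LinearMap.id_apply, LinearMap.mul_apply', extendForm_two_ι_mul, h1,
      fixLeft_apply, ← mul_assoc]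
    rw [eq_neg_of_add_eq_zero_left hs, neg_mul, sub_neg_eq_add]

theorem coderExt_scale (β : V [⋀^Fin 2]→ₗ[k] V) (t : k) (w : Λ) :
    coderExt β (scale V t w) = t ^ (1 : ℤ) • scale V t (coderExt β w) := by
  have : coderExt β ∘ₗ (scale V t).toLinearMap =
      t ^ (1 : ℤ) • (scale V t).toLinearMap ∘ₗ coderExt β := by
    refine exterior_ext_left (by simp [coderExt_one]) fun x w h => ?_
    simp only [LinearMap.comp_apply, AlgHom.toLinearMap_apply, LinearMap.smul_apply] at h ⊢
    rw [map_mul, scale_ι, smul_mul_assoc, map_smul, coderExt_ι_mul, coderExt_ι_mul, map_sub, h,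
      derExt_scale, map_mul, scale_ι, zpow_one, smul_sub, smul_sub, smul_mul_assoc, mul_smul_comm]
  exact LinearMap.congr_fun this w

theorem coderExt_parity (β : V [⋀^Fin 2]→ₗ[k] V) (w : Λ) :
    coderExt β (parity k V w) = -parity k V (coderExt β w) := by
  have := coderExt_scale β (-1) w
  have h := fun w => LinearMap.congr_fun (scale_neg_one (k := k) (V := V)) w
  simp only [AlgHom.toLinearMap_apply] at h this ⊢
  rw [← h, this, h]
  simp

theorem coderExt_parity_mul_ι (β : V [⋀^Fin 2]→ₗ[k] V) (y : V) (w : Λ) :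
    coderExt β (parity k V (w * ι y)) =
      -derExt (fixLeft β y) w - coderExt β (parity k V w) * ι y := by
  have : (coderExt β ∘ₗ parity k V) ∘ₗ LinearMap.mulRight k (ι y) =
      -derExt (fixLeft β y) - LinearMap.mulRight k (ι y) ∘ₗ (coderExt β ∘ₗ parity k V) := by
    have hB : ∀ (x : V) (w : Λ), coderExt β (parity k V (ι x * w)) =
        -derExt (fixLeft β x) (parity k V w) + ι x * coderExt β (parity k V w) := fun x w => by
      rw [parity_ι_mul, map_neg, coderExt_ι_mul]
      abel
    refine exterior_ext_left ?_ fun x w h => ?_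
    · have h1 := hB y 1
      rw [mul_one, parity_one, derExt_one, coderExt_one] at h1
      simp only [LinearMap.comp_apply, LinearMap.mulRight_apply, one_mul, h1, LinearMap.sub_apply,
        LinearMap.neg_apply, derExt_one, parity_one, coderExt_one]
      simp
    · simp only [LinearMap.comp_apply, LinearMap.mulRight_apply, LinearMap.sub_apply,
        LinearMap.neg_apply] at h ⊢
      rw [mul_assoc, hB, h, hB, parity_mul_ι, map_neg, derExt_mul_ι, derExt_ι_mul, fixLeft_swap β y x,
        map_neg, neg_mul, ι_mul_eq (fixLeft β x y) w]
      simp only [mul_sub, add_mul, mul_neg, neg_mul, neg_neg, neg_add, mul_assoc]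
      abel
  exact LinearMap.congr_fun this w

end ExteriorLemmas

end SemiInf

namespace SemiInf

section Oscillators

variable {k : Type*} [Field k] {V D Y : Type*} [AddCommGroup V] [Module k V] [AddCommGroup D]
  [Module k D] [AddCommGroup Y] [Module k Y]

/-- If `D` separates the points of `V`, then every finite-dimensional subspace of `V` has a basis with
a dual system in `D`. -/
theorem exists_dual_system (pair : D →ₗ[k] Module.Dual k V)
    (hsep : ∀ v, (∀ d, pair d v = 0) → v = 0) (W : Submodule k V) [FiniteDimensional k W] :
    ∃ (n : ℕ) (v : Fin n → V) (d : Fin n → D), (∀ i j, pair (d i) (v j) = if i = j then 1 else 0) ∧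
      ∀ w ∈ W, w = ∑ i, pair (d i) w • v i := by
  let b := Module.finBasis k W
  let f : D →ₗ[k] Module.Dual k W := W.subtype.dualMap ∘ₗ pair
  have hf : LinearMap.range f = ⊤ := by
    rw [← Subspace.dualCoannihilator_dualAnnihilator_eq (W := LinearMap.range f)]
    have : (LinearMap.range f).dualCoannihilator = ⊥ := by
      rw [eq_bot_iff]
      intro w hw
      rw [Submodule.mem_dualCoannihilator] at hw
      exact Subtype.ext (hsep w fun d => hw (f d) ⟨d, rfl⟩)
    rw [this, Submodule.dualAnnihilator_bot]
  have hs : ∀ i, ∃ d, f d = b.coord i := fun i => by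
    have : b.coord i ∈ LinearMap.range f := hf ▸ Submodule.mem_top
    exact this
  choose d hd using hs
  have hd' : ∀ i (w : W), pair (d i) w = b.coord i w := fun i w => LinearMap.congr_fun (hd i) w
  refine ⟨_, fun i => b i, d, fun i j => ?_, fun w hw => ?_⟩
  · rw [hd', Module.Basis.coord_apply, Module.Basis.repr_self, Finsupp.single_apply]
    simp only [eq_comm]
  · have := congrArg W.subtype (b.sum_repr ⟨w, hw⟩)
    rw [map_sum] at this
    conv_lhs => rw [show w = W.subtype ⟨w, hw⟩ from rfl, ← this]
    refine Finset.sum_congr rfl fun i _ => ?_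
    rw [map_smul, hd' i ⟨w, hw⟩]
    rfl

/-- For creation operators `a` and annihilation operators `c` acting on a space that is generated
from the subspace `Y₀` of vacuum vectors, the vectors killed by all annihilation operators are in
`Y₀`. -/
theorem mem_of_annihilated (pair : D →ₗ[k] Module.Dual k V)
    (hsep : ∀ v, (∀ d, pair d v = 0) → v = 0) (a : V →ₗ[k] Module.End k Y)
    (c : D →ₗ[k] Module.End k Y) (hca : ∀ d v, c d * a v + a v * c d = pair d v • 1)
    (haa : ∀ v, a v * a v = 0) (Y₀ : Submodule k Y) (h₀ : ∀ d, ∀ y ∈ Y₀, c d y = 0)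
    (hgen : ∀ S : Submodule k Y, Y₀ ≤ S → (∀ v, ∀ y ∈ S, a v y ∈ S) → S = ⊤) {y : Y}
    (hy : ∀ d, c d y = 0) : y ∈ Y₀ := by
  have haa' : ∀ v w, a v * a w = -(a w * a v) := fun v w => by
    have := haa (v + w)
    rw [map_add, add_mul, mul_add, mul_add, haa, haa, zero_add, add_zero] at this
    exact eq_neg_of_add_eq_zero_left this
  let Pr : ∀ {n : ℕ}, (Fin n → V) → (Fin n → D) → Module.End k Y := fun {n} v d =>
    ((List.finRange n).map fun i => c (d i) * a (v i)).prod
  have hfix : ∀ {n : ℕ} (v : Fin n → V) (d : Fin n → D),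
      (∀ i j, pair (d i) (v j) = if i = j then 1 else 0) → ∀ z, (∀ e, c e z = 0) →
      Pr v d z = z := by
    intro n v d hvd z hz
    have : ∀ l : List (Fin n), (l.map fun i => c (d i) * a (v i)).prod z = z := fun l => by
      induction l with
      | nil => simp
      | cons i l ih =>
        rw [List.map_cons, List.prod_cons, Module.End.mul_apply, ih]
        have h1 := LinearMap.congr_fun (hca (d i) (v i)) z
        rw [LinearMap.add_apply, Module.End.mul_apply (a (v i)), hz, map_zero, add_zero, hvd,
          if_pos rfl, one_smul] at h1
        exact h1
    exact this _
  have hkill : ∀ {n : ℕ} (v : Fin n → V) (d : Fin n → D),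
      (∀ i j, pair (d i) (v j) = if i = j then 1 else 0) → ∀ i, Pr v d * a (v i) = 0 := by
    intro n v d hvd i
    have hcomm : ∀ l : List (Fin n), i ∉ l → (l.map fun i => c (d i) * a (v i)).prod * a (v i) =
        a (v i) * (l.map fun i => c (d i) * a (v i)).prod := fun l hl => by
      induction l with
      | nil => simp
      | cons j l ih =>
        rw [List.mem_cons, not_or] at hl
        have h1 := hca (d j) (v i)
        rw [hvd, if_neg (fun h => hl.1 h.symm), zero_smul] at h1
        rw [List.map_cons, List.prod_cons, mul_assoc, ih hl.2, ← mul_assoc, ← mul_assoc,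
          mul_assoc (c (d j)), haa', mul_neg, ← mul_assoc, eq_neg_of_add_eq_zero_left h1, neg_mul,
          neg_mul, neg_mul, neg_neg, mul_assoc (a (v i))]
    have hzero : ∀ l : List (Fin n), i ∈ l →
        (l.map fun i => c (d i) * a (v i)).prod * a (v i) = 0 := fun l hl => by
      induction l with
      | nil => simp at hl
      | cons j l ih =>
        rw [List.map_cons, List.prod_cons, mul_assoc]
        by_cases hil : i ∈ l
        · rw [ih hil, mul_zero]
        · obtain rfl : i = j := (List.mem_cons.1 hl).resolve_right hil
          rw [hcomm l hil, mul_assoc, ← mul_assoc (a (v i)), haa, zero_mul, mul_zero]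
    exact hzero _ (List.mem_finRange i)
  let S : Submodule k Y :=
    { carrier := {z | ∃ W : Submodule k V, FiniteDimensional k W ∧
        ∀ (n : ℕ) (v : Fin n → V) (d : Fin n → D),
          (∀ i j, pair (d i) (v j) = if i = j then 1 else 0) →
          (∀ w ∈ W, w = ∑ i, pair (d i) w • v i) → Pr v d z ∈ Y₀}
      add_mem' := by
        rintro z z' ⟨W, _, h⟩ ⟨W', _, h'⟩
        refine ⟨W ⊔ W', inferInstance, fun n v d hvd hW => ?_⟩
        rw [map_add]
        exact Y₀.add_mem (h n v d hvd fun w hw => hW w (Submodule.mem_sup_left hw))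
          (h' n v d hvd fun w hw => hW w (Submodule.mem_sup_right hw))
      zero_mem' := ⟨⊥, inferInstance, fun n v d _ _ => by rw [map_zero]; exact Y₀.zero_mem⟩
      smul_mem' := by
        rintro t z ⟨W, hW, h⟩
        refine ⟨W, hW, fun n v d hvd hW => ?_⟩
        rw [map_smul]
        exact Y₀.smul_mem _ (h n v d hvd hW) }
  have hS : S = ⊤ := by
    refine hgen S (fun z hz => ⟨⊥, inferInstance, fun n v d hvd _ => ?_⟩) fun x z _ => ?_
    · rw [hfix v d hvd z fun e => h₀ e z hz]
      exact hz
    · refine ⟨Submodule.span k {x}, inferInstance, fun n v d hvd hW => ?_⟩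
      have hx := hW x (Submodule.mem_span_singleton_self x)
      rw [hx, map_sum, LinearMap.sum_apply, map_sum]
      refine Y₀.sum_mem fun i _ => ?_
      rw [map_smul, LinearMap.smul_apply, map_smul, ← Module.End.mul_apply, hkill v d hvd,
        LinearMap.zero_apply, smul_zero]
      exact Y₀.zero_mem
  obtain ⟨W, _, h⟩ : y ∈ S := hS ▸ Submodule.mem_top
  obtain ⟨n, v, d, hvd, hW⟩ := exists_dual_system pair hsep W
  have := h n v d hvd hW
  rwa [hfix v d hvd y hy] at this

end Oscillators

section LocallyFinite

variable {k : Type*} [Field k] {V : Type*} [AddCommGroup V] [Module k V]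
variable {X Y B : Type*} [AddCommGroup X] [Module k X] [AddCommGroup Y] [Module k Y]
  [AddCommGroup B] [Module k B]

local notation "Λ" => ExteriorAlgebra k V

/-- Linear maps on a space of linear maps `a` whose value depends only on the restriction of `a` to a
finite-dimensional subspace. -/
def FinDetermined (T : (Λ →ₗ[k] B) →ₗ[k] Y) : Prop :=
  ∃ W : Submodule k Λ, FiniteDimensional k W ∧ ∀ a, (∀ w ∈ W, a w = 0) → T a = 0

theorem FinDetermined.add {S T : (Λ →ₗ[k] B) →ₗ[k] Y} (hS : FinDetermined S)
    (hT : FinDetermined T) : FinDetermined (S + T) := by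
  obtain ⟨W, _, h⟩ := hS
  obtain ⟨W', _, h'⟩ := hT
  refine ⟨W ⊔ W', inferInstance, fun a ha => ?_⟩
  rw [LinearMap.add_apply, h a fun w hw => ha w (Submodule.mem_sup_left hw),
    h' a fun w hw => ha w (Submodule.mem_sup_right hw), add_zero]

theorem FinDetermined.postcomp {T : (Λ →ₗ[k] B) →ₗ[k] Y} (hT : FinDetermined T)
    (g : Y →ₗ[k] X) : FinDetermined (g ∘ₗ T) := by
  obtain ⟨W, hW, h⟩ := hT
  exact ⟨W, hW, fun a ha => by rw [LinearMap.comp_apply, h a ha, map_zero]⟩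

theorem FinDetermined.smul (c : k) {T : (Λ →ₗ[k] B) →ₗ[k] Y} (hT : FinDetermined T) :
    FinDetermined (c • T) := by
  obtain ⟨W, hW, h⟩ := hT
  exact ⟨W, hW, fun a ha => by rw [LinearMap.smul_apply, h a ha, smul_zero]⟩

theorem FinDetermined.neg {T : (Λ →ₗ[k] B) →ₗ[k] Y} (hT : FinDetermined T) :
    FinDetermined (-T) := by
  obtain ⟨W, hW, h⟩ := hT
  exact ⟨W, hW, fun a ha => by rw [LinearMap.neg_apply, h a ha, neg_zero]⟩

theorem FinDetermined.sub {S T : (Λ →ₗ[k] B) →ₗ[k] Y} (hS : FinDetermined S)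
    (hT : FinDetermined T) : FinDetermined (S - T) := by
  rw [sub_eq_add_neg]
  exact hS.add hT.neg

/-- Composition with a linear transformation of the space of linear maps, all of whose values are
determined by finitely many values of the argument. -/
theorem FinDetermined.precomp {B' : Type*} [AddCommGroup B'] [Module k B']
    {T : (Λ →ₗ[k] B') →ₗ[k] Y} (hT : FinDetermined T) (F : (Λ →ₗ[k] B) →ₗ[k] (Λ →ₗ[k] B'))
    (hF : ∀ w, FinDetermined (LinearMap.applyₗ w ∘ₗ F)) : FinDetermined (T ∘ₗ F) := by
  obtain ⟨W, _, h⟩ := hT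
  choose U hU hU' using hF
  let b := Module.finBasis k W
  refine ⟨⨆ i, U (b i), inferInstance, fun a ha => h _ fun w hw => ?_⟩
  have : F a ∘ₗ W.subtype = 0 := by
    refine b.ext fun i => ?_
    exact hU' _ a fun w hw => ha w (Submodule.mem_iSup_of_mem i hw)
  exact LinearMap.congr_fun this ⟨w, hw⟩

theorem finDetermined_apply (w : Λ) :
    FinDetermined (LinearMap.applyₗ w : (Λ →ₗ[k] B) →ₗ[k] B) :=
  ⟨Submodule.span k {w}, inferInstance,
    fun _ ha => ha w (Submodule.mem_span_singleton_self w)⟩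

/-- A linear map that depends only on the values of its argument on the second components of a tensor
is finitely determined. -/
theorem finDetermined_of_tensor (T : (Λ →ₗ[k] B) →ₗ[k] Λ ⊗[k] X →ₗ[k] Y)
    (hT : ∀ w x, FinDetermined (LinearMap.applyₗ (w ⊗ₜ[k] x) ∘ₗ T)) (t : Λ ⊗[k] X) :
    FinDetermined (LinearMap.applyₗ t ∘ₗ T) := by
  induction t with
  | zero => exact ⟨⊥, inferInstance, fun _ _ => by simp⟩
  | add s t hs ht =>
    have := hs.add ht
    rwa [← LinearMap.add_comp, ← map_add] at this
  | tmul w x => exact hT w x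

/-- A finitely determined linear map that vanishes on the decomposable maps `r ⊗ b` of a given parity
vanishes on all maps of that parity. -/
theorem FinDetermined.eq_zero [CharZero k] {T : (Λ →ₗ[k] B) →ₗ[k] Y} (hT : FinDetermined T) {s : k}
    (hs : s * s = 1)
    (h : ∀ (r : Λ →ₗ[k] k) (b : B), (∀ w, r (parity k V w) = s • r w) → T (r.smulRight b) = 0)
    {a : Λ →ₗ[k] B} (ha : ∀ w, a (parity k V w) = s • a w) : T a = 0 := by
  obtain ⟨W₁, _, hW⟩ := hT
  let W := W₁ ⊔ W₁.map (parity k V)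
  obtain ⟨pr, hpr⟩ := W.subtype.exists_leftInverse_of_injective W.ker_subtype
  let b := Module.finBasis k W
  let r : Fin (Module.finrank k W) → Λ →ₗ[k] k := fun i => b.coord i ∘ₗ pr
  let r' : Fin (Module.finrank k W) → Λ →ₗ[k] k := fun i =>
    (2⁻¹ : k) • (r i + s • r i ∘ₗ parity k V)
  have hr : ∀ w ∈ W, ∑ i, r i w • a (b i) = a w := fun w hw => by
    have h1 : pr w = ⟨w, hw⟩ := LinearMap.congr_fun hpr ⟨w, hw⟩
    have h2 := congrArg (a ∘ₗ W.subtype) (b.sum_repr ⟨w, hw⟩)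
    rw [map_sum] at h2
    simp only [r, LinearMap.comp_apply, h1, Module.Basis.coord_apply]
    simp only [map_smul] at h2
    exact h2
  have h0 : T (a - ∑ i, (r' i).smulRight (a (b i))) = 0 := by
    refine hW _ fun w hw => ?_
    have e1 := hr w (Submodule.mem_sup_left hw)
    have e2 := hr (parity k V w) (Submodule.mem_sup_right ⟨w, hw, rfl⟩)
    rw [ha] at e2
    have e3 : ∑ i, ((r' i).smulRight (a (b i))) w =
        (2⁻¹ : k) • (∑ i, r i w • a (b i) + s • ∑ i, r i (parity k V w) • a (b i)) := by
      rw [Finset.smul_sum, ← Finset.sum_add_distrib, Finset.smul_sum]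
      refine Finset.sum_congr rfl fun i _ => ?_
      simp only [r', LinearMap.smulRight_apply, LinearMap.smul_apply, LinearMap.add_apply,
        LinearMap.comp_apply, smul_eq_mul, smul_smul, ← add_smul]
    rw [LinearMap.sub_apply, LinearMap.sum_apply, e3, e1, e2, smul_smul, hs, one_smul, ← two_smul k,
      smul_smul, inv_mul_cancel₀ two_ne_zero, one_smul, sub_self]
  rw [map_sub, sub_eq_zero, map_sum] at h0
  rw [h0]
  refine Finset.sum_eq_zero fun i _ => h _ _ fun w => ?_
  simp only [r', LinearMap.smul_apply, LinearMap.add_apply, LinearMap.comp_apply, smul_eq_mul,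
    parity_parity]
  linear_combination (-2⁻¹ : k) * r i (parity k V w) * hs

theorem finTrace_sum_smulRight {n : ℕ} (f : Fin n → Module.Dual k X) (v : Fin n → X) :
    finTrace (∑ i, (f i).smulRight (v i)) = ∑ i, f i (v i) := by
  let W := Submodule.span k (Set.range v)
  have hv : ∀ i, v i ∈ W := fun i => Submodule.subset_span ⟨i, rfl⟩
  have hW : FiniteDimensional k W := FiniteDimensional.span_of_finite k (Set.finite_range v)
  have h : ∀ x, (∑ i, (f i).smulRight (v i)) x ∈ W := fun x => by
    rw [LinearMap.sum_apply]
    exact W.sum_mem fun i _ => W.smul_mem _ (hv i)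
  rw [finTrace_eq_of_range_le _ W h]
  have : (LinearMap.codRestrict W (∑ i, (f i).smulRight (v i)) h) ∘ₗ W.subtype =
      ∑ i, (f i ∘ₗ W.subtype).smulRight (⟨v i, hv i⟩ : W) := by
    ext w
    simp [LinearMap.sum_apply]
  rw [this, map_sum]
  refine Finset.sum_congr rfl fun i _ => ?_
  have h1 : (f i ∘ₗ W.subtype).smulRight (⟨v i, hv i⟩ : W) =
      dualTensorHom k W W ((f i ∘ₗ W.subtype) ⊗ₜ ⟨v i, hv i⟩) := by
    ext w
    simp
  rw [h1, LinearMap.trace_eq_contract_apply, contractLeft_apply]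
  rfl

theorem finTrace_eq_zero_of_range_le (T : Module.End k X) (W : Submodule k X)
    [FiniteDimensional k W] (h : ∀ v, T v ∈ W) (h0 : ∀ w ∈ W, T w = 0) : finTrace T = 0 := by
  rw [finTrace_eq_of_range_le T W h]
  have : (T.codRestrict W h) ∘ₗ W.subtype = 0 := by
    ext w
    exact h0 w w.2
  rw [this, map_zero]

end LocallyFinite

end SemiInf

namespace SemiInf

namespace SplitTate

section FockModule

variable {k : Type*} [Field k] {𝔤 : Type*} [LieRing 𝔤] [LieAlgebra k 𝔤] [UniformSpace 𝔤]
  [IsUniformAddGroup 𝔤] (D : SplitTate k 𝔤)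

/-! ### Topological preliminaries -/

theorem exists_open_subspace (D : SplitTate k 𝔤) {U : Set 𝔤} (hU : U ∈ 𝓝 (0 : 𝔤)) :
    ∃ W : Submodule k 𝔤, IsOpen (W : Set 𝔤) ∧ (W : Set 𝔤) ⊆ U := by
  obtain ⟨B, hB, -⟩ := D.isTate.exists_basis
  obtain ⟨W, hW, hWU⟩ := hB.mem_iff.1 hU
  exact ⟨W, AddSubgroup.isOpen_of_mem_nhds W.toAddSubgroup (hB.mem_of_mem hW), hWU⟩

theorem mem_nhds_zero_of_isOpen {U : Submodule k 𝔤} (hU : IsOpen (U : Set 𝔤)) :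
    (U : Set 𝔤) ∈ 𝓝 (0 : 𝔤) := hU.mem_nhds U.zero_mem

theorem exists_open_subspace_forall_eq_zero (D : SplitTate k 𝔤) (f : tateDual k 𝔤) :
    ∃ W : Submodule k 𝔤, IsOpen (W : Set 𝔤) ∧ ∀ x ∈ W, f.1 x = 0 := by
  obtain ⟨W, hW, h⟩ := D.exists_open_subspace (show {v | f.1 v = 0} ∈ 𝓝 (0 : 𝔤) from f.2)
  exact ⟨W, hW, fun x hx => h hx⟩

theorem pr𝔟_coe (b : D.𝔟) : D.pr𝔟 (b : 𝔤) = b := by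
  apply Subtype.ext
  have := D.in𝔟_pr𝔟 (b : 𝔤)
  rw [show D.pr𝔠 (b : 𝔤) = 0 from (Submodule.Quotient.mk_eq_zero _).2 b.2, map_zero,
    sub_zero] at this
  exact this

theorem pr𝔠_coe (b : D.𝔟) : D.pr𝔠 (b : 𝔤) = 0 := (Submodule.Quotient.mk_eq_zero _).2 b.2

theorem pr𝔟_sec (c : D.𝔠) : D.pr𝔟 (D.sec c) = 0 := by
  apply Subtype.ext
  have := D.in𝔟_pr𝔟 (D.sec c)
  rw [D.pr𝔠_sec, sub_self] at this
  exact this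

theorem pr𝔟_add_sec_pr𝔠 (x : 𝔤) : (D.pr𝔟 x : 𝔤) + D.sec (D.pr𝔠 x) = x := by
  have := D.in𝔟_pr𝔟 x
  rw [show (D.pr𝔟 x : 𝔤) = D.in𝔟 (D.pr𝔟 x) from rfl, this, sub_add_cancel]

/-- The restriction `𝔤* → 𝔟*`. -/
def resDual : tateDual k 𝔤 →ₗ[k] tateDual k D.𝔟 where
  toFun f := ⟨f.1 ∘ₗ D.in𝔟, by
    have : Filter.Tendsto (fun b : D.𝔟 => (b : 𝔤)) (𝓝 0) (𝓝 0) :=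
      continuous_subtype_val.tendsto (0 : D.𝔟)
    exact this.eventually f.2⟩
  map_add' _ _ := rfl
  map_smul' _ _ := rfl

theorem resDual_apply (f : tateDual k 𝔤) (b : D.𝔟) : (D.resDual f).1 b = f.1 b := rfl

/-- The extension of functionals from `𝔟` to `𝔤` by zero on the image of the section. -/
def extDual : tateDual k D.𝔟 →ₗ[k] tateDual k 𝔤 where
  toFun β := ⟨β.1 ∘ₗ D.pr𝔟, by
    have h1 : ∀ᶠ b : D.𝔟 in 𝓝 0, β.1 b = 0 := β.2
    have h2 := (D.isCLattice.isOpen.isOpenEmbedding_subtypeVal.map_nhds_eq (0 : D.𝔟))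
    have h3 : ∀ᶠ x in 𝓝 ((0 : D.𝔟) : 𝔤), β.1 (D.pr𝔟 x) = 0 := by
      rw [← h2]
      refine Filter.eventually_map.2 (h1.mono fun b hb => ?_)
      rw [pr𝔟_coe, hb]
    exact h3⟩
  map_add' _ _ := rfl
  map_smul' _ _ := rfl

theorem extDual_apply (β : tateDual k D.𝔟) (x : 𝔤) : (D.extDual β).1 x = β.1 (D.pr𝔟 x) := rfl

theorem extDual_sec (β : tateDual k D.𝔟) (c : D.𝔠) : (D.extDual β).1 (D.sec c) = 0 := by
  rw [extDual_apply, pr𝔟_sec, map_zero]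

theorem resDual_extDual (β : tateDual k D.𝔟) : D.resDual (D.extDual β) = β := by
  ext b
  rw [resDual_apply, extDual_apply, pr𝔟_coe]

/-- Functionals on `𝔠`, considered as functionals on `𝔤` that vanish on `𝔟`. -/
def annDual : Module.Dual k D.𝔠 →ₗ[k] tateDual k 𝔤 where
  toFun ξ := ⟨ξ ∘ₗ D.pr𝔠, by
    filter_upwards [mem_nhds_zero_of_isOpen D.isCLattice.isOpen] with x hx
    rw [LinearMap.comp_apply, show D.pr𝔠 x = 0 from (Submodule.Quotient.mk_eq_zero _).2 hx,
      map_zero]⟩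
  map_add' _ _ := rfl
  map_smul' _ _ := rfl

theorem annDual_apply (ξ : Module.Dual k D.𝔠) (x : 𝔤) : (D.annDual ξ).1 x = ξ (D.pr𝔠 x) := rfl

theorem annDual_coe (ξ : Module.Dual k D.𝔠) (b : D.𝔟) : (D.annDual ξ).1 b = 0 := by
  rw [annDual_apply, pr𝔠_coe, map_zero]

theorem annDual_sec (ξ : Module.Dual k D.𝔠) (c : D.𝔠) : (D.annDual ξ).1 (D.sec c) = ξ c := by
  rw [annDual_apply, pr𝔠_sec]

theorem extDual_resDual_add (f : tateDual k 𝔤) :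
    D.extDual (D.resDual f) + D.annDual (f.1 ∘ₗ D.sec) = f := by
  ext x
  change f.1 (D.pr𝔟 x) + f.1 (D.sec (D.pr𝔠 x)) = f.1 x
  rw [← map_add, pr𝔟_add_sec_pr𝔠]

/-- A finite dual system in `𝔟` and `𝔟*` that is a basis of `𝔟` modulo an open subspace. -/
theorem exists_resolution (U : Submodule k 𝔤) (hU : IsOpen (U : Set 𝔤)) :
    ∃ (n : ℕ) (b : Fin n → D.𝔟) (β : Fin n → tateDual k D.𝔟),
      (∀ i j, (β i).1 (b j) = if i = j then 1 else 0) ∧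
      (∀ x : D.𝔟, ((x - ∑ i, (β i).1 x • b i : D.𝔟) : 𝔤) ∈ U) ∧
      ∀ i (x : D.𝔟), (x : 𝔤) ∈ U → (β i).1 x = 0 := by
  let W : Submodule k D.𝔟 := U.comap D.in𝔟
  have hfin := D.finite_range_of_open W.mkQ U hU fun b hb => (Submodule.Quotient.mk_eq_zero _).2 hb
  rw [Submodule.range_mkQ] at hfin
  have : FiniteDimensional k (D.𝔟 ⧸ W) := Module.Finite.equiv (Submodule.topEquiv)
  let e := Module.finBasis k (D.𝔟 ⧸ W)
  choose b hb using fun i => W.mkQ_surjective (e i)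
  have hW : ∀ i (x : D.𝔟), (x : 𝔤) ∈ U → e.coord i (W.mkQ x) = 0 := fun i x hx => by
    rw [show W.mkQ x = 0 from (Submodule.Quotient.mk_eq_zero _).2 hx, map_zero]
  refine ⟨_, b, fun i => ⟨e.coord i ∘ₗ W.mkQ, ?_⟩, fun i j => ?_, fun x => ?_, hW⟩
  · have h1 : Filter.Tendsto (fun b : D.𝔟 => (b : 𝔤)) (𝓝 0) (𝓝 0) :=
      continuous_subtype_val.tendsto (0 : D.𝔟)
    filter_upwards [h1 (mem_nhds_zero_of_isOpen hU)] with x hx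
    exact hW i x hx
  · change e.coord i (W.mkQ (b j)) = _
    rw [hb, Module.Basis.coord_apply, Module.Basis.repr_self, Finsupp.single_apply]
    simp only [eq_comm]
  · have : W.mkQ (x - ∑ i, e.coord i (W.mkQ x) • b i) = 0 := by
      rw [map_sub, map_sum]
      simp only [map_smul, hb, Module.Basis.coord_apply]
      rw [e.sum_repr, sub_self]
    exact (Submodule.Quotient.mk_eq_zero W).1 this

/-- A functional on `𝔟` that vanishes on the open subspace is determined by the dual system. -/
theorem resolution_apply {Y : Type*} [AddCommGroup Y] [Module k Y] {U : Submodule k 𝔤} {n : ℕ}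
    {b : Fin n → D.𝔟} {β : Fin n → tateDual k D.𝔟}
    (h : ∀ x : D.𝔟, ((x - ∑ i, (β i).1 x • b i : D.𝔟) : 𝔤) ∈ U) (f : D.𝔟 →ₗ[k] Y)
    (hf : ∀ x : D.𝔟, (x : 𝔤) ∈ U → f x = 0) (x : D.𝔟) : f x = ∑ i, (β i).1 x • f (b i) := by
  have := hf _ (h x)
  rw [map_sub, map_sum, sub_eq_zero] at this
  rw [this]
  exact Finset.sum_congr rfl fun i _ => map_smul _ _ _

theorem eq_sum_resolution {U : Submodule k 𝔤} {n : ℕ}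
    {b : Fin n → D.𝔟} {β : Fin n → tateDual k D.𝔟}
    (h : ∀ x : D.𝔟, ((x - ∑ i, (β i).1 x • b i : D.𝔟) : 𝔤) ∈ U) (γ : tateDual k D.𝔟)
    (hf : ∀ x : D.𝔟, (x : 𝔤) ∈ U → γ.1 x = 0) : γ = ∑ i, γ.1 (b i) • β i := by
  ext x
  rw [D.resolution_apply h γ.1 hf x, AddSubmonoidClass.coe_finsetSum, LinearMap.sum_apply]
  refine Finset.sum_congr rfl fun i _ => ?_
  change (β i).1 x * γ.1 (b i) = γ.1 (b i) * (β i).1 x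
  rw [mul_comm]

/-! ### The Clifford operators -/

theorem quadForm_apply (f : tateDual k 𝔤) (x : 𝔤) : quadForm k 𝔤 (f, x) = f.1 x := by
  simp [quadForm, QuadraticForm.dualProd_apply]

/-- The Clifford module, with its structure of a vector space. -/
def FockSpace : Type _ := D.Fock

noncomputable instance : AddCommGroup D.FockSpace := inferInstanceAs (AddCommGroup D.Fock)

noncomputable instance : Module k D.FockSpace := inferInstanceAs (Module k D.Fock)

/-- The class of an element of the Clifford algebra in the Clifford module. -/
noncomputable def fockMk : Cl k 𝔤 →ₗ[k] D.FockSpace :=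
  ((Submodule.Quotient.restrictScalarsEquiv k D.vacuumIdeal).toLinearMap ∘ₗ
    (D.vacuumIdeal.restrictScalars k).mkQ : Cl k 𝔤 →ₗ[k] D.Fock)

theorem fockMk_surjective : Function.Surjective D.fockMk := Submodule.Quotient.mk_surjective _

/-- The action of the Clifford algebra on the Clifford module. -/
noncomputable def fockAct : Cl k 𝔤 →ₐ[k] Module.End k D.FockSpace :=
  (Algebra.lsmul k k D.Fock : Cl k 𝔤 →ₐ[k] Module.End k D.Fock)

theorem fockMk_eq_zero {a : Cl k 𝔤} (h : a ∈ D.vacuumIdeal) : D.fockMk a = 0 :=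
  (Submodule.Quotient.mk_eq_zero D.vacuumIdeal).2 h

/-- The action of `𝔤* ⊕ 𝔤` on the Clifford module. -/
noncomputable def cliff : (tateDual k 𝔤 × 𝔤) →ₗ[k] Module.End k D.FockSpace :=
  D.fockAct.toLinearMap ∘ₗ gen k 𝔤

theorem cliff_fockMk (z : tateDual k 𝔤 × 𝔤) (a : Cl k 𝔤) :
    D.cliff z (D.fockMk a) = D.fockMk (gen k 𝔤 z * a) := rfl

/-- The operators `ι_x`, as a linear map. -/
noncomputable def interL : 𝔤 →ₗ[k] Module.End k D.FockSpace := D.cliff ∘ₗ LinearMap.inr k _ _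

/-- The operators `ε_f`, as a linear map. -/
noncomputable def exterL : tateDual k 𝔤 →ₗ[k] Module.End k D.FockSpace :=
  D.cliff ∘ₗ LinearMap.inl k _ _

theorem cliff_eq (f : tateDual k 𝔤) (x : 𝔤) : D.cliff (f, x) = D.exterL f + D.interL x := by
  rw [interL, exterL, LinearMap.comp_apply, LinearMap.comp_apply, ← map_add]
  simp

theorem cliff_mul_self (z : tateDual k 𝔤 × 𝔤) : D.cliff z * D.cliff z = quadForm k 𝔤 z • 1 := by
  have h := CliffordAlgebra.ι_sq_scalar (quadForm k 𝔤) z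
  have := congrArg D.fockAct h
  rw [map_mul, AlgHom.commutes, Algebra.algebraMap_eq_smul_one] at this
  exact this

theorem interL_mul_self (x : 𝔤) : D.interL x * D.interL x = 0 := by
  have := D.cliff_mul_self (0, x)
  rw [quadForm_apply] at this
  exact this.trans (zero_smul k _)

theorem exterL_mul_self (f : tateDual k 𝔤) : D.exterL f * D.exterL f = 0 := by
  have := D.cliff_mul_self (f, 0)
  rw [quadForm_apply, map_zero] at this
  exact this.trans (zero_smul k _)

theorem interL_interL (x y : 𝔤) (u : D.FockSpace) :
    D.interL x (D.interL y u) = -D.interL y (D.interL x u) := by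
  have := D.interL_mul_self (x + y)
  rw [map_add, add_mul, mul_add, mul_add, interL_mul_self, interL_mul_self, zero_add,
    add_zero] at this
  exact LinearMap.congr_fun (eq_neg_of_add_eq_zero_left this) u

theorem exterL_exterL (f g : tateDual k 𝔤) (u : D.FockSpace) :
    D.exterL f (D.exterL g u) = -D.exterL g (D.exterL f u) := by
  have := D.exterL_mul_self (f + g)
  rw [map_add, add_mul, mul_add, mul_add, exterL_mul_self, exterL_mul_self, zero_add,
    add_zero] at this
  exact LinearMap.congr_fun (eq_neg_of_add_eq_zero_left this) u

theorem exterL_interL (f : tateDual k 𝔤) (x : 𝔤) (u : D.FockSpace) :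
    D.exterL f (D.interL x u) = f.1 x • u - D.interL x (D.exterL f u) := by
  have := D.cliff_mul_self (f, x)
  rw [quadForm_apply, cliff_eq, add_mul, mul_add, mul_add, exterL_mul_self, interL_mul_self,
    zero_add, add_zero] at this
  exact LinearMap.congr_fun (eq_sub_of_add_eq this) u

/-- The vacuum vector. -/
noncomputable def vacuum : D.FockSpace := D.fockMk 1

theorem cliff_vacuum {f : tateDual k 𝔤} {x : 𝔤} (hf : ∀ b ∈ D.𝔟, f.1 b = 0) (hx : x ∈ D.𝔟) :
    D.cliff (f, x) D.vacuum = 0 := by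
  rw [vacuum, cliff_fockMk, mul_one]
  exact D.fockMk_eq_zero (Submodule.subset_span ⟨f, x, hf, hx, rfl⟩)

theorem interL_vacuum {x : 𝔤} (hx : x ∈ D.𝔟) : D.interL x D.vacuum = 0 :=
  D.cliff_vacuum (fun _ _ => rfl) hx

theorem exterL_vacuum {f : tateDual k 𝔤} (hf : ∀ b ∈ D.𝔟, f.1 b = 0) :
    D.exterL f D.vacuum = 0 :=
  D.cliff_vacuum hf D.𝔟.zero_mem

/-- The Clifford module is generated by the vacuum vector. -/
theorem fockSpace_eq_top {S : Submodule k D.FockSpace} (hv : D.vacuum ∈ S)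
    (hi : ∀ x, ∀ u ∈ S, D.interL x u ∈ S) (he : ∀ f, ∀ u ∈ S, D.exterL f u ∈ S) : S = ⊤ := by
  rw [eq_top_iff]
  rintro u -
  obtain ⟨a, rfl⟩ := D.fockMk_surjective u
  induction a using CliffordAlgebra.left_induction with
  | algebraMap r =>
    rw [Algebra.algebraMap_eq_smul_one, map_smul]
    exact S.smul_mem r hv
  | add a b ha hb =>
    rw [map_add]
    exact S.add_mem ha hb
  | ι_mul a z ha =>
    have : D.fockMk (CliffordAlgebra.ι (quadForm k 𝔤) z * a) = D.cliff z (D.fockMk a) := rfl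
    rw [this, show z = (z.1, z.2) from rfl, cliff_eq]
    exact S.add_mem (he _ _ ha) (hi _ _ ha)

section Lift

variable {Y : Type*} [AddCommGroup Y] [Module k Y]
    (ρ : (tateDual k 𝔤 × 𝔤) →ₗ[k] Module.End k Y)
    (hρ : ∀ z u, ρ z (ρ z u) = quadForm k 𝔤 z • u)

/-- The action of the Clifford algebra determined by the action of its generators. -/
noncomputable def cliffordHom : Cl k 𝔤 →ₐ[k] Module.End k Y :=
  CliffordAlgebra.lift (R := k) (M := tateDual k 𝔤 × 𝔤) (quadForm k 𝔤)
    ⟨ρ, fun z => LinearMap.ext fun u => hρ z u⟩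

theorem cliffordHom_gen (z : tateDual k 𝔤 × 𝔤) : cliffordHom ρ hρ (gen k 𝔤 z) = ρ z :=
  CliffordAlgebra.lift_ι_apply _ _ _

variable (y : Y) (hy : ∀ f x, (∀ b ∈ D.𝔟, f.1 b = 0) → x ∈ D.𝔟 → ρ (f, x) y = 0)

/-- The morphism from the Clifford module to another module over the Clifford algebra, with a given
vacuum vector. -/
noncomputable def fockLift : D.FockSpace →ₗ[k] Y :=
  (D.vacuumIdeal.restrictScalars k).liftQ
    ((LinearMap.applyₗ y : Module.End k Y →ₗ[k] Y) ∘ₗ (cliffordHom ρ hρ).toLinearMap) (by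
      intro u hu
      rw [Submodule.restrictScalars_mem] at hu
      rw [LinearMap.mem_ker]
      change cliffordHom ρ hρ u y = 0
      induction hu using Submodule.span_induction with
      | mem u h =>
        obtain ⟨f, x, hf, hx, rfl⟩ := h
        rw [cliffordHom_gen]
        exact hy f x hf hx
      | zero => rw [map_zero, LinearMap.zero_apply]
      | add a b _ _ ha hb => rw [map_add, LinearMap.add_apply, ha, hb, add_zero]
      | smul a u _ hu => rw [smul_eq_mul, map_mul, Module.End.mul_apply, hu, map_zero]) ∘ₗ
  ((Submodule.Quotient.restrictScalarsEquiv k D.vacuumIdeal).symm.toLinearMap :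
    D.Fock →ₗ[k] _)

theorem fockLift_fockMk (a : Cl k 𝔤) :
    D.fockLift ρ hρ y hy (D.fockMk a) = cliffordHom ρ hρ a y := rfl

theorem fockLift_vacuum : D.fockLift ρ hρ y hy D.vacuum = y := by
  rw [vacuum, fockLift_fockMk, map_one, Module.End.one_apply]

theorem fockLift_cliff (z : tateDual k 𝔤 × 𝔤) (u : D.FockSpace) :
    D.fockLift ρ hρ y hy (D.cliff z u) = ρ z (D.fockLift ρ hρ y hy u) := by
  obtain ⟨a, rfl⟩ := D.fockMk_surjective u
  rw [cliff_fockMk, fockLift_fockMk, fockLift_fockMk, map_mul, cliffordHom_gen,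
    Module.End.mul_apply]

theorem fockLift_interL (x : 𝔤) (u : D.FockSpace) :
    D.fockLift ρ hρ y hy (D.interL x u) = ρ (0, x) (D.fockLift ρ hρ y hy u) :=
  D.fockLift_cliff ρ hρ y hy (0, x) u

theorem fockLift_exterL (f : tateDual k 𝔤) (u : D.FockSpace) :
    D.fockLift ρ hρ y hy (D.exterL f u) = ρ (f, 0) (D.fockLift ρ hρ y hy u) :=
  D.fockLift_cliff ρ hρ y hy (f, 0) u

end Lift

end FockModule

end SplitTate

end SemiInf

namespace SemiInf

namespace SplitTate

section CliffordModules

variable {k : Type*} [Field k] {𝔤 : Type*} [LieRing 𝔤] [LieAlgebra k 𝔤] [UniformSpace 𝔤]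
  [IsUniformAddGroup 𝔤] (D : SplitTate k 𝔤)

/-- A sum of copies of the Clifford module, with the space of vacuum vectors `M`: in addition to the
Clifford operators, one has the coaction `co` of the coalgebra `Λ(𝔠)`, the projection `ev` onto
`M ⊗ Λ(𝔠)`, and the operator `G` of multiplication by `2 ^ (-n)` in degree `n`. -/
structure CliffordModule (M Y : Type*) [AddCommGroup M] [Module k M] [AddCommGroup Y]
    [Module k Y] where
  ii : 𝔤 →ₗ[k] Module.End k Y
  ee : tateDual k 𝔤 →ₗ[k] Module.End k Y
  vac : M →ₗ[k] Y
  ii_ii : ∀ x y u, ii x (ii y u) = -ii y (ii x u)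
  ee_ee : ∀ f g u, ee f (ee g u) = -ee g (ee f u)
  ee_ii : ∀ f x u, ee f (ii x u) = f.1 x • u - ii x (ee f u)
  ii_vac : ∀ (b : D.𝔟) m, ii b (vac m) = 0
  ee_vac : ∀ ξ m, ee (D.annDual ξ) (vac m) = 0
  gen : ∀ S : Submodule k Y, (∀ m, vac m ∈ S) → (∀ c, ∀ u ∈ S, ii (D.sec c) u ∈ S) →
    (∀ β, ∀ u ∈ S, ee (D.extDual β) u ∈ S) → S = ⊤
  co : Y →ₗ[k] D.Λ𝔠 ⊗[k] Y
  co_vac : ∀ m, co (vac m) = 1 ⊗ₜ vac m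
  co_ii : ∀ x u, co (ii x u) = TensorProduct.map (parity k D.𝔠) (ii x) (co u) +
    LinearMap.rTensor Y (LinearMap.mulRight k (ExteriorAlgebra.ι k (D.pr𝔠 x))) (co u)
  co_ee : ∀ f u, co (ee f u) = TensorProduct.map (parity k D.𝔠) (ee f) (co u)
  ev : Y →ₗ[k] M ⊗[k] D.Λ𝔠
  ev_vac : ∀ m, ev (vac m) = m ⊗ₜ 1
  ev_sec : ∀ c u, ev (ii (D.sec c) u) =
    LinearMap.lTensor M (LinearMap.mulRight k (ExteriorAlgebra.ι k c)) (ev u)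
  ev_ext : ∀ β u, ev (ee (D.extDual β) u) = 0
  G : Module.End k Y
  G_vac : ∀ m, G (vac m) = vac m
  G_ii : ∀ x u, G (ii x u) = (2 : k) • ii x (G u)
  G_ee : ∀ f u, G (ee f u) = (2⁻¹ : k) • ee f (G u)

/-! ### The Clifford module and its model -/

theorem fockSpace_induction {S : Submodule k D.FockSpace} (hv : D.vacuum ∈ S)
    (hi : ∀ c, ∀ u ∈ S, D.interL (D.sec c) u ∈ S)
    (he : ∀ β, ∀ u ∈ S, D.exterL (D.extDual β) u ∈ S) : S = ⊤ := by
  let P : Submodule k D.FockSpace → Prop := fun S => D.vacuum ∈ S ∧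
    (∀ c, ∀ u ∈ S, D.interL (D.sec c) u ∈ S) ∧ ∀ β, ∀ u ∈ S, D.exterL (D.extDual β) u ∈ S
  let S₀ : Submodule k D.FockSpace := sInf {S | P S}
  have h0 : ∀ {u}, u ∈ S₀ ↔ ∀ S, P S → u ∈ S := fun {u} => Submodule.mem_sInf
  have hP : P S₀ := ⟨h0.2 fun S h => h.1, fun c u hu => h0.2 fun S h => h.2.1 c u (h0.1 hu S h),
    fun β u hu => h0.2 fun S h => h.2.2 β u (h0.1 hu S h)⟩
  have hib : ∀ b : D.𝔟, ∀ u ∈ S₀, D.interL b u ∈ S₀ := fun b u hu => by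
    have := h0.1 hu (S₀ ⊓ S₀.comap (D.interL b)) ⟨⟨hP.1, ?_⟩, fun c u hu => ⟨hP.2.1 c u hu.1, ?_⟩,
      fun β u hu => ⟨hP.2.2 β u hu.1, ?_⟩⟩
    · exact this.2
    · change D.interL b D.vacuum ∈ S₀
      rw [D.interL_vacuum b.2]
      exact S₀.zero_mem
    · change D.interL b (D.interL (D.sec c) u) ∈ S₀
      rw [D.interL_interL]
      exact S₀.neg_mem (hP.2.1 c _ hu.2)
    · change D.interL b (D.exterL (D.extDual β) u) ∈ S₀
      have h := D.exterL_interL (D.extDual β) b u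
      rw [eq_sub_iff_add_eq, ← eq_sub_iff_add_eq'] at h
      rw [h]
      exact S₀.sub_mem (S₀.smul_mem _ hu.1) (hP.2.2 β _ hu.2)
  have hea : ∀ ξ, ∀ u ∈ S₀, D.exterL (D.annDual ξ) u ∈ S₀ := fun ξ u hu => by
    have := h0.1 hu (S₀ ⊓ S₀.comap (D.exterL (D.annDual ξ)))
      ⟨⟨hP.1, ?_⟩, fun c u hu => ⟨hP.2.1 c u hu.1, ?_⟩, fun β u hu => ⟨hP.2.2 β u hu.1, ?_⟩⟩
    · exact this.2
    · change D.exterL (D.annDual ξ) D.vacuum ∈ S₀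
      rw [D.exterL_vacuum fun b hb => D.annDual_coe ξ ⟨b, hb⟩]
      exact S₀.zero_mem
    · change D.exterL (D.annDual ξ) (D.interL (D.sec c) u) ∈ S₀
      rw [D.exterL_interL]
      exact S₀.sub_mem (S₀.smul_mem _ hu.1) (hP.2.1 c _ hu.2)
    · change D.exterL (D.annDual ξ) (D.exterL (D.extDual β) u) ∈ S₀
      rw [D.exterL_exterL]
      exact S₀.neg_mem (hP.2.2 β _ hu.2)
  have hS : S₀ = ⊤ := by
    refine D.fockSpace_eq_top hP.1 (fun x u hu => ?_) fun f u hu => ?_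
    · rw [← D.pr𝔟_add_sec_pr𝔠 x, map_add, LinearMap.add_apply]
      exact S₀.add_mem (hib _ u hu) (hP.2.1 _ u hu)
    · rw [← D.extDual_resDual_add f, map_add, LinearMap.add_apply]
      exact S₀.add_mem (hP.2.2 _ u hu) (hea _ u hu)
  rw [eq_top_iff, ← hS]
  exact sInf_le ⟨hv, hi, he⟩

theorem contractLeft_parity {V : Type*} [AddCommGroup V] [Module k V] (d : Module.Dual k V)
    (w : ExteriorAlgebra k V) : CliffordAlgebra.contractLeft d (parity k V w) =
      -parity k V (CliffordAlgebra.contractLeft d w) := by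
  have : CliffordAlgebra.contractLeft d ∘ₗ parity k V =
      -(parity k V ∘ₗ CliffordAlgebra.contractLeft d) := by
    refine exterior_ext_left ?_ fun x w h => ?_
    · simp only [LinearMap.comp_apply, LinearMap.neg_apply, parity_one]
      rw [CliffordAlgebra.contractLeft_one, map_zero, neg_zero]
    · simp only [LinearMap.comp_apply, LinearMap.neg_apply] at h ⊢
      rw [parity_ι_mul, map_neg, ExteriorAlgebra.ι, CliffordAlgebra.contractLeft_ι_mul,
        CliffordAlgebra.contractLeft_ι_mul, h, map_sub, map_smul]
      have := parity_ι_mul x (CliffordAlgebra.contractLeft d w)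
      rw [ExteriorAlgebra.ι] at this
      rw [this, mul_neg]
  exact LinearMap.congr_fun this w

section Model

variable {B C : Type*} [AddCommGroup B] [Module k B] [AddCommGroup C] [Module k C]

/-- The operator on `Λ(B)` given by the multiplication with a vector and the contraction with a
functional. -/
noncomputable def leftOp : (B × Module.Dual k B) →ₗ[k] Module.End k (ExteriorAlgebra k B) :=
  (LinearMap.mul k _ ∘ₗ ExteriorAlgebra.ι k).coprod CliffordAlgebra.contractLeft

/-- The operator on `Λ(C)` given by the right multiplication with a vector and the right contraction
with a functional. -/
noncomputable def rightOp : (Module.Dual k C × C) →ₗ[k] Module.End k (ExteriorAlgebra k C) :=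
  CliffordAlgebra.contractRight.flip.coprod
    ((LinearMap.mul k (ExteriorAlgebra k C)).flip ∘ₗ ExteriorAlgebra.ι k)

theorem leftOp_apply (z : B × Module.Dual k B) (w : ExteriorAlgebra k B) :
    leftOp z w = ExteriorAlgebra.ι k z.1 * w + CliffordAlgebra.contractLeft z.2 w := rfl

theorem rightOp_apply (z : Module.Dual k C × C) (w : ExteriorAlgebra k C) :
    rightOp z w = CliffordAlgebra.contractRight w z.1 + w * ExteriorAlgebra.ι k z.2 := rfl

theorem leftOp_leftOp (z : B × Module.Dual k B) (w : ExteriorAlgebra k B) :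
    leftOp z (leftOp z w) = z.2 z.1 • w := by
  rw [leftOp_apply, leftOp_apply, map_add, mul_add, ← mul_assoc, ExteriorAlgebra.ι_sq_zero,
    zero_mul, CliffordAlgebra.contractLeft_contractLeft, ExteriorAlgebra.ι,
    CliffordAlgebra.contractLeft_ι_mul]
  abel

theorem leftOp_parity (z : B × Module.Dual k B) (w : ExteriorAlgebra k B) :
    leftOp z (parity k B w) = -parity k B (leftOp z w) := by
  rw [leftOp_apply, leftOp_apply, contractLeft_parity, map_add, parity_ι_mul, neg_add, neg_neg]

theorem rightOp_rightOp (z : Module.Dual k C × C) (w : ExteriorAlgebra k C) :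
    rightOp z (rightOp z w) = z.1 z.2 • w := by
  rw [rightOp_apply, rightOp_apply, map_add, add_mul, mul_assoc, ExteriorAlgebra.ι_sq_zero,
    mul_zero, LinearMap.add_apply, CliffordAlgebra.contractRight_contractRight, ExteriorAlgebra.ι,
    CliffordAlgebra.contractRight_mul_ι]
  abel

theorem leftOp_one (d : Module.Dual k B) : leftOp (0, d) 1 = 0 := by
  rw [leftOp_apply, map_zero, zero_mul, CliffordAlgebra.contractLeft_one, add_zero]

theorem rightOp_one (ξ : Module.Dual k C) : rightOp (ξ, 0) 1 = 0 := by
  rw [rightOp_apply, map_zero, mul_zero, CliffordAlgebra.contractRight_one, add_zero]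

theorem leftOp_vector (β : B) (w : ExteriorAlgebra k B) :
    leftOp (β, 0) w = ExteriorAlgebra.ι k β * w := by
  rw [leftOp_apply, map_zero, LinearMap.zero_apply, add_zero]

theorem rightOp_vector (c : C) (w : ExteriorAlgebra k C) :
    rightOp (0, c) w = w * ExteriorAlgebra.ι k c := by
  rw [rightOp_apply, map_zero, zero_add]

/-- The super tensor product of the operators `leftOp` and `rightOp`. -/
noncomputable def pairOp : ((B × Module.Dual k B) × (Module.Dual k C × C)) →ₗ[k]
    Module.End k (ExteriorAlgebra k B ⊗[k] ExteriorAlgebra k C) :=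
  (LinearMap.rTensorHom (ExteriorAlgebra k C) ∘ₗ leftOp).coprod
    (TensorProduct.mapBilinear (RingHom.id k) _ _ _ _ (parity k B) ∘ₗ rightOp)

theorem pairOp_tmul (z : (B × Module.Dual k B) × (Module.Dual k C × C))
    (u : ExteriorAlgebra k B) (w : ExteriorAlgebra k C) : pairOp z (u ⊗ₜ[k] w) =
      leftOp z.1 u ⊗ₜ w + parity k _ u ⊗ₜ rightOp z.2 w := rfl

theorem pairOp_pairOp (z : (B × Module.Dual k B) × (Module.Dual k C × C))
    (t : ExteriorAlgebra k B ⊗[k] ExteriorAlgebra k C) :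
    pairOp z (pairOp z t) = (z.1.2 z.1.1 + z.2.1 z.2.2) • t := by
  induction t with
  | zero => simp
  | add a b ha hb => rw [map_add, map_add, ha, hb, smul_add]
  | tmul u w =>
    rw [pairOp_tmul, map_add, pairOp_tmul, pairOp_tmul, leftOp_leftOp, rightOp_rightOp,
      leftOp_parity, parity_parity, TensorProduct.neg_tmul, add_smul,
      TensorProduct.smul_tmul', TensorProduct.tmul_smul, TensorProduct.smul_tmul']
    abel

theorem pairOp_one (d : Module.Dual k B) (ξ : Module.Dual k C) :
    pairOp ((0, d), (ξ, 0)) ((1 : ExteriorAlgebra k B) ⊗ₜ[k] (1 : ExteriorAlgebra k C)) = 0 := by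
  rw [pairOp_tmul, leftOp_one, rightOp_one, TensorProduct.zero_tmul, TensorProduct.tmul_zero,
    add_zero]

theorem pairOp_left (β : B) (u : ExteriorAlgebra k B) (w : ExteriorAlgebra k C) :
    pairOp ((β, 0), (0, 0)) (u ⊗ₜ[k] w) = (ExteriorAlgebra.ι k β * u) ⊗ₜ w := by
  rw [pairOp_tmul, leftOp_vector, rightOp_vector, map_zero, mul_zero, TensorProduct.tmul_zero,
    add_zero]

theorem pairOp_right (c : C) (u : ExteriorAlgebra k B) (w : ExteriorAlgebra k C) :
    pairOp ((0, 0), (0, c)) (u ⊗ₜ[k] w) = parity k B u ⊗ₜ (w * ExteriorAlgebra.ι k c) := by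
  rw [pairOp_tmul, leftOp_vector, rightOp_vector, map_zero, zero_mul, TensorProduct.zero_tmul,
    zero_add]

theorem counit_pairOp_left (β : B) (t : ExteriorAlgebra k B ⊗[k] ExteriorAlgebra k C) :
    LinearMap.rTensor (ExteriorAlgebra k C) (counit k B).toLinearMap
      (pairOp ((β, 0), (0, 0)) t) = 0 := by
  induction t with
  | zero => rw [map_zero, map_zero]
  | add a b ha hb => rw [map_add, map_add, ha, hb, add_zero]
  | tmul u w =>
    rw [pairOp_left, LinearMap.rTensor_tmul, AlgHom.toLinearMap_apply, map_mul, counit_ι,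
      zero_mul, TensorProduct.zero_tmul]

theorem counit_pairOp_right (c : C) (t : ExteriorAlgebra k B ⊗[k] ExteriorAlgebra k C) :
    LinearMap.rTensor (ExteriorAlgebra k C) (counit k B).toLinearMap
      (pairOp ((0, 0), (0, c)) t) = LinearMap.lTensor k (LinearMap.mulRight k
        (ExteriorAlgebra.ι k c)) (LinearMap.rTensor (ExteriorAlgebra k C) (counit k B).toLinearMap
          t) := by
  induction t with
  | zero => simp only [map_zero]
  | add a b ha hb => simp only [map_add, ha, hb]
  | tmul u w =>
    rw [pairOp_right, LinearMap.rTensor_tmul, LinearMap.rTensor_tmul, AlgHom.toLinearMap_apply,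
      counit_parity]
    rfl

end Model

/-- The model `Λ(𝔟*) ⊗ Λ(𝔠)` of the Clifford module. -/
abbrev FockModel : Type _ := ExteriorAlgebra k (tateDual k D.𝔟) ⊗[k] D.Λ𝔠

/-- The evaluation of functionals on `𝔟`. -/
def eval𝔟 : D.𝔟 →ₗ[k] Module.Dual k (tateDual k D.𝔟) := (tateDual k D.𝔟).subtype.flip

/-- The blocks of the elements of `𝔤* ⊕ 𝔤`. -/
noncomputable def blocks : (tateDual k 𝔤 × 𝔤) →ₗ[k]
    (tateDual k D.𝔟 × Module.Dual k (tateDual k D.𝔟)) × (Module.Dual k D.𝔠 × D.𝔠) :=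
  (D.resDual.prodMap (D.eval𝔟 ∘ₗ D.pr𝔟)).prod
    ((D.sec.dualMap ∘ₗ (tateDual k 𝔤).subtype).prodMap D.pr𝔠)

theorem blocks_apply (f : tateDual k 𝔤) (x : 𝔤) : D.blocks (f, x) =
    ((D.resDual f, D.eval𝔟 (D.pr𝔟 x)), (f.1 ∘ₗ D.sec, D.pr𝔠 x)) := rfl

theorem blocks_ext (β : tateDual k D.𝔟) : D.blocks (D.extDual β, 0) = ((β, 0), (0, 0)) := by
  have h1 : (D.extDual β).1 ∘ₗ D.sec = 0 := LinearMap.ext (D.extDual_sec β)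
  have h2 : D.eval𝔟 (D.pr𝔟 0) = 0 := by
    rw [(D.pr𝔟).map_zero, (D.eval𝔟).map_zero]
  rw [blocks_apply, resDual_extDual, h1, h2, (D.pr𝔠).map_zero]

theorem blocks_sec (c : D.𝔠) : D.blocks (0, D.sec c) = ((0, 0), (0, c)) := by
  rw [blocks_apply, pr𝔟_sec, pr𝔠_sec, (D.eval𝔟).map_zero, (D.resDual).map_zero]
  rfl

/-- The action of `𝔤* ⊕ 𝔤` on the model of the Clifford module. -/
noncomputable def modelAct : (tateDual k 𝔤 × 𝔤) →ₗ[k] Module.End k D.FockModel :=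
  pairOp ∘ₗ D.blocks

theorem modelAct_modelAct (z : tateDual k 𝔤 × 𝔤) (t : D.FockModel) :
    D.modelAct z (D.modelAct z t) = quadForm k 𝔤 z • t := by
  obtain ⟨f, x⟩ := z
  refine (pairOp_pairOp _ t).trans ?_
  have : f.1 (D.pr𝔟 x) + f.1 (D.sec (D.pr𝔠 x)) = f.1 x := by
    rw [← map_add, pr𝔟_add_sec_pr𝔠]
  rw [quadForm_apply, ← this]
  rfl

theorem modelAct_vacuum (f : tateDual k 𝔤) (x : 𝔤) (hf : ∀ b ∈ D.𝔟, f.1 b = 0) (hx : x ∈ D.𝔟) :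
    D.modelAct (f, x) (1 ⊗ₜ 1) = 0 := by
  have h1 : D.resDual f = 0 := by
    ext b
    exact hf b b.2
  have h2 : D.blocks (f, x) = ((0, D.eval𝔟 (D.pr𝔟 x)), (f.1 ∘ₗ D.sec, 0)) := by
    rw [blocks_apply, h1, D.pr𝔠_coe ⟨x, hx⟩]
  rw [modelAct, LinearMap.comp_apply, h2, pairOp_one]

theorem modelAct_extDual (β : tateDual k D.𝔟) :
    D.modelAct (D.extDual β, 0) = pairOp ((β, 0), (0, 0)) := congrArg pairOp (D.blocks_ext β)

theorem modelAct_secL (c : D.𝔠) : D.modelAct (0, D.sec c) = pairOp ((0, 0), (0, c)) :=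
  congrArg pairOp (D.blocks_sec c)

/-- The map from the Clifford module to its model. -/
noncomputable def toModel : D.FockSpace →ₗ[k] D.FockModel :=
  D.fockLift D.modelAct D.modelAct_modelAct (1 ⊗ₜ 1) D.modelAct_vacuum

theorem toModel_vacuum : D.toModel D.vacuum = 1 ⊗ₜ 1 := D.fockLift_vacuum _ _ _ _

theorem toModel_interL (x : 𝔤) (u : D.FockSpace) :
    D.toModel (D.interL x u) = D.modelAct (0, x) (D.toModel u) := D.fockLift_interL _ _ _ _ _ _

theorem toModel_exterL (f : tateDual k 𝔤) (u : D.FockSpace) :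
    D.toModel (D.exterL f u) = D.modelAct (f, 0) (D.toModel u) := D.fockLift_exterL _ _ _ _ _ _

theorem modelAct_sec (c : D.𝔠) (u : ExteriorAlgebra k (tateDual k D.𝔟)) (w : D.Λ𝔠) :
    D.modelAct (0, D.sec c) (u ⊗ₜ w) = parity k _ u ⊗ₜ (w * ExteriorAlgebra.ι k c) := by
  rw [modelAct_secL, pairOp_right]

theorem modelAct_ext (β : tateDual k D.𝔟) (u : ExteriorAlgebra k (tateDual k D.𝔟)) (w : D.Λ𝔠) :
    D.modelAct (D.extDual β, 0) (u ⊗ₜ w) = (ExteriorAlgebra.ι k β * u) ⊗ₜ w := by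
  rw [modelAct_extDual, pairOp_left]

/-- The coaction of `Λ(𝔠)` on the Clifford module: the images of the generators. -/
noncomputable def coactGen : (tateDual k 𝔤 × 𝔤) →ₗ[k] Module.End k (D.Λ𝔠 ⊗[k] D.FockSpace) :=
  TensorProduct.mapBilinear (RingHom.id k) _ _ _ _ (parity k D.𝔠) ∘ₗ D.cliff +
    LinearMap.rTensorHom D.FockSpace ∘ₗ (LinearMap.mul k D.Λ𝔠).flip ∘ₗ ExteriorAlgebra.ι k ∘ₗ
      D.pr𝔠 ∘ₗ LinearMap.snd k _ _

theorem coactGen_tmul (z : tateDual k 𝔤 × 𝔤) (w : D.Λ𝔠) (u : D.FockSpace) :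
    D.coactGen z (w ⊗ₜ u) = parity k D.𝔠 w ⊗ₜ D.cliff z u +
      (w * ExteriorAlgebra.ι k (D.pr𝔠 z.2)) ⊗ₜ u := rfl

theorem coactGen_coactGen (z : tateDual k 𝔤 × 𝔤) (t : D.Λ𝔠 ⊗[k] D.FockSpace) :
    D.coactGen z (D.coactGen z t) = quadForm k 𝔤 z • t := by
  induction t with
  | zero => simp
  | add a b ha hb => rw [map_add, map_add, ha, hb, smul_add]
  | tmul w u =>
    have h := LinearMap.congr_fun (D.cliff_mul_self z) u
    rw [Module.End.mul_apply, LinearMap.smul_apply, Module.End.one_apply] at h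
    rw [coactGen_tmul, map_add, coactGen_tmul, coactGen_tmul, parity_parity, parity_mul_ι, h,
      mul_assoc, ExteriorAlgebra.ι_sq_zero, mul_zero, TensorProduct.zero_tmul,
      TensorProduct.neg_tmul, TensorProduct.tmul_smul]
    abel

theorem coactGen_vacuum (f : tateDual k 𝔤) (x : 𝔤) (hf : ∀ b ∈ D.𝔟, f.1 b = 0) (hx : x ∈ D.𝔟) :
    D.coactGen (f, x) (1 ⊗ₜ D.vacuum) = 0 := by
  rw [coactGen_tmul, D.cliff_vacuum hf hx, D.pr𝔠_coe ⟨x, hx⟩, map_zero, mul_zero]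
  simp

/-- The action of the generators, twisted by a homothety of the hyperbolic plane. -/
noncomputable def cliffScale : (tateDual k 𝔤 × 𝔤) →ₗ[k] Module.End k D.FockSpace :=
  D.cliff ∘ₗ ((2⁻¹ : k) • LinearMap.id).prodMap ((2 : k) • LinearMap.id)

theorem cliffScale_apply (f : tateDual k 𝔤) (x : 𝔤) :
    D.cliffScale (f, x) = D.cliff ((2⁻¹ : k) • f, (2 : k) • x) := rfl

theorem cliffScale_cliffScale [CharZero k] (z : tateDual k 𝔤 × 𝔤) (u : D.FockSpace) :
    D.cliffScale z (D.cliffScale z u) = quadForm k 𝔤 z • u := by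
  obtain ⟨f, x⟩ := z
  have h := LinearMap.congr_fun (D.cliff_mul_self ((2⁻¹ : k) • f, (2 : k) • x)) u
  rw [Module.End.mul_apply, LinearMap.smul_apply, Module.End.one_apply, quadForm_apply] at h
  rw [cliffScale_apply, h, quadForm_apply]
  change ((2⁻¹ : k) * f.1 ((2 : k) • x)) • u = _
  rw [map_smul, smul_eq_mul, inv_mul_cancel_left₀ two_ne_zero]

theorem cliffScale_vector (x : 𝔤) : D.cliffScale (0, x) = (2 : k) • D.interL x := by
  have : ((2⁻¹ : k) • (0 : tateDual k 𝔤), (2 : k) • x) = (2 : k) • ((0 : tateDual k 𝔤), x) :=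
    Prod.ext ((smul_zero (2⁻¹ : k)).trans (smul_zero (2 : k)).symm) rfl
  rw [cliffScale_apply, this, D.cliff.map_smul]
  rfl

theorem cliffScale_dual (f : tateDual k 𝔤) : D.cliffScale (f, 0) = (2⁻¹ : k) • D.exterL f := by
  have : ((2⁻¹ : k) • f, (2 : k) • (0 : 𝔤)) = (2⁻¹ : k) • (f, (0 : 𝔤)) :=
    Prod.ext rfl ((smul_zero (2 : k)).trans (smul_zero (2⁻¹ : k)).symm)
  rw [cliffScale_apply, this, D.cliff.map_smul]
  rfl

/-- The Clifford module. -/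
noncomputable def fockModule [CharZero k] : D.CliffordModule k D.FockSpace where
  ii := D.interL
  ee := D.exterL
  vac := LinearMap.toSpanSingleton k _ D.vacuum
  ii_ii := D.interL_interL
  ee_ee := D.exterL_exterL
  ee_ii := D.exterL_interL
  ii_vac b m := by
    rw [LinearMap.toSpanSingleton_apply, map_smul, D.interL_vacuum b.2, smul_zero]
  ee_vac ξ m := by
    rw [LinearMap.toSpanSingleton_apply, map_smul,
      D.exterL_vacuum fun b hb => D.annDual_coe ξ ⟨b, hb⟩, smul_zero]
  gen S hv hi he := by
    have := hv 1
    rw [LinearMap.toSpanSingleton_apply, one_smul] at this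
    exact D.fockSpace_induction this hi he
  co := D.fockLift D.coactGen D.coactGen_coactGen (1 ⊗ₜ D.vacuum) D.coactGen_vacuum
  co_vac m := by
    rw [LinearMap.toSpanSingleton_apply, map_smul, fockLift_vacuum, TensorProduct.tmul_smul]
  co_ii x u := D.fockLift_interL _ _ _ _ _ _
  co_ee f u := by
    rw [fockLift_exterL]
    generalize D.fockLift D.coactGen D.coactGen_coactGen (1 ⊗ₜ D.vacuum) D.coactGen_vacuum u = t
    induction t with
    | zero => simp
    | add a b ha hb => rw [map_add, map_add, ha, hb]
    | tmul w u =>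
      rw [coactGen_tmul, map_zero, map_zero, mul_zero, TensorProduct.zero_tmul, add_zero]
      rfl
  ev := LinearMap.rTensor D.Λ𝔠 (counit k _).toLinearMap ∘ₗ D.toModel
  ev_vac m := by
    rw [LinearMap.toSpanSingleton_apply, map_smul, LinearMap.comp_apply, toModel_vacuum,
      LinearMap.rTensor_tmul, AlgHom.toLinearMap_apply, map_one, TensorProduct.smul_tmul',
      smul_eq_mul, mul_one]
  ev_sec c u := by
    rw [LinearMap.comp_apply, LinearMap.comp_apply, toModel_interL, modelAct_secL]
    exact counit_pairOp_right c _
  ev_ext β u := by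
    rw [LinearMap.comp_apply, toModel_exterL, modelAct_extDual]
    exact counit_pairOp_left β _
  G := D.fockLift D.cliffScale D.cliffScale_cliffScale D.vacuum fun f x hf hx => by
    rw [cliffScale_apply]
    refine D.cliff_vacuum (fun b hb => ?_) (D.𝔟.smul_mem _ hx)
    change (2⁻¹ : k) * f.1 b = 0
    rw [hf b hb, mul_zero]
  G_vac m := by
    rw [LinearMap.toSpanSingleton_apply, map_smul, fockLift_vacuum]
  G_ii x u := by
    rw [fockLift_interL, cliffScale_vector]
    rfl
  G_ee f u := by
    rw [fockLift_exterL, cliffScale_dual]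
    rfl

/-- The tensor product of the Clifford module and a vector space. -/
noncomputable def CliffordModule.tensor {D : SplitTate k 𝔤} {Y : Type*} [AddCommGroup Y]
    [Module k Y] (C : D.CliffordModule k Y) (M : Type*) [AddCommGroup M] [Module k M] :
    D.CliffordModule M (M ⊗[k] Y) where
  ii := LinearMap.lTensorHom M ∘ₗ C.ii
  ee := LinearMap.lTensorHom M ∘ₗ C.ee
  vac := LinearMap.lTensor M C.vac ∘ₗ (TensorProduct.rid k M).symm.toLinearMap
  ii_ii x y u := by
    have : LinearMap.lTensor M (C.ii x ∘ₗ C.ii y) = LinearMap.lTensor M (-(C.ii y ∘ₗ C.ii x)) := by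
      congr 1
      exact LinearMap.ext (C.ii_ii x y)
    rw [LinearMap.lTensor_neg, LinearMap.lTensor_comp, LinearMap.lTensor_comp] at this
    exact LinearMap.congr_fun this u
  ee_ee x y u := by
    have : LinearMap.lTensor M (C.ee x ∘ₗ C.ee y) = LinearMap.lTensor M (-(C.ee y ∘ₗ C.ee x)) := by
      congr 1
      exact LinearMap.ext (C.ee_ee x y)
    rw [LinearMap.lTensor_neg, LinearMap.lTensor_comp, LinearMap.lTensor_comp] at this
    exact LinearMap.congr_fun this u
  ee_ii f x u := by
    have : LinearMap.lTensor M (C.ee f ∘ₗ C.ii x) =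
        LinearMap.lTensor M (f.1 x • LinearMap.id - C.ii x ∘ₗ C.ee f) := by
      congr 1
      exact LinearMap.ext (C.ee_ii f x)
    rw [LinearMap.lTensor_sub, LinearMap.lTensor_smul, LinearMap.lTensor_comp,
      LinearMap.lTensor_comp, LinearMap.lTensor_id] at this
    exact LinearMap.congr_fun this u
  ii_vac b m := by
    change LinearMap.lTensor M (C.ii b) (m ⊗ₜ C.vac 1) = 0
    rw [LinearMap.lTensor_tmul, C.ii_vac, TensorProduct.tmul_zero]
  ee_vac ξ m := by
    change LinearMap.lTensor M (C.ee (D.annDual ξ)) (m ⊗ₜ C.vac 1) = 0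
    rw [LinearMap.lTensor_tmul, C.ee_vac, TensorProduct.tmul_zero]
  gen S hv hi he := by
    have h : ∀ m, S.comap (TensorProduct.mk k M Y m) = ⊤ := fun m => by
      refine C.gen _ (fun t => ?_) (fun c u hu => hi c _ hu) fun β u hu => he β _ hu
      have := S.smul_mem t (hv m)
      change t • (m ⊗ₜ[k] C.vac 1) ∈ S at this
      rw [← TensorProduct.tmul_smul, ← map_smul, smul_eq_mul, mul_one] at this
      exact this
    rw [eq_top_iff]
    rintro t -
    induction t with
    | zero => exact S.zero_mem
    | add a b ha hb => exact S.add_mem ha hb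
    | tmul m u =>
      have : u ∈ S.comap (TensorProduct.mk k M Y m) := h m ▸ Submodule.mem_top
      exact this
  co := (TensorProduct.leftComm k M D.Λ𝔠 Y).toLinearMap ∘ₗ LinearMap.lTensor M C.co
  co_vac m := by
    change TensorProduct.leftComm k M D.Λ𝔠 Y (m ⊗ₜ C.co (C.vac 1)) = 1 ⊗ₜ (m ⊗ₜ C.vac 1)
    rw [C.co_vac, TensorProduct.leftComm_tmul]
  co_ii x u := by
    induction u with
    | zero => simp only [map_zero, add_zero]
    | add a b ha hb =>
      simp only [map_add, ha, hb]
      abel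
    | tmul m u =>
      change TensorProduct.leftComm k M D.Λ𝔠 Y (m ⊗ₜ C.co (C.ii x u)) = TensorProduct.map _ _
        (TensorProduct.leftComm k M D.Λ𝔠 Y (m ⊗ₜ C.co u)) + LinearMap.rTensor _ _
        (TensorProduct.leftComm k M D.Λ𝔠 Y (m ⊗ₜ C.co u))
      rw [C.co_ii]
      generalize C.co u = t
      induction t with
      | zero => simp only [map_zero, add_zero, TensorProduct.tmul_zero]
      | add a b ha hb =>
        rw [map_add, map_add, TensorProduct.tmul_add m a b, map_add, map_add, map_add,
          add_add_add_comm, TensorProduct.tmul_add, map_add, ha, hb]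
        abel
      | tmul w u =>
        rw [TensorProduct.map_tmul, LinearMap.rTensor_tmul, TensorProduct.tmul_add, map_add,
          TensorProduct.leftComm_tmul, TensorProduct.leftComm_tmul, TensorProduct.leftComm_tmul]
        rfl
  co_ee f u := by
    induction u with
    | zero => simp only [map_zero]
    | add a b ha hb => simp only [map_add, ha, hb]
    | tmul m u =>
      change TensorProduct.leftComm k M D.Λ𝔠 Y (m ⊗ₜ C.co (C.ee f u)) = TensorProduct.map _ _
        (TensorProduct.leftComm k M D.Λ𝔠 Y (m ⊗ₜ C.co u))
      rw [C.co_ee]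
      generalize C.co u = t
      induction t with
      | zero => simp only [map_zero, TensorProduct.tmul_zero]
      | add a b ha hb => simp only [map_add, TensorProduct.tmul_add, ha, hb]
      | tmul w u =>
        rw [TensorProduct.map_tmul, TensorProduct.leftComm_tmul, TensorProduct.leftComm_tmul]
        rfl
  ev := LinearMap.lTensor M ((TensorProduct.lid k D.Λ𝔠).toLinearMap ∘ₗ C.ev)
  ev_vac m := by
    change m ⊗ₜ TensorProduct.lid k D.Λ𝔠 (C.ev (C.vac 1)) = _
    rw [C.ev_vac, TensorProduct.lid_tmul, one_smul]
  ev_sec c u := by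
    induction u with
    | zero => simp only [map_zero]
    | add a b ha hb => simp only [map_add, ha, hb]
    | tmul m u =>
      change m ⊗ₜ TensorProduct.lid k D.Λ𝔠 (C.ev (C.ii (D.sec c) u)) =
        m ⊗ₜ (TensorProduct.lid k D.Λ𝔠 (C.ev u) * ExteriorAlgebra.ι k c)
      rw [C.ev_sec]
      congr 1
      generalize C.ev u = t
      induction t with
      | zero => simp only [map_zero, zero_mul]
      | add a b ha hb => simp only [map_add, add_mul, ha, hb]
      | tmul s w =>
        rw [LinearMap.lTensor_tmul, TensorProduct.lid_tmul, TensorProduct.lid_tmul,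
          LinearMap.mulRight_apply, smul_mul_assoc]
  ev_ext β u := by
    induction u with
    | zero => simp only [map_zero]
    | add a b ha hb => rw [map_add, map_add, ha, hb, add_zero]
    | tmul m u =>
      change m ⊗ₜ TensorProduct.lid k D.Λ𝔠 (C.ev (C.ee (D.extDual β) u)) = 0
      rw [C.ev_ext, map_zero, TensorProduct.tmul_zero]
  G := LinearMap.lTensor M C.G
  G_vac m := by
    change m ⊗ₜ C.G (C.vac 1) = m ⊗ₜ C.vac 1
    rw [C.G_vac]
  G_ii x u := by
    have : LinearMap.lTensor M (C.G ∘ₗ C.ii x) =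
        LinearMap.lTensor M ((2 : k) • (C.ii x ∘ₗ C.G)) := by
      congr 1
      exact LinearMap.ext (C.G_ii x)
    rw [LinearMap.lTensor_smul, LinearMap.lTensor_comp, LinearMap.lTensor_comp] at this
    exact LinearMap.congr_fun this u
  G_ee x u := by
    have : LinearMap.lTensor M (C.G ∘ₗ C.ee x) =
        LinearMap.lTensor M ((2⁻¹ : k) • (C.ee x ∘ₗ C.G)) := by
      congr 1
      exact LinearMap.ext (C.G_ee x)
    rw [LinearMap.lTensor_smul, LinearMap.lTensor_comp, LinearMap.lTensor_comp] at this
    exact LinearMap.congr_fun this u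

end CliffordModules

end SplitTate

end SemiInf

namespace SemiInf

section ExteriorContraction

variable {k : Type*} [Field k] {V : Type*} [AddCommGroup V] [Module k V]
variable {X Y Z : Type*} [AddCommGroup X] [Module k X] [AddCommGroup Y] [Module k Y]
  [AddCommGroup Z] [Module k Z]

local notation "Λ" => ExteriorAlgebra k V
local notation "ι" => ExteriorAlgebra.ι k

theorem conv_apply (m : X →ₗ[k] Y →ₗ[k] Z) (F : Λ →ₗ[k] X) (G : Λ →ₗ[k] Y) (w : Λ) :
    conv m F G w = TensorProduct.lift m (TensorProduct.map F G (comul k V w)) := rfl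

/-- The right contraction `w ↦ ∑ r(w₂) w₁` of the exterior algebra with a linear form `r`. -/
noncomputable def contr (r : Λ →ₗ[k] k) : Module.End k Λ :=
  conv (LinearMap.lsmul k Λ).flip LinearMap.id r

theorem contr_one (r : Λ →ₗ[k] k) : contr r 1 = r 1 • 1 := by
  rw [contr, conv_apply, comul_one]
  rfl

theorem contr_mul_ι (r : Λ →ₗ[k] k) (c : V) (w : Λ) : contr r (w * ι c) =
    contr (r ∘ₗ parity k V) w * ι c + contr (r ∘ₗ LinearMap.mulRight k (ι c)) w := by
  simp only [contr, conv_apply]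
  rw [comul_mul_ι]
  generalize comul k V w = t
  induction t with
  | zero => simp
  | add a b ha hb =>
    simp only [map_add, add_mul] at ha hb ⊢
    rw [add_add_add_comm, ha, hb]
    abel
  | tmul u v =>
    simp only [map_add, TensorProduct.map_tmul, LinearMap.id_apply, TensorProduct.lift.tmul,
      LinearMap.flip_apply, LinearMap.lsmul_apply, LinearMap.comp_apply, LinearMap.mulRight_apply,
      smul_mul_assoc]

theorem contr_counit (w : Λ) : contr (counit k V).toLinearMap w = w := by
  conv_rhs => rw [← rid_counit_comul w]
  rw [contr, conv_apply]
  generalize comul k V w = t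
  induction t with
  | zero => simp
  | add a b ha hb => rw [map_add, map_add, ha, hb, map_add, map_add]
  | tmul u v => rfl

theorem contr_smul (t : k) (r : Λ →ₗ[k] k) (w : Λ) : contr (t • r) w = t • contr r w := by
  rw [contr, contr, conv_apply, conv_apply]
  generalize comul k V w = z
  induction z with
  | zero => simp
  | add a b ha hb => simp only [map_add, smul_add, ha, hb]
  | tmul u v => simp [smul_smul]

theorem comp_ιInv_parity (ξ : V →ₗ[k] X) : (ξ ∘ₗ ExteriorAlgebra.ιInv) ∘ₗ parity k V =
    -(ξ ∘ₗ ExteriorAlgebra.ιInv) := by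
  refine LinearMap.ext fun w => ?_
  simp only [LinearMap.comp_apply, LinearMap.neg_apply]
  rw [ιInv_parity, map_neg]

theorem comp_ιInv_mulRight (ξ : Module.Dual k V) (c : V) :
    (ξ ∘ₗ ExteriorAlgebra.ιInv) ∘ₗ LinearMap.mulRight k (ι c) =
      ξ c • (counit k V).toLinearMap := by
  refine LinearMap.ext fun w => ?_
  simp only [LinearMap.comp_apply, LinearMap.smul_apply, LinearMap.mulRight_apply]
  rw [ιInv_mul_ι, map_smul, smul_eq_mul, smul_eq_mul, mul_comm]
  rfl

theorem contr_ιInv_mul_ι (ξ : Module.Dual k V) (c : V) (w : Λ) :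
    contr (ξ ∘ₗ ExteriorAlgebra.ιInv) (w * ι c) =
      ξ c • w - contr (ξ ∘ₗ ExteriorAlgebra.ιInv) w * ι c := by
  rw [contr_mul_ι, comp_ιInv_parity, comp_ιInv_mulRight, contr_smul, contr_counit,
    ← neg_one_smul k (ξ ∘ₗ _), contr_smul, neg_smul, one_smul, neg_mul]
  abel

theorem contr_ιInv_scale (ξ : Module.Dual k V) (t : k) (w : Λ) :
    contr (ξ ∘ₗ ExteriorAlgebra.ιInv) (scale V t w) =
      t • scale V t (contr (ξ ∘ₗ ExteriorAlgebra.ιInv) w) := by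
  have : contr (ξ ∘ₗ ExteriorAlgebra.ιInv) ∘ₗ (scale V t).toLinearMap =
      t • (scale V t).toLinearMap ∘ₗ contr (ξ ∘ₗ ExteriorAlgebra.ιInv) := by
    refine exterior_ext_right ?_ fun x w h => ?_
    · simp only [LinearMap.comp_apply, LinearMap.smul_apply, AlgHom.toLinearMap_apply, map_one,
        contr_one, ιInv_one, map_zero, zero_smul, smul_zero]
    · simp only [LinearMap.comp_apply, LinearMap.smul_apply, AlgHom.toLinearMap_apply, map_mul,
        scale_ι] at h ⊢
      rw [mul_smul_comm, map_smul, contr_ιInv_mul_ι, contr_ιInv_mul_ι, h, map_sub, map_smul, map_mul,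
        scale_ι, mul_smul_comm, smul_mul_assoc]
  exact LinearMap.congr_fun this w

/-- A tensor in `Λ(V) ⊗ Y` that is killed by all contractions and by the counit is zero. -/
theorem eq_zero_of_contr_eq_zero {z : Λ ⊗[k] Y}
    (h : ∀ ξ : Module.Dual k V, LinearMap.rTensor Y (contr (ξ ∘ₗ ExteriorAlgebra.ιInv)) z = 0)
    (h0 : LinearMap.rTensor Y (counit k V).toLinearMap z = 0) : z = 0 := by
  have hc : ∀ t : k, ∀ r : Λ →ₗ[k] k, contr (t • r) = t • contr r := fun t r =>
    LinearMap.ext (contr_smul t r)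
  have hcadd : ∀ r s : Λ →ₗ[k] k, contr (r + s) = contr r + contr s := fun r s => by
    simp only [contr, conv, TensorProduct.map_add_right, LinearMap.comp_add, LinearMap.add_comp]
  let c : Module.Dual k V →ₗ[k] Module.End k (Λ ⊗[k] Y) :=
    { toFun := fun ξ => LinearMap.rTensor Y (contr (ξ ∘ₗ ExteriorAlgebra.ιInv))
      map_add' := fun ξ η => by
        rw [LinearMap.add_comp, hcadd, LinearMap.rTensor_add]
      map_smul' := fun t ξ => by
        rw [LinearMap.smul_comp, hc, LinearMap.rTensor_smul, RingHom.id_apply] }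
  let a : V →ₗ[k] Module.End k (Λ ⊗[k] Y) :=
    LinearMap.rTensorHom Y ∘ₗ (LinearMap.mul k Λ).flip ∘ₗ ExteriorAlgebra.ι k
  have hz : z ∈ LinearMap.range (TensorProduct.mk k Λ Y 1) := by
    refine mem_of_annihilated (Module.Dual.eval k V).flip
      (fun v hv => (Module.forall_dual_apply_eq_zero_iff k v).1 hv) a c (fun ξ v => ?_)
      (fun v => ?_) (LinearMap.range (TensorProduct.mk k Λ Y 1)) (fun ξ y hy => ?_) (fun S hS ha => ?_) h
    · refine TensorProduct.ext' fun w y => ?_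
      change (contr _ (w * ι v)) ⊗ₜ[k] y + (contr _ w * ι v) ⊗ₜ[k] y = ξ v • (w ⊗ₜ[k] y)
      rw [contr_ιInv_mul_ι, TensorProduct.sub_tmul, sub_add_cancel, TensorProduct.smul_tmul']
    · refine TensorProduct.ext' fun w y => ?_
      change (w * ι v * ι v) ⊗ₜ[k] y = 0
      rw [mul_assoc, ExteriorAlgebra.ι_sq_zero, mul_zero, TensorProduct.zero_tmul]
    · obtain ⟨y, rfl⟩ := hy
      change contr _ 1 ⊗ₜ[k] y = 0
      rw [contr_one, LinearMap.comp_apply, ιInv_one, map_zero, zero_smul, TensorProduct.zero_tmul]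
    · rw [eq_top_iff]
      rintro t -
      induction t with
      | zero => exact S.zero_mem
      | add a b ha hb => exact S.add_mem ha hb
      | tmul w y =>
        induction w using CliffordAlgebra.right_induction with
        | algebraMap r =>
          rw [Algebra.algebraMap_eq_smul_one, ← TensorProduct.smul_tmul']
          exact S.smul_mem r (hS ⟨y, rfl⟩)
        | add a b ha hb =>
          rw [TensorProduct.add_tmul]
          exact S.add_mem ha hb
        | mul_ι x w hw => exact ha x _ hw
  obtain ⟨y, rfl⟩ := hz
  change (counit k V 1) ⊗ₜ[k] y = 0 at h0
  rw [map_one] at h0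
  have := congrArg (TensorProduct.lid k Y).toLinearMap h0
  simp only [LinearEquiv.coe_coe] at this
  rw [TensorProduct.lid_tmul, one_smul, map_zero] at this
  rw [this, map_zero]

/-- Linear maps of parity `p` on the exterior algebra. -/
def Par (p : ℕ) (F : Λ →ₗ[k] X) : Prop := ∀ w, F (parity k V w) = (-1 : k) ^ p • F w

theorem Par.comp_parity {p : ℕ} {F : Λ →ₗ[k] X} (hF : Par p F) :
    F ∘ₗ parity k V = (-1 : k) ^ p • F := LinearMap.ext hF

theorem Par.postcomp {p : ℕ} {F : Λ →ₗ[k] X} (hF : Par p F) (g : X →ₗ[k] Y) :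
    Par p (g ∘ₗ F) := fun w => by
  rw [LinearMap.comp_apply, hF, map_smul, LinearMap.comp_apply]

theorem Par.smulRight {p : ℕ} {r : Λ →ₗ[k] k} (hr : Par p r) (x : X) :
    Par p (r.smulRight x) :=
  fun w => by
    rw [LinearMap.smulRight_apply, hr, LinearMap.smulRight_apply, smul_eq_mul, mul_smul]

theorem HomDeg.par {p : ℕ} {F : Λ →ₗ[k] X} (hF : HomDeg p F) : Par p F := fun w => by
  rw [hF.parity, zpow_natCast]

theorem par_ιInv : Par 1 (ExteriorAlgebra.ιInv (R := k) (M := V)) := fun w => by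
  rw [ιInv_parity, pow_one, neg_smul, one_smul]

theorem neg_one_pow_mul_self (p : ℕ) : (-1 : k) ^ p * (-1 : k) ^ p = 1 := by
  rw [← mul_pow, neg_one_mul, neg_neg, one_pow]

theorem Par.comp_mulLeft {p : ℕ} {F : Λ →ₗ[k] X} (hF : Par p F) {x : V} :
    Par (p + 1) (F ∘ₗ LinearMap.mulLeft k (ι x)) := fun w => by
  rw [LinearMap.comp_apply, LinearMap.mulLeft_apply, LinearMap.comp_apply,
    LinearMap.mulLeft_apply, pow_succ, mul_neg_one, neg_smul, ← hF, parity_ι_mul, map_neg, neg_neg]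

theorem conv_ι_mul {p : ℕ} (m : X →ₗ[k] Y →ₗ[k] Z) {F : Λ →ₗ[k] X} (G : Λ →ₗ[k] Y)
    (hF : Par p F) (x : V) (w : Λ) : SemiInf.conv m F G (ι x * w) =
      SemiInf.conv m (F ∘ₗ LinearMap.mulLeft k (ι x)) G w +
        (-1 : k) ^ p • SemiInf.conv m F (G ∘ₗ LinearMap.mulLeft k (ι x)) w := by
  simp only [conv_apply]
  rw [comul_ι_mul]
  generalize comul k V w = s
  induction s with
  | zero => simp
  | add a b ha hb =>
    simp only [map_add, smul_add, ha, hb]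
    abel
  | tmul u v =>
    have h1 := hF u
    simp only [AlgHom.toLinearMap_apply] at h1
    simp only [comulStep_tmul, map_add, TensorProduct.map_tmul, TensorProduct.lift.tmul,
      LinearMap.comp_apply, LinearMap.mulLeft_apply, h1, map_smul, LinearMap.smul_apply]

/-- The comultiplication of the exterior algebra is supercocommutative. -/
theorem conv_comm {p q : ℕ} (m : X →ₗ[k] Y →ₗ[k] Z) {F : Λ →ₗ[k] X} {G : Λ →ₗ[k] Y}
    (hF : Par p F) (hG : Par q G) : SemiInf.conv m F G = (-1 : k) ^ (p * q) •
      SemiInf.conv m.flip G F := by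
  have key : ∀ w : Λ, ∀ (p q : ℕ) (F : Λ →ₗ[k] X) (G : Λ →ₗ[k] Y), Par p F → Par q G →
      SemiInf.conv m F G w = (-1 : k) ^ (p * q) • SemiInf.conv m.flip G F w := by
    intro w
    induction w using CliffordAlgebra.left_induction with
    | algebraMap r =>
      intro p q F G hF hG
      rw [Algebra.algebraMap_eq_smul_one, map_smul, map_smul, conv_apply, conv_apply, comul_one,
        TensorProduct.map_tmul, TensorProduct.map_tmul, TensorProduct.lift.tmul,
        TensorProduct.lift.tmul, LinearMap.flip_apply]
      have h1 := hF 1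
      have h2 := hG 1
      rw [parity_one] at h1 h2
      rcases Nat.even_or_odd p with hp | hp
      · rw [(hp.mul_right q).neg_one_pow, one_smul]
      · rcases Nat.even_or_odd q with hq | hq
        · rw [(hq.mul_left p).neg_one_pow, one_smul]
        · rw [(hp.mul hq).neg_one_pow]
          rw [hp.neg_one_pow] at h1
          rw [hq.neg_one_pow] at h2
          have e : m (F 1) (G 1) = -m (F 1) (G 1) := by
            conv_lhs => rw [h2]
            rw [neg_smul, one_smul, map_neg]
          rw [neg_smul, one_smul, ← smul_neg, ← e]
    | add a b ha hb =>
      intro p q F G hF hG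
      rw [map_add, map_add, ha p q F G hF hG, hb p q F G hF hG, smul_add]
    | ι_mul w x hw =>
      intro p q F G hF hG
      change SemiInf.conv m F G (ι x * w) = (-1 : k) ^ (p * q) • SemiInf.conv m.flip G F (ι x * w)
      rw [conv_ι_mul m G hF, conv_ι_mul m.flip F hG, hw _ _ _ _ hF.comp_mulLeft hG,
        hw _ _ _ _ hF hG.comp_mulLeft, smul_add, smul_smul, smul_smul, add_comm]
      congr 2
      · rw [mul_add, mul_one, pow_add, mul_comm, mul_assoc, neg_one_pow_mul_self, mul_one]
      · rw [add_mul, one_mul, pow_add]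
  exact LinearMap.ext fun w => key w p q F G hF hG

end ExteriorContraction

end SemiInf

namespace SemiInf

section Comodule

variable {k : Type*} [Field k] {V : Type*} [AddCommGroup V] [Module k V]
variable {M Y Z : Type*} [AddCommGroup M] [Module k M] [AddCommGroup Y] [Module k Y]
  [AddCommGroup Z] [Module k Z]

local notation "Λ" => ExteriorAlgebra k V
local notation "ι" => ExteriorAlgebra.ι k

theorem comul_parity (w : Λ) : comul k V (parity k V w) =
    TensorProduct.map (parity k V) (parity k V) (comul k V w) := by
  have h := comul_scale (-1 : k) w
  rwa [scale_neg_one, show scale V (-1 : k) w = parity k V w from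
    LinearMap.congr_fun (scale_neg_one (k := k) (V := V)) w] at h

variable (V Y) in
/-- The map `w ⊗ y ↦ ∑ w₂ ⊗ (w₁ ⊗ y)`. -/
noncomputable def comulFlip : Λ ⊗[k] Y →ₗ[k] Λ ⊗[k] (Λ ⊗[k] Y) :=
  (TensorProduct.leftComm k Λ Λ Y).toLinearMap ∘ₗ
    (TensorProduct.assoc k Λ Λ Y).toLinearMap ∘ₗ LinearMap.rTensor Y (comul k V)

theorem comulFlip_tmul (w : Λ) (y : Y) : comulFlip V Y (w ⊗ₜ[k] y) =
    TensorProduct.leftComm k Λ Λ Y (TensorProduct.assoc k Λ Λ Y (comul k V w ⊗ₜ y)) := rfl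

theorem comulFlip_map (A : Module.End k Y) (t : Λ ⊗[k] Y) :
    comulFlip V Y (TensorProduct.map (parity k V) A t) =
      TensorProduct.map (parity k V) (TensorProduct.map (parity k V) A) (comulFlip V Y t) := by
  induction t with
  | zero => simp only [map_zero]
  | add a b ha hb => simp only [map_add, ha, hb]
  | tmul w u =>
    rw [TensorProduct.map_tmul, comulFlip_tmul, comulFlip_tmul, comul_parity]
    generalize comul k V w = s
    induction s with
    | zero => simp only [map_zero, TensorProduct.zero_tmul]
    | add a b ha hb => simp only [map_add, TensorProduct.add_tmul, ha, hb]
    | tmul w₁ w₂ => rfl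

theorem comulFlip_rTensor (c : V) (t : Λ ⊗[k] Y) :
    comulFlip V Y (LinearMap.rTensor Y (LinearMap.mulRight k (ι c)) t) =
      TensorProduct.map (parity k V) (LinearMap.rTensor Y (LinearMap.mulRight k (ι c)))
        (comulFlip V Y t) + LinearMap.rTensor _ (LinearMap.mulRight k (ι c)) (comulFlip V Y t) := by
  induction t with
  | zero => simp only [map_zero, add_zero]
  | add a b ha hb =>
    simp only [map_add, ha, hb]
    abel
  | tmul w u =>
    rw [LinearMap.rTensor_tmul, comulFlip_tmul, comulFlip_tmul, LinearMap.mulRight_apply,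
      comul_mul_ι]
    generalize comul k V w = s
    induction s with
    | zero => simp only [map_zero, TensorProduct.zero_tmul, add_zero]
    | add a b ha hb =>
      simp only [map_add, TensorProduct.add_tmul] at ha hb ⊢
      rw [add_add_add_comm, ha, hb]
      abel
    | tmul w₁ w₂ =>
      rw [TensorProduct.add_tmul, map_add, map_add]
      rfl

variable (V M) in
/-- The map `m ⊗ w ↦ ∑ w₂ ⊗ (m ⊗ w₁)`. -/
noncomputable def comulSwap : M ⊗[k] Λ →ₗ[k] Λ ⊗[k] (M ⊗[k] Λ) :=
  (TensorProduct.comm k (M ⊗[k] Λ) Λ).toLinearMap ∘ₗ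
    (TensorProduct.assoc k M Λ Λ).symm.toLinearMap ∘ₗ LinearMap.lTensor M (comul k V)

theorem comulSwap_tmul (m : M) (w : Λ) : comulSwap V M (m ⊗ₜ[k] w) =
    TensorProduct.comm k (M ⊗[k] Λ) Λ
      ((TensorProduct.assoc k M Λ Λ).symm (m ⊗ₜ comul k V w)) := rfl

theorem comulSwap_lTensor (c : V) (t : M ⊗[k] Λ) :
    comulSwap V M (LinearMap.lTensor M (LinearMap.mulRight k (ι c)) t) =
      TensorProduct.map (parity k V) (LinearMap.lTensor M (LinearMap.mulRight k (ι c)))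
        (comulSwap V M t) + LinearMap.rTensor _ (LinearMap.mulRight k (ι c)) (comulSwap V M t) := by
  induction t with
  | zero => simp only [map_zero, add_zero]
  | add a b ha hb =>
    simp only [map_add, ha, hb]
    abel
  | tmul m w =>
    rw [LinearMap.lTensor_tmul, comulSwap_tmul, comulSwap_tmul, LinearMap.mulRight_apply,
      comul_mul_ι]
    generalize comul k V w = s
    induction s with
    | zero => simp only [map_zero, TensorProduct.tmul_zero, add_zero]
    | add a b ha hb =>
      simp only [map_add, TensorProduct.tmul_add] at ha hb ⊢
      rw [add_add_add_comm, ha, hb]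
      abel
    | tmul w₁ w₂ =>
      rw [TensorProduct.tmul_add, map_add, map_add]
      rfl

/-- Application of a linear map to the second factor of a transformed tensor. -/
theorem lTensor_map_of_eq {φ : Y →ₗ[k] Z} {A : Module.End k Y} {B : Module.End k Z}
    (h : ∀ u, φ (A u) = B (φ u)) (F : Module.End k Λ) (t : Λ ⊗[k] Y) :
    LinearMap.lTensor Λ φ (TensorProduct.map F A t) =
      TensorProduct.map F B (LinearMap.lTensor Λ φ t) := by
  induction t with
  | zero => simp only [map_zero]
  | add a b ha hb => simp only [map_add, ha, hb]
  | tmul w u => simp only [TensorProduct.map_tmul, LinearMap.lTensor_tmul, h]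

end Comodule

namespace SplitTate

variable {k : Type*} [Field k] {𝔤 : Type*} [LieRing 𝔤] [LieAlgebra k 𝔤] [UniformSpace 𝔤]
  [IsUniformAddGroup 𝔤] {D : SplitTate k 𝔤}
variable {M Y : Type*} [AddCommGroup M] [Module k M] [AddCommGroup Y] [Module k Y]

section SlotModule

variable (M) (D)

theorem contractN_eq (r : D.Λ𝔠 →ₗ[k] k) : D.contractN M r = LinearMap.lTensor M (contr r) := rfl

theorem slotAct_tmul (F : D.Λ𝔠 →ₗ[k] Module.End k (D.N M)) (m : M) (w : D.Λ𝔠) :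
    D.slotAct M F (m ⊗ₜ w) = TensorProduct.lift (F.flip ∘ₗ TensorProduct.mk k M D.Λ𝔠 m)
      (comul k D.𝔠 w) := by
  change TensorProduct.lift F.flip ((TensorProduct.assoc k M D.Λ𝔠 D.Λ𝔠).symm
    (m ⊗ₜ comul k D.𝔠 w)) = _
  generalize comul k D.𝔠 w = t
  induction t with
  | zero => simp only [TensorProduct.tmul_zero, map_zero]
  | add a b ha hb => simp only [TensorProduct.tmul_add, map_add, ha, hb]
  | tmul u v => rfl

theorem contractN_eq_slotAct (r : D.Λ𝔠 →ₗ[k] k) :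
    D.contractN M r = D.slotAct M (r.smulRight 1) := by
  refine TensorProduct.ext' fun m w => ?_
  rw [slotAct_tmul, contractN_eq, LinearMap.lTensor_tmul, contr, conv_apply]
  generalize comul k D.𝔠 w = t
  induction t with
  | zero => simp only [map_zero, TensorProduct.tmul_zero]
  | add a b ha hb => simp only [map_add, TensorProduct.tmul_add, ha, hb]
  | tmul u v =>
    change m ⊗ₜ[k] (r v • u) = r v • (m ⊗ₜ[k] u)
    rw [TensorProduct.tmul_smul]

end SlotModule

namespace CliffordModule

variable (C : D.CliffordModule M Y)

theorem ii_ee (x : 𝔤) (f : tateDual k 𝔤) (u : Y) :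
    C.ii x (C.ee f u) = f.1 x • u - C.ee f (C.ii x u) := by
  rw [C.ee_ii, sub_sub_cancel]

theorem hom_ext {Z : Type*} [AddCommGroup Z] [Module k Z] {S T : Y →ₗ[k] Z}
    (hv : ∀ m, S (C.vac m) = T (C.vac m))
    (hi : ∀ c u, S u = T u → S (C.ii (D.sec c) u) = T (C.ii (D.sec c) u))
    (he : ∀ β u, S u = T u → S (C.ee (D.extDual β) u) = T (C.ee (D.extDual β) u)) : S = T :=
  LinearMap.eqLocus_eq_top.1 (C.gen (LinearMap.eqLocus S T) hv hi he)

/-! ### Operators that involve the coaction -/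

/-- The operator `u ↦ ∑ T(w) u'`, where `∑ w ⊗ u'` is the coaction of `u`. -/
noncomputable def slot : (D.Λ𝔠 →ₗ[k] Module.End k Y) →ₗ[k] Module.End k Y :=
  LinearMap.lcomp k Y C.co ∘ₗ (TensorProduct.lift.equiv (RingHom.id k) D.Λ𝔠 Y Y).toLinearMap

theorem slot_apply (T : D.Λ𝔠 →ₗ[k] Module.End k Y) (u : Y) :
    C.slot T u = TensorProduct.lift T (C.co u) := rfl

theorem comp_slot (A : Module.End k Y) (T : D.Λ𝔠 →ₗ[k] Module.End k Y) :
    A * C.slot T = C.slot (LinearMap.mulLeft k A ∘ₗ T) := by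
  refine LinearMap.ext fun u => ?_
  change A (TensorProduct.lift T (C.co u)) = TensorProduct.lift _ (C.co u)
  generalize C.co u = t
  induction t with
  | zero => simp only [map_zero]
  | add a b ha hb => simp only [map_add, ha, hb]
  | tmul w u => rfl

theorem slot_comp {A : Module.End k Y} {F : Module.End k D.Λ𝔠}
    (hA : ∀ u, C.co (A u) = TensorProduct.map F A (C.co u)) (T : D.Λ𝔠 →ₗ[k] Module.End k Y) :
    C.slot T * A = C.slot (LinearMap.mulRight k A ∘ₗ T ∘ₗ F) := by
  refine LinearMap.ext fun u => ?_
  change TensorProduct.lift T (C.co (A u)) = TensorProduct.lift _ (C.co u)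
  rw [hA]
  generalize C.co u = t
  induction t with
  | zero => simp only [map_zero]
  | add a b ha hb => simp only [map_add, ha, hb]
  | tmul w u => rfl

theorem co_ii_coe (b : D.𝔟) (u : Y) :
    C.co (C.ii b u) = TensorProduct.map (parity k D.𝔠) (C.ii b) (C.co u) := by
  rw [C.co_ii, D.pr𝔠_coe, map_zero, show LinearMap.mulRight k (0 : D.Λ𝔠) = 0 from
    LinearMap.ext fun w => mul_zero w, LinearMap.rTensor_zero, LinearMap.zero_apply, add_zero]

theorem slot_ii_coe (b : D.𝔟) (T : D.Λ𝔠 →ₗ[k] Module.End k Y) :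
    C.slot T * C.ii b = C.slot (LinearMap.mulRight k (C.ii b) ∘ₗ T ∘ₗ parity k D.𝔠) :=
  C.slot_comp (C.co_ii_coe b) T

theorem slot_ee (f : tateDual k 𝔤) (T : D.Λ𝔠 →ₗ[k] Module.End k Y) :
    C.slot T * C.ee f = C.slot (LinearMap.mulRight k (C.ee f) ∘ₗ T ∘ₗ parity k D.𝔠) :=
  C.slot_comp (C.co_ee f) T

theorem slot_ii (x : 𝔤) (T : D.Λ𝔠 →ₗ[k] Module.End k Y) :
    C.slot T * C.ii x = C.slot (LinearMap.mulRight k (C.ii x) ∘ₗ T ∘ₗ parity k D.𝔠) +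
      C.slot (T ∘ₗ LinearMap.mulRight k (ExteriorAlgebra.ι k (D.pr𝔠 x))) := by
  refine LinearMap.ext fun u => ?_
  change TensorProduct.lift T (C.co (C.ii x u)) =
    TensorProduct.lift _ (C.co u) + TensorProduct.lift _ (C.co u)
  rw [C.co_ii]
  generalize C.co u = t
  induction t with
  | zero => simp only [map_zero, add_zero]
  | add a b ha hb =>
    simp only [map_add] at ha hb ⊢
    rw [add_add_add_comm, ha, hb]
    abel
  | tmul w u =>
    rw [map_add]
    rfl

/-- The coaction is coassociative. -/
theorem coassoc (u : Y) : LinearMap.lTensor D.Λ𝔠 C.co (C.co u) = comulFlip D.𝔠 Y (C.co u) := by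
  have : LinearMap.lTensor D.Λ𝔠 C.co ∘ₗ C.co = comulFlip D.𝔠 Y ∘ₗ C.co := by
    refine C.hom_ext (fun m => ?_) (fun c u h => ?_) fun β u h => ?_
    · rw [LinearMap.comp_apply, LinearMap.comp_apply, C.co_vac, LinearMap.lTensor_tmul, C.co_vac,
        comulFlip_tmul, comul_one]
      rfl
    · rw [LinearMap.comp_apply, LinearMap.comp_apply] at h ⊢
      have h1 : ∀ u, C.co (C.ii (D.sec c) u) = (TensorProduct.map (parity k D.𝔠) (C.ii (D.sec c)) +
          LinearMap.rTensor Y (LinearMap.mulRight k (ExteriorAlgebra.ι k c))) (C.co u) := fun u => by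
        rw [C.co_ii, D.pr𝔠_sec, LinearMap.add_apply]
      have h2 := lTensor_map_of_eq (φ := C.co) (A := LinearMap.id) (B := LinearMap.id)
        (fun _ => rfl) (LinearMap.mulRight k (ExteriorAlgebra.ι k c)) (C.co u)
      rw [C.co_ii, map_add, map_add, comulFlip_map, D.pr𝔠_sec, comulFlip_rTensor,
        lTensor_map_of_eq h1, TensorProduct.map_add_right, LinearMap.add_apply, ← h, ← add_assoc]
      exact congrArg _ h2
    · rw [LinearMap.comp_apply, LinearMap.comp_apply] at h ⊢
      rw [C.co_ee, comulFlip_map, ← h, lTensor_map_of_eq (C.co_ee _)]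
  exact LinearMap.congr_fun this u

theorem slot_slot (T : D.Λ𝔠 →ₗ[k] D.Λ𝔠 →ₗ[k] Module.End k Y) :
    C.slot (C.slot ∘ₗ T) = C.slot (conv T.flip LinearMap.id LinearMap.id) := by
  refine LinearMap.ext fun u => ?_
  let L : D.Λ𝔠 ⊗[k] (D.Λ𝔠 ⊗[k] Y) →ₗ[k] Y := TensorProduct.lift
    ((TensorProduct.lift.equiv (RingHom.id k) D.Λ𝔠 Y Y).toLinearMap ∘ₗ T)
  have h := congrArg L (C.coassoc u)
  have h1 : C.slot (C.slot ∘ₗ T) u = L (LinearMap.lTensor D.Λ𝔠 C.co (C.co u)) := by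
    rw [slot_apply]
    generalize C.co u = t
    induction t with
    | zero => simp only [map_zero]
    | add a b ha hb => simp only [map_add, ha, hb]
    | tmul w u => rfl
  rw [h1, h, slot_apply]
  generalize C.co u = t
  induction t with
  | zero => simp only [map_zero]
  | add a b ha hb => simp only [map_add, ha, hb]
  | tmul w u =>
    rw [comulFlip_tmul, TensorProduct.lift.tmul, conv_apply, TensorProduct.map_id,
      LinearMap.id_apply]
    generalize comul k D.𝔠 w = s
    induction s with
    | zero => simp only [map_zero, TensorProduct.zero_tmul, LinearMap.zero_apply]
    | add a b ha hb => simp only [map_add, TensorProduct.add_tmul, LinearMap.add_apply, ha, hb]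
    | tmul w₁ w₂ => rfl

theorem ev_co (u : Y) : LinearMap.lTensor D.Λ𝔠 C.ev (C.co u) = comulSwap D.𝔠 M (C.ev u) := by
  have : LinearMap.lTensor D.Λ𝔠 C.ev ∘ₗ C.co = comulSwap D.𝔠 M ∘ₗ C.ev := by
    refine C.hom_ext (fun m => ?_) (fun c u h => ?_) fun β u h => ?_
    · rw [LinearMap.comp_apply, LinearMap.comp_apply, C.co_vac, LinearMap.lTensor_tmul, C.ev_vac,
        comulSwap_tmul, comul_one]
      rfl
    · rw [LinearMap.comp_apply, LinearMap.comp_apply] at h ⊢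
      have h2 := lTensor_map_of_eq (φ := C.ev) (A := LinearMap.id) (B := LinearMap.id)
        (fun _ => rfl) (LinearMap.mulRight k (ExteriorAlgebra.ι k c)) (C.co u)
      rw [C.co_ii, C.ev_sec, D.pr𝔠_sec, map_add, comulSwap_lTensor, ← h,
        lTensor_map_of_eq (C.ev_sec c)]
      exact congrArg _ h2
    · rw [LinearMap.comp_apply, LinearMap.comp_apply, C.ev_ext, map_zero, C.co_ee,
        lTensor_map_of_eq (B := 0) fun u => C.ev_ext β u]
      rw [TensorProduct.map_zero_right, LinearMap.zero_apply]
  exact LinearMap.congr_fun this u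

theorem ev_slot {T : D.Λ𝔠 →ₗ[k] Module.End k Y} {F : D.Λ𝔠 →ₗ[k] Module.End k (D.N M)}
    (h : ∀ w u, C.ev (T w u) = F w (C.ev u)) (u : Y) :
    C.ev (C.slot T u) = D.slotAct M F (C.ev u) := by
  have h1 : C.ev (C.slot T u) = TensorProduct.lift F (LinearMap.lTensor D.Λ𝔠 C.ev (C.co u)) := by
    rw [slot_apply]
    generalize C.co u = t
    induction t with
    | zero => simp only [map_zero]
    | add a b ha hb => simp only [map_add, ha, hb]
    | tmul w u => exact h w u
  rw [h1, C.ev_co]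
  change TensorProduct.lift F (TensorProduct.comm k (M ⊗[k] D.Λ𝔠) D.Λ𝔠
    ((TensorProduct.assoc k M D.Λ𝔠 D.Λ𝔠).symm (LinearMap.lTensor M (comul k D.𝔠) (C.ev u)))) =
    TensorProduct.lift F.flip ((TensorProduct.assoc k M D.Λ𝔠 D.Λ𝔠).symm
      (LinearMap.lTensor M (comul k D.𝔠) (C.ev u)))
  generalize (TensorProduct.assoc k M D.Λ𝔠 D.Λ𝔠).symm
    (LinearMap.lTensor M (comul k D.𝔠) (C.ev u)) = t
  induction t using TensorProduct.induction_on with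
  | zero => simp only [map_zero]
  | add a b ha hb => simp only [map_add, ha, hb]
  | tmul w u => rfl

/-! ### The action of `Λ(𝔠)*` and of `A` -/

/-- The action of `R` on a Clifford module. -/
noncomputable def cc (r : D.Λ𝔠 →ₗ[k] k) : Module.End k Y := C.slot (r.smulRight 1)

/-- The operator `u ↦ ∑ ι_{a(w̄)} u'`, where `w̄` is the image of `w` under the parity involution. For
`a = r ⊗ b` it is the composition of `ι_b` and of the action of `r`. -/
noncomputable def jj : (D.Λ𝔠 →ₗ[k] D.𝔟) →ₗ[k] Module.End k Y where
  toFun a := C.slot (C.ii ∘ₗ D.in𝔟 ∘ₗ a ∘ₗ parity k D.𝔠)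
  map_add' a a' := by rw [LinearMap.add_comp, LinearMap.comp_add, LinearMap.comp_add, map_add]
  map_smul' t a := by
    rw [LinearMap.smul_comp, LinearMap.comp_smul, LinearMap.comp_smul, map_smul, RingHom.id_apply]

theorem jj_apply (a : D.Λ𝔠 →ₗ[k] D.𝔟) :
    C.jj a = C.slot (C.ii ∘ₗ D.in𝔟 ∘ₗ a ∘ₗ parity k D.𝔠) := rfl

theorem cc_smul (t : k) (r : D.Λ𝔠 →ₗ[k] k) : C.cc (t • r) = t • C.cc r := by
  rw [cc, cc, ← map_smul]
  congr 1
  exact LinearMap.ext fun w => mul_smul t (r w) (1 : Module.End k Y)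

theorem cc_neg (r : D.Λ𝔠 →ₗ[k] k) : C.cc (-r) = -C.cc r := by
  rw [← neg_one_smul k r, cc_smul, neg_one_smul]

theorem cc_counit : C.cc (counit k D.𝔠).toLinearMap = 1 := by
  refine C.hom_ext (fun m => ?_) (fun c u h => ?_) fun β u h => ?_
  · rw [cc, slot_apply, C.co_vac]
    change counit k D.𝔠 1 • C.vac m = C.vac m
    rw [map_one, one_smul]
  · have h1 : (counit k D.𝔠).toLinearMap.smulRight (1 : Module.End k Y) ∘ₗ
        LinearMap.mulRight k (ExteriorAlgebra.ι k (D.pr𝔠 (D.sec c))) = 0 :=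
      LinearMap.ext fun w => by
        change counit k D.𝔠 (w * _) • (1 : Module.End k Y) = 0
        rw [counit_mul_ι, zero_smul]
    have h2 : LinearMap.mulRight k (C.ii (D.sec c)) ∘ₗ
        (counit k D.𝔠).toLinearMap.smulRight (1 : Module.End k Y) ∘ₗ parity k D.𝔠 =
        LinearMap.mulLeft k (C.ii (D.sec c)) ∘ₗ
          (counit k D.𝔠).toLinearMap.smulRight (1 : Module.End k Y) :=
      LinearMap.ext fun w => by
        change (counit k D.𝔠 (parity k D.𝔠 w) • (1 : Module.End k Y)) * C.ii (D.sec c) =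
          C.ii (D.sec c) * (counit k D.𝔠 w • (1 : Module.End k Y))
        rw [counit_parity, smul_mul_assoc, mul_smul_comm, one_mul, mul_one]
    rw [← Module.End.mul_apply, cc, slot_ii, h1, map_zero, add_zero, h2, ← comp_slot,
      Module.End.mul_apply, ← cc, h]
    rfl
  · have h2 : LinearMap.mulRight k (C.ee (D.extDual β)) ∘ₗ
        (counit k D.𝔠).toLinearMap.smulRight (1 : Module.End k Y) ∘ₗ parity k D.𝔠 =
        LinearMap.mulLeft k (C.ee (D.extDual β)) ∘ₗ
          (counit k D.𝔠).toLinearMap.smulRight (1 : Module.End k Y) :=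
      LinearMap.ext fun w => by
        change (counit k D.𝔠 (parity k D.𝔠 w) • (1 : Module.End k Y)) * C.ee (D.extDual β) =
          C.ee (D.extDual β) * (counit k D.𝔠 w • (1 : Module.End k Y))
        rw [counit_parity, smul_mul_assoc, mul_smul_comm, one_mul, mul_one]
    rw [← Module.End.mul_apply, cc, slot_ee, h2, ← comp_slot, Module.End.mul_apply, ← cc, h]
    rfl

/-- Commutation of `cc` with an operator that is compatible with the coaction. -/
theorem cc_comp {A : Module.End k Y} {F : Module.End k D.Λ𝔠}
    (hA : ∀ u, C.co (A u) = TensorProduct.map F A (C.co u)) (r : D.Λ𝔠 →ₗ[k] k) :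
    C.cc r * A = A * C.cc (r ∘ₗ F) := by
  rw [cc, cc, C.slot_comp hA, comp_slot]
  congr 1
  refine LinearMap.ext fun w => ?_
  change (r (F w) • (1 : Module.End k Y)) * A = A * (r (F w) • (1 : Module.End k Y))
  rw [smul_mul_assoc, mul_smul_comm, one_mul, mul_one]

theorem cc_ii_coe (r : D.Λ𝔠 →ₗ[k] k) (b : D.𝔟) :
    C.cc r * C.ii b = C.ii b * C.cc (r ∘ₗ parity k D.𝔠) := C.cc_comp (C.co_ii_coe b) r

theorem cc_ee (r : D.Λ𝔠 →ₗ[k] k) (f : tateDual k 𝔤) :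
    C.cc r * C.ee f = C.ee f * C.cc (r ∘ₗ parity k D.𝔠) := C.cc_comp (C.co_ee f) r

theorem cc_ii (r : D.Λ𝔠 →ₗ[k] k) (x : 𝔤) : C.cc r * C.ii x = C.ii x * C.cc (r ∘ₗ parity k D.𝔠) +
    C.cc (r ∘ₗ LinearMap.mulRight k (ExteriorAlgebra.ι k (D.pr𝔠 x))) := by
  rw [cc, cc, slot_ii, comp_slot]
  congr 2
  refine LinearMap.ext fun w => ?_
  change (r (parity k D.𝔠 w) • (1 : Module.End k Y)) * C.ii x =
    C.ii x * (r (parity k D.𝔠 w) • (1 : Module.End k Y))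
  rw [smul_mul_assoc, mul_smul_comm, one_mul, mul_one]

theorem slot_cc (T : D.Λ𝔠 →ₗ[k] Module.End k Y) (r : D.Λ𝔠 →ₗ[k] k) :
    C.slot T * C.cc r = C.slot (conv (LinearMap.lsmul k (Module.End k Y)).flip T r) := by
  have h := C.slot_slot (LinearMap.smulRight r T)
  have h1 : C.slot T * C.cc r = C.slot (C.slot ∘ₗ LinearMap.smulRight r T) := by
    rw [cc, comp_slot]
    congr 1
    refine LinearMap.ext fun w => ?_
    change C.slot T * (r w • (1 : Module.End k Y)) = C.slot (r w • T)
    rw [mul_smul_comm, mul_one, map_smul]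
  rw [h1, h]
  congr 1
  refine LinearMap.ext fun w => ?_
  rw [conv_apply, conv_apply]
  generalize comul k D.𝔠 w = t
  induction t with
  | zero => simp only [map_zero]
  | add a b ha hb => simp only [map_add, ha, hb]
  | tmul u v => rfl

theorem cc_cc (r s : D.Λ𝔠 →ₗ[k] k) :
    C.cc r * C.cc s = C.cc (conv (LinearMap.mul k k) r s) := by
  rw [cc, slot_cc, cc]
  congr 1
  refine LinearMap.ext fun w => ?_
  rw [conv_apply, LinearMap.smulRight_apply, conv_apply]
  generalize comul k D.𝔠 w = t
  induction t with
  | zero => simp only [map_zero, zero_smul]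
  | add a b ha hb => simp only [map_add, add_smul, ha, hb]
  | tmul u v =>
    change s v • r u • (1 : Module.End k Y) = (r u * s v) • 1
    rw [smul_smul, mul_comm]

theorem cc_ιInv (ξ : Module.Dual k D.𝔠) :
    C.cc (ξ ∘ₗ ExteriorAlgebra.ιInv) = C.ee (D.annDual ξ) := by
  refine C.hom_ext (fun m => ?_) (fun c u h => ?_) fun β u h => ?_
  · rw [C.ee_vac, cc, slot_apply, C.co_vac]
    change ξ (ExteriorAlgebra.ιInv 1) • C.vac m = 0
    rw [ιInv_one, map_zero, zero_smul]
  · rw [← Module.End.mul_apply, cc_ii, comp_ιInv_parity, D.pr𝔠_sec, comp_ιInv_mulRight, cc_neg,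
      cc_smul, cc_counit, C.ee_ii, annDual_sec, LinearMap.add_apply, Module.End.mul_apply,
      LinearMap.neg_apply, h, map_neg, LinearMap.smul_apply, Module.End.one_apply]
    abel
  · rw [← Module.End.mul_apply, cc_ee, comp_ιInv_parity, cc_neg, Module.End.mul_apply,
      LinearMap.neg_apply, h, map_neg, C.ee_ee, neg_neg]

theorem ev_cc (r : D.Λ𝔠 →ₗ[k] k) (u : Y) : C.ev (C.cc r u) = D.contractN M r (C.ev u) := by
  rw [contractN_eq_slotAct]
  refine C.ev_slot (fun w u => ?_) u
  change C.ev (r w • u) = r w • C.ev u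
  rw [map_smul]

theorem cc_mul_jj (r : D.Λ𝔠 →ₗ[k] k) (a : D.Λ𝔠 →ₗ[k] D.𝔟) :
    C.cc r * C.jj a = C.jj (conv (LinearMap.lsmul k D.𝔟) r a) := by
  rw [jj_apply, comp_slot, jj_apply]
  have h := C.slot_slot ((LinearMap.mul k (Module.End k Y)).compl₁₂
    (C.ii ∘ₗ D.in𝔟 ∘ₗ a ∘ₗ parity k D.𝔠) ((r ∘ₗ parity k D.𝔠).smulRight 1))
  have h1 : LinearMap.mulLeft k (C.cc r) ∘ₗ C.ii ∘ₗ D.in𝔟 ∘ₗ a ∘ₗ parity k D.𝔠 =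
      C.slot ∘ₗ ((LinearMap.mul k (Module.End k Y)).compl₁₂
        (C.ii ∘ₗ D.in𝔟 ∘ₗ a ∘ₗ parity k D.𝔠) ((r ∘ₗ parity k D.𝔠).smulRight 1)) := by
    refine LinearMap.ext fun w => ?_
    change C.cc r * C.ii (a (parity k D.𝔠 w)) = C.slot (LinearMap.mulLeft k
      (C.ii (a (parity k D.𝔠 w))) ∘ₗ ((r ∘ₗ parity k D.𝔠).smulRight 1))
    rw [cc_ii_coe, ← comp_slot, cc]
  rw [h1, h]
  congr 1
  refine LinearMap.ext fun w => ?_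
  have h2 := comul_parity (k := k) w
  simp only [AlgHom.toLinearMap_apply] at h2
  simp only [LinearMap.comp_apply]
  rw [conv_apply, conv_apply, AlgHom.toLinearMap_apply, h2]
  generalize comul k D.𝔠 w = t
  induction t with
  | zero => simp only [map_zero]
  | add a b ha hb => simp only [map_add, ha, hb]
  | tmul u v =>
    change C.ii (a (parity k D.𝔠 v)) * (r (parity k D.𝔠 u) • (1 : Module.End k Y)) =
      C.ii (r (parity k D.𝔠 u) • a (parity k D.𝔠 v) : D.𝔟)
    rw [mul_smul_comm, mul_one]
    exact (map_smul _ _ _).symm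

theorem jj_mul_ee (a : D.Λ𝔠 →ₗ[k] D.𝔟) (f : tateDual k 𝔤) :
    C.jj a * C.ee f = C.cc (f.1 ∘ₗ D.in𝔟 ∘ₗ a) - C.ee f * C.jj (a ∘ₗ parity k D.𝔠) := by
  rw [jj_apply, jj_apply, slot_ee, comp_slot, cc, ← map_sub]
  congr 1
  refine LinearMap.ext fun w => LinearMap.ext fun u => ?_
  change C.ii (a (parity k D.𝔠 (parity k D.𝔠 w))) (C.ee f u) =
    f.1 (a w) • u - C.ee f (C.ii (a (parity k D.𝔠 (parity k D.𝔠 w))) u)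
  rw [parity_parity, C.ii_ee]

theorem jj_mul_ii (a : D.Λ𝔠 →ₗ[k] D.𝔟) (b : D.𝔟) :
    C.jj a * C.ii b = -(C.ii b * C.jj (a ∘ₗ parity k D.𝔠)) := by
  rw [jj_apply, jj_apply, slot_ii_coe, comp_slot, ← map_neg]
  congr 1
  refine LinearMap.ext fun w => LinearMap.ext fun u => ?_
  change C.ii (a (parity k D.𝔠 (parity k D.𝔠 w))) (C.ii b u) =
    -C.ii b (C.ii (a (parity k D.𝔠 (parity k D.𝔠 w))) u)
  rw [C.ii_ii]

theorem jj_smulRight (r : D.Λ𝔠 →ₗ[k] k) (b : D.𝔟) :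
    C.jj (r.smulRight b) = C.cc r * C.ii b := by
  rw [cc_ii_coe, jj_apply, cc, comp_slot]
  congr 1
  refine LinearMap.ext fun w => ?_
  change C.ii ((r (parity k D.𝔠 w) • b : D.𝔟) : 𝔤) =
    C.ii b * (r (parity k D.𝔠 w) • (1 : Module.End k Y))
  rw [mul_smul_comm, mul_one]
  exact map_smul C.ii _ _

/-- The operators `jj` supercommute. -/
theorem jj_mul_jj {p q : ℕ} {a a' : D.Λ𝔠 →ₗ[k] D.𝔟} (ha : Par p a) (ha' : Par q a') :
    C.jj a * C.jj a' = (-1 : k) ^ ((p + 1) * (q + 1)) • (C.jj a' * C.jj a) := by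
  let m : 𝔤 →ₗ[k] 𝔤 →ₗ[k] Module.End k Y := (LinearMap.mul k (Module.End k Y)).compl₁₂ C.ii C.ii
  have key : ∀ {p q : ℕ} {a a' : D.Λ𝔠 →ₗ[k] D.𝔟}, Par p a → Par q a' →
      C.jj a * C.jj a' = (-1 : k) ^ q • C.slot (conv m (D.in𝔟 ∘ₗ a) (D.in𝔟 ∘ₗ a')) := by
    intro p q a a' ha ha'
    have h := C.slot_slot (-(m.compl₁₂ (D.in𝔟 ∘ₗ a' ∘ₗ parity k D.𝔠)
      (D.in𝔟 ∘ₗ a)))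
    have h1 : C.jj a * C.jj a' = C.slot (C.slot ∘ₗ (-(m.compl₁₂ (D.in𝔟 ∘ₗ a' ∘ₗ parity k D.𝔠)
        (D.in𝔟 ∘ₗ a)))) := by
      rw [C.jj_apply a', comp_slot]
      congr 1
      refine LinearMap.ext fun w => ?_
      change C.jj a * C.ii (a' (parity k D.𝔠 w)) = C.slot (-(LinearMap.mulLeft k
        (C.ii (a' (parity k D.𝔠 w))) ∘ₗ C.ii ∘ₗ D.in𝔟 ∘ₗ a))
      rw [jj_mul_ii, map_neg, ← comp_slot, jj_apply, LinearMap.comp_assoc _ _ a, parity_comp_parity,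
        LinearMap.comp_id]
    rw [h1, h, ← map_smul]
    congr 1
    refine LinearMap.ext fun w => ?_
    rw [LinearMap.smul_apply, conv_apply, conv_apply]
    generalize comul k D.𝔠 w = t
    induction t with
    | zero => simp only [map_zero, smul_zero]
    | add a b ha hb => simp only [map_add, smul_add, ha, hb]
    | tmul u v =>
      change -(C.ii (a' (parity k D.𝔠 v)) * C.ii (a u)) =
        (-1 : k) ^ q • (C.ii (a u) * C.ii (a' v))
      have h2 : C.ii (a u : 𝔤) * C.ii (a' v : 𝔤) = -(C.ii (a' v : 𝔤) * C.ii (a u : 𝔤)) :=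
        LinearMap.ext fun z => C.ii_ii _ _ z
      have h3 : C.ii (a' (parity k D.𝔠 v) : 𝔤) = (-1 : k) ^ q • C.ii (a' v : 𝔤) := by
        rw [ha' v]
        exact map_smul C.ii _ _
      rw [h2, h3, smul_mul_assoc, smul_neg]
  have hm : m.flip = -m := by
    refine LinearMap.ext fun x => LinearMap.ext fun y => LinearMap.ext fun z => ?_
    exact C.ii_ii y x z
  have hneg : ∀ F G : D.Λ𝔠 →ₗ[k] 𝔤, conv (-m) F G = -conv m F G := fun F G => by
    refine LinearMap.ext fun w => ?_
    rw [LinearMap.neg_apply, conv_apply, conv_apply]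
    generalize comul k D.𝔠 w = t
    induction t with
    | zero => simp only [map_zero, neg_zero]
    | add a b ha hb =>
      simp only [map_add, ha, hb]
      abel
    | tmul u v => rfl
  rw [key ha ha', key ha' ha, conv_comm m (ha.postcomp D.in𝔟) (ha'.postcomp D.in𝔟), hm, hneg,
    map_smul, map_neg, smul_neg, smul_neg, smul_smul, smul_smul, ← neg_smul]
  congr 1
  rw [mul_add, add_mul, mul_one, one_mul, pow_add, pow_add, pow_add, pow_one]
  linear_combination (-1 : k) ^ (p * q) * (-1 : k) ^ q * neg_one_pow_mul_self (k := k) p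

theorem finDetermined_jj (u : Y) : FinDetermined (LinearMap.applyₗ u ∘ₗ C.jj) := by
  let T : (D.Λ𝔠 →ₗ[k] D.𝔟) →ₗ[k] D.Λ𝔠 ⊗[k] Y →ₗ[k] Y :=
    (TensorProduct.lift.equiv (RingHom.id k) D.Λ𝔠 Y Y).toLinearMap ∘ₗ
      LinearMap.lcomp k (Module.End k Y) (parity k D.𝔠) ∘ₗ
        LinearMap.llcomp k D.Λ𝔠 D.𝔟 (Module.End k Y) (C.ii ∘ₗ D.in𝔟)
  have h := finDetermined_of_tensor T (fun w y => ⟨Submodule.span k {parity k D.𝔠 w}, inferInstance,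
    fun a ha => ?_⟩) (C.co u)
  · exact h
  · change C.ii (a (parity k D.𝔠 w)) y = 0
    rw [ha _ (Submodule.mem_span_singleton_self _)]
    change C.ii 0 y = 0
    rw [map_zero, LinearMap.zero_apply]

end CliffordModule

end SplitTate

end SemiInf

namespace SemiInf

namespace SplitTate

variable {k : Type*} [Field k] {𝔤 : Type*} [LieRing 𝔤] [LieAlgebra k 𝔤] [UniformSpace 𝔤]
  [IsUniformAddGroup 𝔤] {D : SplitTate k 𝔤}
variable {M Y : Type*} [AddCommGroup M] [Module k M] [AddCommGroup Y] [Module k Y]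

/-- A finite dual system in `𝔟` and `𝔟*` that is a basis of `𝔟` modulo the open subspace `U`. -/
structure Resolution (D : SplitTate k 𝔤) (U : Submodule k 𝔤) where
  n : ℕ
  b : Fin n → D.𝔟
  β : Fin n → tateDual k D.𝔟
  dual : ∀ i j, (β i).1 (b j) = if i = j then 1 else 0
  sub_mem : ∀ x : D.𝔟, ((x - ∑ i, (β i).1 x • b i : D.𝔟) : 𝔤) ∈ U
  vanish : ∀ i (x : D.𝔟), (x : 𝔤) ∈ U → (β i).1 x = 0

theorem nonempty_resolution (D : SplitTate k 𝔤) {U : Submodule k 𝔤} (hU : IsOpen (U : Set 𝔤)) :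
    Nonempty (D.Resolution U) := by
  obtain ⟨n, b, β, h1, h2, h3⟩ := D.exists_resolution U hU
  exact ⟨⟨n, b, β, h1, h2, h3⟩⟩

/-- The linear maps from `𝔟` that vanish on an open subspace. -/
def openKer (D : SplitTate k 𝔤) (Y : Type*) [AddCommGroup Y] [Module k Y] :
    Submodule k (D.𝔟 →ₗ[k] Y) where
  carrier := {l | ∃ U : Submodule k 𝔤, IsOpen (U : Set 𝔤) ∧ ∀ b : D.𝔟, (b : 𝔤) ∈ U → l b = 0}
  add_mem' := by
    rintro l l' ⟨U, hU, h⟩ ⟨U', hU', h'⟩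
    refine ⟨U ⊓ U', hU.inter hU', fun b hb => ?_⟩
    rw [LinearMap.add_apply, h b hb.1, h' b hb.2, add_zero]
  zero_mem' := ⟨⊤, isOpen_univ, fun _ _ => rfl⟩
  smul_mem' := by
    rintro t l ⟨U, hU, h⟩
    exact ⟨U, hU, fun b hb => by rw [LinearMap.smul_apply, h b hb, smul_zero]⟩

namespace CliffordModule

variable (C : D.CliffordModule M Y)

/-! ### Creation and annihilation operators -/

/-- The annihilation operators. -/
def ann : (D.𝔟 × Module.Dual k D.𝔠) →ₗ[k] Module.End k Y :=
  (C.ii ∘ₗ D.in𝔟).coprod (C.ee ∘ₗ D.annDual)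

/-- The creation operators. -/
def cre : (tateDual k D.𝔟 × D.𝔠) →ₗ[k] Module.End k Y :=
  (C.ee ∘ₗ D.extDual).coprod (C.ii ∘ₗ D.sec)

variable (D) in
/-- The pairing of the annihilation operators with the creation operators. -/
def annPair : (D.𝔟 × Module.Dual k D.𝔠) →ₗ[k] Module.Dual k (tateDual k D.𝔟 × D.𝔠) :=
  LinearMap.mk₂ k (fun a v => v.1.1 a.1 + a.2 v.2)
    (fun a a' v => by
      change v.1.1 (a.1 + a'.1) + (a.2 v.2 + a'.2 v.2) = _
      rw [map_add]
      abel)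
    (fun t a v => by
      change v.1.1 (t • a.1) + t * a.2 v.2 = t * (v.1.1 a.1 + a.2 v.2)
      rw [map_smul, smul_eq_mul]
      ring)
    (fun a v v' => by
      change (v.1.1 a.1 + v'.1.1 a.1) + a.2 (v.2 + v'.2) = _
      rw [map_add]
      abel)
    (fun t a v => by
      change t * v.1.1 a.1 + a.2 (t • v.2) = t * (v.1.1 a.1 + a.2 v.2)
      rw [map_smul, smul_eq_mul]
      ring)

theorem ann_cre (a : D.𝔟 × Module.Dual k D.𝔠) (v : tateDual k D.𝔟 × D.𝔠) (u : Y) :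
    C.ann a (C.cre v u) = annPair D a v • u - C.cre v (C.ann a u) := by
  change C.ii a.1 (C.ee (D.extDual v.1) u + C.ii (D.sec v.2) u) + C.ee (D.annDual a.2)
      (C.ee (D.extDual v.1) u + C.ii (D.sec v.2) u) = (v.1.1 a.1 + a.2 v.2) • u -
    (C.ee (D.extDual v.1) (C.ii a.1 u + C.ee (D.annDual a.2) u) +
      C.ii (D.sec v.2) (C.ii a.1 u + C.ee (D.annDual a.2) u))
  have h1 : C.ii a.1 (C.ee (D.extDual v.1) u) = v.1.1 a.1 • u - C.ee (D.extDual v.1) (C.ii a.1 u) := by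
    rw [C.ii_ee, extDual_apply, pr𝔟_coe]
  have h2 : C.ee (D.annDual a.2) (C.ii (D.sec v.2) u) =
      a.2 v.2 • u - C.ii (D.sec v.2) (C.ee (D.annDual a.2) u) := by
    rw [C.ee_ii, annDual_sec]
  rw [map_add, map_add, map_add, map_add, h1, h2, C.ii_ii a.1, C.ee_ee _ (D.extDual v.1), add_smul]
  abel

/-- The vectors that are killed by all products of `m` operators of a family. -/
def killed {I : Type*} (A : I → Module.End k Y) : ℕ → Submodule k Y
  | 0 => ⊥
  | m + 1 => ⨅ i, (killed A m).comap (A i)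

theorem mem_killed_succ {I : Type*} {A : I → Module.End k Y} {m : ℕ} {u : Y} :
    u ∈ killed A (m + 1) ↔ ∀ i, A i u ∈ killed A m := by
  rw [killed, Submodule.mem_iInf]
  rfl

theorem killed_le_succ {I : Type*} (A : I → Module.End k Y) (m : ℕ) :
    killed A m ≤ killed A (m + 1) := by
  induction m with
  | zero => exact bot_le
  | succ m ih => exact fun u hu => mem_killed_succ.2 fun i => ih (mem_killed_succ.1 hu i)

theorem killed_mono {I : Type*} (A : I → Module.End k Y) : Monotone (killed A) :=
  monotone_nat_of_le_succ (killed_le_succ A)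

theorem exists_mem_killed (u : Y) : ∃ m, u ∈ killed C.ann m := by
  have hcre : ∀ v m, ∀ u ∈ killed C.ann m, C.cre v u ∈ killed C.ann (m + 1) := by
    intro v m
    induction m with
    | zero =>
      intro u hu
      rw [(Submodule.mem_bot k).1 hu, map_zero]
      exact Submodule.zero_mem _
    | succ m ih =>
      intro u hu
      refine mem_killed_succ.2 fun a => ?_
      rw [ann_cre]
      exact Submodule.sub_mem _ (Submodule.smul_mem _ _ hu) (ih _ (mem_killed_succ.1 hu a))
  let S : Submodule k Y :=
    { carrier := {u | ∃ m, u ∈ killed C.ann m}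
      add_mem' := by
        rintro u u' ⟨m, h⟩ ⟨m', h'⟩
        exact ⟨max m m', Submodule.add_mem _ (killed_mono _ (le_max_left _ _) h)
          (killed_mono _ (le_max_right _ _) h')⟩
      zero_mem' := ⟨0, Submodule.zero_mem _⟩
      smul_mem' := by
        rintro t u ⟨m, h⟩
        exact ⟨m, Submodule.smul_mem _ t h⟩ }
  have hS : S = ⊤ := by
    refine C.gen S (fun m => ⟨1, mem_killed_succ.2 fun a => ?_⟩) (fun c u ⟨m, h⟩ => ⟨m + 1, ?_⟩)
      fun β u ⟨m, h⟩ => ⟨m + 1, ?_⟩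
    · change C.ii a.1 (C.vac m) + C.ee (D.annDual a.2) (C.vac m) ∈ _
      rw [C.ii_vac, C.ee_vac, add_zero]
      exact Submodule.zero_mem _
    · have := hcre (0, c) m u h
      change C.ee (D.extDual 0) u + C.ii (D.sec c) u ∈ _ at this
      rwa [map_zero, map_zero, LinearMap.zero_apply, zero_add] at this
    · have := hcre (β, 0) m u h
      change C.ee (D.extDual β) u + C.ii (D.sec 0) u ∈ _ at this
      rwa [map_zero, map_zero, LinearMap.zero_apply, add_zero] at this
  have : u ∈ S := hS ▸ Submodule.mem_top
  exact this

/-- A property of vectors holds if it holds for `u` whenever it holds for all `a u`, where `a` is an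
annihilation operator. -/
theorem annihilator_induction {P : Y → Prop} (h0 : P 0) (h : ∀ u, (∀ a, P (C.ann a u)) → P u)
    (u : Y) : P u := by
  obtain ⟨m, hm⟩ := C.exists_mem_killed u
  induction m generalizing u with
  | zero => rwa [(Submodule.mem_bot k).1 hm]
  | succ m ih => exact h u fun a => ih _ (mem_killed_succ.1 hm a)

/-- Two linear maps that are intertwined with the `ε_ξ` for `ξ ∈ 𝔠*` in the same way, and whose
composition with the counit of `Λ(𝔠)` is the same, are equal. -/
theorem eq_zero_of_contr {X : Y →ₗ[k] D.Λ𝔠 ⊗[k] Y} {s : k}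
    (hX : ∀ ξ u, LinearMap.rTensor Y (contr (ξ ∘ₗ ExteriorAlgebra.ιInv)) (X u) =
      s • X (C.ee (D.annDual ξ) u))
    (h0 : ∀ u, LinearMap.rTensor Y (counit k D.𝔠).toLinearMap (X u) = 0) : X = 0 := by
  refine LinearMap.ext fun u => ?_
  refine C.annihilator_induction (P := fun u => X u = 0) (map_zero _) (fun u hu => ?_) u
  refine eq_zero_of_contr_eq_zero (fun ξ => ?_) (h0 u)
  have := hu (0, ξ)
  change X (C.ii ((0 : D.𝔟) : 𝔤) u + C.ee (D.annDual ξ) u) = 0 at this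
  rw [ZeroMemClass.coe_zero, map_zero, LinearMap.zero_apply, zero_add] at this
  rw [hX, this, smul_zero]

theorem co_cc (r : D.Λ𝔠 →ₗ[k] k) (u : Y) :
    C.co (C.cc r u) = LinearMap.rTensor Y (contr r) (C.co u) := by
  let L : D.Λ𝔠 ⊗[k] (D.Λ𝔠 ⊗[k] Y) →ₗ[k] D.Λ𝔠 ⊗[k] Y :=
    (TensorProduct.lid k _).toLinearMap ∘ₗ LinearMap.rTensor _ r
  have h := congrArg L (C.coassoc u)
  have h1 : L (LinearMap.lTensor D.Λ𝔠 C.co (C.co u)) = C.co (C.cc r u) := by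
    rw [cc, slot_apply]
    generalize C.co u = t
    induction t with
    | zero => simp only [map_zero]
    | add a b ha hb => simp only [map_add, ha, hb]
    | tmul w u =>
      change r w • C.co u = C.co (r w • u)
      rw [map_smul]
  rw [← h1, h]
  generalize C.co u = t
  induction t with
  | zero => simp only [map_zero]
  | add a b ha hb => simp only [map_add, ha, hb]
  | tmul w u =>
    rw [comulFlip_tmul, LinearMap.rTensor_tmul, contr, conv_apply]
    generalize comul k D.𝔠 w = s
    induction s with
    | zero => simp only [map_zero, TensorProduct.zero_tmul]
    | add a b ha hb => simp only [map_add, TensorProduct.add_tmul, ha, hb]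
    | tmul w₁ w₂ =>
      change r w₂ • (w₁ ⊗ₜ[k] u) = (r w₂ • w₁) ⊗ₜ[k] u
      rw [TensorProduct.smul_tmul']

theorem counit_co (u : Y) :
    LinearMap.rTensor Y (counit k D.𝔠).toLinearMap (C.co u) = (1 : k) ⊗ₜ u := by
  have h : ∀ t : D.Λ𝔠 ⊗[k] Y, LinearMap.rTensor Y (counit k D.𝔠).toLinearMap t =
      (1 : k) ⊗ₜ TensorProduct.lift ((counit k D.𝔠).toLinearMap.smulRight (1 : Module.End k Y)) t := by
    intro t
    induction t with
    | zero => simp only [map_zero, TensorProduct.tmul_zero]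
    | add a b ha hb => simp only [map_add, TensorProduct.tmul_add, ha, hb]
    | tmul w u =>
      change counit k D.𝔠 w ⊗ₜ[k] u = (1 : k) ⊗ₜ[k] (counit k D.𝔠 w • u)
      rw [TensorProduct.tmul_smul, TensorProduct.smul_tmul', smul_eq_mul, mul_one]
  rw [h, ← slot_apply, ← cc, cc_counit]
  rfl

/-- An operator that commutes or anticommutes with all `ε_ξ`, `ξ ∈ 𝔠*`, supercommutes with the action
of `R`. -/
theorem cc_comm {T : Module.End k Y} {s : k} (hs : s * s = 1)
    (hT : ∀ ξ, T * C.ee (D.annDual ξ) = s • (C.ee (D.annDual ξ) * T)) (r : D.Λ𝔠 →ₗ[k] k) :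
    C.cc r * T = T * C.cc (r ∘ₗ (scale D.𝔠 s).toLinearMap) := by
  have key : C.co ∘ₗ T - TensorProduct.map (scale D.𝔠 s).toLinearMap T ∘ₗ C.co = 0 := by
    refine C.eq_zero_of_contr (s := s) (fun ξ u => ?_) fun u => ?_
    · have hmap : ∀ t, LinearMap.rTensor Y (contr (ξ ∘ₗ ExteriorAlgebra.ιInv))
          (TensorProduct.map (scale D.𝔠 s).toLinearMap T t) =
          s • TensorProduct.map (scale D.𝔠 s).toLinearMap T
            (LinearMap.rTensor Y (contr (ξ ∘ₗ ExteriorAlgebra.ιInv)) t) := fun t => by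
        induction t with
        | zero => simp only [map_zero, smul_zero]
        | add a b ha hb => simp only [map_add, ha, hb, smul_add]
        | tmul w u =>
          rw [TensorProduct.map_tmul, LinearMap.rTensor_tmul, AlgHom.toLinearMap_apply,
            contr_ιInv_scale, LinearMap.rTensor_tmul, TensorProduct.map_tmul,
            TensorProduct.smul_tmul']
          rfl
      have h1 : C.ee (D.annDual ξ) (T u) = s • T (C.ee (D.annDual ξ) u) := by
        have := LinearMap.congr_fun (hT ξ) u
        rw [Module.End.mul_apply, LinearMap.smul_apply, Module.End.mul_apply] at this
        rw [this, smul_smul, hs, one_smul]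
      simp only [LinearMap.sub_apply, LinearMap.comp_apply]
      rw [map_sub, hmap, ← co_cc, cc_ιInv, h1, ← co_cc, cc_ιInv, map_smul, smul_sub]
    · have hmap : ∀ t, LinearMap.rTensor Y (counit k D.𝔠).toLinearMap
          (TensorProduct.map (scale D.𝔠 s).toLinearMap T t) =
          LinearMap.lTensor k T (LinearMap.rTensor Y (counit k D.𝔠).toLinearMap t) := fun t => by
        have hsc : (counit k D.𝔠).comp (scale D.𝔠 s) = counit k D.𝔠 := by
          ext x
          simp only [AlgHom.comp_toLinearMap, LinearMap.comp_apply, AlgHom.toLinearMap_apply]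
          rw [scale_ι, map_smul, counit_ι, smul_zero]
        induction t with
        | zero => simp only [map_zero]
        | add a b ha hb => simp only [map_add, ha, hb]
        | tmul w u =>
          have := AlgHom.congr_fun hsc w
          rw [AlgHom.comp_apply] at this
          rw [TensorProduct.map_tmul, LinearMap.rTensor_tmul, LinearMap.rTensor_tmul,
            LinearMap.lTensor_tmul, AlgHom.toLinearMap_apply, AlgHom.toLinearMap_apply, this]
          rfl
      simp only [LinearMap.sub_apply, LinearMap.comp_apply]
      rw [map_sub, hmap, counit_co, counit_co, LinearMap.lTensor_tmul, sub_self]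
  have h : ∀ u, C.co (T u) = TensorProduct.map (scale D.𝔠 s).toLinearMap T (C.co u) := fun u => by
    have := LinearMap.congr_fun key u
    rw [LinearMap.sub_apply] at this
    exact sub_eq_zero.1 this
  exact C.cc_comp h r

/-- The vacuum expectation value. -/
noncomputable def vev : Y →ₗ[k] M :=
  (TensorProduct.rid k M).toLinearMap ∘ₗ LinearMap.lTensor M (counit k D.𝔠).toLinearMap ∘ₗ C.ev

theorem vev_vac (m : M) : C.vev (C.vac m) = m := by
  change TensorProduct.rid k M (LinearMap.lTensor M _ (C.ev (C.vac m))) = m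
  rw [C.ev_vac, LinearMap.lTensor_tmul, AlgHom.toLinearMap_apply, map_one, TensorProduct.rid_tmul,
    one_smul]

theorem vev_sec (c : D.𝔠) (u : Y) : C.vev (C.ii (D.sec c) u) = 0 := by
  change TensorProduct.rid k M (LinearMap.lTensor M _ (C.ev (C.ii (D.sec c) u))) = 0
  rw [C.ev_sec]
  generalize C.ev u = n
  induction n with
  | zero => simp only [map_zero]
  | add a b ha hb => rw [map_add, map_add, map_add, ha, hb, add_zero]
  | tmul m w =>
    rw [LinearMap.lTensor_tmul, LinearMap.lTensor_tmul, LinearMap.mulRight_apply,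
      AlgHom.toLinearMap_apply, counit_mul_ι, TensorProduct.tmul_zero, map_zero]

/-! ### The subspace killed by the `ι_b` -/

variable [CharZero k]

theorem ii_self (x : 𝔤) (u : Y) : C.ii x (C.ii x u) = 0 := by
  have h : (2 : k) • C.ii x (C.ii x u) = 0 := by
    rw [two_smul]
    nth_rewrite 2 [C.ii_ii]
    exact add_neg_cancel _
  exact (smul_eq_zero.1 h).resolve_left two_ne_zero

theorem ee_self (f : tateDual k 𝔤) (u : Y) : C.ee f (C.ee f u) = 0 := by
  have h : (2 : k) • C.ee f (C.ee f u) = 0 := by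
    rw [two_smul]
    nth_rewrite 2 [C.ee_ee]
    exact add_neg_cancel _
  exact (smul_eq_zero.1 h).resolve_left two_ne_zero

/-- The action of `Λ(𝔠)` by the operators `ι_{sc}`. -/
noncomputable def secHom : D.Λ𝔠 →ₐ[k] Module.End k Y :=
  ExteriorAlgebra.lift k ⟨C.ii ∘ₗ D.sec, fun _ => LinearMap.ext fun u => C.ii_self _ u⟩

theorem secHom_ι (c : D.𝔠) : C.secHom (ExteriorAlgebra.ι k c) = C.ii (D.sec c) :=
  ExteriorAlgebra.lift_ι_apply _ _ _ _

/-- The section of `ev` whose image is the subspace killed by the operators `ι_b`. -/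
noncomputable def jmap : M ⊗[k] D.Λ𝔠 →ₗ[k] Y := TensorProduct.lift
  ((C.secHom.toLinearMap ∘ₗ CliffordAlgebra.reverse).flip ∘ₗ C.vac)

theorem jmap_tmul (m : M) (w : D.Λ𝔠) :
    C.jmap (m ⊗ₜ w) = C.secHom (CliffordAlgebra.reverse w) (C.vac m) := rfl

theorem jmap_one (m : M) : C.jmap (m ⊗ₜ 1) = C.vac m := by
  rw [jmap_tmul, CliffordAlgebra.reverse.map_one, map_one]
  rfl

theorem jmap_mul_ι (m : M) (w : D.Λ𝔠) (c : D.𝔠) :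
    C.jmap (m ⊗ₜ (w * ExteriorAlgebra.ι k c)) = C.ii (D.sec c) (C.jmap (m ⊗ₜ w)) := by
  have h : CliffordAlgebra.reverse (ExteriorAlgebra.ι k c) = ExteriorAlgebra.ι k c :=
    CliffordAlgebra.reverse_ι c
  rw [jmap_tmul, jmap_tmul, CliffordAlgebra.reverse.map_mul, h, map_mul, secHom_ι]
  rfl

theorem ev_jmap (n : M ⊗[k] D.Λ𝔠) : C.ev (C.jmap n) = n := by
  have : C.ev ∘ₗ C.jmap = LinearMap.id := by
    refine TensorProduct.ext (LinearMap.ext fun m => exterior_ext_right ?_ fun c w h => ?_)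
    · change C.ev (C.jmap (m ⊗ₜ 1)) = _
      rw [jmap_one, C.ev_vac]
      rfl
    · change C.ev (C.jmap (m ⊗ₜ w)) = m ⊗ₜ w at h
      change C.ev (C.jmap (m ⊗ₜ (w * ExteriorAlgebra.ι k c))) =
        m ⊗ₜ (w * ExteriorAlgebra.ι k c)
      rw [jmap_mul_ι, C.ev_sec, h]
      rfl
  exact LinearMap.congr_fun this n

theorem ii_jmap (b : D.𝔟) (n : M ⊗[k] D.Λ𝔠) : C.ii b (C.jmap n) = 0 := by
  have : C.ii b ∘ₗ C.jmap = 0 := by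
    refine TensorProduct.ext (LinearMap.ext fun m => exterior_ext_right ?_ fun c w h => ?_)
    · change C.ii b (C.jmap (m ⊗ₜ 1)) = _
      rw [jmap_one, C.ii_vac]
      rfl
    · change C.ii b (C.jmap (m ⊗ₜ w)) = 0 at h
      change C.ii b (C.jmap (m ⊗ₜ (w * ExteriorAlgebra.ι k c))) = 0
      rw [jmap_mul_ι, C.ii_ii, h, map_zero, neg_zero]
  exact LinearMap.congr_fun this n

theorem ii_sec_jmap (c : D.𝔠) (n : M ⊗[k] D.Λ𝔠) : C.ii (D.sec c) (C.jmap n) =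
    C.jmap (LinearMap.lTensor M (LinearMap.mulRight k (ExteriorAlgebra.ι k c)) n) := by
  induction n with
  | zero => simp only [map_zero]
  | add a b ha hb => simp only [map_add, ha, hb]
  | tmul m w => exact (C.jmap_mul_ι m w c).symm

/-- The vectors killed by the operators `ι_b` are determined by their image under `ev`. -/
theorem eq_jmap_of_ii_eq_zero {u : Y} (h : ∀ b : D.𝔟, C.ii b u = 0) : u = C.jmap (C.ev u) := by
  have hu : u ∈ LinearMap.range C.jmap := by
    refine mem_of_annihilated (V := tateDual k D.𝔟) (D := D.𝔟) (Y := Y) D.eval𝔟 (fun β hβ => ?_) (C.ee ∘ₗ D.extDual) (C.ii ∘ₗ D.in𝔟)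
      (fun b β => ?_) (fun β => LinearMap.ext fun u => C.ee_self _ u) (LinearMap.range C.jmap)
      (fun b y hy => ?_) (fun S hS ha => ?_) h
    · ext b
      exact hβ b
    · refine LinearMap.ext fun u => ?_
      change C.ii b (C.ee (D.extDual β) u) + C.ee (D.extDual β) (C.ii b u) = β.1 b • u
      rw [C.ii_ee, extDual_apply, pr𝔟_coe, sub_add_cancel]
    · obtain ⟨n, rfl⟩ := hy
      exact C.ii_jmap b n
    · let P : Submodule k Y → Prop := fun S => LinearMap.range C.jmap ≤ S ∧
        ∀ β, ∀ u ∈ S, C.ee (D.extDual β) u ∈ S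
      let S₀ : Submodule k Y := sInf {S | P S}
      have h0 : ∀ {u}, u ∈ S₀ ↔ ∀ S, P S → u ∈ S := fun {u} => Submodule.mem_sInf
      have hP : P S₀ := ⟨fun u hu => h0.2 fun S h => h.1 hu,
        fun β u hu => h0.2 fun S h => h.2 β u (h0.1 hu S h)⟩
      have hsec : ∀ c, ∀ u ∈ S₀, C.ii (D.sec c) u ∈ S₀ := fun c u hu => by
        have := h0.1 hu (S₀ ⊓ S₀.comap (C.ii (D.sec c))) ⟨fun u hu => ⟨hP.1 hu, ?_⟩,
          fun β u hu => ⟨hP.2 β u hu.1, ?_⟩⟩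
        · exact this.2
        · obtain ⟨n, rfl⟩ := hu
          change C.ii (D.sec c) (C.jmap n) ∈ S₀
          rw [ii_sec_jmap]
          exact hP.1 ⟨_, rfl⟩
        · change C.ii (D.sec c) (C.ee (D.extDual β) u) ∈ S₀
          rw [C.ii_ee, extDual_sec, zero_smul, zero_sub]
          exact S₀.neg_mem (hP.2 β _ hu.2)
      have htop := C.gen S₀ (fun m => hP.1 ⟨m ⊗ₜ 1, C.jmap_one m⟩) hsec hP.2
      rw [eq_top_iff, ← htop]
      exact sInf_le ⟨hS, ha⟩
  obtain ⟨n, rfl⟩ := hu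
  rw [ev_jmap]

/-- The vectors killed by all annihilation operators are the vacuum vectors. -/
theorem eq_vac_of_ann_eq_zero {u : Y} (hi : ∀ b : D.𝔟, C.ii b u = 0)
    (he : ∀ ξ, C.ee (D.annDual ξ) u = 0) : u = C.vac (C.vev u) := by
  have hu : u ∈ LinearMap.range C.vac := by
    have hadd : ∀ (A B : Module.End k Y), A * A = 0 → B * B = 0 → A * B = -(B * A) →
        (A + B) * (A + B) = 0 := fun A B hA hB hAB => by
      rw [add_mul, mul_add, mul_add, hA, hB, hAB]
      abel
    refine mem_of_annihilated (V := tateDual k D.𝔟 × D.𝔠) (D := D.𝔟 × Module.Dual k D.𝔠) (Y := Y)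
      (annPair D) (fun v hv => ?_) C.cre C.ann (fun a v => ?_) (fun v => ?_)
      (LinearMap.range C.vac) (fun a y hy => ?_) (fun S hS ha => ?_) fun a => ?_
    · refine Prod.ext ?_ ?_
      · ext b
        have : v.1.1 b + (0 : Module.Dual k D.𝔠) v.2 = 0 := hv (b, 0)
        rwa [LinearMap.zero_apply, add_zero] at this
      · refine (Module.forall_dual_apply_eq_zero_iff k v.2).1 fun ξ => ?_
        have : v.1.1 0 + ξ v.2 = 0 := hv (0, ξ)
        rwa [map_zero, zero_add] at this
    · refine LinearMap.ext fun u => ?_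
      change C.ann a (C.cre v u) + C.cre v (C.ann a u) = annPair D a v • u
      rw [ann_cre, sub_add_cancel]
    · refine hadd _ _ (LinearMap.ext fun u => C.ee_self _ u)
        (LinearMap.ext fun u => C.ii_self _ u) (LinearMap.ext fun u => ?_)
      change C.ee (D.extDual v.1) (C.ii (D.sec v.2) u) = -C.ii (D.sec v.2) (C.ee (D.extDual v.1) u)
      rw [C.ee_ii, extDual_sec, zero_smul, zero_sub]
    · obtain ⟨m, rfl⟩ := hy
      change C.ii a.1 (C.vac m) + C.ee (D.annDual a.2) (C.vac m) = 0
      rw [C.ii_vac, C.ee_vac, add_zero]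
    · refine C.gen S (fun m => hS ⟨m, rfl⟩) (fun c u hu => ?_) fun β u hu => ?_
      · have := ha (0, c) u hu
        change C.ee (D.extDual 0) u + C.ii (D.sec c) u ∈ _ at this
        rwa [map_zero, map_zero, LinearMap.zero_apply, zero_add] at this
      · have := ha (β, 0) u hu
        change C.ee (D.extDual β) u + C.ii (D.sec 0) u ∈ _ at this
        rwa [map_zero, map_zero, LinearMap.zero_apply, add_zero] at this
    · change C.ii a.1 u + C.ee (D.annDual a.2) u = 0
      rw [hi, he, add_zero]
  obtain ⟨m, rfl⟩ := hu
  rw [vev_vac]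

/-- An operator that commutes with the Clifford operators and whose vacuum expectation value is zero
is zero. -/
theorem eq_zero_of_comm {T : Module.End k Y} (hi : ∀ x, T * C.ii x = C.ii x * T)
    (he : ∀ f, T * C.ee f = C.ee f * T) (h0 : ∀ m, C.vev (T (C.vac m)) = 0) : T = 0 := by
  have hi' := fun x u => LinearMap.congr_fun (hi x) u
  have he' := fun f u => LinearMap.congr_fun (he f) u
  simp only [Module.End.mul_apply] at hi' he'
  refine C.hom_ext (fun m => ?_) (fun c u h => ?_) fun β u h => ?_
  · rw [C.eq_vac_of_ann_eq_zero (u := T (C.vac m)) (fun b => by rw [← hi', C.ii_vac, map_zero])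
      (fun ξ => by rw [← he', C.ee_vac, map_zero]), h0, map_zero]
    rfl
  · rw [hi', h, LinearMap.zero_apply, map_zero]
    rfl
  · rw [he', h, LinearMap.zero_apply, map_zero]
    rfl

end CliffordModule

end SplitTate

end SemiInf

namespace SemiInf

namespace SplitTate

variable {k : Type*} [Field k] {𝔤 : Type*} [LieRing 𝔤] [LieAlgebra k 𝔤] [UniformSpace 𝔤]
  [IsUniformAddGroup 𝔤] {D : SplitTate k 𝔤}
variable {M Y : Type*} [AddCommGroup M] [Module k M] [AddCommGroup Y] [Module k Y]

/-- For every neighbourhood `V` of `0`, the bracket maps `U × 𝔟` to `V` for small enough `U`. -/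
theorem exists_open_lie_mem (D : SplitTate k 𝔤) {V : Submodule k 𝔤} (hV : IsOpen (V : Set 𝔤)) :
    ∃ U : Submodule k 𝔤, IsOpen (U : Set 𝔤) ∧ ∀ x ∈ U, ∀ b : D.𝔟, ⁅x, (b : 𝔤)⁆ ∈ V := by
  have h0 : (fun p : 𝔤 × 𝔤 => ⁅p.1, p.2⁆) ⁻¹' (V : Set 𝔤) ∈ 𝓝 ((0 : 𝔤), (0 : 𝔤)) := by
    refine D.isTate.continuous_lie.continuousAt.preimage_mem_nhds ?_
    rw [lie_zero]
    exact mem_nhds_zero_of_isOpen hV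
  rw [nhds_prod_eq, Filter.mem_prod_iff] at h0
  obtain ⟨t, ht, t', ht', htt⟩ := h0
  obtain ⟨W, hW, hWt⟩ := D.exists_open_subspace ht
  obtain ⟨W', hW', hWt'⟩ := D.exists_open_subspace ht'
  obtain ⟨F, hF⟩ := D.isCLattice.bounded W' hW'
  refine ⟨W ⊓ ⨅ f : F, V.comap (LieAlgebra.ad k 𝔤 (f : 𝔤)), ?_, fun x hx b => ?_⟩
  · rw [Submodule.coe_inf, Submodule.coe_iInf]
    exact hW.inter (isOpen_iInter_of_finite fun f => hV.preimage (D.continuous_ad f))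
  · obtain ⟨w, hw, s, hs, hws⟩ := Submodule.mem_sup.1 (hF b.2)
    rw [← hws, lie_add]
    refine V.add_mem (htt (Set.mk_mem_prod (hWt hx.1) (hWt' hw))) ?_
    have hle : Submodule.span k (F : Set 𝔤) ≤ V.comap (LieAlgebra.ad k 𝔤 x) := by
      refine Submodule.span_le.2 fun f hf => ?_
      have := (Submodule.mem_iInf _).1 hx.2 ⟨f, hf⟩
      change ⁅f, x⁆ ∈ V at this
      change ⁅x, f⁆ ∈ V
      rw [← lie_skew]
      exact V.neg_mem this
    exact hle hs

theorem Resolution.apply {U : Submodule k 𝔤} (R : D.Resolution U) (l : D.𝔟 →ₗ[k] Y)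
    (hl : ∀ b : D.𝔟, (b : 𝔤) ∈ U → l b = 0) (x : D.𝔟) : l x = ∑ i, (R.β i).1 x • l (R.b i) :=
  D.resolution_apply R.sub_mem l hl x

namespace CliffordModule

variable (C : D.CliffordModule M Y)

/-! ### Sums over `𝔟` -/

theorem sum_resolution_eq {U U' : Submodule k 𝔤} (R : D.Resolution U) (R' : D.Resolution U')
    (h : U' ≤ U) (l : D.𝔟 →ₗ[k] Y) (hl : ∀ b : D.𝔟, (b : 𝔤) ∈ U → l b = 0) :
    ∑ i, C.ee (D.extDual (R.β i)) (l (R.b i)) = ∑ i, C.ee (D.extDual (R'.β i)) (l (R'.b i)) := by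
  have h1 : ∀ i, R.β i = ∑ j, (R.β i).1 (R'.b j) • R'.β j := fun i =>
    D.eq_sum_resolution R'.sub_mem (R.β i) fun x hx => R.vanish i x (h hx)
  calc ∑ i, C.ee (D.extDual (R.β i)) (l (R.b i)) =
      ∑ i, ∑ j, C.ee (D.extDual (R'.β j)) ((R.β i).1 (R'.b j) • l (R.b i)) :=
        Finset.sum_congr rfl fun i _ => by
          conv_lhs => rw [h1 i]
          simp only [map_sum, map_smul, LinearMap.sum_apply, LinearMap.smul_apply]
    _ = _ := by
      rw [Finset.sum_comm]
      refine Finset.sum_congr rfl fun j _ => ?_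
      rw [← map_sum, ← R.apply l hl]

theorem exists_sumB : ∃ S : (D.𝔟 →ₗ[k] Y) →ₗ[k] Y, ∀ (U : Submodule k 𝔤), IsOpen (U : Set 𝔤) →
    ∀ (R : D.Resolution U) (l : D.𝔟 →ₗ[k] Y), (∀ b : D.𝔟, (b : 𝔤) ∈ U → l b = 0) →
      S l = ∑ i, C.ee (D.extDual (R.β i)) (l (R.b i)) := by
  let F : D.openKer Y → Y := fun l =>
    let R := (D.nonempty_resolution l.2.choose_spec.1).some
    ∑ i, C.ee (D.extDual (R.β i)) (l.1 (R.b i))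
  have hF : ∀ (l : D.openKer Y) (U : Submodule k 𝔤), IsOpen (U : Set 𝔤) →
      ∀ (R : D.Resolution U), (∀ b : D.𝔟, (b : 𝔤) ∈ U → l.1 b = 0) →
      F l = ∑ i, C.ee (D.extDual (R.β i)) (l.1 (R.b i)) := fun l U hU R hl => by
    have hV := l.2.choose_spec
    obtain ⟨R'⟩ := D.nonempty_resolution (U := U ⊓ l.2.choose) (hU.inter hV.1)
    rw [C.sum_resolution_eq R R' inf_le_left l.1 hl]
    exact C.sum_resolution_eq _ R' inf_le_right l.1 hV.2
  let S₀ : D.openKer Y →ₗ[k] Y :=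
    { toFun := F
      map_add' := fun l l' => by
        have h := l.2.choose_spec
        have h' := l'.2.choose_spec
        have hU : IsOpen ((l.2.choose ⊓ l'.2.choose : Submodule k 𝔤) : Set 𝔤) := h.1.inter h'.1
        obtain ⟨R⟩ := D.nonempty_resolution hU
        rw [hF l _ hU R fun b hb => h.2 b hb.1, hF l' _ hU R fun b hb => h'.2 b hb.2,
          hF (l + l') _ hU R fun b hb => ?_, ← Finset.sum_add_distrib]
        · refine Finset.sum_congr rfl fun i _ => ?_
          rw [Submodule.coe_add, LinearMap.add_apply, map_add]
        · rw [Submodule.coe_add, LinearMap.add_apply, h.2 b hb.1, h'.2 b hb.2, add_zero]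
      map_smul' := fun t l => by
        have h := l.2.choose_spec
        obtain ⟨R⟩ := D.nonempty_resolution h.1
        rw [RingHom.id_apply, hF l _ h.1 R h.2, hF (t • l) _ h.1 R fun b hb => ?_, Finset.smul_sum]
        · refine Finset.sum_congr rfl fun i _ => ?_
          rw [Submodule.coe_smul, LinearMap.smul_apply, map_smul]
        · rw [Submodule.coe_smul, LinearMap.smul_apply, h.2 b hb, smul_zero] }
  obtain ⟨S, hS⟩ := S₀.exists_extend
  refine ⟨S, fun U hU R l hl => ?_⟩
  exact (LinearMap.congr_fun hS ⟨l, U, hU, hl⟩).trans (hF ⟨l, U, hU, hl⟩ U hU R hl)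

/-- The sum `∑ ε_{b*} l(b)` over a topological basis of `𝔟`, for a linear map `l` with open kernel. -/
noncomputable def sumB : (D.𝔟 →ₗ[k] Y) →ₗ[k] Y := C.exists_sumB.choose

theorem sumB_eq {U : Submodule k 𝔤} (hU : IsOpen (U : Set 𝔤)) (R : D.Resolution U)
    {l : D.𝔟 →ₗ[k] Y} (hl : ∀ b : D.𝔟, (b : 𝔤) ∈ U → l b = 0) :
    C.sumB l = ∑ i, C.ee (D.extDual (R.β i)) (l (R.b i)) :=
  C.exists_sumB.choose_spec U hU R l hl

theorem ii_sumB (x : 𝔤) {l : D.𝔟 →ₗ[k] Y} (hl : l ∈ D.openKer Y) :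
    C.ii x (C.sumB l) = l (D.pr𝔟 x) - C.sumB (C.ii x ∘ₗ l) := by
  obtain ⟨U, hU, h⟩ := hl
  obtain ⟨R⟩ := D.nonempty_resolution hU
  rw [C.sumB_eq hU R h, C.sumB_eq hU R fun b hb => by rw [LinearMap.comp_apply, h b hb, map_zero],
    R.apply l h (D.pr𝔟 x), map_sum, ← Finset.sum_sub_distrib]
  refine Finset.sum_congr rfl fun i _ => ?_
  rw [C.ii_ee, extDual_apply]
  rfl

theorem ee_sumB (f : tateDual k 𝔤) {l : D.𝔟 →ₗ[k] Y} (hl : l ∈ D.openKer Y) :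
    C.ee f (C.sumB l) = -C.sumB (C.ee f ∘ₗ l) := by
  obtain ⟨U, hU, h⟩ := hl
  obtain ⟨R⟩ := D.nonempty_resolution hU
  rw [C.sumB_eq hU R h, C.sumB_eq hU R fun b hb => by rw [LinearMap.comp_apply, h b hb, map_zero],
    map_sum, ← Finset.sum_neg_distrib]
  exact Finset.sum_congr rfl fun i _ => C.ee_ee _ _ _

theorem sumB_comp {A : Module.End k Y} {s : k}
    (hA : ∀ β u, A (C.ee (D.extDual β) u) = s • C.ee (D.extDual β) (A u))
    {l : D.𝔟 →ₗ[k] Y} (hl : l ∈ D.openKer Y) : A (C.sumB l) = s • C.sumB (A ∘ₗ l) := by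
  obtain ⟨U, hU, h⟩ := hl
  obtain ⟨R⟩ := D.nonempty_resolution hU
  rw [C.sumB_eq hU R h, C.sumB_eq hU R fun b hb => by rw [LinearMap.comp_apply, h b hb, map_zero],
    map_sum, Finset.smul_sum]
  exact Finset.sum_congr rfl fun i _ => hA _ _

theorem sumB_smulRight (β : tateDual k D.𝔟) (u : Y) :
    C.sumB (β.1.smulRight u) = C.ee (D.extDual β) u := by
  obtain ⟨W, hW, h⟩ := D.exists_open_subspace_forall_eq_zero (D.extDual β)
  have h' : ∀ b : D.𝔟, (b : 𝔤) ∈ W → β.1 b = 0 := fun b hb => by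
    have := h b hb
    rwa [extDual_apply, pr𝔟_coe] at this
  obtain ⟨R⟩ := D.nonempty_resolution hW
  rw [C.sumB_eq hW R fun b hb => by rw [LinearMap.smulRight_apply, h' b hb, zero_smul],
    D.eq_sum_resolution R.sub_mem β h']
  simp only [map_sum, map_smul, LinearMap.sum_apply, LinearMap.smul_apply]
  refine Finset.sum_congr rfl fun i _ => ?_
  rw [LinearMap.smulRight_apply, ← D.eq_sum_resolution R.sub_mem β h', map_smul]

theorem ev_sumB {l : D.𝔟 →ₗ[k] Y} (hl : l ∈ D.openKer Y) : C.ev (C.sumB l) = 0 := by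
  obtain ⟨U, hU, h⟩ := hl
  obtain ⟨R⟩ := D.nonempty_resolution hU
  rw [C.sumB_eq hU R h, map_sum]
  exact Finset.sum_eq_zero fun i _ => C.ev_ext _ _

/-- The operator `∑ ε_{b*} T(b)`. -/
noncomputable def sumOp : (D.𝔟 →ₗ[k] Module.End k Y) →ₗ[k] Module.End k Y where
  toFun T := C.sumB ∘ₗ T.flip
  map_add' S T := LinearMap.ext fun u => C.sumB.map_add (S.flip u) (T.flip u)
  map_smul' t T := LinearMap.ext fun u => C.sumB.map_smul t (T.flip u)

theorem sumOp_apply (T : D.𝔟 →ₗ[k] Module.End k Y) (u : Y) : C.sumOp T u = C.sumB (T.flip u) := rfl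

/-- A family of operators that is locally finite: every vector is killed by all operators in the
family with small index. -/
def LocFin (T : D.𝔟 →ₗ[k] Module.End k Y) : Prop := ∀ u, T.flip u ∈ D.openKer Y

theorem ii_mul_sumOp (x : 𝔤) {T : D.𝔟 →ₗ[k] Module.End k Y} (hT : LocFin T) :
    C.ii x * C.sumOp T = T (D.pr𝔟 x) - C.sumOp (LinearMap.mulLeft k (C.ii x) ∘ₗ T) :=
  LinearMap.ext fun u => C.ii_sumB x (hT u)

theorem ee_mul_sumOp (f : tateDual k 𝔤) {T : D.𝔟 →ₗ[k] Module.End k Y} (hT : LocFin T) :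
    C.ee f * C.sumOp T = -C.sumOp (LinearMap.mulLeft k (C.ee f) ∘ₗ T) :=
  LinearMap.ext fun u => C.ee_sumB f (hT u)

theorem mul_sumOp {A : Module.End k Y} {s : k}
    (hA : ∀ β u, A (C.ee (D.extDual β) u) = s • C.ee (D.extDual β) (A u))
    {T : D.𝔟 →ₗ[k] Module.End k Y} (hT : LocFin T) :
    A * C.sumOp T = s • C.sumOp (LinearMap.mulLeft k A ∘ₗ T) :=
  LinearMap.ext fun u => C.sumB_comp hA (hT u)

theorem sumOp_mul (T : D.𝔟 →ₗ[k] Module.End k Y) (A : Module.End k Y) :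
    C.sumOp T * A = C.sumOp (LinearMap.mulRight k A ∘ₗ T) := rfl

theorem sumOp_smulRight (β : tateDual k D.𝔟) (A : Module.End k Y) :
    C.sumOp (β.1.smulRight A) = C.ee (D.extDual β) * A :=
  LinearMap.ext fun u => C.sumB_smulRight β (A u)

theorem ev_sumOp {T : D.𝔟 →ₗ[k] Module.End k Y} (hT : LocFin T) (u : Y) :
    C.ev (C.sumOp T u) = 0 := C.ev_sumB (hT u)

/-! ### Sums over `𝔠` -/

theorem slot_counit (A : Module.End k Y) :
    C.slot ((counit k D.𝔠).toLinearMap.smulRight A) = A := by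
  have h := C.comp_slot A ((counit k D.𝔠).toLinearMap.smulRight 1)
  have h1 : C.slot ((counit k D.𝔠).toLinearMap.smulRight 1) = 1 := C.cc_counit
  rw [h1, mul_one] at h
  conv_rhs => rw [h]
  congr 1
  refine LinearMap.ext fun w => ?_
  change counit k D.𝔠 w • A = A * (counit k D.𝔠 w • (1 : Module.End k Y))
  rw [mul_smul_comm, mul_one]

/-- The operator `∑ T(c) ε_{c*}`. -/
noncomputable def slotC : (D.𝔠 →ₗ[k] Module.End k Y) →ₗ[k] Module.End k Y where
  toFun T := C.slot (T ∘ₗ ExteriorAlgebra.ιInv)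
  map_add' S T := by rw [LinearMap.add_comp, map_add]
  map_smul' t T := by rw [LinearMap.smul_comp, map_smul, RingHom.id_apply]

theorem slotC_apply (T : D.𝔠 →ₗ[k] Module.End k Y) :
    C.slotC T = C.slot (T ∘ₗ ExteriorAlgebra.ιInv) := rfl

theorem slotC_vac (T : D.𝔠 →ₗ[k] Module.End k Y) (m : M) : C.slotC T (C.vac m) = 0 := by
  rw [slotC_apply, slot_apply, C.co_vac, TensorProduct.lift.tmul, LinearMap.comp_apply, ιInv_one,
    map_zero, LinearMap.zero_apply]

theorem comp_ιInv_comp_parity (T : D.𝔠 →ₗ[k] Module.End k Y) (A : Module.End k Y) :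
    LinearMap.mulRight k A ∘ₗ (T ∘ₗ ExteriorAlgebra.ιInv) ∘ₗ parity k D.𝔠 =
      -((LinearMap.mulRight k A ∘ₗ T) ∘ₗ ExteriorAlgebra.ιInv) := by
  rw [comp_ιInv_parity, LinearMap.comp_neg]
  rfl

theorem slotC_mul_ii (T : D.𝔠 →ₗ[k] Module.End k Y) (x : 𝔤) :
    C.slotC T * C.ii x = T (D.pr𝔠 x) - C.slotC (LinearMap.mulRight k (C.ii x) ∘ₗ T) := by
  have h : (T ∘ₗ ExteriorAlgebra.ιInv) ∘ₗ LinearMap.mulRight k (ExteriorAlgebra.ι k (D.pr𝔠 x)) =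
      (counit k D.𝔠).toLinearMap.smulRight (T (D.pr𝔠 x)) := by
    refine LinearMap.ext fun w => ?_
    rw [LinearMap.comp_apply, LinearMap.comp_apply, LinearMap.mulRight_apply, ιInv_mul_ι, map_smul]
    rfl
  rw [slotC_apply, slot_ii, comp_ιInv_comp_parity, h, slot_counit, map_neg, neg_add_eq_sub]
  rfl

theorem slotC_mul_ee (T : D.𝔠 →ₗ[k] Module.End k Y) (f : tateDual k 𝔤) :
    C.slotC T * C.ee f = -C.slotC (LinearMap.mulRight k (C.ee f) ∘ₗ T) := by
  rw [slotC_apply, slot_ee, comp_ιInv_comp_parity, map_neg]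
  rfl

theorem mul_slotC (A : Module.End k Y) (T : D.𝔠 →ₗ[k] Module.End k Y) :
    A * C.slotC T = C.slotC (LinearMap.mulLeft k A ∘ₗ T) := C.comp_slot A _

theorem slotC_smulRight (ξ : Module.Dual k D.𝔠) (A : Module.End k Y) :
    C.slotC (ξ.smulRight A) = A * C.ee (D.annDual ξ) := by
  rw [← cc_ιInv, cc, comp_slot, slotC_apply]
  congr 1
  refine LinearMap.ext fun w => ?_
  change ξ (ExteriorAlgebra.ιInv w) • A = A * (ξ (ExteriorAlgebra.ιInv w) • (1 : Module.End k Y))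
  rw [mul_smul_comm, mul_one]

/-! ### Local finiteness -/

theorem exists_ii_eq_zero (u : Y) :
    ∃ U : Submodule k 𝔤, IsOpen (U : Set 𝔤) ∧ ∀ x ∈ U, C.ii x u = 0 := by
  let S : Submodule k Y :=
    { carrier := {u | ∃ U : Submodule k 𝔤, IsOpen (U : Set 𝔤) ∧ ∀ x ∈ U, C.ii x u = 0}
      add_mem' := by
        rintro u u' ⟨U, hU, h⟩ ⟨U', hU', h'⟩
        exact ⟨U ⊓ U', hU.inter hU', fun x hx => by rw [map_add, h x hx.1, h' x hx.2, add_zero]⟩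
      zero_mem' := ⟨⊤, isOpen_univ, fun x _ => map_zero _⟩
      smul_mem' := by
        rintro t u ⟨U, hU, h⟩
        exact ⟨U, hU, fun x hx => by rw [map_smul, h x hx, smul_zero]⟩ }
  have hS : S = ⊤ := by
    refine C.gen S (fun m => ⟨D.𝔟.toSubmodule, D.isCLattice.isOpen, fun x hx => C.ii_vac ⟨x, hx⟩ m⟩)
      ?_ ?_
    · rintro c u ⟨U, hU, h⟩
      exact ⟨U, hU, fun x hx => by rw [C.ii_ii, h x hx, map_zero, neg_zero]⟩
    · rintro β u ⟨U, hU, h⟩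
      obtain ⟨W, hW, hβ⟩ := D.exists_open_subspace_forall_eq_zero (D.extDual β)
      exact ⟨U ⊓ W, hU.inter hW, fun x hx => by
        rw [C.ii_ee, hβ x hx.2, h x hx.1, zero_smul, map_zero, sub_zero]⟩
  have : u ∈ S := hS ▸ Submodule.mem_top
  exact this

theorem exists_ee_eq_zero (u : Y) : ∃ F : Finset D.𝔠, ∀ f : tateDual k 𝔤,
    (∀ b : D.𝔟, f.1 b = 0) → (∀ c ∈ F, f.1 (D.sec c) = 0) → C.ee f u = 0 := by
  classical
  let S : Submodule k Y :=
    { carrier := {u | ∃ F : Finset D.𝔠, ∀ f : tateDual k 𝔤,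
        (∀ b : D.𝔟, f.1 b = 0) → (∀ c ∈ F, f.1 (D.sec c) = 0) → C.ee f u = 0}
      add_mem' := by
        rintro u u' ⟨F, h⟩ ⟨F', h'⟩
        exact ⟨F ∪ F', fun f hb hc => by
          rw [map_add, h f hb fun c hF => hc c (Finset.mem_union_left _ hF),
            h' f hb fun c hF => hc c (Finset.mem_union_right _ hF), add_zero]⟩
      zero_mem' := ⟨∅, fun f _ _ => map_zero _⟩
      smul_mem' := by
        rintro t u ⟨F, h⟩
        exact ⟨F, fun f hb hc => by rw [map_smul, h f hb hc, smul_zero]⟩ }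
  have hS : S = ⊤ := by
    refine C.gen S (fun m => ⟨∅, fun f hb _ => ?_⟩) ?_ ?_
    · have : D.resDual f = 0 := Subtype.ext (LinearMap.ext hb)
      rw [← D.extDual_resDual_add f, this, map_zero, zero_add, C.ee_vac]
    · rintro c u ⟨F, h⟩
      exact ⟨insert c F, fun f hb hc => by
        rw [C.ee_ii, hc c (Finset.mem_insert_self c F),
          h f hb fun c' hF => hc c' (Finset.mem_insert_of_mem hF), zero_smul, map_zero, sub_zero]⟩
    · rintro β u ⟨F, h⟩
      exact ⟨F, fun f hb hc => by rw [C.ee_ee, h f hb hc, map_zero, neg_zero]⟩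
  have : u ∈ S := hS ▸ Submodule.mem_top
  exact this

theorem locFin_ii {T : D.𝔟 →ₗ[k] 𝔤} (hT : ∀ U : Submodule k 𝔤, IsOpen (U : Set 𝔤) →
    ∃ V : Submodule k 𝔤, IsOpen (V : Set 𝔤) ∧ ∀ b : D.𝔟, (b : 𝔤) ∈ V → T b ∈ U) :
    LocFin (C.ii ∘ₗ T) := fun u => by
  obtain ⟨U, hU, h⟩ := C.exists_ii_eq_zero u
  obtain ⟨V, hV, h'⟩ := hT U hU
  exact ⟨V, hV, fun b hb => h _ (h' b hb)⟩

theorem locFin_ii_ad (x : 𝔤) : LocFin (C.ii ∘ₗ LieAlgebra.ad k 𝔤 x ∘ₗ D.in𝔟) :=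
  C.locFin_ii fun U hU => ⟨U.comap (LieAlgebra.ad k 𝔤 x), hU.preimage (D.continuous_ad x),
    fun _ hb => hb⟩

end CliffordModule

end SplitTate

end SemiInf

namespace SemiInf

namespace SplitTate

variable {k : Type*} [Field k] {𝔤 : Type*} [LieRing 𝔤] [LieAlgebra k 𝔤] [UniformSpace 𝔤]
  [IsUniformAddGroup 𝔤] {D : SplitTate k 𝔤}
variable {M Y : Type*} [AddCommGroup M] [Module k M] [AddCommGroup Y] [Module k Y]

namespace CliffordModule

variable (C : D.CliffordModule M Y)

/-! ### The normally ordered action of `𝔤` -/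

/-- The normally ordered action of `𝔤`. -/
noncomputable def theta : 𝔤 →ₗ[k] Module.End k Y where
  toFun x := C.slotC (C.ii ∘ₗ LieAlgebra.ad k 𝔤 x ∘ₗ D.sec) -
    C.sumOp (C.ii ∘ₗ LieAlgebra.ad k 𝔤 x ∘ₗ D.in𝔟)
  map_add' x y := by
    simp only [map_add, LinearMap.add_comp, LinearMap.comp_add]
    abel
  map_smul' t x := by
    simp only [map_smul, LinearMap.smul_comp, LinearMap.comp_smul, smul_sub, RingHom.id_apply]

theorem theta_def (x : 𝔤) : C.theta x = C.slotC (C.ii ∘ₗ LieAlgebra.ad k 𝔤 x ∘ₗ D.sec) -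
    C.sumOp (C.ii ∘ₗ LieAlgebra.ad k 𝔤 x ∘ₗ D.in𝔟) := rfl

theorem theta_comm_ii (x y : 𝔤) : C.theta x * C.ii y - C.ii y * C.theta x = C.ii ⁅x, y⁆ := by
  have hanti : ∀ z : 𝔤, C.ii z * C.ii y = -(C.ii y * C.ii z) := fun z =>
    LinearMap.ext fun u => C.ii_ii z y u
  have h1 : LinearMap.mulRight k (C.ii y) ∘ₗ C.ii ∘ₗ LieAlgebra.ad k 𝔤 x ∘ₗ D.in𝔟 =
      -(LinearMap.mulLeft k (C.ii y) ∘ₗ C.ii ∘ₗ LieAlgebra.ad k 𝔤 x ∘ₗ D.in𝔟) :=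
    LinearMap.ext fun b => hanti _
  have h2 : LinearMap.mulRight k (C.ii y) ∘ₗ C.ii ∘ₗ LieAlgebra.ad k 𝔤 x ∘ₗ D.sec =
      -(LinearMap.mulLeft k (C.ii y) ∘ₗ C.ii ∘ₗ LieAlgebra.ad k 𝔤 x ∘ₗ D.sec) :=
    LinearMap.ext fun b => hanti _
  have h3 : C.ii ⁅x, y⁆ = C.ii ⁅x, (D.pr𝔟 y : 𝔤)⁆ + C.ii ⁅x, D.sec (D.pr𝔠 y)⁆ := by
    rw [← map_add, ← lie_add, pr𝔟_add_sec_pr𝔠]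
  rw [theta_def, sub_mul, mul_sub, slotC_mul_ii, sumOp_mul, C.ii_mul_sumOp y (C.locFin_ii_ad x),
    mul_slotC, h1, h2, map_neg, map_neg, h3]
  change C.ii ⁅x, D.sec (D.pr𝔠 y)⁆ - _ - _ - (_ - (C.ii ⁅x, (D.pr𝔟 y : 𝔤)⁆ - _)) = _
  abel

theorem theta_comm_ee (x : 𝔤) (f : tateDual k 𝔤) :
    C.theta x * C.ee f - C.ee f * C.theta x = C.ee (D.coad x f) := by
  have hanti : ∀ z : 𝔤, C.ii z * C.ee f = -(C.ee f * C.ii z) + f.1 z • 1 := fun z =>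
    LinearMap.ext fun u => by
      change C.ii z (C.ee f u) = -C.ee f (C.ii z u) + f.1 z • u
      rw [C.ii_ee, neg_add_eq_sub]
  have h1 : LinearMap.mulRight k (C.ee f) ∘ₗ C.ii ∘ₗ LieAlgebra.ad k 𝔤 x ∘ₗ D.in𝔟 =
      -(LinearMap.mulLeft k (C.ee f) ∘ₗ C.ii ∘ₗ LieAlgebra.ad k 𝔤 x ∘ₗ D.in𝔟) -
        (D.resDual (D.coad x f)).1.smulRight 1 := LinearMap.ext fun b => by
    rw [sub_eq_add_neg]
    refine (hanti _).trans (congrArg _ ?_)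
    change f.1 ⁅x, (b : 𝔤)⁆ • (1 : Module.End k Y) = -(-f.1 ⁅x, (b : 𝔤)⁆ • 1)
    rw [neg_smul, neg_neg]
  have h2 : LinearMap.mulRight k (C.ee f) ∘ₗ C.ii ∘ₗ LieAlgebra.ad k 𝔤 x ∘ₗ D.sec =
      -(LinearMap.mulLeft k (C.ee f) ∘ₗ C.ii ∘ₗ LieAlgebra.ad k 𝔤 x ∘ₗ D.sec) -
        ((D.coad x f).1 ∘ₗ D.sec).smulRight 1 := LinearMap.ext fun c => by
    rw [sub_eq_add_neg]
    refine (hanti _).trans (congrArg _ ?_)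
    change f.1 ⁅x, D.sec c⁆ • (1 : Module.End k Y) = -(-f.1 ⁅x, D.sec c⁆ • 1)
    rw [neg_smul, neg_neg]
  conv_rhs => rw [← D.extDual_resDual_add (D.coad x f)]
  rw [theta_def, sub_mul, mul_sub, slotC_mul_ee, sumOp_mul, C.ee_mul_sumOp f (C.locFin_ii_ad x),
    mul_slotC, h1, h2, map_sub, map_sub, map_neg, map_neg, slotC_smulRight, sumOp_smulRight,
    mul_one, one_mul, map_add]
  abel

theorem theta_ii (x y : 𝔤) (u : Y) : C.theta x (C.ii y u) = C.ii ⁅x, y⁆ u + C.ii y (C.theta x u) := by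
  have := LinearMap.congr_fun (C.theta_comm_ii x y) u
  rw [← this]
  exact (sub_add_cancel _ _).symm

theorem theta_ee (x : 𝔤) (f : tateDual k 𝔤) (u : Y) :
    C.theta x (C.ee f u) = C.ee (D.coad x f) u + C.ee f (C.theta x u) := by
  have := LinearMap.congr_fun (C.theta_comm_ee x f) u
  rw [← this]
  exact (sub_add_cancel _ _).symm

/-- The action of `x` on vacuum vectors, in terms of a dual system in `𝔟` and `𝔟*`. -/
theorem theta_vac {U : Submodule k 𝔤} (hU : IsOpen (U : Set 𝔤)) (R : D.Resolution U) {x : 𝔤}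
    (hx : ∀ b ∈ U, ⁅x, b⁆ ∈ D.𝔟) (m : M) : C.theta x (C.vac m) =
      ∑ i, C.ii (D.sec (D.pr𝔠 ⁅x, (R.b i : 𝔤)⁆)) (C.ee (D.extDual (R.β i)) (C.vac m)) := by
  rw [theta_def, LinearMap.sub_apply, slotC_vac, zero_sub, sumOp_apply,
    C.sumB_eq hU R fun b hb => C.ii_vac ⟨_, hx b hb⟩ m, ← Finset.sum_neg_distrib]
  refine Finset.sum_congr rfl fun i _ => ?_
  have h : C.ii ⁅x, (R.b i : 𝔤)⁆ (C.vac m) = C.ii (D.sec (D.pr𝔠 ⁅x, (R.b i : 𝔤)⁆)) (C.vac m) := by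
    conv_lhs => rw [← D.pr𝔟_add_sec_pr𝔠 ⁅x, (R.b i : 𝔤)⁆]
    rw [map_add, LinearMap.add_apply, C.ii_vac, zero_add]
  change -C.ee _ (C.ii ⁅x, (R.b i : 𝔤)⁆ (C.vac m)) = _
  rw [h, C.ee_ii, extDual_sec, zero_smul, zero_sub, neg_neg]

theorem isOpen_comap_ad (D : SplitTate k 𝔤) (x : 𝔤) :
    IsOpen ((D.𝔟.toSubmodule.comap (LieAlgebra.ad k 𝔤 x) : Submodule k 𝔤) : Set 𝔤) :=
  D.isCLattice.isOpen.preimage (D.continuous_ad x)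

theorem theta_vac_mem (x : 𝔤) (m : M) :
    C.theta x (C.vac m) ∈ Submodule.span k {v | ∃ z u, v = C.ii (D.sec z) u} := by
  obtain ⟨R⟩ := D.nonempty_resolution (isOpen_comap_ad D x)
  rw [C.theta_vac (isOpen_comap_ad D x) R (fun b hb => hb)]
  exact Submodule.sum_mem _ fun i _ => Submodule.subset_span ⟨_, _, rfl⟩

theorem theta_coe_vac (b : D.𝔟) (m : M) : C.theta b (C.vac m) = 0 := by
  obtain ⟨R⟩ := D.nonempty_resolution (isOpen_comap_ad D (b : 𝔤))
  rw [C.theta_vac (isOpen_comap_ad D (b : 𝔤)) R (fun b hb => hb)]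
  refine Finset.sum_eq_zero fun i _ => ?_
  have : D.pr𝔠 ⁅(b : 𝔤), (R.b i : 𝔤)⁆ = 0 := D.pr𝔠_coe ⁅b, R.b i⁆
  rw [this, map_zero, map_zero, LinearMap.zero_apply]

theorem vev_eq_zero_of_mem {v : Y}
    (h : v ∈ Submodule.span k {v | ∃ z u, v = C.ii (D.sec z) u}) : C.vev v = 0 := by
  refine Submodule.span_induction (p := fun v _ => C.vev v = 0) ?_ (map_zero _)
    (fun u v _ _ hu hv => by rw [map_add, hu, hv, add_zero])
    (fun t v _ hv => by rw [map_smul, hv, smul_zero]) h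
  rintro _ ⟨z, u, rfl⟩
  exact C.vev_sec z u

theorem vev_theta_vac (x : 𝔤) (m : M) : C.vev (C.theta x (C.vac m)) = 0 :=
  C.vev_eq_zero_of_mem (C.theta_vac_mem x m)

/-- The operators `θ_b`, `b ∈ 𝔟`, are locally finite. -/
theorem locFin_theta : LocFin (C.theta ∘ₗ D.in𝔟) := fun u => by
  let S : Submodule k Y := (D.openKer Y).comap (C.theta ∘ₗ D.in𝔟).flip
  have hS : S = ⊤ := by
    refine C.gen S (fun m => ?_) ?_ ?_
    · exact ⟨⊤, isOpen_univ, fun b _ => C.theta_coe_vac b m⟩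
    · rintro c u ⟨U, hU, h⟩
      obtain ⟨V, hV, hi⟩ := C.exists_ii_eq_zero u
      refine ⟨U ⊓ V.comap (LieAlgebra.ad k 𝔤 (D.sec c)),
        hU.inter (hV.preimage (D.continuous_ad _)), fun b hb => ?_⟩
      change C.theta b (C.ii (D.sec c) u) = 0
      have h0 : C.theta b u = 0 := h b hb.1
      have h1 : C.ii ⁅D.sec c, (b : 𝔤)⁆ u = 0 := hi _ hb.2
      rw [theta_ii, h0, map_zero, add_zero, ← lie_skew, map_neg, LinearMap.neg_apply, h1, neg_zero]
    · rintro β u ⟨U, hU, h⟩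
      obtain ⟨W, hW, hβ⟩ := D.exists_open_subspace_forall_eq_zero (D.extDual β)
      obtain ⟨V, hV, hVW⟩ := D.exists_open_lie_mem hW
      obtain ⟨F, hF⟩ := C.exists_ee_eq_zero u
      refine ⟨U ⊓ V ⊓ ⨅ c : F, W.comap (LieAlgebra.ad k 𝔤 (D.sec c)), ?_, fun b hb => ?_⟩
      · rw [Submodule.coe_inf, Submodule.coe_iInf]
        exact (hU.inter hV).inter (isOpen_iInter_of_finite fun c => hW.preimage (D.continuous_ad _))
      · change C.theta b (C.ee (D.extDual β) u) = 0
        have h0 : C.theta b u = 0 := h b hb.1.1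
        rw [theta_ee, h0, map_zero, add_zero]
        refine hF _ (fun b' => ?_) fun c hc => ?_
        · change -((D.extDual β).1 ⁅(b : 𝔤), (b' : 𝔤)⁆) = 0
          rw [hβ _ (hVW b hb.1.2 b'), neg_zero]
        · change -((D.extDual β).1 ⁅(b : 𝔤), D.sec c⁆) = 0
          have h1 : (D.extDual β).1 ⁅D.sec c, (b : 𝔤)⁆ = 0 :=
            hβ _ ((Submodule.mem_iInf _).1 hb.2 ⟨c, hc⟩)
          rw [← lie_skew, map_neg, h1, neg_zero, neg_zero]
  have : u ∈ S := hS ▸ Submodule.mem_top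
  exact this

theorem vev_theta_theta_vac {U : Submodule k 𝔤} (hU : IsOpen (U : Set 𝔤)) (R : D.Resolution U)
    (x : 𝔤) {y : 𝔤} (hy : ∀ b ∈ U, ⁅y, b⁆ ∈ D.𝔟) (m : M) :
    C.vev (C.theta x (C.theta y (C.vac m))) =
      finTrace (D.block𝔟𝔠 (LieAlgebra.ad k 𝔤 y) ∘ₗ D.block𝔠𝔟 (LieAlgebra.ad k 𝔤 x)) • m := by
  have hterm : ∀ (z : 𝔤) (β : tateDual k D.𝔟),
      C.vev (C.ii z (C.ee (D.extDual β) (C.vac m))) = β.1 (D.pr𝔟 z) • m := fun z β => by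
    conv_lhs => rw [← D.pr𝔟_add_sec_pr𝔠 z]
    rw [map_add, LinearMap.add_apply, map_add, vev_sec, add_zero, C.ii_ee, C.ii_vac, map_zero,
      sub_zero, map_smul, vev_vac, extDual_apply, pr𝔟_coe]
  have hblock : D.block𝔟𝔠 (LieAlgebra.ad k 𝔤 y) ∘ₗ D.block𝔠𝔟 (LieAlgebra.ad k 𝔤 x) =
      ∑ i, ((R.β i).1 ∘ₗ D.block𝔠𝔟 (LieAlgebra.ad k 𝔤 x)).smulRight
        (D.block𝔟𝔠 (LieAlgebra.ad k 𝔤 y) (R.b i)) := by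
    refine LinearMap.ext fun c => ?_
    rw [LinearMap.sum_apply, LinearMap.comp_apply,
      R.apply (D.block𝔟𝔠 (LieAlgebra.ad k 𝔤 y)) fun b hb =>
        (Submodule.Quotient.mk_eq_zero _).2 (hy b hb)]
    rfl
  rw [C.theta_vac hU R hy, map_sum, map_sum, hblock, finTrace_sum_smulRight, Finset.sum_smul]
  refine Finset.sum_congr rfl fun i _ => ?_
  rw [theta_ii, map_add, vev_sec, add_zero, hterm]
  rfl

variable [CharZero k]

theorem theta_unique {x : 𝔤} {T : Module.End k Y}
    (hi : ∀ y, T * C.ii y - C.ii y * T = C.ii ⁅x, y⁆)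
    (he : ∀ f, T * C.ee f - C.ee f * T = C.ee (D.coad x f)) (h0 : ∀ m, C.vev (T (C.vac m)) = 0) :
    T = C.theta x := by
  refine sub_eq_zero.1 (C.eq_zero_of_comm (fun y => ?_) (fun f => ?_) fun m => ?_)
  · rw [sub_mul, mul_sub, sub_eq_sub_iff_sub_eq_sub, hi, theta_comm_ii]
  · rw [sub_mul, mul_sub, sub_eq_sub_iff_sub_eq_sub, he, theta_comm_ee]
  · rw [LinearMap.sub_apply, map_sub, h0, vev_theta_vac, sub_zero]

theorem theta_comm_theta (x y : 𝔤) : C.theta x * C.theta y - C.theta y * C.theta x =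
    C.theta ⁅x, y⁆ - D.criticalCocycle x y • 1 := by
  rw [eq_sub_iff_add_eq]
  refine C.theta_unique (fun z => ?_) (fun f => ?_) fun m => ?_
  · have h1 := C.theta_comm_ii x z
    have h2 := C.theta_comm_ii y z
    have h3 := C.theta_comm_ii x ⁅y, z⁆
    have h4 := C.theta_comm_ii y ⁅x, z⁆
    have h5 : C.ii ⁅⁅x, y⁆, z⁆ = C.ii ⁅x, ⁅y, z⁆⁆ - C.ii ⁅y, ⁅x, z⁆⁆ := by
      rw [← map_sub, lie_lie]
    rw [h5, ← h3, ← h4, ← h1, ← h2]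
    simp only [add_mul, mul_add, sub_mul, mul_sub, mul_assoc, smul_mul_assoc, mul_smul_comm,
      one_mul, mul_one]
    abel
  · have h1 := C.theta_comm_ee x f
    have h2 := C.theta_comm_ee y f
    have h3 := C.theta_comm_ee x (D.coad y f)
    have h4 := C.theta_comm_ee y (D.coad x f)
    have h5 : C.ee (D.coad ⁅x, y⁆ f) = C.ee (D.coad x (D.coad y f)) -
        C.ee (D.coad y (D.coad x f)) := by
      rw [← map_sub]
      congr 1
      refine Subtype.ext (LinearMap.ext fun z => ?_)
      change -f.1 ⁅⁅x, y⁆, z⁆ = -(-f.1 ⁅y, ⁅x, z⁆⁆) - -(-f.1 ⁅x, ⁅y, z⁆⁆)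
      rw [lie_lie, map_sub]
      ring
    rw [h5, ← h3, ← h4, ← h1, ← h2]
    simp only [add_mul, mul_add, sub_mul, mul_sub, mul_assoc, smul_mul_assoc, mul_smul_comm,
      one_mul, mul_one]
    abel
  · have hU : IsOpen ((D.𝔟.toSubmodule.comap (LieAlgebra.ad k 𝔤 x) ⊓
        D.𝔟.toSubmodule.comap (LieAlgebra.ad k 𝔤 y) : Submodule k 𝔤) : Set 𝔤) :=
      (isOpen_comap_ad D x).inter (isOpen_comap_ad D y)
    obtain ⟨R⟩ := D.nonempty_resolution hU
    have hx := C.vev_theta_theta_vac hU R y (y := x) (fun b hb => hb.1) m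
    have hy := C.vev_theta_theta_vac hU R x (y := y) (fun b hb => hb.2) m
    have hr : ∀ X Z : Module.End k 𝔤, Continuous X → FiniteDimensional k
        (LinearMap.range (D.block𝔟𝔠 X ∘ₗ D.block𝔠𝔟 Z)) := fun X Z hX => by
      have := D.finite_range_block X hX
      exact Submodule.finiteDimensional_of_le (LinearMap.range_comp_le_range _ _)
    have hω : D.criticalCocycle x y =
        finTrace (D.block𝔟𝔠 (LieAlgebra.ad k 𝔤 x) ∘ₗ D.block𝔠𝔟 (LieAlgebra.ad k 𝔤 y)) -
        finTrace (D.block𝔟𝔠 (LieAlgebra.ad k 𝔤 y) ∘ₗ D.block𝔠𝔟 (LieAlgebra.ad k 𝔤 x)) := by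
      have h1 := hr (LieAlgebra.ad k 𝔤 x) (LieAlgebra.ad k 𝔤 y) (D.continuous_ad x)
      have h2 := hr (LieAlgebra.ad k 𝔤 y) (LieAlgebra.ad k 𝔤 x) (D.continuous_ad y)
      rw [criticalCocycle, criticalCocycleEnd, eq_sub_iff_add_eq,
        ← finTrace_add _ _ (D.finite_range_ad x y) h2]
      congr 1
      exact sub_add_cancel _ _
    rw [LinearMap.add_apply, LinearMap.sub_apply, Module.End.mul_apply, Module.End.mul_apply,
      map_add, map_sub, hx, hy, LinearMap.smul_apply, Module.End.one_apply, map_smul, vev_vac, hω,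
      sub_smul]
    abel

end CliffordModule

end SplitTate

end SemiInf

namespace SemiInf

theorem eigenspace_eq_of_iSup_eq_top {k V ι : Type*} [Field k] [AddCommGroup V] [Module k V]
    {f : Module.End k V} {μ : ι → k} (hμ : Function.Injective μ) {W : ι → Submodule k V}
    (hW : ∀ i, ∀ v ∈ W i, f v = μ i • v) (htop : ⨆ i, W i = ⊤) {i : ι} {v : V}
    (hv : f v = μ i • v) : v ∈ W i := by
  classical
  have hle : ∀ j, W j ≤ f.eigenspace (μ j) := fun j v hv =>
    Module.End.mem_eigenspace_iff.2 (hW j v hv)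
  have h1 : v ∈ W i ⊔ ⨆ (j) (_ : j ≠ i), W j := by
    rw [← iSup_split_single]
    exact htop ▸ Submodule.mem_top
  obtain ⟨w, hw, w', hw', rfl⟩ := Submodule.mem_sup.1 h1
  have h2 : w' ∈ f.eigenspace (μ i) := by
    have := Submodule.sub_mem _ (Module.End.mem_eigenspace_iff.2 hv) (hle i hw)
    rwa [add_sub_cancel_left] at this
  have h3 : w' ∈ ⨆ (s) (_ : s ≠ μ i), f.eigenspace s := by
    refine (iSup_le fun j => iSup_le fun hj => ?_ :
      ⨆ (j) (_ : j ≠ i), W j ≤ ⨆ (s) (_ : s ≠ μ i), f.eigenspace s) hw'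
    exact (hle j).trans (le_iSup₂_of_le (μ j) (fun h => hj (hμ h)) le_rfl)
  have h4 : w' = 0 := (Submodule.disjoint_def.1 (f.eigenspaces_iSupIndep (μ i))) _ h2 h3
  rwa [h4, add_zero]

theorem two_zpow_neg_injective (k : Type*) [Field k] [CharZero k] :
    Function.Injective fun n : ℤ => (2 : k) ^ (-n) := by
  intro m n h
  have h1 : (((2 : ℚ) ^ (-m) : ℚ) : k) = (((2 : ℚ) ^ (-n) : ℚ) : k) := by
    push_cast
    exact h
  have h2 := zpow_right_injective₀ (by norm_num : (0 : ℚ) < 2) (by norm_num) (Rat.cast_injective h1)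
  exact neg_injective h2

theorem scale_of_mem {k V : Type*} [Field k] [AddCommGroup V] [Module k V] (t : k) {j : ℕ}
    {w : ExteriorAlgebra k V} (hw : w ∈ ⋀[k]^j V) : scale V t w = t ^ j • w := by
  rw [← ExteriorAlgebra.ιMulti_span_fixedDegree] at hw
  refine Submodule.span_induction (p := fun w _ => scale V t w = t ^ j • w) ?_ ?_ ?_ ?_ hw
  · rintro _ ⟨v, rfl⟩
    exact scale_ιMulti t v
  · rw [map_zero, smul_zero]
  · intro u v _ _ hu hv
    rw [map_add, hu, hv, smul_add]
  · intro c v _ hv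
    rw [map_smul, hv, smul_comm]

theorem iSup_exteriorPower (k V : Type*) [Field k] [AddCommGroup V] [Module k V] :
    ⨆ j : ℕ, (⋀[k]^j V : Submodule k (ExteriorAlgebra k V)) = ⊤ := by
  rw [eq_top_iff, ← ExteriorAlgebra.ιMulti_span, Submodule.span_le]
  rintro _ ⟨⟨j, v⟩, rfl⟩
  refine Submodule.mem_iSup_of_mem j ?_
  rw [← ExteriorAlgebra.ιMulti_span_fixedDegree]
  exact Submodule.subset_span ⟨v, rfl⟩

namespace SplitTate

variable {k : Type*} [Field k] {𝔤 : Type*} [LieRing 𝔤] [LieAlgebra k 𝔤] [UniformSpace 𝔤]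
  [IsUniformAddGroup 𝔤] {D : SplitTate k 𝔤}
variable {M Y : Type*} [AddCommGroup M] [Module k M] [AddCommGroup Y] [Module k Y]

theorem lTensor_scale_of_mem {n : ℤ} {v : D.N M} (hv : v ∈ D.gradeN M n) (t : k) :
    LinearMap.lTensor M (scale D.𝔠 t).toLinearMap v = t ^ (-n) • v := by
  refine Submodule.span_induction (p := fun v _ => LinearMap.lTensor M (scale D.𝔠 t).toLinearMap v =
    t ^ (-n) • v) ?_ ?_ ?_ ?_ hv
  · rintro _ ⟨j, m, w, rfl, hw, rfl⟩
    rw [LinearMap.lTensor_tmul, AlgHom.toLinearMap_apply, scale_of_mem t hw, neg_neg, zpow_natCast,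
      TensorProduct.tmul_smul]
  · rw [map_zero, smul_zero]
  · intro u v _ _ hu hv
    rw [map_add, hu, hv, smul_add]
  · intro c v _ hv
    rw [map_smul, hv, smul_comm]

variable (D M) in
theorem iSup_gradeN : ⨆ n : ℤ, D.gradeN M n = ⊤ := by
  rw [eq_top_iff]
  intro v _
  induction v using TensorProduct.induction_on with
  | zero => exact Submodule.zero_mem _
  | add a b ha hb => exact Submodule.add_mem _ (ha trivial) (hb trivial)
  | tmul m w =>
    have h : (⊤ : Submodule k D.Λ𝔠) ≤ (⨆ n : ℤ, D.gradeN M n).comap (TensorProduct.mk k M D.Λ𝔠 m) := by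
      rw [← iSup_exteriorPower]
      exact iSup_le fun j w hw => Submodule.mem_iSup_of_mem (-(j : ℤ))
        (Submodule.subset_span ⟨j, m, w, rfl, hw, rfl⟩)
    exact h (Submodule.mem_top (x := w))

theorem mem_gradeN_iff [CharZero k] {n : ℤ} {v : D.N M} : v ∈ D.gradeN M n ↔
    LinearMap.lTensor M (scale D.𝔠 (2 : k)).toLinearMap v = (2 : k) ^ (-n) • v :=
  ⟨fun h => lTensor_scale_of_mem h 2, fun h =>
    eigenspace_eq_of_iSup_eq_top (two_zpow_neg_injective k)
      (fun _ _ hv => lTensor_scale_of_mem hv 2) (D.iSup_gradeN M) h⟩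

theorem eq_zero_of_mem_gradeN {n : ℤ} (hn : 0 < n) {v : D.N M} (h : v ∈ D.gradeN M n) :
    v = 0 := by
  have : D.gradeN M n = ⊥ := by
    rw [gradeN, Submodule.span_eq_bot]
    rintro _ ⟨j, m, w, hj, -, -⟩
    omega
  rwa [this, Submodule.mem_bot] at h

namespace CliffordModule

variable (C : D.CliffordModule M Y)

/-! ### The grading -/

/-- The component of degree `n`. -/
def grade (n : ℤ) : Submodule k Y := C.G.eigenspace ((2 : k) ^ (-n))

theorem mem_grade {n : ℤ} {u : Y} : u ∈ C.grade n ↔ C.G u = (2 : k) ^ (-n) • u :=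
  Module.End.mem_eigenspace_iff

/-- Operators of degree `p`. -/
def Deg (p : ℤ) (T : Module.End k Y) : Prop := C.G * T = (2 : k) ^ (-p) • (T * C.G)

variable {C}

theorem Deg.add {p : ℤ} {S T : Module.End k Y} (hS : C.Deg p S) (hT : C.Deg p T) :
    C.Deg p (S + T) := by
  rw [Deg, mul_add, hS, hT, add_mul, smul_add]

theorem Deg.smul {p : ℤ} {T : Module.End k Y} (t : k) (hT : C.Deg p T) : C.Deg p (t • T) := by
  rw [Deg, mul_smul_comm, hT, smul_mul_assoc, smul_comm]

theorem Deg.neg {p : ℤ} {T : Module.End k Y} (hT : C.Deg p T) : C.Deg p (-T) := by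
  rw [Deg, mul_neg, hT, neg_mul, smul_neg]

theorem Deg.sub {p : ℤ} {S T : Module.End k Y} (hS : C.Deg p S) (hT : C.Deg p T) :
    C.Deg p (S - T) := by
  rw [sub_eq_add_neg]
  exact hS.add hT.neg

variable (C)

theorem deg_ii (x : 𝔤) : C.Deg (-1) (C.ii x) := LinearMap.ext fun u => by
  rw [neg_neg, zpow_one]
  exact C.G_ii x u

theorem deg_ee (f : tateDual k 𝔤) : C.Deg 1 (C.ee f) := LinearMap.ext fun u => by
  rw [zpow_neg_one]
  exact C.G_ee f u

theorem vac_mem_grade (m : M) : C.vac m ∈ C.grade 0 := by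
  rw [mem_grade, C.G_vac, neg_zero, zpow_zero, one_smul]

theorem ev_G (u : Y) :
    C.ev (C.G u) = LinearMap.lTensor M (scale D.𝔠 (2 : k)).toLinearMap (C.ev u) := by
  have : C.ev ∘ₗ C.G = LinearMap.lTensor M (scale D.𝔠 (2 : k)).toLinearMap ∘ₗ C.ev := by
    refine C.hom_ext (fun m => ?_) (fun c u h => ?_) fun β u h => ?_
    · simp only [LinearMap.comp_apply]
      rw [C.G_vac, C.ev_vac, LinearMap.lTensor_tmul, AlgHom.toLinearMap_apply, map_one]
    · simp only [LinearMap.comp_apply] at h ⊢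
      rw [C.G_ii, map_smul, C.ev_sec, C.ev_sec, h]
      generalize C.ev u = n
      induction n with
      | zero => simp only [map_zero, smul_zero]
      | add a b ha hb => simp only [map_add, smul_add, ha, hb]
      | tmul m w =>
        simp only [LinearMap.lTensor_tmul, AlgHom.toLinearMap_apply, LinearMap.mulRight_apply]
        rw [map_mul, scale_ι, mul_smul_comm, TensorProduct.tmul_smul]
    · simp only [LinearMap.comp_apply] at h ⊢
      rw [C.G_ee, map_smul, C.ev_ext, C.ev_ext, map_zero, smul_zero]
  exact LinearMap.congr_fun this u

theorem co_G (u : Y) :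
    C.co (C.G u) = TensorProduct.map (scale D.𝔠 (2 : k)).toLinearMap C.G (C.co u) := by
  have : C.co ∘ₗ C.G = TensorProduct.map (scale D.𝔠 (2 : k)).toLinearMap C.G ∘ₗ C.co := by
    have hpar : ∀ w : D.Λ𝔠, scale D.𝔠 (2 : k) (CliffordAlgebra.involute w) =
        CliffordAlgebra.involute (scale D.𝔠 (2 : k) w) := fun w => by
      have : (scale D.𝔠 (2 : k)).toLinearMap ∘ₗ parity k D.𝔠 =
          parity k D.𝔠 ∘ₗ (scale D.𝔠 (2 : k)).toLinearMap := by
        refine exterior_ext_right ?_ fun x w h => ?_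
        · change scale D.𝔠 (2 : k) (parity k D.𝔠 1) = parity k D.𝔠 (scale D.𝔠 (2 : k) 1)
          rw [parity_one, map_one, parity_one]
        · change scale D.𝔠 (2 : k) (parity k D.𝔠 w) = parity k D.𝔠 (scale D.𝔠 (2 : k) w) at h
          change scale D.𝔠 (2 : k) (parity k D.𝔠 (w * ExteriorAlgebra.ι k x)) =
            parity k D.𝔠 (scale D.𝔠 (2 : k) (w * ExteriorAlgebra.ι k x))
          rw [parity_mul_ι, map_neg, map_mul, map_mul, h, scale_ι, mul_smul_comm, mul_smul_comm,
            map_smul, parity_mul_ι, smul_neg]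
      exact LinearMap.congr_fun this w
    refine C.hom_ext (fun m => ?_) (fun c u h => ?_) fun β u h => ?_
    · simp only [LinearMap.comp_apply]
      rw [C.G_vac, C.co_vac, TensorProduct.map_tmul, AlgHom.toLinearMap_apply, map_one, C.G_vac]
    · simp only [LinearMap.comp_apply] at h ⊢
      rw [C.G_ii, map_smul, C.co_ii, C.co_ii, h]
      generalize C.co u = t
      induction t with
      | zero => simp only [map_zero, smul_zero, add_zero]
      | add a b ha hb =>
        simp only [map_add, smul_add] at ha hb ⊢
        rw [add_add_add_comm, ha, hb, add_add_add_comm]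
      | tmul w u =>
        simp only [TensorProduct.map_tmul, AlgHom.toLinearMap_apply, LinearMap.mulRight_apply,
          map_add, LinearMap.rTensor_tmul, C.G_ii, hpar, map_mul, scale_ι, mul_smul_comm, smul_add,
          TensorProduct.tmul_smul, TensorProduct.smul_tmul']
    · simp only [LinearMap.comp_apply] at h ⊢
      rw [C.G_ee, map_smul, C.co_ee, C.co_ee, h]
      generalize C.co u = t
      induction t with
      | zero => simp only [map_zero, smul_zero]
      | add a b ha hb => simp only [map_add, smul_add, ha, hb]
      | tmul w u =>
        simp only [TensorProduct.map_tmul, AlgHom.toLinearMap_apply, C.G_ee, hpar,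
          TensorProduct.tmul_smul]
  exact LinearMap.congr_fun this u

variable {C} [CharZero k]

theorem Deg.mul {p q : ℤ} {S T : Module.End k Y} (hS : C.Deg p S) (hT : C.Deg q T) :
    C.Deg (p + q) (S * T) := by
  rw [Deg, ← mul_assoc, hS, smul_mul_assoc, mul_assoc, hT, mul_smul_comm, smul_smul,
    ← zpow_add₀ two_ne_zero, mul_assoc, neg_add]

theorem Deg.mem_grade {p n : ℤ} {T : Module.End k Y} (hT : C.Deg p T) {u : Y} (hu : u ∈ C.grade n) :
    T u ∈ C.grade (n + p) := by
  rw [CliffordModule.mem_grade] at hu ⊢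
  have := LinearMap.congr_fun hT u
  rw [Module.End.mul_apply, LinearMap.smul_apply, Module.End.mul_apply, hu, map_smul, smul_smul,
    ← zpow_add₀ two_ne_zero] at this
  rw [this, neg_add, add_comm (-n)]

variable (C)

theorem iSup_grade : ⨆ n : ℤ, C.grade n = ⊤ := by
  refine C.gen _ (fun m => Submodule.mem_iSup_of_mem 0 (C.vac_mem_grade m)) (fun c u hu => ?_)
    fun β u hu => ?_
  · have : ⨆ n : ℤ, C.grade n ≤ (⨆ n : ℤ, C.grade n).comap (C.ii (D.sec c)) :=
      iSup_le fun n u hu => Submodule.mem_iSup_of_mem (n + -1) ((C.deg_ii _).mem_grade hu)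
    exact this hu
  · have : ⨆ n : ℤ, C.grade n ≤ (⨆ n : ℤ, C.grade n).comap (C.ee (D.extDual β)) :=
      iSup_le fun n u hu => Submodule.mem_iSup_of_mem (n + 1) ((C.deg_ee _).mem_grade hu)
    exact this hu

theorem grade_eq_of_le {W : ℤ → Submodule k Y} (hW : ∀ n, W n ≤ C.grade n) (htop : ⨆ n, W n = ⊤)
    (n : ℤ) : W n = C.grade n :=
  le_antisymm (hW n) fun _ hu => eigenspace_eq_of_iSup_eq_top (two_zpow_neg_injective k)
    (fun n _ hv => C.mem_grade.1 (hW n hv)) htop (C.mem_grade.1 hu)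

theorem ev_mem_gradeN {n : ℤ} {u : Y} (hu : u ∈ C.grade n) : C.ev u ∈ D.gradeN M n := by
  rw [mem_gradeN_iff, ← ev_G, C.mem_grade.1 hu, map_smul]

theorem deg_slot {p q : ℤ} {T : D.Λ𝔠 →ₗ[k] Module.End k Y} (hq : HomDeg q T)
    (hp : ∀ w, C.Deg p (T w)) : C.Deg (p + q) (C.slot T) := by
  have h1 : LinearMap.mulLeft k C.G ∘ₗ T = (2 : k) ^ (-p) • (LinearMap.mulRight k C.G ∘ₗ T) :=
    LinearMap.ext hp
  have h2 : LinearMap.mulRight k C.G ∘ₗ T ∘ₗ (scale D.𝔠 (2 : k)).toLinearMap =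
      (2 : k) ^ q • (LinearMap.mulRight k C.G ∘ₗ T) := LinearMap.ext fun w => by
    change T (scale D.𝔠 (2 : k) w) * C.G = (2 : k) ^ q • (T w * C.G)
    rw [hq 2 two_ne_zero, smul_mul_assoc]
  rw [Deg, C.comp_slot, C.slot_comp C.co_G, h1, h2, map_smul, map_smul, smul_smul,
    ← zpow_add₀ two_ne_zero]
  congr 2
  ring

theorem deg_slotC {p : ℤ} {T : D.𝔠 →ₗ[k] Module.End k Y} (hp : ∀ c, C.Deg p (T c)) :
    C.Deg (p + 1) (C.slotC T) := C.deg_slot (homDeg_ιInv.postcomp T) fun _ => hp _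

theorem deg_jj {p : ℤ} {a : D.Λ𝔠 →ₗ[k] D.𝔟} (ha : HomDeg p a) : C.Deg (p - 1) (C.jj a) := by
  have hpar : HomDeg p (a ∘ₗ parity k D.𝔠) := by
    have : a ∘ₗ parity k D.𝔠 = (-1 : k) ^ p • a := LinearMap.ext fun w => ha.parity w
    rw [this]
    exact ha.smul _
  rw [jj_apply, sub_eq_neg_add]
  exact C.deg_slot (hpar.postcomp (C.ii ∘ₗ D.in𝔟)) fun _ => C.deg_ii _

theorem deg_sumOp {p : ℤ} {T : D.𝔟 →ₗ[k] Module.End k Y} (hT : LocFin T)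
    (hp : ∀ b, C.Deg p (T b)) : C.Deg (p + 1) (C.sumOp T) := by
  have h1 : LinearMap.mulLeft k C.G ∘ₗ T = (2 : k) ^ (-p) • (LinearMap.mulRight k C.G ∘ₗ T) :=
    LinearMap.ext hp
  rw [Deg, C.mul_sumOp (fun β u => C.G_ee _ u) hT, h1, map_smul, smul_smul, sumOp_mul, neg_add,
    zpow_add₀ two_ne_zero, zpow_neg_one, mul_comm]

theorem deg_theta (x : 𝔤) : C.Deg 0 (C.theta x) :=
  (C.deg_slotC fun _ => C.deg_ii _).sub (C.deg_sumOp (C.locFin_ii_ad x) fun _ => C.deg_ii _)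

theorem jmap_scale (n : M ⊗[k] D.Λ𝔠) :
    C.G (C.jmap n) = C.jmap (LinearMap.lTensor M (scale D.𝔠 (2 : k)).toLinearMap n) := by
  have h := C.eq_jmap_of_ii_eq_zero (u := C.G (C.jmap n)) fun b => by
    have := C.G_ii b (C.jmap n)
    rw [C.ii_jmap, map_zero] at this
    exact (smul_eq_zero.1 this.symm).resolve_left two_ne_zero
  rw [h, ev_G, ev_jmap]

theorem jmap_mem_grade {n : ℤ} {v : M ⊗[k] D.Λ𝔠} (hv : v ∈ D.gradeN M n) :
    C.jmap v ∈ C.grade n := by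
  rw [mem_grade, jmap_scale, mem_gradeN_iff.1 hv, map_smul]

/-- There are no vectors of positive degree that are killed by the operators `ι_b`. -/
theorem eq_zero_of_ii_eq_zero {n : ℤ} (hn : 0 < n) {u : Y} (hu : u ∈ C.grade n)
    (h : ∀ b : D.𝔟, C.ii b u = 0) : u = 0 := by
  rw [C.eq_jmap_of_ii_eq_zero h, eq_zero_of_mem_gradeN hn (C.ev_mem_gradeN hu), map_zero]

/-- The span of the products of `n` operators `ε_f` applied to vacuum vectors, where `f ∈ 𝔟*`. -/
noncomputable def extWords : ℕ → Submodule k Y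
  | 0 => LinearMap.range C.vac
  | n + 1 => ⨆ β, (extWords n).map (C.ee (D.extDual β))

/-- An operator of positive degree that commutes or anticommutes with all `ι_x` is zero. -/
theorem eq_zero_of_ii_comm {T : Module.End k Y} {s : k} {p : ℤ} (hp : 0 < p) (hT : C.Deg p T)
    (hi : ∀ x u, T (C.ii x u) = s • C.ii x (T u)) (hs : s ≠ 0) : T = 0 := by
  let E : ℕ → Submodule k Y := C.extWords
  have hsucc : ∀ n, E (n + 1) = ⨆ β, (E n).map (C.ee (D.extDual β)) := fun n => rfl
  have hind : ∀ n (S : Submodule k Y), (∀ β, ∀ u ∈ E n, C.ee (D.extDual β) u ∈ S) →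
      E (n + 1) ≤ S := fun n S h => by
    rw [hsucc]
    exact iSup_le fun β => Submodule.map_le_iff_le_comap.2 (h β)
  have hmem : ∀ n β, ∀ u ∈ E n, C.ee (D.extDual β) u ∈ E (n + 1) := fun n β u hu => by
    rw [hsucc]
    exact Submodule.mem_iSup_of_mem β ⟨u, hu, rfl⟩
  have hdeg : ∀ n, E n ≤ C.grade n := fun n => by
    induction n with
    | zero =>
      rintro _ ⟨m, rfl⟩
      exact C.vac_mem_grade m
    | succ n ih =>
      refine hind n _ fun β u hu => ?_
      rw [Nat.cast_add, Nat.cast_one]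
      exact (C.deg_ee _).mem_grade (ih hu)
  have hann : ∀ n, ∀ b : D.𝔟, ∀ u ∈ E (n + 1), C.ii b u ∈ E n := fun n => by
    induction n with
    | zero =>
      refine fun b => hind 0 ((E 0).comap (C.ii b)) fun β u hu => ?_
      obtain ⟨m, rfl⟩ := hu
      change C.ii b (C.ee (D.extDual β) (C.vac m)) ∈ E 0
      rw [C.ii_ee, C.ii_vac, map_zero, sub_zero]
      exact Submodule.smul_mem _ _ ⟨m, rfl⟩
    | succ n ih =>
      refine fun b => hind _ ((E (n + 1)).comap (C.ii b)) fun β u hu => ?_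
      change C.ii b (C.ee (D.extDual β) u) ∈ E (n + 1)
      rw [C.ii_ee]
      exact Submodule.sub_mem _ (Submodule.smul_mem _ _ hu) (hmem n β _ (ih b u hu))
  have hzero : ∀ n, ∀ u ∈ E n, T u = 0 := fun n => by
    induction n with
    | zero =>
      intro u hu
      refine C.eq_zero_of_ii_eq_zero (n := 0 + p) (by omega) (hT.mem_grade (hdeg 0 hu)) fun b => ?_
      obtain ⟨m, rfl⟩ := hu
      have := hi b (C.vac m)
      rw [C.ii_vac, map_zero] at this
      exact (smul_eq_zero.1 this.symm).resolve_left hs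
    | succ n ih =>
      intro u hu
      refine C.eq_zero_of_ii_eq_zero (n := (n + 1 : ℕ) + p) (by omega)
        (hT.mem_grade (hdeg (n + 1) hu)) fun b => ?_
      have := hi b u
      rw [ih _ (hann n b u hu)] at this
      exact (smul_eq_zero.1 this.symm).resolve_left hs
  let P : Submodule k Y → Prop := fun S => (∀ n, E n ≤ S) ∧ ∀ c, ∀ u ∈ S, C.ii (D.sec c) u ∈ S
  let S₀ : Submodule k Y := sInf {S | P S}
  have h0 : ∀ {u}, u ∈ S₀ ↔ ∀ S, P S → u ∈ S := fun {u} => Submodule.mem_sInf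
  have hP : P S₀ := ⟨fun n u hu => h0.2 fun S h => h.1 n hu,
    fun c u hu => h0.2 fun S h => h.2 c u (h0.1 hu S h)⟩
  have hext : ∀ β, ∀ u ∈ S₀, C.ee (D.extDual β) u ∈ S₀ := fun β u hu => by
    have := h0.1 hu (S₀ ⊓ S₀.comap (C.ee (D.extDual β)))
      ⟨fun n u hu => ⟨hP.1 n hu, hP.1 (n + 1) (hmem n β u hu)⟩,
        fun c u hu => ⟨hP.2 c u hu.1, ?_⟩⟩
    · exact this.2
    · change C.ee (D.extDual β) (C.ii (D.sec c) u) ∈ S₀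
      rw [C.ee_ii, extDual_sec, zero_smul, zero_sub]
      exact S₀.neg_mem (hP.2 c _ hu.2)
  have htop : S₀ = ⊤ := C.gen S₀ (fun m => hP.1 0 ⟨m, rfl⟩) hP.2 hext
  have hle : S₀ ≤ LinearMap.ker T := sInf_le ⟨fun n u hu => hzero n u hu, fun c u hu => by
    rw [LinearMap.mem_ker] at hu ⊢
    rw [hi, hu, map_zero, smul_zero]⟩
  rw [htop, top_le_iff] at hle
  exact LinearMap.ker_eq_top.1 hle

end CliffordModule

end SplitTate

end SemiInf

namespace SemiInf

namespace SplitTate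

variable {k : Type*} [Field k] {𝔤 : Type*} [LieRing 𝔤] [LieAlgebra k 𝔤] [UniformSpace 𝔤]
  [IsUniformAddGroup 𝔤] {D : SplitTate k 𝔤}
variable {M Y : Type*} [AddCommGroup M] [Module k M] [AddCommGroup Y] [Module k Y]
variable [LieRingModule D.Sharp M] [LieModule k D.Sharp M]

theorem actM_comm (hM : D.IsDiscreteLevelOne M) (x y : 𝔤) (m : M) :
    D.actM M x (D.actM M y m) - D.actM M y (D.actM M x m) =
      D.actM M ⁅x, y⁆ m + D.criticalCocycle x y • m := by
  have h : ⁅D.lift x, D.lift y⁆ = D.lift ⁅x, y⁆ + D.criticalCocycle x y • D.K := by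
    refine Prod.ext ?_ ?_
    · change ⁅x, y⁆ = ⁅x, y⁆ + D.criticalCocycle x y • (0 : 𝔤)
      rw [smul_zero, add_zero]
    · change D.criticalCocycle x y = 0 + D.criticalCocycle x y * 1
      ring
  have h1 := lie_lie (D.lift x) (D.lift y) m
  rw [h, add_lie, smul_lie, hM.K_lie] at h1
  exact h1.symm

/-- The extension of the action of `𝔤` on the space of vacuum vectors to a sum of copies of the
Clifford module. -/
structure MatterAction (C : D.CliffordModule M Y) where
  act : 𝔤 →ₗ[k] Module.End k Y
  act_ii : ∀ x y u, act x (C.ii y u) = C.ii y (act x u)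
  act_ee : ∀ x f u, act x (C.ee f u) = C.ee f (act x u)
  act_vac : ∀ x m, act x (C.vac m) = C.vac (D.actM M x m)

/-- The action of `𝔤` on the first factor of the tensor product of `M` and a Clifford module. -/
noncomputable def CliffordModule.tensorAction (C : D.CliffordModule k Y) :
    MatterAction (C.tensor M) where
  act := LinearMap.rTensorHom Y ∘ₗ D.actM M
  act_ii x y u := by
    change LinearMap.rTensor Y _ (LinearMap.lTensor M _ u) =
      LinearMap.lTensor M _ (LinearMap.rTensor Y _ u)
    rw [← LinearMap.comp_apply, LinearMap.rTensor_comp_lTensor, ← LinearMap.lTensor_comp_rTensor]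
    rfl
  act_ee x y u := by
    change LinearMap.rTensor Y _ (LinearMap.lTensor M _ u) =
      LinearMap.lTensor M _ (LinearMap.rTensor Y _ u)
    rw [← LinearMap.comp_apply, LinearMap.rTensor_comp_lTensor, ← LinearMap.lTensor_comp_rTensor]
    rfl
  act_vac x m := rfl

namespace MatterAction

variable {C : D.CliffordModule M Y} (X : MatterAction C)

theorem act_comm (hM : D.IsDiscreteLevelOne M) (x y : 𝔤) :
    X.act x * X.act y - X.act y * X.act x = X.act ⁅x, y⁆ + D.criticalCocycle x y • 1 := by
  refine C.hom_ext (fun m => ?_) (fun c u h => ?_) fun β u h => ?_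
  · change X.act x (X.act y (C.vac m)) - X.act y (X.act x (C.vac m)) =
      X.act ⁅x, y⁆ (C.vac m) + D.criticalCocycle x y • C.vac m
    simp only [X.act_vac]
    rw [← map_sub, actM_comm hM, map_add, map_smul]
  · change X.act x (X.act y (C.ii _ u)) - X.act y (X.act x (C.ii _ u)) =
      X.act ⁅x, y⁆ (C.ii _ u) + D.criticalCocycle x y • C.ii _ u
    simp only [X.act_ii]
    rw [← map_sub, ← map_smul, ← map_add]
    exact congrArg _ h
  · change X.act x (X.act y (C.ee _ u)) - X.act y (X.act x (C.ee _ u)) =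
      X.act ⁅x, y⁆ (C.ee _ u) + D.criticalCocycle x y • C.ee _ u
    simp only [X.act_ee]
    rw [← map_sub, ← map_smul, ← map_add]
    exact congrArg _ h

theorem ev_act (x : 𝔤) (u : Y) :
    C.ev (X.act x u) = LinearMap.rTensor D.Λ𝔠 (D.actM M x) (C.ev u) := by
  have : C.ev ∘ₗ X.act x = LinearMap.rTensor D.Λ𝔠 (D.actM M x) ∘ₗ C.ev := by
    refine C.hom_ext (fun m => ?_) (fun c u h => ?_) fun β u h => ?_
    · simp only [LinearMap.comp_apply]
      rw [X.act_vac, C.ev_vac, C.ev_vac, LinearMap.rTensor_tmul]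
    · simp only [LinearMap.comp_apply] at h ⊢
      rw [X.act_ii, C.ev_sec, C.ev_sec, h]
      generalize C.ev u = n
      rw [← LinearMap.comp_apply, ← LinearMap.comp_apply, LinearMap.rTensor_comp_lTensor,
        LinearMap.lTensor_comp_rTensor]
    · simp only [LinearMap.comp_apply]
      rw [X.act_ee, C.ev_ext, C.ev_ext, map_zero]
  exact LinearMap.congr_fun this u

theorem deg_act (x : 𝔤) : C.Deg 0 (X.act x) := by
  rw [CliffordModule.Deg, neg_zero, zpow_zero, one_smul]
  refine C.hom_ext (fun m => ?_) (fun c u h => ?_) fun β u h => ?_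
  · simp only [Module.End.mul_apply]
    rw [X.act_vac, C.G_vac, C.G_vac, X.act_vac]
  · simp only [Module.End.mul_apply] at h ⊢
    rw [X.act_ii, C.G_ii, C.G_ii, map_smul, X.act_ii, h]
  · simp only [Module.End.mul_apply] at h ⊢
    rw [X.act_ee, C.G_ee, C.G_ee, map_smul, X.act_ee, h]

theorem locFin_act (hM : D.IsDiscreteLevelOne M) :
    CliffordModule.LocFin (X.act ∘ₗ D.in𝔟) := fun u => by
  let S : Submodule k Y := (D.openKer Y).comap (X.act ∘ₗ D.in𝔟).flip
  have hS : S = ⊤ := by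
    refine C.gen S (fun m => ?_) ?_ ?_
    · obtain ⟨U, hU, h⟩ := D.exists_open_subspace (hM.discrete m)
      refine ⟨U, hU, fun b hb => ?_⟩
      have h0 : D.actM M b m = 0 := h hb
      change X.act b (C.vac m) = 0
      rw [X.act_vac, h0, map_zero]
    · rintro c u ⟨U, hU, h⟩
      refine ⟨U, hU, fun b hb => ?_⟩
      have h0 : X.act b u = 0 := h b hb
      change X.act b (C.ii _ u) = 0
      rw [X.act_ii, h0, map_zero]
    · rintro β u ⟨U, hU, h⟩
      refine ⟨U, hU, fun b hb => ?_⟩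
      have h0 : X.act b u = 0 := h b hb
      change X.act b (C.ee _ u) = 0
      rw [X.act_ee, h0, map_zero]
  have : u ∈ S := hS ▸ Submodule.mem_top
  exact this

/-! ### The BRST differential -/

/-- The total action of `𝔤`. -/
noncomputable def tot : 𝔤 →ₗ[k] Module.End k Y := X.act + C.theta

/-- The sum of the action on vacuum vectors and half the normally ordered action. -/
noncomputable def half : 𝔤 →ₗ[k] Module.End k Y := X.act + (2⁻¹ : k) • C.theta

/-- The BRST differential. -/
noncomputable def brst : Module.End k Y :=
  C.sumOp (X.half ∘ₗ D.in𝔟) + C.slotC (X.half ∘ₗ D.sec)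

theorem tot_ii (x y : 𝔤) (u : Y) : X.tot x (C.ii y u) = C.ii ⁅x, y⁆ u + C.ii y (X.tot x u) := by
  change X.act x (C.ii y u) + C.theta x (C.ii y u) = _ + C.ii y (X.act x u + C.theta x u)
  rw [X.act_ii, C.theta_ii, map_add]
  abel

theorem tot_ee (x : 𝔤) (f : tateDual k 𝔤) (u : Y) :
    X.tot x (C.ee f u) = C.ee (D.coad x f) u + C.ee f (X.tot x u) := by
  change X.act x (C.ee f u) + C.theta x (C.ee f u) = _ + C.ee f (X.act x u + C.theta x u)
  rw [X.act_ee, C.theta_ee, map_add]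
  abel

theorem half_ii (x y : 𝔤) : X.half x * C.ii y = C.ii y * X.half x + (2⁻¹ : k) • C.ii ⁅x, y⁆ :=
  LinearMap.ext fun u => by
    change X.act x (C.ii y u) + (2⁻¹ : k) • C.theta x (C.ii y u) =
      C.ii y (X.act x u + (2⁻¹ : k) • C.theta x u) + (2⁻¹ : k) • C.ii ⁅x, y⁆ u
    rw [X.act_ii, C.theta_ii, map_add, smul_add, map_smul]
    abel

theorem locFin_half (hM : D.IsDiscreteLevelOne M) :
    CliffordModule.LocFin (X.half ∘ₗ D.in𝔟) :=
  fun u => Submodule.add_mem _ (X.locFin_act hM u) (Submodule.smul_mem _ (2⁻¹ : k) (C.locFin_theta u))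

variable [CharZero k]

theorem tot_comm (hM : D.IsDiscreteLevelOne M) (x y : 𝔤) :
    X.tot x * X.tot y - X.tot y * X.tot x = X.tot ⁅x, y⁆ := by
  have h1 := X.act_comm hM x y
  have h2 := C.theta_comm_theta x y
  have hc : ∀ z w : 𝔤, X.act z * C.theta w = C.theta w * X.act z := fun z w => by
    refine sub_eq_zero.1 (C.eq_zero_of_comm (fun y => ?_) (fun f => ?_) fun m => ?_)
    · refine LinearMap.ext fun u => ?_
      change X.act z (C.theta w (C.ii y u)) - C.theta w (X.act z (C.ii y u)) =
        C.ii y (X.act z (C.theta w u) - C.theta w (X.act z u))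
      rw [X.act_ii, C.theta_ii, C.theta_ii, map_add, X.act_ii, X.act_ii, map_sub]
      abel
    · refine LinearMap.ext fun u => ?_
      change X.act z (C.theta w (C.ee f u)) - C.theta w (X.act z (C.ee f u)) =
        C.ee f (X.act z (C.theta w u) - C.theta w (X.act z u))
      rw [X.act_ee, C.theta_ee, C.theta_ee, map_add, X.act_ee, X.act_ee, map_sub]
      abel
    · change C.vev (X.act z (C.theta w (C.vac m)) - C.theta w (X.act z (C.vac m))) = 0
      rw [map_sub, X.act_vac, C.vev_theta_vac, sub_zero]
      refine C.vev_eq_zero_of_mem ?_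
      refine Submodule.span_induction (p := fun v _ => X.act z v ∈ Submodule.span k
        {v | ∃ z u, v = C.ii (D.sec z) u}) ?_ ?_ ?_ ?_ (C.theta_vac_mem w m)
      · rintro _ ⟨c, u, rfl⟩
        rw [X.act_ii]
        exact Submodule.subset_span ⟨_, _, rfl⟩
      · rw [map_zero]
        exact Submodule.zero_mem _
      · intro u v _ _ hu hv
        rw [map_add]
        exact Submodule.add_mem _ hu hv
      · intro t v _ hv
        rw [map_smul]
        exact Submodule.smul_mem _ t hv
  change (X.act x + C.theta x) * (X.act y + C.theta y) -
    (X.act y + C.theta y) * (X.act x + C.theta x) = X.act ⁅x, y⁆ + C.theta ⁅x, y⁆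
  rw [eq_sub_iff_add_eq] at h2
  rw [eq_sub_of_add_eq h1.symm, ← h2, add_mul, mul_add, mul_add, add_mul, mul_add, mul_add, hc x y, hc y x]
  abel

theorem deg_half (x : 𝔤) : C.Deg 0 (X.half x) := (X.deg_act x).add ((C.deg_theta x).smul _)

theorem deg_tot (x : 𝔤) : C.Deg 0 (X.tot x) := (X.deg_act x).add (C.deg_theta x)

theorem deg_brst (hM : D.IsDiscreteLevelOne M) : C.Deg 1 X.brst := by
  have := (C.deg_sumOp (X.locFin_half hM) fun b => X.deg_half b).add
    (C.deg_slotC (T := X.half ∘ₗ D.sec) fun c => X.deg_half _)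
  rwa [zero_add] at this

theorem brst_cartan (hM : D.IsDiscreteLevelOne M) (x : 𝔤) :
    X.brst * C.ii x + C.ii x * X.brst = X.tot x := by
  have h1 : LinearMap.mulRight k (C.ii x) ∘ₗ X.half ∘ₗ D.in𝔟 =
      LinearMap.mulLeft k (C.ii x) ∘ₗ X.half ∘ₗ D.in𝔟 -
        (2⁻¹ : k) • (C.ii ∘ₗ LieAlgebra.ad k 𝔤 x ∘ₗ D.in𝔟) := LinearMap.ext fun b => by
    refine (X.half_ii _ x).trans ?_
    rw [← lie_skew, map_neg, smul_neg, ← sub_eq_add_neg]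
    rfl
  have h2 : LinearMap.mulRight k (C.ii x) ∘ₗ X.half ∘ₗ D.sec =
      LinearMap.mulLeft k (C.ii x) ∘ₗ X.half ∘ₗ D.sec -
        (2⁻¹ : k) • (C.ii ∘ₗ LieAlgebra.ad k 𝔤 x ∘ₗ D.sec) := LinearMap.ext fun b => by
    refine (X.half_ii _ x).trans ?_
    rw [← lie_skew, map_neg, smul_neg, ← sub_eq_add_neg]
    rfl
  have h3 : X.half x = (X.half ∘ₗ D.in𝔟) (D.pr𝔟 x) + (X.half ∘ₗ D.sec) (D.pr𝔠 x) := by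
    conv_lhs => rw [← D.pr𝔟_add_sec_pr𝔠 x, map_add]
    rfl
  have h4 : X.tot x = X.half x + (2⁻¹ : k) • C.theta x := by
    change X.act x + C.theta x = X.act x + (2⁻¹ : k) • C.theta x + (2⁻¹ : k) • C.theta x
    rw [add_assoc, ← add_smul, ← two_mul, mul_inv_cancel₀ two_ne_zero, one_smul]
  rw [h4, h3, C.theta_def, brst, add_mul, mul_add, C.sumOp_mul, C.slotC_mul_ii,
    C.ii_mul_sumOp x (X.locFin_half hM), C.mul_slotC, h1, h2, map_sub, map_sub, map_smul, map_smul,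
    smul_sub]
  abel

theorem brst_ii (hM : D.IsDiscreteLevelOne M) (x : 𝔤) (u : Y) :
    X.brst (C.ii x u) = X.tot x u - C.ii x (X.brst u) :=
  eq_sub_of_add_eq (LinearMap.congr_fun (X.brst_cartan hM x) u)

theorem brst_unique (hM : D.IsDiscreteLevelOne M) {d : Module.End k Y} (hd : C.Deg 1 d)
    (h : ∀ x u, d (C.ii x u) = X.tot x u - C.ii x (d u)) : d = X.brst := by
  refine sub_eq_zero.1 (C.eq_zero_of_ii_comm (s := -1) one_pos (hd.sub (X.deg_brst hM))
    (fun x u => ?_) (neg_ne_zero.2 one_ne_zero))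
  rw [LinearMap.sub_apply, LinearMap.sub_apply, h, X.brst_ii hM, neg_one_smul, map_sub]
  abel

theorem brst_tot (hM : D.IsDiscreteLevelOne M) (x : 𝔤) : X.brst * X.tot x = X.tot x * X.brst := by
  have h1 := (X.deg_brst hM).mul (X.deg_tot x)
  have h2 := (X.deg_tot x).mul (X.deg_brst hM)
  rw [add_zero] at h1
  rw [zero_add] at h2
  refine sub_eq_zero.1 (C.eq_zero_of_ii_comm (s := -1) one_pos (h1.sub h2) (fun y u => ?_)
    (neg_ne_zero.2 one_ne_zero))
  have h := LinearMap.congr_fun (X.tot_comm hM x y) u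
  simp only [LinearMap.sub_apply, Module.End.mul_apply] at h ⊢
  rw [X.tot_ii, map_add, X.brst_ii hM, X.brst_ii hM, X.brst_ii hM, map_sub, X.tot_ii, ← h,
    neg_one_smul, map_sub]
  abel

theorem brst_brst (hM : D.IsDiscreteLevelOne M) : X.brst * X.brst = 0 := by
  refine C.eq_zero_of_ii_comm (s := 1) (p := 1 + 1) (by norm_num)
    ((X.deg_brst hM).mul (X.deg_brst hM)) (fun y u => ?_) one_ne_zero
  have h := LinearMap.congr_fun (X.brst_tot hM y) u
  simp only [Module.End.mul_apply] at h ⊢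
  rw [X.brst_ii hM, map_sub, X.brst_ii hM, h, one_smul]
  abel

/-- The action of `R` is compatible with the BRST differential up to operators that commute with it. -/
theorem brst_ee_comm (hM : D.IsDiscreteLevelOne M) (f g : tateDual k 𝔤) :
    (X.brst * C.ee f + C.ee f * X.brst) * C.ee g = C.ee g * (X.brst * C.ee f + C.ee f * X.brst) := by
  have hD : ∀ y u, (X.brst * C.ee f + C.ee f * X.brst) (C.ii y u) =
      C.ii y ((X.brst * C.ee f + C.ee f * X.brst) u) - C.ee (D.coad y f) u := fun y u => by
    simp only [LinearMap.add_apply, Module.End.mul_apply, map_add]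
    rw [X.brst_ii hM, C.ee_ii, map_sub, map_sub, map_smul, X.brst_ii hM, X.tot_ee, C.ee_ii]
    abel
  have hdeg : C.Deg (1 + 1) (X.brst * C.ee f + C.ee f * X.brst) :=
    ((X.deg_brst hM).mul (C.deg_ee f)).add ((C.deg_ee f).mul (X.deg_brst hM))
  generalize X.brst * C.ee f + C.ee f * X.brst = T at hD hdeg ⊢
  refine sub_eq_zero.1 (C.eq_zero_of_ii_comm (s := -1) (p := 1 + 1 + 1) (by norm_num)
    ((hdeg.mul (C.deg_ee g)).sub ?_) (fun y u => ?_) (neg_ne_zero.2 one_ne_zero))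
  · have := (C.deg_ee g).mul hdeg
    rwa [add_comm] at this
  · simp only [LinearMap.sub_apply, Module.End.mul_apply]
    rw [C.ee_ii, map_sub, map_smul, hD, hD, map_sub, C.ee_ii, C.ee_ee (D.coad y f) g, neg_one_smul,
      map_sub]
    abel

end MatterAction

end SplitTate

end SemiInf

namespace SemiInf

section ExteriorAlgebraLemmas

variable {k : Type*} [Field k] {V : Type*} [AddCommGroup V] [Module k V]
variable {X : Type*} [AddCommGroup X] [Module k X]

local notation "Λ" => ExteriorAlgebra k V
local notation "ι" => ExteriorAlgebra.ι k

theorem conv_id_ι_derExt (T : Module.End k V) :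
    conv (LinearMap.mul k Λ) LinearMap.id (ι ∘ₗ T ∘ₗ ExteriorAlgebra.ιInv) = derExt T := by
  refine exterior_ext_right ?_ fun c w h => ?_
  · rw [conv_apply, comul_one, derExt_one, TensorProduct.map_tmul, TensorProduct.lift.tmul,
      LinearMap.comp_apply, LinearMap.comp_apply, ιInv_one, map_zero, map_zero, map_zero]
  · rw [conv_apply] at h ⊢
    have h1 := rid_counit_comul w
    rw [derExt_mul_ι, ← h, comul_mul_ι]
    conv_rhs =>
      arg 2
      rw [← h1]
    generalize comul k V w = t
    induction t with
    | zero => simp only [map_zero, zero_mul, add_zero]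
    | add a b ha hb =>
      simp only [map_add, add_mul] at ha hb ⊢
      rw [add_add_add_comm, ha, hb, add_add_add_comm]
    | tmul u v =>
      have h2 : ι c * ι (T (ExteriorAlgebra.ιInv v)) = -(ι (T (ExteriorAlgebra.ιInv v)) * ι c) :=
        eq_neg_of_add_eq_zero_left (ExteriorAlgebra.ι_add_mul_swap _ _)
      simp only [TensorProduct.map_tmul, map_add, TensorProduct.lift.tmul, LinearMap.comp_apply,
        LinearMap.id_apply, LinearMap.mulRight_apply, LinearMap.mul_apply', ιInv_mul_ι,
        LinearMap.lTensor_tmul, AlgHom.toLinearMap_apply, TensorProduct.rid_tmul, map_smul]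
      have h3 : ExteriorAlgebra.ιInv (R := k) (CliffordAlgebra.involute v) =
        -ExteriorAlgebra.ιInv (R := k) v := ιInv_parity v
      rw [h3, map_neg, map_neg, mul_neg, mul_assoc, h2, mul_neg, neg_neg, mul_assoc, smul_mul_assoc]

theorem extendForm_two_parity (β : V [⋀^Fin 2]→ₗ[k] X) (w : Λ) :
    extendForm β (parity k V w) = extendForm β w := by
  have := (homDeg_extendForm β).parity w
  rw [this]
  norm_num

theorem extendForm_two_mul_ι (β : V [⋀^Fin 2]→ₗ[k] X) (y : V) (w : Λ) :
    extendForm β (w * ι y) = -fixLeft β y (ExteriorAlgebra.ιInv w) := by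
  rw [← parity_parity w, ← ι_mul_eq, extendForm_two_ι_mul, parity_parity, ← fixLeft_apply,
    ιInv_parity, map_neg]

theorem conv_id_ι_coderExt (β : V [⋀^Fin 2]→ₗ[k] V) :
    conv (LinearMap.mul k Λ) LinearMap.id (ι ∘ₗ extendForm β) = coderExt β ∘ₗ parity k V := by
  refine exterior_ext_right ?_ fun y w h => ?_
  · rw [conv_apply, comul_one, LinearMap.comp_apply, parity_one, coderExt_one,
      TensorProduct.map_tmul, TensorProduct.lift.tmul, LinearMap.comp_apply,
      extendForm_one two_ne_zero, map_zero, map_zero]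
  · rw [LinearMap.comp_apply] at h ⊢
    rw [coderExt_parity_mul_ι, ← h, ← conv_id_ι_derExt, conv_apply, conv_apply, conv_apply,
      comul_mul_ι]
    generalize comul k V w = t
    induction t with
    | zero => simp only [map_zero, zero_mul, add_zero, neg_zero, sub_zero]
    | add a b ha hb =>
      simp only [map_add, add_mul, neg_add] at ha hb ⊢
      rw [add_add_add_comm, ha, hb]
      abel
    | tmul u v =>
      have h2 : ι y * ι (extendForm β v) = -(ι (extendForm β v) * ι y) :=
        eq_neg_of_add_eq_zero_left (ExteriorAlgebra.ι_add_mul_swap _ _)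
      simp only [TensorProduct.map_tmul, map_add, TensorProduct.lift.tmul, LinearMap.comp_apply,
        LinearMap.id_apply, LinearMap.mulRight_apply, LinearMap.mul_apply', extendForm_two_parity,
        extendForm_two_mul_ι, map_neg]
      rw [mul_assoc, h2, mul_neg, mul_assoc]
      abel

theorem conv_fixLeft_ιInv (β : V [⋀^Fin 2]→ₗ[k] X) :
    conv (fixLeft β) ExteriorAlgebra.ιInv ExteriorAlgebra.ιInv = (2 : k) • extendForm β := by
  refine exterior_ext_left ?_ fun x w _ => ?_
  · rw [conv_apply, comul_one, TensorProduct.map_tmul, ιInv_one, TensorProduct.zero_tmul, map_zero,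
      LinearMap.smul_apply, extendForm_one two_ne_zero, smul_zero]
  · have h1 : (ExteriorAlgebra.ιInv (R := k) (M := V)) ∘ₗ LinearMap.mulLeft k (ι x) =
        (counit k V).toLinearMap.smulRight x := LinearMap.ext fun w => ιInv_ι_mul x w
    have h2 : ∀ w : Λ, conv (fixLeft β) ((counit k V).toLinearMap.smulRight x)
        ExteriorAlgebra.ιInv w = fixLeft β x (ExteriorAlgebra.ιInv w) := fun w => by
      conv_rhs => rw [← lid_counit_comul w]
      rw [conv_apply]
      generalize comul k V w = t
      induction t with
      | zero => simp only [map_zero]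
      | add a b ha hb => simp only [map_add, ha, hb]
      | tmul u v =>
        change fixLeft β (counit k V u • x) _ = fixLeft β x (ExteriorAlgebra.ιInv (counit k V u • v))
        rw [map_smul, map_smul, map_smul, LinearMap.smul_apply]
    have h3 : ∀ w : Λ, conv (fixLeft β) ExteriorAlgebra.ιInv
        ((counit k V).toLinearMap.smulRight x) w = fixLeft β (ExteriorAlgebra.ιInv w) x := fun w => by
      conv_rhs => rw [← rid_counit_comul w]
      rw [conv_apply]
      generalize comul k V w = t
      induction t with
      | zero => simp only [map_zero, LinearMap.zero_apply]
      | add a b ha hb => simp only [map_add, ha, hb, LinearMap.add_apply]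
      | tmul u v =>
        change fixLeft β _ (counit k V v • x) = fixLeft β (ExteriorAlgebra.ιInv (counit k V v • u)) x
        rw [map_smul, map_smul, map_smul, LinearMap.smul_apply]
    rw [conv_ι_mul _ _ par_ιInv, h1, h2, h3, fixLeft_swap β _ x, LinearMap.smul_apply,
      extendForm_two_ι_mul, ← fixLeft_apply, pow_one, neg_one_smul, neg_neg, two_smul]

theorem comul_coderExt_parity (β : V [⋀^Fin 2]→ₗ[k] V) (w : Λ) :
    comul k V (coderExt β (parity k V w)) =
      TensorProduct.map (coderExt β ∘ₗ parity k V) (parity k V) (comul k V w) +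
        TensorProduct.map LinearMap.id (coderExt β ∘ₗ parity k V) (comul k V w) := by
  have : comul k V ∘ₗ coderExt β ∘ₗ parity k V =
      (TensorProduct.map (coderExt β ∘ₗ parity k V) (parity k V) +
        TensorProduct.map LinearMap.id (coderExt β ∘ₗ parity k V)) ∘ₗ comul k V := by
    refine exterior_ext_right ?_ fun y w h => ?_
    · simp only [LinearMap.comp_apply, LinearMap.add_apply]
      rw [comul_one, TensorProduct.map_tmul, TensorProduct.map_tmul, LinearMap.comp_apply,
        parity_one, coderExt_one, map_zero, TensorProduct.zero_tmul, TensorProduct.tmul_zero,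
        add_zero]
    · simp only [LinearMap.comp_apply, LinearMap.add_apply] at h ⊢
      change comul k V (coderExt β (parity k V w)) = _ at h
      change comul k V (coderExt β (parity k V (w * ι y))) = _
      rw [coderExt_parity_mul_ι, map_sub, map_neg, comul_derExt, comul_mul_ι, h, comul_mul_ι]
      generalize comul k V w = t
      induction t with
      | zero => simp only [map_zero, add_zero, neg_zero, sub_zero]
      | add a b ha hb =>
        simp only [map_add] at ha hb ⊢
        have := congrArg₂ (· + ·) ha hb
        refine Eq.trans ?_ (this.trans ?_)
        · abel
        · abel
      | tmul u v =>
        simp only [TensorProduct.map_tmul, map_add, LinearMap.id_apply, LinearMap.mulRight_apply]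
        have e1 : ∀ z : Λ, (coderExt β ∘ₗ parity k V) (z * ι y) =
            -derExt (fixLeft β y) z - coderExt β (parity k V z) * ι y :=
          coderExt_parity_mul_ι β y
        have e2 : (coderExt β ∘ₗ parity k V) (parity k V v) = -parity k V (coderExt β (parity k V v)) :=
          coderExt_parity β _
        have e3 : ∀ z, (coderExt β ∘ₗ parity k V) z = coderExt β (parity k V z) := fun z => rfl
        rw [e1, e1, e2, e3, e3, parity_mul_ι, parity_parity]
        simp only [TensorProduct.add_tmul, TensorProduct.tmul_add, TensorProduct.neg_tmul,
          TensorProduct.tmul_neg, sub_eq_add_neg]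
        abel
  exact LinearMap.congr_fun this w

theorem counit_comp_derExt (T : Module.End k V) : (counit k V).toLinearMap ∘ₗ derExt T = 0 := by
  refine exterior_ext_right ?_ fun x w _ => ?_
  · rw [LinearMap.comp_apply, derExt_one, map_zero]
    rfl
  · rw [LinearMap.comp_apply, derExt_mul_ι, AlgHom.toLinearMap_apply, map_add, counit_mul_ι,
      counit_mul_ι, add_zero]
    rfl

theorem contr_derExt (r : Λ →ₗ[k] k) (T : Module.End k V) (w : Λ) :
    contr r (derExt T w) = derExt T (contr r w) + contr (r ∘ₗ derExt T) w := by
  rw [contr, contr, conv_apply, conv_apply, conv_apply, comul_derExt]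
  generalize comul k V w = t
  induction t with
  | zero => simp only [map_zero, add_zero]
  | add a b ha hb =>
    simp only [map_add] at ha hb ⊢
    rw [add_add_add_comm, ha, hb, add_add_add_comm]
  | tmul u v =>
    simp only [TensorProduct.map_tmul, map_add, TensorProduct.lift.tmul]
    congr 1
    exact (map_smul (derExt T) (r v) u).symm

theorem coderExt_parity_contr {p : ℕ} {r : Λ →ₗ[k] k} (hr : Par p r) (β : V [⋀^Fin 2]→ₗ[k] V)
    (w : Λ) : coderExt β (parity k V (contr r w)) =
      (-1 : k) ^ p • contr r (coderExt β (parity k V w)) + contr (r ∘ₗ coderExt β) w := by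
  have h1 : ∀ v, r (coderExt β (parity k V v)) = -((-1 : k) ^ p * r (coderExt β v)) := fun v => by
    rw [coderExt_parity, map_neg, hr, smul_eq_mul]
  rw [contr, contr, conv_apply, conv_apply, conv_apply, comul_coderExt_parity]
  generalize comul k V w = t
  induction t with
  | zero => simp only [map_zero, add_zero, smul_zero]
  | add a b ha hb =>
    simp only [map_add, smul_add] at ha hb ⊢
    rw [ha, hb]
    abel
  | tmul u v =>
    simp only [TensorProduct.map_tmul, map_add, TensorProduct.lift.tmul]
    change coderExt β (parity k V (r v • u)) = (-1 : k) ^ p •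
      (r (parity k V v) • coderExt β (parity k V u) + r (coderExt β (parity k V v)) • u) +
      r (coderExt β v) • u
    rw [h1, hr, smul_add, smul_smul, smul_smul, smul_eq_mul, ← mul_assoc, neg_one_pow_mul_self,
      one_mul, mul_neg, ← mul_assoc, neg_one_pow_mul_self, one_mul, map_smul, map_smul, neg_smul]
    abel

end ExteriorAlgebraLemmas

end SemiInf

namespace SemiInf

namespace SplitTate

variable {k : Type*} [Field k] {𝔤 : Type*} [LieRing 𝔤] [LieAlgebra k 𝔤] [UniformSpace 𝔤]
  [IsUniformAddGroup 𝔤] {D : SplitTate k 𝔤}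
variable {M Y : Type*} [AddCommGroup M] [Module k M] [AddCommGroup Y] [Module k Y]

theorem par_comp_boundary {Z : Type*} [AddCommGroup Z] [Module k Z] {p : ℕ} {r : D.Λ𝔠 →ₗ[k] Z}
    (hr : Par p r) : Par (p + 1) (r ∘ₗ D.boundary) := fun w => by
  have : D.boundary (parity k D.𝔠 w) = -parity k D.𝔠 (D.boundary w) := coderExt_parity _ _
  rw [LinearMap.comp_apply, this, map_neg, hr, pow_succ, mul_neg_one, neg_smul]
  rfl

namespace CliffordModule

variable (C : D.CliffordModule M Y)

theorem ev_slot_congr {S T : D.Λ𝔠 →ₗ[k] Module.End k Y}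
    (h : ∀ w u, C.ev (S w u) = C.ev (T w u)) (u : Y) : C.ev (C.slot S u) = C.ev (C.slot T u) := by
  rw [slot_apply, slot_apply]
  generalize C.co u = t
  induction t with
  | zero => simp only [map_zero]
  | add a b ha hb => simp only [map_add, ha, hb]
  | tmul w u => exact h w u

theorem ev_slot_sec [LieRingModule D.Sharp M] [LieModule k D.Sharp M] (T : D.Λ𝔠 →ₗ[k] D.𝔠) (u : Y) :
    C.ev (C.slot (C.ii ∘ₗ D.sec ∘ₗ T) u) = LinearMap.lTensor M
      (conv (LinearMap.mul k D.Λ𝔠) LinearMap.id (ExteriorAlgebra.ι k ∘ₗ T)) (C.ev u) := by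
  rw [C.ev_slot (F := LinearMap.lTensorHom M ∘ₗ (LinearMap.mul k D.Λ𝔠).flip ∘ₗ
    ExteriorAlgebra.ι k ∘ₗ T) (fun w u => C.ev_sec (T w) u)]
  generalize C.ev u = n
  induction n with
  | zero => simp only [map_zero]
  | add a b ha hb => simp only [map_add, ha, hb]
  | tmul m w =>
    rw [slotAct_tmul, LinearMap.lTensor_tmul, conv_apply]
    generalize comul k D.𝔠 w = t
    induction t with
    | zero => simp only [map_zero, TensorProduct.tmul_zero]
    | add a b ha hb => simp only [map_add, TensorProduct.tmul_add, ha, hb]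
    | tmul u v => rfl

theorem ii_eq_add (x : 𝔤) : C.ii x = C.ii (D.pr𝔟 x : 𝔤) + C.ii (D.sec (D.pr𝔠 x)) := by
  rw [← map_add, pr𝔟_add_sec_pr𝔠]

theorem slot_ii_comp {T : D.Λ𝔠 →ₗ[k] 𝔤} {p : ℕ} (hT : Par p T) : C.slot (C.ii ∘ₗ T) =
    (-1 : k) ^ p • C.jj (D.pr𝔟 ∘ₗ T) + C.slot (C.ii ∘ₗ D.sec ∘ₗ D.pr𝔠 ∘ₗ T) := by
  have h : C.ii ∘ₗ T = C.ii ∘ₗ D.in𝔟 ∘ₗ D.pr𝔟 ∘ₗ T + C.ii ∘ₗ D.sec ∘ₗ D.pr𝔠 ∘ₗ T :=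
    LinearMap.ext fun w => C.ii_eq_add (T w)
  have h1 : (D.pr𝔟 ∘ₗ T) ∘ₗ parity k D.𝔠 = (-1 : k) ^ p • (D.pr𝔟 ∘ₗ T) :=
    (hT.postcomp D.pr𝔟).comp_parity
  rw [h, map_add, jj_apply, h1, LinearMap.comp_smul, LinearMap.comp_smul, map_smul, smul_smul,
    neg_one_pow_mul_self, one_smul]

theorem ev_theta [LieRingModule D.Sharp M] [LieModule k D.Sharp M] (x : 𝔤) (u : Y) :
    C.ev (C.theta x u) =
      LinearMap.lTensor M (derExt (D.block𝔠𝔠 (LieAlgebra.ad k 𝔤 x))) (C.ev u) -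
        C.ev (C.jj (D.block𝔠𝔟 (LieAlgebra.ad k 𝔤 x) ∘ₗ ExteriorAlgebra.ιInv) u) := by
  have hpar : Par 1 ((LieAlgebra.ad k 𝔤 x ∘ₗ D.sec) ∘ₗ
    ExteriorAlgebra.ιInv (R := k) (M := D.𝔠)) := par_ιInv.postcomp _
  have h := C.slot_ii_comp hpar
  have h2 : C.slotC (C.ii ∘ₗ LieAlgebra.ad k 𝔤 x ∘ₗ D.sec) =
      C.slot (C.ii ∘ₗ ((LieAlgebra.ad k 𝔤 x ∘ₗ D.sec) ∘ₗ ExteriorAlgebra.ιInv)) := rfl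
  rw [theta_def, LinearMap.sub_apply, map_sub, C.ev_sumOp (C.locFin_ii_ad x), sub_zero, h2, h,
    LinearMap.add_apply, map_add, ev_slot_sec, pow_one, neg_one_smul, LinearMap.neg_apply, map_neg,
    add_comm, ← sub_eq_add_neg, ← conv_id_ι_derExt]
  rfl

theorem ev_slotC_theta [CharZero k] [LieRingModule D.Sharp M] [LieModule k D.Sharp M] (u : Y) :
    C.ev (C.slotC (((2⁻¹ : k) • C.theta) ∘ₗ D.sec) u) =
      LinearMap.lTensor M (D.boundary ∘ₗ parity k D.𝔠) (C.ev u) -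
        C.ev (C.jj (extendForm D.curvature) u) := by
  let Ξ : D.Λ𝔠 →ₗ[k] D.Λ𝔠 →ₗ[k] Module.End k Y :=
    (fixLeft (C.ii.compAlternatingMap D.bracket𝔠)).compl₁₂ ExteriorAlgebra.ιInv ExteriorAlgebra.ιInv
  have h1 : ∀ w u, C.ev ((((2⁻¹ : k) • C.theta) ∘ₗ D.sec ∘ₗ ExteriorAlgebra.ιInv) w u) =
      C.ev (((2⁻¹ : k) • (C.slot ∘ₗ Ξ)) w u) := fun w u => by
    change C.ev ((2⁻¹ : k) • C.theta _ u) = C.ev ((2⁻¹ : k) • C.slot (Ξ w) u)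
    rw [map_smul, map_smul, theta_def, LinearMap.sub_apply, map_sub,
      C.ev_sumOp (C.locFin_ii_ad _), sub_zero]
    rfl
  have h2 : conv Ξ.flip LinearMap.id LinearMap.id =
      -((2 : k) • (C.ii ∘ₗ extendForm D.bracket𝔠)) := by
    have h3 := conv_fixLeft_ιInv (C.ii.compAlternatingMap D.bracket𝔠)
    have h4 : extendForm (C.ii.compAlternatingMap D.bracket𝔠) = C.ii ∘ₗ extendForm D.bracket𝔠 := by
      have := extendForm_formPart (p := 2) (F := C.ii ∘ₗ extendForm D.bracket𝔠)
        ((homDeg_extendForm D.bracket𝔠).postcomp C.ii)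
      rw [← this]
      congr 1
      refine AlternatingMap.ext fun v => ?_
      change C.ii (D.bracket𝔠 v) = C.ii (extendForm D.bracket𝔠 (ExteriorAlgebra.ιMulti k 2 v))
      rw [extendForm_ιMulti]
    rw [← h4, ← h3]
    refine LinearMap.ext fun w => ?_
    rw [LinearMap.neg_apply, conv_apply, conv_apply]
    generalize comul k D.𝔠 w = t
    induction t with
    | zero => simp only [map_zero, neg_zero]
    | add a b ha hb => simp only [map_add, ha, hb, neg_add]
    | tmul w₁ w₂ =>
      change fixLeft (C.ii.compAlternatingMap D.bracket𝔠) (ExteriorAlgebra.ιInv w₂)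
        (ExteriorAlgebra.ιInv w₁) = -fixLeft (C.ii.compAlternatingMap D.bracket𝔠)
        (ExteriorAlgebra.ιInv w₁) (ExteriorAlgebra.ιInv w₂)
      rw [fixLeft_swap]
  have h5 : ∀ {X : Type _} [AddCommGroup X] [Module k X] (g : 𝔤 →ₗ[k] X),
      g ∘ₗ extendForm D.bracket𝔠 = extendForm (g.compAlternatingMap D.bracket𝔠) := fun g => by
    have := extendForm_formPart (p := 2) (F := g ∘ₗ extendForm D.bracket𝔠)
      ((homDeg_extendForm D.bracket𝔠).postcomp g)
    rw [← this]
    congr 1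
    refine AlternatingMap.ext fun v => ?_
    change g (extendForm D.bracket𝔠 (ExteriorAlgebra.ιMulti k 2 v)) = g (D.bracket𝔠 v)
    rw [extendForm_ιMulti]
  have h6 : D.pr𝔟 ∘ₗ extendForm D.bracket𝔠 = extendForm D.curvature := h5 D.pr𝔟
  have h7 : D.pr𝔠 ∘ₗ extendForm D.bracket𝔠 = extendForm D.μ𝔠 := h5 D.pr𝔠
  have h8 : D.boundary = -coderExt D.μ𝔠 := by
    refine LinearMap.ext fun w => ?_
    have : extendForm (-D.μ𝔠) = -extendForm D.μ𝔠 := by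
      refine LinearMap.ext fun w => ?_
      rw [← neg_one_smul k, extendForm_smul, LinearMap.smul_apply, neg_one_smul, LinearMap.neg_apply]
    rw [LinearMap.neg_apply, boundary, coderExt_apply, coderExt_apply, this, LinearMap.comp_neg,
      ← neg_one_smul k, TensorProduct.map_smul_left, LinearMap.smul_apply, map_smul, neg_one_smul]
  have h9 : Par 2 (extendForm D.bracket𝔠) := (homDeg_extendForm D.bracket𝔠).par
  have h10 : C.slotC (((2⁻¹ : k) • C.theta) ∘ₗ D.sec) =
      C.slot (((2⁻¹ : k) • C.theta) ∘ₗ D.sec ∘ₗ ExteriorAlgebra.ιInv) := rfl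
  rw [h10, C.ev_slot_congr h1, map_smul, slot_slot, h2, map_neg, map_smul, smul_neg, smul_smul,
    inv_mul_cancel₀ two_ne_zero, one_smul, LinearMap.neg_apply, map_neg, C.slot_ii_comp h9, h6, h7,
    LinearMap.add_apply, map_add, ev_slot_sec, conv_id_ι_coderExt, h8, LinearMap.neg_comp,
    LinearMap.lTensor_neg, LinearMap.neg_apply, neg_one_sq, one_smul]
  abel

theorem cc_comp_parity {p : ℕ} {r : D.Λ𝔠 →ₗ[k] k} (hr : Par p r) :
    C.cc (r ∘ₗ parity k D.𝔠) = (-1 : k) ^ p • C.cc r := by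
  rw [hr.comp_parity, C.cc_smul]

theorem cc_ee_par {p : ℕ} {r : D.Λ𝔠 →ₗ[k] k} (hr : Par p r) (f : tateDual k 𝔤) :
    C.cc r * C.ee f = (-1 : k) ^ p • (C.ee f * C.cc r) := by
  rw [C.cc_ee, C.cc_comp_parity hr, mul_smul_comm]

theorem cc_ii_par {p : ℕ} {r : D.Λ𝔠 →ₗ[k] k} (hr : Par p r) (b : D.𝔟) :
    C.cc r * C.ii b = (-1 : k) ^ p • (C.ii b * C.cc r) := by
  rw [C.cc_ii_coe, C.cc_comp_parity hr, mul_smul_comm]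

/-- Operators that supercommute with the `ε_ξ` supercommute with the action of `R`. -/
theorem cc_supercomm {p q : ℕ} {T : Module.End k Y}
    (hT : ∀ ξ, T * C.ee (D.annDual ξ) = (-1 : k) ^ q • (C.ee (D.annDual ξ) * T))
    {r : D.Λ𝔠 →ₗ[k] k} (hr : Par p r) : T * C.cc r = (-1 : k) ^ (q * p) • (C.cc r * T) := by
  have h := C.cc_comm (neg_one_pow_mul_self q) hT r
  rcases neg_one_pow_eq_or k q with hq | hq
  · rw [pow_mul, hq, one_pow, one_smul]
    rw [hq, scale_one, LinearMap.comp_id] at h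
    exact h.symm
  · rw [pow_mul, hq]
    rw [hq, scale_neg_one, C.cc_comp_parity hr, mul_smul_comm] at h
    rw [h, smul_smul, neg_one_pow_mul_self, one_smul]

end CliffordModule

namespace MatterAction

variable [LieRingModule D.Sharp M] [LieModule k D.Sharp M]
variable {C : D.CliffordModule M Y} (X : MatterAction C)

theorem ev_slotC_act (u : Y) : C.ev (C.slotC (X.act ∘ₗ D.sec) u) =
    D.slotAct M (LinearMap.rTensorHom D.Λ𝔠 ∘ₗ D.actM M ∘ₗ D.sec ∘ₗ ExteriorAlgebra.ιInv) (C.ev u) :=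
  C.ev_slot (fun w u => X.ev_act (D.sec (ExteriorAlgebra.ιInv w)) u) u

variable [CharZero k]

/-- The projection to `M ⊗ Λ(𝔠)` intertwines the BRST differential with `dN` up to the action of the
curvature. -/
theorem ev_brst (hM : D.IsDiscreteLevelOne M) (u : Y) :
    C.ev (X.brst u) = D.dN M (C.ev u) - C.ev (C.jj (extendForm D.curvature) u) := by
  have h : X.half ∘ₗ D.sec = X.act ∘ₗ D.sec + ((2⁻¹ : k) • C.theta) ∘ₗ D.sec :=
    LinearMap.add_comp _ _ _
  rw [brst, LinearMap.add_apply, map_add, C.ev_sumOp (X.locFin_half hM), zero_add, h, map_add,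
    LinearMap.add_apply, map_add, ev_slotC_act, C.ev_slotC_theta, dN, LinearMap.add_apply,
    add_sub_assoc]

/-- The failure of the action of `R` to commute with the BRST differential. -/
noncomputable def defect (p : ℕ) (r : D.Λ𝔠 →ₗ[k] k) : Module.End k Y :=
  X.brst * C.cc r - (-1 : k) ^ p • (C.cc r * X.brst) - C.cc (r ∘ₗ D.boundary)

theorem brst_ee_cc (hM : D.IsDiscreteLevelOne M) {p : ℕ} {r : D.Λ𝔠 →ₗ[k] k} (hr : Par p r)
    (f : tateDual k 𝔤) : (X.brst * C.ee f + C.ee f * X.brst) * C.cc r =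
      C.cc r * (X.brst * C.ee f + C.ee f * X.brst) := by
  have := C.cc_supercomm (q := 0) (T := X.brst * C.ee f + C.ee f * X.brst)
    (fun ξ => by rw [pow_zero, one_smul, X.brst_ee_comm hM]) hr
  rwa [zero_mul, pow_zero, one_smul] at this

theorem defect_ee (hM : D.IsDiscreteLevelOne M) {p : ℕ} {r : D.Λ𝔠 →ₗ[k] k} (hr : Par p r)
    (f : tateDual k 𝔤) :
    X.defect p r * C.ee f = (-1 : k) ^ (p + 1) • (C.ee f * X.defect p r) := by
  have h1 := X.brst_ee_cc hM hr f
  have h2 := C.cc_ee_par hr f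
  have h3 := C.cc_ee_par (par_comp_boundary hr) f
  have h4 : ∀ A B : Module.End k Y, (-1 : k) ^ p • ((-1 : k) ^ p • (A * B)) = A * B := fun A B => by
    rw [smul_smul, neg_one_pow_mul_self, one_smul]
  rw [add_mul, mul_add] at h1
  have e1 : X.brst * C.cc r * C.ee f = (-1 : k) ^ p • (X.brst * C.ee f * C.cc r) := by
    rw [mul_assoc, h2, mul_smul_comm, mul_assoc]
  have e2 : X.brst * C.ee f * C.cc r = C.cc r * (X.brst * C.ee f) + C.cc r * (C.ee f * X.brst) -
      C.ee f * X.brst * C.cc r := eq_sub_of_add_eq h1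
  have e3 : C.cc r * (C.ee f * X.brst) = (-1 : k) ^ p • (C.ee f * (C.cc r * X.brst)) := by
    rw [← mul_assoc, h2, smul_mul_assoc, mul_assoc]
  rw [defect, sub_mul, sub_mul, smul_mul_assoc, mul_sub, mul_sub, mul_smul_comm, e1, e2, e3, h3,
    smul_sub, smul_add, h4, pow_succ, mul_neg_one, neg_smul, neg_smul, smul_sub, smul_sub, h4,
    mul_assoc, mul_assoc]
  abel

theorem defect_cc (hM : D.IsDiscreteLevelOne M) {p q : ℕ} {r s : D.Λ𝔠 →ₗ[k] k} (hr : Par p r)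
    (hs : Par q s) : X.defect p r * C.cc s = (-1 : k) ^ ((p + 1) * q) • (C.cc s * X.defect p r) :=
  C.cc_supercomm (fun _ => X.defect_ee hM hr _) hs

theorem co_tot (b : D.𝔟) (u : Y) : C.co (X.tot b u) =
    LinearMap.rTensor Y (D.actΛ b) (C.co u) + LinearMap.lTensor D.Λ𝔠 (X.tot b) (C.co u) := by
  have key : C.co ∘ₗ X.tot b - (LinearMap.rTensor Y (D.actΛ b) + LinearMap.lTensor D.Λ𝔠 (X.tot b)) ∘ₗ
      C.co = 0 := by
    have hco : ∀ ξ : Module.Dual k D.𝔠, D.coad b (D.annDual ξ) + D.annDual (ξ ∘ₗ D.μ₁ b) = 0 := fun ξ => by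
      refine Subtype.ext (LinearMap.ext fun x => ?_)
      change -(D.annDual ξ).1 ⁅(b : 𝔤), x⁆ + ξ (D.pr𝔠 ⁅(b : 𝔤), D.sec (D.pr𝔠 x)⁆) = 0
      rw [annDual_apply, neg_add_eq_zero]
      have h : D.pr𝔠 ⁅(b : 𝔤), (D.pr𝔟 x : 𝔤)⁆ = 0 := D.pr𝔠_coe ⁅b, D.pr𝔟 x⁆
      conv_lhs => rw [← D.pr𝔟_add_sec_pr𝔠 x]
      rw [lie_add, map_add, h, zero_add]
    have hee : ∀ (ξ : Module.Dual k D.𝔠) (u : Y), C.ee (D.coad b (D.annDual ξ)) u =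
        -C.ee (D.annDual (ξ ∘ₗ D.μ₁ b)) u := fun ξ u => by
      refine eq_neg_of_add_eq_zero_left ?_
      rw [← LinearMap.add_apply, ← map_add, hco, map_zero, LinearMap.zero_apply]
    have hξ : ∀ ξ : Module.Dual k D.𝔠, (ξ ∘ₗ ExteriorAlgebra.ιInv) ∘ₗ derExt (D.μ₁ b) =
        (ξ ∘ₗ D.μ₁ b) ∘ₗ ExteriorAlgebra.ιInv := fun ξ => by
      refine exterior_ext_left ?_ fun x w _ => ?_
      · simp only [LinearMap.comp_apply]
        rw [derExt_one, ιInv_one, map_zero, map_zero, map_zero, map_zero]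
      · simp only [LinearMap.comp_apply]
        have hc : counit k D.𝔠 (derExt (D.μ₁ b) w) = 0 :=
          LinearMap.congr_fun (counit_comp_derExt (D.μ₁ b)) w
        rw [derExt_ι_mul, map_add, ιInv_ι_mul, ιInv_ι_mul, ιInv_ι_mul, hc, zero_smul, add_zero,
          map_smul, map_smul, map_smul]
    refine C.eq_zero_of_contr (s := 1) (fun ξ u => ?_) fun u => ?_
    · have hA : ∀ t, LinearMap.rTensor Y (contr (ξ ∘ₗ ExteriorAlgebra.ιInv))
          (LinearMap.rTensor Y (D.actΛ b) t + LinearMap.lTensor D.Λ𝔠 (X.tot b) t) =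
          LinearMap.rTensor Y (D.actΛ b) (LinearMap.rTensor Y (contr (ξ ∘ₗ ExteriorAlgebra.ιInv)) t) +
          LinearMap.lTensor D.Λ𝔠 (X.tot b)
            (LinearMap.rTensor Y (contr (ξ ∘ₗ ExteriorAlgebra.ιInv)) t) +
          LinearMap.rTensor Y (contr ((ξ ∘ₗ D.μ₁ b) ∘ₗ ExteriorAlgebra.ιInv)) t := fun t => by
        induction t with
        | zero => simp only [map_zero, add_zero]
        | add a b ha hb =>
          simp only [map_add] at ha hb ⊢
          have := congrArg₂ (· + ·) ha hb
          refine Eq.trans ?_ (this.trans ?_) <;> abel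
        | tmul w u =>
          have h1 := contr_derExt (ξ ∘ₗ ExteriorAlgebra.ιInv) (D.μ₁ b) w
          rw [hξ] at h1
          simp only [LinearMap.rTensor_tmul, LinearMap.lTensor_tmul, map_add]
          change contr _ (derExt (D.μ₁ b) w) ⊗ₜ[k] u + _ = derExt (D.μ₁ b) _ ⊗ₜ[k] u + _ + _
          rw [h1, TensorProduct.add_tmul]
          abel
      simp only [LinearMap.sub_apply, LinearMap.comp_apply, LinearMap.add_apply]
      rw [map_sub, hA, ← C.co_cc, C.cc_ιInv, ← C.co_cc, C.cc_ιInv, ← C.co_cc, C.cc_ιInv, X.tot_ee,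
        hee, map_add, map_neg, one_smul]
      abel
    · have h1 : ∀ t : D.Λ𝔠 ⊗[k] Y, LinearMap.rTensor Y (counit k D.𝔠).toLinearMap
          (LinearMap.rTensor Y (D.actΛ b) t + LinearMap.lTensor D.Λ𝔠 (X.tot b) t) =
          LinearMap.lTensor k (X.tot b) (LinearMap.rTensor Y (counit k D.𝔠).toLinearMap t) := fun t => by
        rw [map_add, ← LinearMap.rTensor_comp_apply]
        change LinearMap.rTensor Y ((counit k D.𝔠).toLinearMap ∘ₗ derExt (D.μ₁ b)) t + _ = _
        rw [counit_comp_derExt, LinearMap.rTensor_zero, LinearMap.zero_apply, zero_add, ← LinearMap.comp_apply,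
          LinearMap.rTensor_comp_lTensor, ← LinearMap.lTensor_comp_rTensor]
        rfl
      simp only [LinearMap.sub_apply, LinearMap.comp_apply, LinearMap.add_apply]
      rw [map_sub, h1, C.counit_co, C.counit_co, LinearMap.lTensor_tmul, sub_self]
  have := LinearMap.congr_fun key u
  exact sub_eq_zero.1 this

theorem cc_tot (b : D.𝔟) (r : D.Λ𝔠 →ₗ[k] k) :
    C.cc r * X.tot b = X.tot b * C.cc r + C.cc (r ∘ₗ D.actΛ b) := by
  refine LinearMap.ext fun u => ?_
  rw [LinearMap.add_apply, Module.End.mul_apply, Module.End.mul_apply, CliffordModule.cc,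
    CliffordModule.cc, C.slot_apply, C.slot_apply, C.slot_apply, X.co_tot]
  generalize C.co u = t
  induction t with
  | zero => simp only [map_zero, add_zero]
  | add a b ha hb =>
    simp only [map_add] at ha hb ⊢
    rw [add_add_add_comm, ha, hb, add_add_add_comm]
  | tmul w u =>
    rw [map_add, add_comm]
    change r w • X.tot b u + _ = X.tot b (r w • u) + _
    rw [map_smul]
    rfl

theorem defect_ii (hM : D.IsDiscreteLevelOne M) {p : ℕ} {r : D.Λ𝔠 →ₗ[k] k} (hr : Par p r)
    (b : D.𝔟) : X.defect p r * C.ii b + (-1 : k) ^ p • (C.ii b * X.defect p r) =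
      -((-1 : k) ^ p • C.cc (r ∘ₗ D.actΛ b)) := by
  have h1 := X.brst_cartan hM b
  have h2 := C.cc_ii_par hr b
  have h3 := C.cc_ii_par (par_comp_boundary hr) b
  have h4 : ∀ A B : Module.End k Y, (-1 : k) ^ p • ((-1 : k) ^ p • (A * B)) = A * B := fun A B => by
    rw [smul_smul, neg_one_pow_mul_self, one_smul]
  have h5 := X.cc_tot b r
  have e1 : X.brst * C.cc r * C.ii b = (-1 : k) ^ p • (X.tot b * C.cc r) -
      (-1 : k) ^ p • (C.ii b * (X.brst * C.cc r)) := by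
    rw [mul_assoc, h2, mul_smul_comm, ← mul_assoc, eq_sub_of_add_eq h1, sub_mul, smul_sub, mul_assoc]
  have e2 : C.cc r * X.brst * C.ii b = X.tot b * C.cc r + C.cc (r ∘ₗ D.actΛ b) -
      (-1 : k) ^ p • (C.ii b * (C.cc r * X.brst)) := by
    rw [mul_assoc, eq_sub_of_add_eq h1, mul_sub, h5, ← mul_assoc, h2, smul_mul_assoc, mul_assoc]
  rw [defect, sub_mul, sub_mul, smul_mul_assoc, mul_sub, mul_sub, mul_smul_comm, e1, e2, h3,
    smul_sub, smul_sub, smul_sub, smul_add, h4, pow_succ, mul_neg_one, neg_smul]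
  abel

end MatterAction

end SplitTate

end SemiInf

namespace SemiInf

section Conv

variable {k : Type*} [Field k] {V : Type*} [AddCommGroup V] [Module k V]
variable {B X Y Z : Type*} [AddCommGroup X] [Module k X] [AddCommGroup Y] [Module k Y]
  [AddCommGroup Z] [Module k Z] [AddCommGroup B] [Module k B]

local notation "Λ" => ExteriorAlgebra k V

/-- The convolution, as a bilinear map. -/
noncomputable def convL (m : X →ₗ[k] Y →ₗ[k] Z) :
    (Λ →ₗ[k] X) →ₗ[k] (Λ →ₗ[k] Y) →ₗ[k] (Λ →ₗ[k] Z) :=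
  LinearMap.mk₂ k (conv m)
    (fun F F' G => by simp only [conv, TensorProduct.map_add_left, LinearMap.add_comp,
      LinearMap.comp_add])
    (fun t F G => by simp only [conv, TensorProduct.map_smul_left, LinearMap.smul_comp,
      LinearMap.comp_smul])
    (fun F G G' => by simp only [conv, TensorProduct.map_add_right, LinearMap.add_comp,
      LinearMap.comp_add])
    fun t F G => by simp only [conv, TensorProduct.map_smul_right, LinearMap.smul_comp,
      LinearMap.comp_smul]

theorem finDetermined_convL_left (m : X →ₗ[k] Y →ₗ[k] Z) (G : Λ →ₗ[k] Y) (w : Λ) :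
    FinDetermined (LinearMap.applyₗ w ∘ₗ (convL m).flip G) := by
  have h : ∀ t : Λ ⊗[k] Λ, ∃ W : Submodule k Λ, FiniteDimensional k W ∧ ∀ F : Λ →ₗ[k] X,
      (∀ w ∈ W, F w = 0) → TensorProduct.lift m (TensorProduct.map F G t) = 0 := by
    intro t
    induction t with
    | zero => exact ⟨⊥, inferInstance, fun F _ => by simp only [map_zero]⟩
    | add s t hs ht =>
      obtain ⟨W, _, h⟩ := hs
      obtain ⟨W', _, h'⟩ := ht
      refine ⟨W ⊔ W', inferInstance, fun F hF => ?_⟩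
      rw [map_add, map_add, h F fun w hw => hF w (Submodule.mem_sup_left hw),
        h' F fun w hw => hF w (Submodule.mem_sup_right hw), add_zero]
    | tmul u v =>
      refine ⟨Submodule.span k {u}, inferInstance, fun F hF => ?_⟩
      rw [TensorProduct.map_tmul, hF u (Submodule.mem_span_singleton_self u),
        TensorProduct.zero_tmul, map_zero]
  exact h (comul k V w)

theorem finDetermined_convL_right (m : X →ₗ[k] Y →ₗ[k] Z) (F : Λ →ₗ[k] X) (w : Λ) :
    FinDetermined (LinearMap.applyₗ w ∘ₗ convL m F) := by
  have h : ∀ t : Λ ⊗[k] Λ, ∃ W : Submodule k Λ, FiniteDimensional k W ∧ ∀ G : Λ →ₗ[k] Y,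
      (∀ w ∈ W, G w = 0) → TensorProduct.lift m (TensorProduct.map F G t) = 0 := by
    intro t
    induction t with
    | zero => exact ⟨⊥, inferInstance, fun F _ => by simp only [map_zero]⟩
    | add s t hs ht =>
      obtain ⟨W, _, h⟩ := hs
      obtain ⟨W', _, h'⟩ := ht
      refine ⟨W ⊔ W', inferInstance, fun G hG => ?_⟩
      rw [map_add, map_add, h G fun w hw => hG w (Submodule.mem_sup_left hw),
        h' G fun w hw => hG w (Submodule.mem_sup_right hw), add_zero]
    | tmul u v =>
      refine ⟨Submodule.span k {v}, inferInstance, fun G hG => ?_⟩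
      rw [TensorProduct.map_tmul, hG v (Submodule.mem_span_singleton_self v),
        TensorProduct.tmul_zero, map_zero]
  exact h (comul k V w)

end Conv

namespace SplitTate

variable {k : Type*} [Field k] {𝔤 : Type*} [LieRing 𝔤] [LieAlgebra k 𝔤] [UniformSpace 𝔤]
  [IsUniformAddGroup 𝔤] {D : SplitTate k 𝔤}
variable {M Y : Type*} [AddCommGroup M] [Module k M] [AddCommGroup Y] [Module k Y]

/-! ### The operations of the Lie algebroid on linear maps `Λ(𝔠) → 𝔟` -/

variable (D) in
/-- The derivation of `A`, as a linear transformation of the space of linear maps `Λ(𝔠) → 𝔟`. -/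
noncomputable def dAL : (D.Λ𝔠 →ₗ[k] D.𝔟) →ₗ[k] (D.Λ𝔠 →ₗ[k] D.𝔟) :=
  LinearMap.lcomp k D.𝔟 D.boundary -
    (convL D.μ₂).flip ExteriorAlgebra.ιInv ∘ₗ LinearMap.lcomp k D.𝔟 (parity k D.𝔠)

theorem dAL_apply (a : D.Λ𝔠 →ₗ[k] D.𝔟) :
    D.dAL a = a ∘ₗ D.boundary - conv D.μ₂ (a ∘ₗ parity k D.𝔠) ExteriorAlgebra.ιInv := rfl

theorem homDeg_comp_boundary {X : Type*} [AddCommGroup X] [Module k X] {p : ℤ}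
    {F : D.Λ𝔠 →ₗ[k] X} (hF : HomDeg p F) : HomDeg (p + 1) (F ∘ₗ D.boundary) :=
  hF.precomp fun t _ w => coderExt_scale _ t w

theorem homDeg_comp_parity {X : Type*} [AddCommGroup X] [Module k X] {p : ℤ}
    {F : D.Λ𝔠 →ₗ[k] X} (hF : HomDeg p F) : HomDeg p (F ∘ₗ parity k D.𝔠) := by
  have : F ∘ₗ parity k D.𝔠 = (-1 : k) ^ p • F := LinearMap.ext fun w => hF.parity w
  rw [this]
  exact hF.smul _

theorem homDeg_dAL {p : ℤ} {a : D.Λ𝔠 →ₗ[k] D.𝔟} (ha : HomDeg p a) : HomDeg (p + 1) (D.dAL a) :=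
  (homDeg_comp_boundary ha).sub ((homDeg_comp_parity ha).conv homDeg_ιInv)

theorem extendForm_dA [CharZero k] {p : ℕ} (a : D.A p) :
    extendForm (D.dA a) = D.dAL (extendForm a) := by
  have h := homDeg_dAL (homDeg_extendForm a)
  unfold dA
  exact extendForm_formPart h

theorem finDetermined_dAL (w : D.Λ𝔠) : FinDetermined (LinearMap.applyₗ w ∘ₗ D.dAL) := by
  have h2 := (finDetermined_convL_left D.μ₂ (ExteriorAlgebra.ιInv (R := k)) w).precomp
    (LinearMap.lcomp k D.𝔟 (parity k D.𝔠)) fun w => finDetermined_apply (parity k D.𝔠 w)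
  exact (finDetermined_apply (D.boundary w)).sub h2

variable (D) in
/-- The bracket of `A`, as a bilinear map on the space of linear maps `Λ(𝔠) → 𝔟`; the sign `s` is
`(-1) ^ (p q)` for elements of degrees `p` and `q`. -/
noncomputable def bracketL (s : k) : (D.Λ𝔠 →ₗ[k] D.𝔟) →ₗ[k] (D.Λ𝔠 →ₗ[k] D.𝔟) →ₗ[k]
    (D.Λ𝔠 →ₗ[k] D.𝔟) :=
  let P : (D.Λ𝔠 →ₗ[k] D.𝔟) →ₗ[k] (D.Λ𝔠 →ₗ[k] D.𝔟) →ₗ[k] (D.Λ𝔠 →ₗ[k] D.𝔟) :=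
    (LinearMap.llcomp k D.Λ𝔠 D.Λ𝔠 D.𝔟).flip ∘ₗ (convL D.actΛ).flip LinearMap.id
  convL (LieAlgebra.ad k D.𝔟 : D.𝔟 →ₗ[k] Module.End k D.𝔟) - P + s • P.flip

theorem bracketL_apply (s : k) (a b : D.Λ𝔠 →ₗ[k] D.𝔟) : D.bracketL s a b =
    conv (LieAlgebra.ad k D.𝔟 : D.𝔟 →ₗ[k] Module.End k D.𝔟) a b + D.derForm a b -
      s • D.derForm b a := by
  change conv _ a b - b ∘ₗ conv D.actΛ a LinearMap.id + s • (a ∘ₗ conv D.actΛ b LinearMap.id) =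
    conv _ a b + -(b ∘ₗ conv D.actΛ a LinearMap.id) - s • -(a ∘ₗ conv D.actΛ b LinearMap.id)
  rw [smul_neg, sub_neg_eq_add, sub_eq_add_neg]

theorem homDeg_derForm {X : Type*} [AddCommGroup X] [Module k X] {p q : ℤ} {a : D.Λ𝔠 →ₗ[k] D.𝔟}
    {f : D.Λ𝔠 →ₗ[k] X} (ha : HomDeg p a) (hf : HomDeg q f) : HomDeg (p + q) (D.derForm a f) := by
  refine HomDeg.neg ?_
  rw [add_comm]
  refine hf.precomp fun t ht w => ?_
  have h : ∀ (b : D.𝔟) (v : D.Λ𝔠), D.actΛ b (scale D.𝔠 t v) = scale D.𝔠 t (D.actΛ b v) :=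
    fun b v => derExt_scale (D.μ₁ b) t v
  rw [conv_apply, conv_apply, comul_scale]
  generalize comul k D.𝔠 w = s
  induction s with
  | zero => simp only [map_zero, smul_zero]
  | add a b ha hb => simp only [map_add, ha, hb, smul_add]
  | tmul u v =>
    simp only [TensorProduct.map_tmul, AlgHom.toLinearMap_apply, TensorProduct.lift.tmul,
      LinearMap.id_apply]
    rw [ha t ht, h, map_smul, LinearMap.smul_apply, map_smul]

theorem homDeg_bracketL {p q : ℤ} {a b : D.Λ𝔠 →ₗ[k] D.𝔟} (ha : HomDeg p a) (hb : HomDeg q b)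
    (s : k) : HomDeg (p + q) (D.bracketL s a b) := by
  rw [bracketL_apply]
  refine HomDeg.sub (HomDeg.add (ha.conv hb) (homDeg_derForm ha hb)) (HomDeg.smul s ?_)
  rw [add_comm]
  exact homDeg_derForm hb ha

theorem extendForm_bracketA [CharZero k] {p q : ℕ} (a : D.A p) (b : D.A q) :
    extendForm (D.bracketA a b) = D.bracketL ((-1) ^ (p * q)) (extendForm a) (extendForm b) := by
  have h : HomDeg ((p + q : ℕ) : ℤ) (D.bracketL ((-1) ^ (p * q)) (extendForm a) (extendForm b)) := by
    rw [Nat.cast_add]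
    exact homDeg_bracketL (homDeg_extendForm a) (homDeg_extendForm b) _
  rw [← extendForm_formPart h, bracketL_apply]
  rfl

theorem finDetermined_bracketL_left (s : k) (b : D.Λ𝔠 →ₗ[k] D.𝔟) (w : D.Λ𝔠) :
    FinDetermined (LinearMap.applyₗ w ∘ₗ (D.bracketL s).flip b) := by
  have h1 := finDetermined_convL_left (LieAlgebra.ad k D.𝔟 : D.𝔟 →ₗ[k] Module.End k D.𝔟) b w
  have h2 := (finDetermined_convL_left D.actΛ (LinearMap.id (R := k) (M := D.Λ𝔠)) w).postcomp b
  have h3 := (finDetermined_apply (B := D.𝔟) (conv D.actΛ b LinearMap.id w)).smul s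
  exact (h1.sub h2).add h3

theorem finDetermined_bracketL_right (s : k) (a : D.Λ𝔠 →ₗ[k] D.𝔟) (w : D.Λ𝔠) :
    FinDetermined (LinearMap.applyₗ w ∘ₗ D.bracketL s a) := by
  have h1 := finDetermined_convL_right (LieAlgebra.ad k D.𝔟 : D.𝔟 →ₗ[k] Module.End k D.𝔟) a w
  have h2 := finDetermined_apply (B := D.𝔟) (conv D.actΛ a LinearMap.id w)
  have h3 := ((finDetermined_convL_left D.actΛ (LinearMap.id (R := k) (M := D.Λ𝔠)) w).postcomp
    a).smul s
  exact (h1.sub h2).add h3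

section LeftAction

variable (D M) [LieRingModule D.Sharp M] [LieModule k D.Sharp M]

/-- The divergence, as a linear map. -/
noncomputable def divergenceL : (D.Λ𝔠 →ₗ[k] D.𝔟) →ₗ[k] (D.Λ𝔠 →ₗ[k] k) where
  toFun := D.divergence
  map_add' a a' := LinearMap.ext fun w => by
    change finTrace (D.actΛ.flip w ∘ₗ (a + a')) = finTrace (D.actΛ.flip w ∘ₗ a) + finTrace _
    rw [LinearMap.comp_add, finTrace_add _ _ (D.finite_range_actΛ_comp a w)
      (D.finite_range_actΛ_comp a' w)]
  map_smul' t a := LinearMap.ext fun w => by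
    change finTrace (D.actΛ.flip w ∘ₗ (t • a)) = t * finTrace (D.actΛ.flip w ∘ₗ a)
    rw [LinearMap.comp_smul, finTrace_smul _ _ (D.finite_range_actΛ_comp a w)]

variable {D}

theorem divergence_smulRight (r : D.Λ𝔠 →ₗ[k] k) (b : D.𝔟) :
    D.divergence (r.smulRight b) = r ∘ₗ D.actΛ b := LinearMap.ext fun w => by
  have h := finTrace_sum_smulRight (fun _ : Fin 1 => r) fun _ => D.actΛ b w
  rw [Fin.sum_univ_one, Fin.sum_univ_one] at h
  refine Eq.trans ?_ h
  change finTrace (D.actΛ.flip w ∘ₗ r.smulRight b) = _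
  congr 1
  refine LinearMap.ext fun v => ?_
  exact map_smul (D.actΛ.flip w) (r v) b

theorem finDetermined_divergenceL (w : D.Λ𝔠) :
    FinDetermined (LinearMap.applyₗ w ∘ₗ D.divergenceL) := by
  have := D.finite_range_actΛ w
  refine ⟨LinearMap.range (D.actΛ.flip w), this, fun a ha => ?_⟩
  refine finTrace_eq_zero_of_range_le (D.actΛ.flip w ∘ₗ a) (LinearMap.range (D.actΛ.flip w))
    (fun v => ⟨a v, rfl⟩) fun v hv => ?_
  rw [LinearMap.comp_apply, ha v hv, map_zero]

variable (D)

/-- The left action of `A` on `M ⊗ Λ(𝔠)`, as a linear map. -/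
noncomputable def leftActL (n : D.N M) : (D.Λ𝔠 →ₗ[k] D.𝔟) →ₗ[k] D.N M where
  toFun a := D.leftAct M a n
  map_add' a a' := by
    have h := LinearMap.congr_fun (D.divergenceL.map_add a a')
    have h1 : D.contractN M (D.divergence (a + a')) n =
        D.contractN M (D.divergence a) n + D.contractN M (D.divergence a') n := by
      have : D.divergence (a + a') = D.divergence a + D.divergence a' := D.divergenceL.map_add a a'
      rw [this]
      change LinearMap.lTensor M (convL _ _ _) n = _
      rw [map_add, LinearMap.lTensor_add]
      rfl
    have h2 : D.rightAct M (a + a') n = D.rightAct M a n + D.rightAct M a' n := by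
      change TensorProduct.lift (LinearMap.flip (D.act𝔟N M ∘ₗ (a + a'))) _ = _
      have : LinearMap.flip (D.act𝔟N M ∘ₗ (a + a')) = LinearMap.flip (D.act𝔟N M ∘ₗ a) +
          LinearMap.flip (D.act𝔟N M ∘ₗ a') := by
        rw [LinearMap.comp_add]
        rfl
      rw [this]
      generalize LinearMap.lTensor M (comul k D.𝔠) n = z
      change TensorProduct.lift.equiv _ _ _ _ _ _ = _
      rw [map_add]
      rfl
    change D.rightAct M (a + a') n + _ = D.rightAct M a n + _ + (D.rightAct M a' n + _)
    rw [h1, h2]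
    abel
  map_smul' t a := by
    have h1 : D.contractN M (D.divergence (t • a)) n = t • D.contractN M (D.divergence a) n := by
      have : D.divergence (t • a) = t • D.divergence a := D.divergenceL.map_smul t a
      rw [this]
      change LinearMap.lTensor M (convL _ _ _) n = _
      rw [map_smul, LinearMap.lTensor_smul]
      rfl
    have h2 : D.rightAct M (t • a) n = t • D.rightAct M a n := by
      change TensorProduct.lift (LinearMap.flip (D.act𝔟N M ∘ₗ (t • a))) _ = _
      have : LinearMap.flip (D.act𝔟N M ∘ₗ (t • a)) = t • LinearMap.flip (D.act𝔟N M ∘ₗ a) := by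
        rw [LinearMap.comp_smul]
        rfl
      rw [this]
      change TensorProduct.lift.equiv _ _ _ _ _ _ = _
      rw [map_smul]
      rfl
    change D.rightAct M (t • a) n + _ = t • (D.rightAct M a n + _)
    rw [h1, h2, smul_add]

end LeftAction

end SplitTate

end SemiInf

namespace SemiInf

namespace SplitTate

variable {k : Type*} [Field k] {𝔤 : Type*} [LieRing 𝔤] [LieAlgebra k 𝔤] [UniformSpace 𝔤]
  [IsUniformAddGroup 𝔤] {D : SplitTate k 𝔤}
variable {M Y : Type*} [AddCommGroup M] [Module k M] [AddCommGroup Y] [Module k Y]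

namespace CliffordModule

variable (C : D.CliffordModule M Y)

theorem jj_mul_ii_par {p : ℕ} {a : D.Λ𝔠 →ₗ[k] D.𝔟} (ha : Par p a) (b : D.𝔟) :
    C.jj a * C.ii b = (-1 : k) ^ (p + 1) • (C.ii b * C.jj a) := by
  rw [jj_mul_ii, ha.comp_parity, map_smul, mul_smul_comm, pow_succ, mul_neg_one, neg_smul]

theorem jj_mul_cc {p q : ℕ} {a : D.Λ𝔠 →ₗ[k] D.𝔟} (ha : Par q a) {r : D.Λ𝔠 →ₗ[k] k}
    (hr : Par p r) : C.jj a * C.cc r = (-1 : k) ^ ((q + 1) * p) • (C.cc r * C.jj a) := by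
  refine C.cc_supercomm (fun ξ => ?_) hr
  have h : (D.annDual ξ).1 ∘ₗ D.in𝔟 ∘ₗ a = 0 := LinearMap.ext fun w => D.annDual_coe ξ (a w)
  have h0 : C.cc (0 : D.Λ𝔠 →ₗ[k] k) = 0 := by
    have := C.cc_smul 0 0
    rwa [zero_smul, zero_smul] at this
  rw [jj_mul_ee, h, h0, zero_sub, ha.comp_parity, map_smul, mul_smul_comm, pow_succ, mul_neg_one,
    neg_smul]

theorem jj_bracketL (s' : k) (r s : D.Λ𝔠 →ₗ[k] k) (x y : D.𝔟) :
    C.jj (D.bracketL s' (r.smulRight x) (s.smulRight y)) =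
      C.cc r * C.cc s * C.ii ⁅(x : 𝔤), (y : 𝔤)⁆ - C.cc r * C.cc (s ∘ₗ D.actΛ x) * C.ii y +
        s' • (C.cc s * C.cc (r ∘ₗ D.actΛ y) * C.ii x) := by
  have h1 : conv (LieAlgebra.ad k D.𝔟 : D.𝔟 →ₗ[k] Module.End k D.𝔟) (r.smulRight x) (s.smulRight y) =
      (conv (LinearMap.mul k k) r s).smulRight ⁅x, y⁆ := by
    refine LinearMap.ext fun w => ?_
    rw [LinearMap.smulRight_apply, conv_apply, conv_apply]
    generalize comul k D.𝔠 w = t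
    induction t with
    | zero => simp only [map_zero, zero_smul]
    | add a b ha hb => simp only [map_add, add_smul, ha, hb]
    | tmul u v =>
      change ⁅r u • x, s v • y⁆ = (r u * s v) • ⁅x, y⁆
      rw [smul_lie, lie_smul, smul_smul]
  have h2 : ∀ (r s : D.Λ𝔠 →ₗ[k] k) (x y : D.𝔟), D.derForm (r.smulRight x) (s.smulRight y) =
      -(conv (LinearMap.mul k k) r (s ∘ₗ D.actΛ x)).smulRight y := fun r s x y => by
    refine LinearMap.ext fun w => ?_
    change -(s (conv D.actΛ (r.smulRight x) LinearMap.id w) • y) = 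
      -(conv (LinearMap.mul k k) r (s ∘ₗ D.actΛ x) w • y)
    rw [conv_apply, conv_apply]
    congr 2
    generalize comul k D.𝔠 w = t
    induction t with
    | zero => simp only [map_zero]
    | add a b ha hb => simp only [map_add, ha, hb]
    | tmul u v =>
      change s (D.actΛ (r u • x) v) = r u * s (D.actΛ x v)
      rw [map_smul, LinearMap.smul_apply, map_smul, smul_eq_mul]
  rw [bracketL_apply, h1, h2, h2, smul_neg, sub_neg_eq_add, map_add, map_add, map_neg, map_smul,
    C.jj_smulRight, C.jj_smulRight, C.jj_smulRight, C.cc_cc, C.cc_cc, C.cc_cc, ← sub_eq_add_neg]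
  rfl

end CliffordModule

section LeftAction

variable [LieRingModule D.Sharp M] [LieModule k D.Sharp M]

theorem finDetermined_slotAct {B : Type*} [AddCommGroup B] [Module k B]
    (T : B →ₗ[k] Module.End k (D.N M)) (n : D.N M) : ∃ W : Submodule k D.Λ𝔠, FiniteDimensional k W ∧
      ∀ a : D.Λ𝔠 →ₗ[k] B, (∀ w ∈ W, a w = 0) → D.slotAct M (T ∘ₗ a) n = 0 := by
  have h : ∀ t : D.N M ⊗[k] D.Λ𝔠, ∃ W : Submodule k D.Λ𝔠, FiniteDimensional k W ∧
      ∀ a : D.Λ𝔠 →ₗ[k] B, (∀ w ∈ W, a w = 0) → TensorProduct.lift (T ∘ₗ a).flip t = 0 := by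
    intro t
    induction t using TensorProduct.induction_on with
    | zero => exact ⟨⊥, inferInstance, fun a _ => map_zero _⟩
    | add s t hs ht =>
      obtain ⟨W, _, h⟩ := hs
      obtain ⟨W', _, h'⟩ := ht
      refine ⟨W ⊔ W', inferInstance, fun a ha => ?_⟩
      rw [map_add, h a fun w hw => ha w (Submodule.mem_sup_left hw),
        h' a fun w hw => ha w (Submodule.mem_sup_right hw), add_zero]
    | tmul n w =>
      refine ⟨Submodule.span k {w}, inferInstance, fun a ha => ?_⟩
      change T (a w) n = 0
      rw [ha w (Submodule.mem_span_singleton_self w), map_zero, LinearMap.zero_apply]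
  exact h _

theorem finDetermined_leftActL (n : D.N M) : FinDetermined (D.leftActL M n) := by
  obtain ⟨W, _, h⟩ := finDetermined_slotAct (D.act𝔟N M) n
  obtain ⟨W', _, h'⟩ := finDetermined_slotAct (M := M) (D := D)
    (LinearMap.toSpanSingleton k (Module.End k (D.N M)) 1) n
  have hd : ∀ w, FinDetermined (LinearMap.applyₗ w ∘ₗ D.divergenceL) := finDetermined_divergenceL
  choose U hU hU' using hd
  let b := Module.finBasis k W'
  refine ⟨W ⊔ ⨆ i, U (b i), inferInstance, fun a ha => ?_⟩
  have h1 : D.divergence a ∘ₗ W'.subtype = 0 := b.ext fun i => hU' _ a fun w hw =>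
    ha w (Submodule.mem_sup_right (Submodule.mem_iSup_of_mem i hw))
  have h2 := h' (D.divergence a) fun w hw => LinearMap.congr_fun h1 ⟨w, hw⟩
  change D.slotAct M (D.act𝔟N M ∘ₗ a) n + D.contractN M (D.divergence a) n = 0
  rw [h a fun w hw => ha w (Submodule.mem_sup_left hw), contractN_eq_slotAct, zero_add]
  exact h2

theorem leftAct_smulRight (r : D.Λ𝔠 →ₗ[k] k) (b : D.𝔟) (n : D.N M) :
    D.leftAct M (r.smulRight b) n = D.contractN M r (D.act𝔟N M b n) := by
  have h1 : D.rightAct M (r.smulRight b) n = D.act𝔟N M b (D.contractN M r n) := by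
    rw [contractN_eq_slotAct]
    change TensorProduct.lift _ _ = D.act𝔟N M b (TensorProduct.lift _ _)
    generalize (TensorProduct.assoc k M D.Λ𝔠 D.Λ𝔠).symm.toLinearMap
      (LinearMap.lTensor M (comul k D.𝔠) n) = t
    induction t using TensorProduct.induction_on with
    | zero => simp only [map_zero]
    | add a b ha hb => simp only [map_add, ha, hb]
    | tmul n w =>
      change D.act𝔟N M (r w • b) n = D.act𝔟N M b (r w • n)
      rw [map_smul, map_smul, LinearMap.smul_apply]
  rw [leftAct, LinearMap.add_apply, h1, divergence_smulRight]
  clear h1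
  induction n using TensorProduct.induction_on with
  | zero => simp only [map_zero, add_zero]
  | add s t hs ht =>
    simp only [map_add] at hs ht ⊢
    rw [add_add_add_comm, hs, ht]
  | tmul m w =>
    simp only [contractN_eq, LinearMap.lTensor_tmul]
    change D.actM M b m ⊗ₜ[k] contr r w + m ⊗ₜ[k] derExt (D.μ₁ b) (contr r w) +
        m ⊗ₜ[k] contr (r ∘ₗ derExt (D.μ₁ b)) w =
      LinearMap.lTensor M (contr r) (D.actM M b m ⊗ₜ[k] w + m ⊗ₜ[k] derExt (D.μ₁ b) w)
    rw [map_add, LinearMap.lTensor_tmul, LinearMap.lTensor_tmul, contr_derExt, TensorProduct.tmul_add,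
      add_assoc]

end LeftAction

namespace MatterAction

variable [LieRingModule D.Sharp M] [LieModule k D.Sharp M]
variable {C : D.CliffordModule M Y} (X : MatterAction C) [CharZero k]

theorem ev_defect (hM : D.IsDiscreteLevelOne M) {p : ℕ} {r : D.Λ𝔠 →ₗ[k] k} (hr : Par p r) (u : Y) :
    C.ev (X.defect p r u) = 0 := by
  have hA : C.slotC (X.act ∘ₗ D.sec) * C.cc r = (-1 : k) ^ p • (C.cc r * C.slotC (X.act ∘ₗ D.sec)) := by
    have := C.cc_supercomm (q := 1) (T := C.slotC (X.act ∘ₗ D.sec)) (fun ξ => ?_) hr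
    · rwa [one_mul] at this
    · rw [C.slotC_mul_ee, C.mul_slotC, pow_one, neg_one_smul]
      congr 2
      exact LinearMap.ext fun c => LinearMap.ext fun u => X.act_ee _ _ u
  have hA' := X.ev_slotC_act (C.cc r u)
  rw [← Module.End.mul_apply, hA, LinearMap.smul_apply, Module.End.mul_apply, map_smul, C.ev_cc,
    ev_slotC_act, C.ev_cc] at hA'
  have hB := LinearMap.congr_fun (C.jj_mul_cc (homDeg_extendForm D.curvature).par hr) u
  have h3 : (-1 : k) ^ ((2 + 1) * p) = (-1) ^ p := by rw [pow_mul]; norm_num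
  rw [h3] at hB
  have hN : ∀ n, LinearMap.lTensor M (D.boundary ∘ₗ parity k D.𝔠) (D.contractN M r n) =
      (-1 : k) ^ p • D.contractN M r (LinearMap.lTensor M (D.boundary ∘ₗ parity k D.𝔠) n) +
        D.contractN M (r ∘ₗ D.boundary) n := fun n => by
    clear hA'
    induction n using TensorProduct.induction_on with
    | zero => simp only [map_zero, add_zero, smul_zero]
    | add s t hs ht =>
      simp only [map_add, smul_add] at hs ht ⊢
      rw [hs, ht]
      abel
    | tmul m w =>
      simp only [contractN_eq, LinearMap.lTensor_tmul, LinearMap.comp_apply, boundary]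
      rw [coderExt_parity_contr hr, TensorProduct.tmul_add, TensorProduct.tmul_smul]
  change C.ev (X.brst (C.cc r u) - (-1 : k) ^ p • C.cc r (X.brst u) - C.cc (r ∘ₗ D.boundary) u) = 0
  rw [map_sub, map_sub, map_smul, X.ev_brst hM, C.ev_cc, C.ev_cc, C.ev_cc, X.ev_brst hM,
    ← Module.End.mul_apply (C.jj _), hB, LinearMap.smul_apply, Module.End.mul_apply, map_smul, C.ev_cc,
    dN, LinearMap.add_apply, LinearMap.add_apply, ← hA', hN, map_sub, map_add, smul_sub, smul_add]
  abel

/-- The operator that corresponds to the action of `a` by Lie derivatives. -/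
noncomputable def lam (p : ℕ) : (D.Λ𝔠 →ₗ[k] D.𝔟) →ₗ[k] Module.End k Y :=
  (-1 : k) ^ p • (LinearMap.mulLeft k X.brst ∘ₗ C.jj) + LinearMap.mulRight k X.brst ∘ₗ C.jj -
    (-1 : k) ^ p • (C.jj ∘ₗ D.dAL)

theorem lam_apply (p : ℕ) (a : D.Λ𝔠 →ₗ[k] D.𝔟) : X.lam p a =
    (-1 : k) ^ p • (X.brst * C.jj a) + C.jj a * X.brst - (-1 : k) ^ p • C.jj (D.dAL a) := rfl

theorem finDetermined_lam (p : ℕ) (u : Y) : FinDetermined (LinearMap.applyₗ u ∘ₗ X.lam p) :=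
  ((((C.finDetermined_jj u).postcomp X.brst).smul ((-1 : k) ^ p)).add
    (C.finDetermined_jj (X.brst u))).sub
    (((C.finDetermined_jj u).precomp D.dAL finDetermined_dAL).smul ((-1 : k) ^ p))

/-- The action on `Y` of an element of `𝔟`, as an element of the Lie algebroid. -/
noncomputable def lam𝔟 (b : D.𝔟) : Module.End k Y :=
  X.tot b + C.jj (D.μ₂ b ∘ₗ ExteriorAlgebra.ιInv)

theorem lam_smulRight (hM : D.IsDiscreteLevelOne M) {p : ℕ} {r : D.Λ𝔠 →ₗ[k] k} (hr : Par p r)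
    (b : D.𝔟) : X.lam p (r.smulRight b) =
      (-1 : k) ^ p • (X.defect p r * C.ii b) + C.cc r * X.lam𝔟 b := by
  have h1 : D.dAL (r.smulRight b) = (r ∘ₗ D.boundary).smulRight b -
      (-1 : k) ^ p • conv (LinearMap.lsmul k D.𝔟) r (D.μ₂ b ∘ₗ ExteriorAlgebra.ιInv) := by
    refine LinearMap.ext fun w => ?_
    rw [dAL_apply, LinearMap.sub_apply, LinearMap.sub_apply, LinearMap.smul_apply,
      (hr.smulRight b).comp_parity, conv_apply, conv_apply]
    congr 1
    generalize comul k D.𝔠 w = t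
    induction t with
    | zero => simp only [map_zero, smul_zero]
    | add a b ha hb => simp only [map_add, smul_add, ha, hb]
    | tmul u v =>
      change D.μ₂ ((-1 : k) ^ p • r u • b) (ExteriorAlgebra.ιInv v) =
        (-1 : k) ^ p • r u • D.μ₂ b (ExteriorAlgebra.ιInv v)
      rw [map_smul, map_smul, LinearMap.smul_apply, LinearMap.smul_apply]
  rw [lam_apply, h1, map_sub, map_smul, ← C.cc_mul_jj, C.jj_smulRight, C.jj_smulRight, defect, lam𝔟,
    mul_add, ← X.brst_cartan hM b, sub_mul, sub_mul, mul_add, smul_sub, smul_sub, smul_sub, smul_smul,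
    neg_one_pow_mul_self, one_smul, smul_mul_assoc, smul_smul, neg_one_pow_mul_self, one_smul]
  simp only [mul_assoc]
  abel

theorem ev_lam𝔟 (b : D.𝔟) (u : Y) : C.ev (X.lam𝔟 b u) = D.act𝔟N M b (C.ev u) := by
  change C.ev (X.act b u + C.theta b u + _) = LinearMap.rTensor D.Λ𝔠 (D.actM M b) (C.ev u) +
    LinearMap.lTensor M (derExt (D.μ₁ b)) (C.ev u)
  rw [map_add, map_add, X.ev_act, C.ev_theta, add_assoc]
  congr 1
  exact sub_add_cancel _ _

theorem ev_lam (hM : D.IsDiscreteLevelOne M) {p : ℕ} {a : D.Λ𝔠 →ₗ[k] D.𝔟} (ha : Par p a) (u : Y) :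
    C.ev (X.lam p a u) = D.leftAct M a (C.ev u) := by
  have := (((X.finDetermined_lam p u).postcomp C.ev).sub
    (finDetermined_leftActL (C.ev u))).eq_zero (neg_one_pow_mul_self p) (fun r b hr => ?_) ha
  · exact sub_eq_zero.1 this
  · change C.ev (X.lam p (r.smulRight b) u) - D.leftAct M (r.smulRight b) (C.ev u) = 0
    have hr' : Par p r := hr
    rw [X.lam_smulRight hM hr', leftAct_smulRight, LinearMap.add_apply, LinearMap.smul_apply, map_add,
      map_smul, Module.End.mul_apply, X.ev_defect hM hr', Module.End.mul_apply, C.ev_cc, ev_lam𝔟,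
      smul_zero, zero_add, sub_self]

theorem lam𝔟_ii (b y : D.𝔟) : X.lam𝔟 b * C.ii y = C.ii ⁅(b : 𝔤), (y : 𝔤)⁆ + C.ii y * X.lam𝔟 b := by
  have h1 : X.tot b * C.ii y = C.ii ⁅(b : 𝔤), (y : 𝔤)⁆ + C.ii y * X.tot b :=
    LinearMap.ext fun u => X.tot_ii b y u
  have h2 := C.jj_mul_ii_par (par_ιInv.postcomp (D.μ₂ b)) y
  rw [lam𝔟, add_mul, mul_add, h1, h2]
  norm_num
  abel

theorem lam𝔟_cc (b : D.𝔟) {q : ℕ} {s : D.Λ𝔠 →ₗ[k] k} (hs : Par q s) :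
    X.lam𝔟 b * C.cc s = C.cc s * X.lam𝔟 b - C.cc (s ∘ₗ D.actΛ b) := by
  have h2 := C.jj_mul_cc (par_ιInv.postcomp (D.μ₂ b)) hs
  rw [pow_mul, show (-1 : k) ^ (1 + 1) = 1 by norm_num, one_pow, one_smul] at h2
  rw [lam𝔟, add_mul, mul_add, h2, X.cc_tot]
  abel

theorem lam_mul_jj_smulRight (hM : D.IsDiscreteLevelOne M) {p q : ℕ} {r s : D.Λ𝔠 →ₗ[k] k}
    (hr : Par p r) (hs : Par q s) (x y : D.𝔟) :
    X.lam p (r.smulRight x) * C.jj (s.smulRight y) =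
      (-1 : k) ^ (p * (q + 1)) • (C.jj (s.smulRight y) * X.lam p (r.smulRight x)) +
        C.jj (D.bracketL ((-1) ^ (p * q)) (r.smulRight x) (s.smulRight y)) := by
  have hp2 := neg_one_pow_mul_self (k := k) p
  have hq2 := neg_one_pow_mul_self (k := k) q
  have hpq2 := neg_one_pow_mul_self (k := k) (p * q)
  have hxy : C.ii (x : 𝔤) * C.ii (y : 𝔤) = -(C.ii (y : 𝔤) * C.ii (x : 𝔤)) :=
    LinearMap.ext fun u => C.ii_ii _ _ u
  have hrs : C.cc s * C.cc r = (-1 : k) ^ (q * p) • (C.cc r * C.cc s) :=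
    C.cc_supercomm (fun ξ => C.cc_ee_par hs _) hr
  have e1 : X.defect p r * C.ii x * (C.cc s * C.ii y) =
      -((-1 : k) ^ (p * q) • (C.cc s * X.defect p r * C.ii y * C.ii x)) := by
    have h := C.cc_ii_par hs x
    have h' : C.ii (x : 𝔤) * C.cc s = (-1 : k) ^ q • (C.cc s * C.ii (x : 𝔤)) := by
      rw [h, smul_smul, hq2, one_smul]
    rw [mul_assoc, ← mul_assoc (C.ii (x : 𝔤)), h', smul_mul_assoc, mul_smul_comm, mul_assoc (C.cc s),
      hxy, mul_neg, mul_neg, ← mul_assoc, X.defect_cc hM hr hs, smul_neg, smul_mul_assoc, smul_smul,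
      add_mul, one_mul, pow_add, mul_left_comm, hq2, mul_one, mul_assoc, mul_assoc, mul_assoc]
  have e2 : C.cc r * X.lam𝔟 x * (C.cc s * C.ii y) = C.cc r * C.cc s * C.ii ⁅(x : 𝔤), (y : 𝔤)⁆ +
      C.cc r * C.cc s * C.ii y * X.lam𝔟 x - C.cc r * C.cc (s ∘ₗ D.actΛ x) * C.ii y := by
    rw [mul_assoc, ← mul_assoc (X.lam𝔟 x), X.lam𝔟_cc x hs, sub_mul, mul_assoc (C.cc s), X.lam𝔟_ii,
      mul_sub, mul_add, mul_add]
    simp only [mul_assoc]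
  have e3 : C.cc s * C.ii y * (X.defect p r * C.ii x) =
      -((-1 : k) ^ p • (C.cc s * X.defect p r * C.ii y * C.ii x)) -
        C.cc s * C.cc (r ∘ₗ D.actΛ y) * C.ii x := by
    have h := X.defect_ii hM hr y
    have h' : C.ii (y : 𝔤) * X.defect p r = -((-1 : k) ^ p • (X.defect p r * C.ii y)) -
        C.cc (r ∘ₗ D.actΛ y) := by
      have := congrArg (fun T => (-1 : k) ^ p • T) h
      simp only [smul_add, smul_neg, smul_smul, hp2, one_smul] at this
      rw [sub_eq_add_neg, ← this]
      abel
    rw [mul_assoc, ← mul_assoc (C.ii (y : 𝔤)), h', sub_mul, mul_sub, neg_mul, mul_neg, smul_mul_assoc,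
      mul_smul_comm]
    simp only [mul_assoc]
  have e4 : C.cc s * C.ii y * (C.cc r * X.lam𝔟 x) =
      (-1 : k) ^ p • (-1 : k) ^ (p * q) • (C.cc r * C.cc s * C.ii y * X.lam𝔟 x) := by
    have h := C.cc_ii_par hr y
    have h' : C.ii (y : 𝔤) * C.cc r = (-1 : k) ^ p • (C.cc r * C.ii (y : 𝔤)) := by
      rw [h, smul_smul, hp2, one_smul]
    rw [mul_assoc, ← mul_assoc (C.ii (y : 𝔤)), h', smul_mul_assoc, mul_smul_comm, ← mul_assoc,
      ← mul_assoc, hrs, mul_comm q p, smul_mul_assoc, smul_mul_assoc]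
  rw [X.lam_smulRight hM hr, C.jj_smulRight, C.jj_bracketL, mul_add p q 1, mul_one, pow_add,
    add_mul, mul_add, smul_mul_assoc, mul_smul_comm, e1, e2, e3, e4]
  generalize (-1 : k) ^ p = P at hp2 ⊢
  generalize (-1 : k) ^ (p * q) = Q at hpq2 ⊢
  match_scalars
  · linear_combination (Q * P) * hp2
  · rfl
  · linear_combination -(Q * Q) * hp2 - hpq2
  · rfl
  · linear_combination Q * hp2

theorem lam_mul_jj (hM : D.IsDiscreteLevelOne M) {p q : ℕ} {a b : D.Λ𝔠 →ₗ[k] D.𝔟}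
    (ha : Par p a) (hb : Par q b) : X.lam p a * C.jj b =
      (-1 : k) ^ (p * (q + 1)) • (C.jj b * X.lam p a) +
        C.jj (D.bracketL ((-1) ^ (p * q)) a b) := by
  refine LinearMap.ext fun u => ?_
  have h1 : ∀ (r : D.Λ𝔠 →ₗ[k] k) (x : D.𝔟), Par p r → (X.lam p (r.smulRight x) * C.jj b) u =
      ((-1 : k) ^ (p * (q + 1)) • (C.jj b * X.lam p (r.smulRight x)) +
        C.jj (D.bracketL ((-1) ^ (p * q)) (r.smulRight x) b)) u := fun r x hr => by
    have := ((((C.finDetermined_jj u).postcomp (X.lam p (r.smulRight x))).sub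
      ((C.finDetermined_jj (X.lam p (r.smulRight x) u)).smul ((-1 : k) ^ (p * (q + 1))))).sub
      ((C.finDetermined_jj u).precomp (D.bracketL ((-1) ^ (p * q)) (r.smulRight x))
        (finDetermined_bracketL_right _ _))).eq_zero (neg_one_pow_mul_self q) (fun s y hs => ?_) hb
    · exact (sub_eq_iff_eq_add.1 (sub_eq_zero.1 this)).trans (add_comm _ _)
    · have := LinearMap.congr_fun (X.lam_mul_jj_smulRight hM hr hs x y) u
      exact sub_eq_zero.2 (sub_eq_iff_eq_add.2 (this.trans (add_comm _ _)))
  have := ((((X.finDetermined_lam p (C.jj b u))).sub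
      (((X.finDetermined_lam p u).postcomp (C.jj b)).smul ((-1 : k) ^ (p * (q + 1))))).sub
      ((C.finDetermined_jj u).precomp ((D.bracketL ((-1) ^ (p * q))).flip b)
        (finDetermined_bracketL_left _ _))).eq_zero (neg_one_pow_mul_self p) (fun r x hr => ?_) ha
  · exact (sub_eq_iff_eq_add.1 (sub_eq_zero.1 this)).trans (add_comm _ _)
  · exact sub_eq_zero.2 (sub_eq_iff_eq_add.2 ((h1 r x hr).trans (add_comm _ _)))

end MatterAction

end SplitTate

end SemiInf

namespace SemiInf

theorem neg_one_zpow_congr {k : Type*} [Field k] {m n : ℤ} (h : Even (m - n)) :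
    (-1 : k) ^ m = (-1) ^ n := by
  have h1 : (-1 : k) ≠ 0 := neg_ne_zero.2 one_ne_zero
  rw [← sub_add_cancel m n, zpow_add₀ h1, h.neg_one_zpow, one_mul]

theorem neg_neg_one_zpow {k : Type*} [Field k] (m : ℤ) : -(-1 : k) ^ m = (-1) ^ (m + 1) := by
  rw [zpow_add_one₀ (neg_ne_zero.2 one_ne_zero), mul_neg_one]

theorem neg_one_zpow_mul {k : Type*} [Field k] (m n : ℤ) :
    (-1 : k) ^ m * (-1) ^ n = (-1) ^ (m + n) :=
  (zpow_add₀ (neg_ne_zero.2 one_ne_zero) m n).symm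

theorem neg_one_pow_eq_zpow {k : Type*} [Field k] (m : ℕ) : (-1 : k) ^ m = (-1) ^ (m : ℤ) :=
  (zpow_natCast _ _).symm

namespace SplitTate

variable {k : Type*} [Field k] {𝔤 : Type*} [LieRing 𝔤] [LieAlgebra k 𝔤] [UniformSpace 𝔤]
  [IsUniformAddGroup 𝔤] {D : SplitTate k 𝔤}
variable {M Y : Type*} [AddCommGroup M] [Module k M] [AddCommGroup Y] [Module k Y]

section Recursion

variable [LieRingModule D.Sharp M] [LieModule k D.Sharp M]

theorem differential_apply (n : ℤ) (φ : D.PreCochain M) (l : List D.HomA) :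
    D.differential M n φ l =
    (∑ i : Fin l.length,
      (-1 : k) ^ ((i : ℤ) + 1 + l[i].1 * (n - (l.length - 1) + D.degSum (l.take i))) •
        D.leftAct M (extendForm l[i].2) (φ (l.eraseIdx i))) +
    (∑ i : Fin l.length, ∑ j ∈ Finset.Ioi i,
      (-1 : k) ^ ((i : ℤ) + j + 1 + l[i].1 * D.degSum (l.take i) +
          l[j].1 * (D.degSum (l.take j) - l[i].1)) •
        φ (⟨l[i].1 + l[j].1, D.bracketA l[i].2 l[j].2⟩ :: (l.eraseIdx j).eraseIdx i)) +
    (-1 : k) ^ l.length • (D.dN M (φ l) -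
      ∑ i : Fin l.length, (-1 : k) ^ (n - l.length + D.degSum (l.take i)) •
        φ (l.set i ⟨l[i].1 + 1, D.dA l[i].2⟩)) + φ (⟨2, D.curvature⟩ :: l) := by
  simp only [differential, d₁, d₂, LinearMap.add_apply, Pi.add_apply, LinearMap.pi_apply,
    LinearMap.smul_apply, LinearMap.sub_apply, LinearMap.sum_apply, LinearMap.comp_apply,
    LinearMap.proj_apply]

variable (D M) in
/-- The Lie derivative along `a` of cochains of degree `n`. -/
noncomputable def lieDer (n : ℤ) (a : D.HomA) (φ : D.PreCochain M) : D.PreCochain M := fun l =>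
  (-1 : k) ^ (1 + a.1 * (n - l.length)) • D.leftAct M (extendForm a.2) (φ l) +
    ∑ j : Fin l.length, (-1 : k) ^ ((j : ℤ) + l[j].1 * D.degSum (l.take j)) •
      φ (⟨a.1 + l[j].1, D.bracketA a.2 l[j].2⟩ :: l.eraseIdx j)

theorem degSum_cons (a : D.HomA) (l : List D.HomA) : D.degSum (a :: l) = a.1 + D.degSum l := by
  rw [degSum, List.map_cons, List.sum_cons]
  rfl

theorem differential_cons {φ : D.PreCochain M} (hφ : ∀ (a b : D.HomA) (l : List D.HomA),
    φ (a :: b :: l) = -(-1 : k) ^ (a.1 * b.1) • φ (b :: a :: l)) (n : ℤ) (a : D.HomA)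
    (l : List D.HomA) : D.differential M n φ (a :: l) =
      -D.differential M (n + a.1 - 1) (fun l => φ (a :: l)) l + D.lieDer M n a φ l -
        (-1 : k) ^ n • φ (⟨a.1 + 1, D.dA a.2⟩ :: l) := by
  rw [differential_apply, differential_apply, lieDer]
  have e1 : (∑ i : Fin (a :: l).length, (-1 : k) ^ ((i : ℤ) + 1 + (a :: l)[i].1 *
      (n - (((a :: l).length : ℤ) - 1) + D.degSum ((a :: l).take i))) •
        D.leftAct M (extendForm (a :: l)[i].2) (φ ((a :: l).eraseIdx i))) =
      (-1 : k) ^ (1 + a.1 * (n - l.length)) • D.leftAct M (extendForm a.2) (φ l) -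
      ∑ i : Fin l.length, (-1 : k) ^ ((i : ℤ) + 1 + l[i].1 * (n + a.1 - 1 - (l.length - 1) +
        D.degSum (l.take i))) • D.leftAct M (extendForm l[i].2) (φ (a :: l.eraseIdx i)) := by
    refine (Fin.sum_univ_succ _).trans ?_
    refine Eq.trans ?_ (sub_eq_add_neg _ _).symm
    rw [← Finset.sum_neg_distrib]
    refine congrArg₂ (· + ·) ?_ (Finset.sum_congr rfl fun i _ => ?_)
    · refine congrArg₂ (· • ·) (neg_one_zpow_congr ?_) rfl
      rw [show D.degSum ((a :: l).take ((0 : Fin (l.length + 1)) : ℕ)) = 0 from rfl]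
      simp
    · rw [← neg_smul, neg_neg_one_zpow]
      refine congrArg₂ (· • ·) (neg_one_zpow_congr ?_) rfl
      rw [show D.degSum ((a :: l).take ((i.succ : Fin (l.length + 1)) : ℕ)) =
        a.1 + D.degSum (l.take i) from degSum_cons _ _]
      simp only [List.length_cons, Fin.val_succ]
      push_cast
      refine ⟨0, ?_⟩
      change (i : ℤ) + 1 + 1 + (l[i].1 : ℤ) * _ - _ = _
      ring
  have e2 : (∑ i : Fin (a :: l).length, ∑ j ∈ Finset.Ioi i, (-1 : k) ^ ((i : ℤ) + j + 1 +
      (a :: l)[i].1 * D.degSum ((a :: l).take i) +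
          (a :: l)[j].1 * (D.degSum ((a :: l).take j) - (a :: l)[i].1)) •
        φ (⟨(a :: l)[i].1 + (a :: l)[j].1, D.bracketA (a :: l)[i].2 (a :: l)[j].2⟩ ::
          ((a :: l).eraseIdx j).eraseIdx i)) =
      (∑ j : Fin l.length, (-1 : k) ^ ((j : ℤ) + l[j].1 * D.degSum (l.take j)) •
        φ (⟨a.1 + l[j].1, D.bracketA a.2 l[j].2⟩ :: l.eraseIdx j)) -
      ∑ i : Fin l.length, ∑ j ∈ Finset.Ioi i,
        (-1 : k) ^ ((i : ℤ) + j + 1 + l[i].1 * D.degSum (l.take i) +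
          l[j].1 * (D.degSum (l.take j) - l[i].1)) •
        φ (a :: ⟨l[i].1 + l[j].1, D.bracketA l[i].2 l[j].2⟩ :: (l.eraseIdx j).eraseIdx i) := by
    refine (Fin.sum_univ_succ _).trans ?_
    refine Eq.trans ?_ (sub_eq_add_neg _ _).symm
    rw [← Finset.sum_neg_distrib]
    refine congrArg₂ (· + ·) ?_ (Finset.sum_congr rfl fun i _ => ?_)
    · refine (Fin.sum_Ioi_zero _).trans (Finset.sum_congr rfl fun j _ => ?_)
      refine congrArg₂ (· • ·) (neg_one_zpow_congr ?_) rfl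
      rw [show D.degSum ((a :: l).take ((0 : Fin (l.length + 1)) : ℕ)) = 0 from rfl,
        show D.degSum ((a :: l).take ((j.succ : Fin (l.length + 1)) : ℕ)) =
        a.1 + D.degSum (l.take j) from degSum_cons _ _]
      refine ⟨1, ?_⟩
      change ((0 : ℕ) : ℤ) + ((j + 1 : ℕ) : ℤ) + 1 + (a.1 : ℤ) * 0 +
        (l[j].1 : ℤ) * (a.1 + _ - a.1) - _ = _
      push_cast
      ring
    · rw [← Finset.sum_neg_distrib]
      refine (Fin.sum_Ioi_succ _ i).trans (Finset.sum_congr rfl fun j _ => ?_)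
      rw [← neg_smul, neg_neg_one_zpow]
      change _ • φ (⟨l[i].1 + l[j].1, D.bracketA l[i].2 l[j].2⟩ ::
        a :: (l.eraseIdx j).eraseIdx i) = _
      rw [hφ, neg_smul, smul_neg, ← neg_smul, smul_smul, neg_one_pow_eq_zpow, neg_mul,
        neg_one_zpow_mul, neg_neg_one_zpow]
      refine congrArg₂ (· • ·) (neg_one_zpow_congr ?_) rfl
      rw [show D.degSum ((a :: l).take ((i.succ : Fin (l.length + 1)) : ℕ)) =
        a.1 + D.degSum (l.take i) from degSum_cons _ _,
        show D.degSum ((a :: l).take ((j.succ : Fin (l.length + 1)) : ℕ)) =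
        a.1 + D.degSum (l.take j) from degSum_cons _ _]
      change Even (((i + 1 : ℕ) : ℤ) + ((j + 1 : ℕ) : ℤ) + 1 + (l[i].1 : ℤ) * (a.1 + _) +
        (l[j].1 : ℤ) * (a.1 + _ - l[i].1) + (((l[i].1 + l[j].1) * a.1 : ℕ) : ℤ) + 1 - _)
      push_cast
      refine ⟨1 + l[i].1 * a.1 + l[j].1 * a.1, ?_⟩
      ring
  have e3 : (∑ i : Fin (a :: l).length, (-1 : k) ^ (n - (a :: l).length +
      D.degSum ((a :: l).take i)) • φ ((a :: l).set i ⟨(a :: l)[i].1 + 1, D.dA (a :: l)[i].2⟩)) =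
      (-1 : k) ^ (n - l.length - 1) • φ (⟨a.1 + 1, D.dA a.2⟩ :: l) +
      ∑ i : Fin l.length, (-1 : k) ^ (n + a.1 - 1 - l.length + D.degSum (l.take i)) •
        φ (a :: l.set i ⟨l[i].1 + 1, D.dA l[i].2⟩) := by
    refine (Fin.sum_univ_succ _).trans ?_
    refine congrArg₂ (· + ·) ?_ (Finset.sum_congr rfl fun i _ => ?_)
    · refine congrArg₂ (· • ·) (neg_one_zpow_congr ?_) rfl
      rw [show D.degSum ((a :: l).take ((0 : Fin (l.length + 1)) : ℕ)) = 0 from rfl]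
      simp only [List.length_cons]
      push_cast
      exact ⟨0, by ring⟩
    · refine congrArg₂ (· • ·) (neg_one_zpow_congr ?_) rfl
      rw [show D.degSum ((a :: l).take ((i.succ : Fin (l.length + 1)) : ℕ)) =
        a.1 + D.degSum (l.take i) from degSum_cons _ _]
      simp only [List.length_cons]
      push_cast
      exact ⟨0, by ring⟩
  have e4 : φ (⟨2, D.curvature⟩ :: a :: l) = -φ (a :: ⟨2, D.curvature⟩ :: l) := by
    rw [hφ, pow_mul]
    norm_num
  have e5 : (-1 : k) ^ l.length * (-1) ^ (n - l.length - 1) = -(-1) ^ n := by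
    rw [neg_one_pow_eq_zpow, neg_one_zpow_mul, neg_neg_one_zpow]
    exact neg_one_zpow_congr ⟨-1, by ring⟩
  rw [e1, e2, e3, e4, List.length_cons, pow_succ, mul_neg_one, neg_smul, smul_sub, smul_add, smul_smul,
    e5, smul_sub, neg_smul]
  abel

end Recursion

namespace CliffordModule

variable (C : D.CliffordModule M Y)

/-- The values of the cochain of degree `n` that corresponds to an element of a Clifford module. -/
noncomputable def expand : List D.HomA → ℤ → Y →ₗ[k] D.N M
  | [], _ => C.ev
  | a :: l, n => (-1 : k) ^ (a.1 * (n - 1) + 1) • expand l (n + a.1 - 1) ∘ₗ C.jj (extendForm a.2)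

theorem expand_cons (a : D.HomA) (l : List D.HomA) (n : ℤ) (u : Y) : C.expand (a :: l) n u =
    (-1 : k) ^ (a.1 * (n - 1) + 1) • C.expand l (n + a.1 - 1) (C.jj (extendForm a.2) u) := rfl

theorem expand_swap (l₁ l₂ : List D.HomA) (a b : D.HomA) (n : ℤ) (u : Y) :
    C.expand (l₁ ++ a :: b :: l₂) n u =
      -(-1 : k) ^ (a.1 * b.1) • C.expand (l₁ ++ b :: a :: l₂) n u := by
  induction l₁ generalizing n u with
  | nil =>
    have h := LinearMap.congr_fun (C.jj_mul_jj (homDeg_extendForm b.2).par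
      (homDeg_extendForm a.2).par) u
    rw [Module.End.mul_apply, LinearMap.smul_apply, Module.End.mul_apply] at h
    rw [List.nil_append, List.nil_append, expand_cons, expand_cons, expand_cons, expand_cons, h,
      map_smul, show n + b.1 - 1 + a.1 - 1 = n + a.1 - 1 + b.1 - 1 by ring]
    simp only [smul_smul, neg_one_pow_eq_zpow, neg_neg_one_zpow, neg_one_zpow_mul]
    congr 1
    refine neg_one_zpow_congr ?_
    push_cast
    exact ⟨a.1, by ring⟩
  | cons c l₁ ih =>
    rw [List.cons_append, List.cons_append, expand_cons, expand_cons, ih, smul_comm]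

end CliffordModule

namespace MatterAction

variable [LieRingModule D.Sharp M] [LieModule k D.Sharp M]
variable {C : D.CliffordModule M Y} (X : MatterAction C) [CharZero k]

set_option maxHeartbeats 800000 in
theorem lieDer_expand (hM : D.IsDiscreteLevelOne M) (a : D.HomA) (l : List D.HomA) (n : ℤ) (u : Y) :
    D.lieDer M n a (fun l => C.expand l n u) l =
      (-1 : k) ^ (a.1 * n + 1) • C.expand l (n + a.1) (X.lam a.1 (extendForm a.2) u) := by
  induction l generalizing n u with
  | nil =>
    rw [lieDer]
    change (-1 : k) ^ (1 + a.1 * (n - 0)) • D.leftAct M (extendForm a.2) (C.ev u) + ∑ j : Fin 0, _ =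
      (-1 : k) ^ (a.1 * n + 1) • C.ev (X.lam a.1 (extendForm a.2) u)
    rw [X.ev_lam hM (homDeg_extendForm a.2).par, Fin.sum_univ_zero, add_zero, sub_zero, add_comm]
  | cons b l ih =>
    have h := LinearMap.congr_fun (X.lam_mul_jj hM (homDeg_extendForm a.2).par
      (homDeg_extendForm b.2).par) u
    rw [Module.End.mul_apply, LinearMap.add_apply, LinearMap.smul_apply, Module.End.mul_apply] at h
    have h1 := ih (n + b.1 - 1) (C.jj (extendForm b.2) u)
    rw [h, map_add, map_smul, lieDer] at h1
    have e1 : ∑ j : Fin (b :: l).length, (-1 : k) ^ ((j : ℤ) + (b :: l)[j].1 *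
        D.degSum ((b :: l).take j)) • C.expand (⟨a.1 + (b :: l)[j].1,
          D.bracketA a.2 (b :: l)[j].2⟩ :: (b :: l).eraseIdx j) n u =
        (-1 : k) ^ ((a.1 + b.1) * (n - 1) + 1) • C.expand l (n + a.1 + b.1 - 1)
          (C.jj (D.bracketL ((-1) ^ (a.1 * b.1)) (extendForm a.2) (extendForm b.2)) u) +
        (-1 : k) ^ (1 + a.1 * b.1 + b.1 * (n - 1)) • ∑ j : Fin l.length,
          (-1 : k) ^ ((j : ℤ) + l[j].1 * D.degSum (l.take j)) •
            C.expand (⟨a.1 + l[j].1, D.bracketA a.2 l[j].2⟩ :: l.eraseIdx j) (n + b.1 - 1)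
              (C.jj (extendForm b.2) u) := by
      refine (Fin.sum_univ_succ _).trans ?_
      refine congrArg₂ (· + ·) ?_ ?_
      · change (-1 : k) ^ (((0 : ℕ) : ℤ) + (b.1 : ℤ) * 0) •
          C.expand (⟨a.1 + b.1, D.bracketA a.2 b.2⟩ :: l) n u = _
        rw [mul_zero, add_zero, Nat.cast_zero, zpow_zero, one_smul, C.expand_cons, extendForm_bracketA]
        push_cast
        rw [add_assoc n]
      · rw [Finset.smul_sum]
        refine Finset.sum_congr rfl fun j _ => ?_
        change (-1 : k) ^ (((j + 1 : ℕ) : ℤ) + (l[j].1 : ℤ) * D.degSum (b :: l.take j)) •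
          C.expand (⟨a.1 + l[j].1, D.bracketA a.2 l[j].2⟩ :: b :: l.eraseIdx j) n u = _
        have hs := C.expand_swap [] (l.eraseIdx j) ⟨a.1 + l[j].1, D.bracketA a.2 l[j].2⟩ b n u
        rw [List.nil_append, List.nil_append] at hs
        rw [hs, C.expand_cons, degSum_cons]
        simp only [smul_smul, neg_one_pow_eq_zpow, neg_neg_one_zpow, neg_one_zpow_mul]
        congr 1
        refine neg_one_zpow_congr ?_
        push_cast
        exact ⟨1 + l[j].1 * b.1, by ring⟩
    rw [lieDer, e1, C.expand_cons b l (n + a.1), C.expand_cons b l n]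
    have e2 : (-1 : k) ^ (1 + a.1 * (n - (b :: l).length)) • D.leftAct M (extendForm a.2)
        ((-1 : k) ^ (b.1 * (n - 1) + 1) • C.expand l (n + b.1 - 1) (C.jj (extendForm b.2) u)) =
        (-1 : k) ^ (1 + a.1 * b.1 + b.1 * (n - 1)) • (-1 : k) ^ (1 + a.1 * (n + b.1 - 1 - l.length)) •
          D.leftAct M (extendForm a.2) (C.expand l (n + b.1 - 1) (C.jj (extendForm b.2) u)) := by
      rw [map_smul, smul_smul, smul_smul, neg_one_zpow_mul, neg_one_zpow_mul]
      congr 1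
      refine neg_one_zpow_congr ?_
      rw [List.length_cons]
      push_cast
      exact ⟨-(a.1 * b.1), by ring⟩
    rw [e2, add_left_comm, ← smul_add, h1, show n + b.1 - 1 + a.1 = n + a.1 + b.1 - 1 by ring, smul_add,
      smul_add]
    simp only [smul_smul, neg_one_pow_eq_zpow, neg_one_zpow_mul]
    have e3 : (-1 : k) ^ (1 + a.1 * b.1 + b.1 * (n - 1) + (a.1 * (n + b.1 - 1) + 1)) =
        -(-1 : k) ^ ((a.1 + b.1) * (n - 1) + 1) := by
      rw [neg_neg_one_zpow]
      exact neg_one_zpow_congr ⟨a.1 * b.1, by ring⟩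
    rw [e3, add_comm, add_assoc, neg_smul, neg_add_cancel, add_zero]
    congr 1
    refine neg_one_zpow_congr ?_
    push_cast
    exact ⟨a.1 * b.1, by ring⟩

theorem differential_expand (hM : D.IsDiscreteLevelOne M) (l : List D.HomA) (n : ℤ) (u : Y) :
    D.differential M n (fun l => C.expand l n u) l = C.expand l (n + 1) (X.brst u) := by
  induction l generalizing n u with
  | nil =>
    rw [differential_apply]
    change ∑ i : Fin 0, _ + ∑ i : Fin 0, _ + (-1 : k) ^ 0 • (D.dN M (C.ev u) - ∑ i : Fin 0, _) +
      (-1 : k) ^ ((2 : ℕ) * (n - 1) + 1) • C.ev (C.jj (extendForm D.curvature) u) = C.ev (X.brst u)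
    have : (-1 : k) ^ (((2 : ℕ) : ℤ) * (n - 1) + 1) = -1 := Odd.neg_one_zpow ⟨n - 1, by push_cast; ring⟩
    rw [Fin.sum_univ_zero, Fin.sum_univ_zero, Fin.sum_univ_zero, X.ev_brst hM, this, pow_zero, one_smul,
      neg_one_smul, sub_zero, add_zero, zero_add, sub_eq_add_neg]
  | cons a l ih =>
    rw [differential_cons fun a b l => C.expand_swap [] l a b n u, X.lieDer_expand hM]
    have h1 : (fun l => C.expand (a :: l) n u) = (-1 : k) ^ (a.1 * (n - 1) + 1) •
      fun l => C.expand l (n + a.1 - 1) (C.jj (extendForm a.2) u) := rfl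
    rw [h1, map_smul, Pi.smul_apply, ih, C.expand_cons, C.expand_cons, X.lam_apply,
      show n + a.1 - 1 + 1 = n + a.1 by ring, show n + 1 + a.1 - 1 = n + a.1 by ring,
      show n + ((a.1 + 1 : ℕ) : ℤ) - 1 = n + a.1 by push_cast; ring, extendForm_dA]
    simp only [LinearMap.sub_apply, LinearMap.add_apply, LinearMap.smul_apply, Module.End.mul_apply,
      map_sub, map_add, map_smul, smul_sub, smul_add, smul_smul, neg_one_pow_eq_zpow,
      neg_one_zpow_mul]
    have e1 : (-1 : k) ^ (a.1 * n + 1 + a.1) = (-1) ^ (a.1 * (n - 1) + 1) :=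
      neg_one_zpow_congr ⟨a.1, by ring⟩
    have e2 : (-1 : k) ^ (n + (((a.1 + 1 : ℕ) : ℤ) * (n - 1) + 1)) = -(-1) ^ (a.1 * (n - 1) + 1) := by
      rw [neg_neg_one_zpow]
      exact neg_one_zpow_congr ⟨n - 1, by push_cast; ring⟩
    rw [e1, e2, show (a.1 : ℤ) * (n + 1 - 1) + 1 = a.1 * n + 1 by ring, neg_smul]
    abel

end MatterAction

end SplitTate

end SemiInf

namespace SemiInf

theorem extendForm_const {k : Type*} [Field k] [CharZero k] {V X : Type*} [AddCommGroup V] [Module k V]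
    [AddCommGroup X] [Module k X] (x : X) :
    extendForm (AlternatingMap.constOfIsEmpty k V (Fin 0) x) =
      (counit k V).toLinearMap.smulRight x := by
  have h : HomDeg 0 ((counit k V).toLinearMap.smulRight x) := fun t _ w => by
    have : (counit k V).comp (scale V t) = counit k V := by
      refine ExteriorAlgebra.hom_ext (LinearMap.ext fun v => ?_)
      change counit k V (scale V t (ExteriorAlgebra.ι k v)) = counit k V (ExteriorAlgebra.ι k v)
      rw [scale_ι, map_smul, counit_ι, smul_zero]
    rw [zpow_zero, one_smul]
    exact congrArg (· • x) (DFunLike.congr_fun this w)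
  have h1 := extendForm_formPart (p := 0) h
  rw [← h1]
  congr 1
  refine AlternatingMap.ext fun v => ?_
  change x = counit k V (ExteriorAlgebra.ιMulti k 0 v) • x
  rw [ExteriorAlgebra.ιMulti_zero_apply, map_one, one_smul]

namespace SplitTate

variable {k : Type*} [Field k] {𝔤 : Type*} [LieRing 𝔤] [LieAlgebra k 𝔤] [UniformSpace 𝔤]
  [IsUniformAddGroup 𝔤] {D : SplitTate k 𝔤}
variable {M Y : Type*} [AddCommGroup M] [Module k M] [AddCommGroup Y] [Module k Y]

theorem exists_finset_extendForm_mem (w : D.Λ𝔠) : ∃ S : ∀ p : ℕ, Finset (Fin p → D.𝔠),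
    ∀ (U : Submodule k 𝔤) (p : ℕ) (a : D.A p), (∀ v ∈ S p, (a v : 𝔤) ∈ U) →
      (extendForm a w : 𝔤) ∈ U := by
  classical
  have hw : w ∈ Submodule.span k (Set.range fun x : Σ n, (Fin n → D.𝔠) =>
      ExteriorAlgebra.ιMulti k x.1 x.2) := by
    rw [ExteriorAlgebra.ιMulti_span]
    exact Submodule.mem_top
  induction hw using Submodule.span_induction with
  | mem w h =>
    obtain ⟨⟨n, v⟩, rfl⟩ := h
    refine ⟨fun p => if h : p = n then {v ∘ Fin.cast h} else ∅, fun U p a ha => ?_⟩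
    by_cases h : p = n
    · subst h
      simp only [dif_pos] at ha
      change (extendForm a (ExteriorAlgebra.ιMulti k p v) : 𝔤) ∈ U
      rw [extendForm_ιMulti]
      exact ha v (Finset.mem_singleton_self v)
    · change (extendForm a (ExteriorAlgebra.ιMulti k n v) : 𝔤) ∈ U
      rw [extendForm_ιMulti_of_ne fun e => h e.symm]
      exact U.zero_mem
  | zero => exact ⟨fun _ => ∅, fun U p a _ => by rw [map_zero]; exact U.zero_mem⟩
  | add x y _ _ hx hy =>
    obtain ⟨S, hS⟩ := hx
    obtain ⟨S', hS'⟩ := hy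
    refine ⟨fun p => S p ∪ S' p, fun U p a ha => ?_⟩
    rw [map_add]
    exact U.add_mem (hS U p a fun v hv => ha v (Finset.mem_union_left _ hv))
      (hS' U p a fun v hv => ha v (Finset.mem_union_right _ hv))
  | smul t x _ hx =>
    obtain ⟨S, hS⟩ := hx
    refine ⟨S, fun U p a ha => ?_⟩
    rw [map_smul]
    exact U.smul_mem t (hS U p a ha)

variable (D) in
/-- An element of `𝔟`, as an element of degree `0` of `A`. -/
def const (b : D.𝔟) : D.HomA := ⟨0, AlternatingMap.constOfIsEmpty k D.𝔠 (Fin 0) b⟩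

namespace CliffordModule

variable (C : D.CliffordModule M Y)

theorem exists_jj_eq_zero (u : Y) : ∃ (S : ∀ p : ℕ, Finset (Fin p → D.𝔠)) (U : Submodule k 𝔤),
    IsOpen (U : Set 𝔤) ∧ ∀ (p : ℕ) (a : D.A p), (∀ v ∈ S p, (a v : 𝔤) ∈ U) →
      C.jj (extendForm a) u = 0 := by
  classical
  have h : ∀ t : D.Λ𝔠 ⊗[k] Y, ∃ (S : ∀ p : ℕ, Finset (Fin p → D.𝔠)) (U : Submodule k 𝔤),
      IsOpen (U : Set 𝔤) ∧ ∀ (p : ℕ) (a : D.A p), (∀ v ∈ S p, (a v : 𝔤) ∈ U) →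
      TensorProduct.lift (C.ii ∘ₗ D.in𝔟 ∘ₗ extendForm a ∘ₗ parity k D.𝔠) t = 0 := by
    intro t
    induction t with
    | zero => exact ⟨fun _ => ∅, ⊤, isOpen_univ, fun p a _ => map_zero _⟩
    | add s t hs ht =>
      obtain ⟨S, U, hU, h⟩ := hs
      obtain ⟨S', U', hU', h'⟩ := ht
      refine ⟨fun p => S p ∪ S' p, U ⊓ U', hU.inter hU', fun p a ha => ?_⟩
      rw [map_add, h p a fun v hv => (ha v (Finset.mem_union_left _ hv)).1,
        h' p a fun v hv => (ha v (Finset.mem_union_right _ hv)).2, add_zero]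
    | tmul w y =>
      obtain ⟨S, hS⟩ := exists_finset_extendForm_mem (parity k D.𝔠 w)
      obtain ⟨U, hU, h⟩ := C.exists_ii_eq_zero y
      exact ⟨S, U, hU, fun p a ha => h _ (hS U p a ha)⟩
  exact h (C.co u)

theorem jj_eq_zero [CharZero k] {u : Y} (h : ∀ b : D.𝔟, C.ii b u = 0) {p : ℕ} {a : D.Λ𝔠 →ₗ[k] D.𝔟}
    (ha : Par p a) : C.jj a u = 0 :=
  (C.finDetermined_jj u).eq_zero (neg_one_pow_mul_self p) (fun r b _ => by
    change C.jj (r.smulRight b) u = 0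
    rw [C.jj_smulRight, Module.End.mul_apply, h, map_zero]) ha

theorem jj_const [CharZero k] (b : D.𝔟) : C.jj (extendForm (D.const b).2) = C.ii b := by
  rw [const, extendForm_const, jj_smulRight, cc_counit, one_mul]

theorem jj_mem_killed [CharZero k] {p : ℕ} {a : D.Λ𝔠 →ₗ[k] D.𝔟} (ha : Par p a) (m : ℕ) {u : Y}
    (hu : u ∈ killed C.ann (m + 1)) : C.jj a u ∈ killed C.ann m := by
  have hann : ∀ x, C.jj a * C.ann x = (-1 : k) ^ (p + 1) • (C.ann x * C.jj a) := fun x => by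
    have h := C.jj_mul_cc ha (par_ιInv.postcomp x.2)
    rw [mul_one, C.cc_ιInv] at h
    change C.jj a * (C.ii x.1 + C.ee (D.annDual x.2)) = _ • ((C.ii x.1 + C.ee (D.annDual x.2)) * _)
    rw [mul_add, add_mul, smul_add, C.jj_mul_ii_par ha, h]
  induction m generalizing u with
  | zero =>
    refine (Submodule.mem_bot k).2 (C.jj_eq_zero (fun b => ?_) ha)
    have := mem_killed_succ.1 hu (b, 0)
    rw [killed, Submodule.mem_bot] at this
    change C.ii b u + C.ee (D.annDual 0) u = 0 at this
    rwa [map_zero, map_zero, LinearMap.zero_apply, add_zero] at this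
  | succ m ih =>
    refine mem_killed_succ.2 fun x => ?_
    have h1 := LinearMap.congr_fun (hann x) u
    have h2 := (killed C.ann m).smul_mem ((-1 : k) ^ (p + 1)) (ih (mem_killed_succ.1 hu x))
    rwa [← Module.End.mul_apply, h1, LinearMap.smul_apply, smul_smul, neg_one_pow_mul_self,
      one_smul] at h2

theorem expand_eq_zero [CharZero k] (l : List D.HomA) (n : ℤ) {u : Y} {m : ℕ}
    (hu : u ∈ killed C.ann m) (hl : m ≤ l.length) : C.expand l n u = 0 := by
  induction l generalizing n u m with
  | nil =>
    rw [Nat.le_zero.1 hl] at hu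
    rw [(Submodule.mem_bot k).1 hu, map_zero]
  | cons a l ih =>
    have h := killed_mono C.ann hl hu
    rw [expand_cons, ih _ (C.jj_mem_killed (homDeg_extendForm a.2).par _ h) le_rfl, smul_zero]

theorem expand_middle_eq_zero (l₁ l₂ : List D.HomA) {a : D.HomA} {u : Y}
    (h : C.jj (extendForm a.2) u = 0) (n : ℤ) : C.expand (l₁ ++ a :: l₂) n u = 0 := by
  have : ∀ l₀ : List D.HomA, C.expand (l₀ ++ (a :: l₁) ++ l₂) n u = 0 →
      C.expand (l₀ ++ (l₁ ++ a :: l₂)) n u = 0 := by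
    induction l₁ with
    | nil => exact fun l₀ h => by simpa using h
    | cons b l₁ ih =>
      intro l₀ h
      have := ih (l₀ ++ [b]) (by
        simp only [List.append_assoc, List.cons_append, List.nil_append] at h ⊢
        rw [C.expand_swap, h, smul_zero])
      simpa using this
  refine this [] ?_
  rw [List.nil_append, List.cons_append, expand_cons, h, map_zero, smul_zero]

theorem expand_cc (l : List D.HomA) (m : ℤ) {q : ℕ} {r : D.Λ𝔠 →ₗ[k] k} (hr : Par q r) (u : Y) :
    C.expand l (m + q) (C.cc r u) =
      (-1 : k) ^ ((q : ℤ) * l.length) • D.contractN M r (C.expand l m u) := by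
  induction l generalizing m u with
  | nil =>
    change C.ev (C.cc r u) = (-1 : k) ^ ((q : ℤ) * (0 : ℕ)) • _
    rw [Nat.cast_zero, mul_zero, zpow_zero, one_smul, C.ev_cc]
    rfl
  | cons a l ih =>
    have h := LinearMap.congr_fun (C.jj_mul_cc (homDeg_extendForm a.2).par hr) u
    rw [Module.End.mul_apply, LinearMap.smul_apply, Module.End.mul_apply] at h
    rw [expand_cons, expand_cons, h, map_smul, show m + q + a.1 - 1 = m + a.1 - 1 + q by ring, ih,
      map_smul]
    simp only [smul_smul, neg_one_pow_eq_zpow, neg_one_zpow_mul]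
    congr 1
    refine neg_one_zpow_congr ?_
    rw [List.length_cons]
    push_cast
    exact ⟨a.1 * q, by ring⟩

theorem expand_mem_gradeN [CharZero k] (l : List D.HomA) (n : ℤ) {u : Y} (hu : u ∈ C.grade n) :
    C.expand l n u ∈ D.gradeN M (n - l.length + D.degSum l) := by
  induction l generalizing n u with
  | nil =>
    change C.ev u ∈ D.gradeN M (n - 0 + 0)
    rw [sub_zero, add_zero]
    exact C.ev_mem_gradeN hu
  | cons a l ih =>
    have h := ih (n + a.1 - 1) (by
      have := (C.deg_jj (homDeg_extendForm a.2)).mem_grade hu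
      rwa [← add_sub_assoc] at this)
    rw [degSum_cons, List.length_cons, show n - ((l.length + 1 : ℕ) : ℤ) + (a.1 + D.degSum l) =
      n + a.1 - 1 - l.length + D.degSum l by push_cast; ring]
    exact Submodule.smul_mem _ _ h

theorem expand_mem_cochains [CharZero k] {n : ℤ} {u : Y} (hu : u ∈ C.grade n) :
    (fun l => C.expand l n u) ∈ D.cochains M n := by
  refine ⟨fun l₁ l₂ p a b => ?_, fun l₁ l₂ a b => C.expand_swap l₁ l₂ a b n u,
    fun l q p r a => ?_, fun ps => ?_, fun l => C.expand_mem_gradeN l n hu, ?_⟩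
  · change C.expand _ n u = C.expand _ n u + C.expand _ n u
    clear hu
    induction l₁ generalizing n u with
    | nil =>
      rw [List.nil_append, List.nil_append, List.nil_append, expand_cons, expand_cons, expand_cons]
      have : extendForm (a + b) = extendForm a + extendForm b := extendForm_add a b
      rw [this, map_add, LinearMap.add_apply, map_add, smul_add]
    | cons c l₁ ih =>
      rw [List.cons_append, List.cons_append, List.cons_append, expand_cons, expand_cons, expand_cons,
        ih, smul_add]
  · change C.expand _ n u = _ • D.contractN M _ (C.expand _ n u)
    have h : extendForm (D.smulA r a) = conv (LinearMap.lsmul k D.𝔟) (extendForm r) (extendForm a) :=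
      extendForm_formPart (by
        rw [Nat.cast_add]
        exact (homDeg_extendForm r).conv (homDeg_extendForm a))
    rw [expand_cons, expand_cons, h, ← C.cc_mul_jj, Module.End.mul_apply,
      show n + ((q + p : ℕ) : ℤ) - 1 = n + p - 1 + q by push_cast; ring,
      C.expand_cc l _ (homDeg_extendForm r).par, map_smul]
    simp only [smul_smul, neg_one_zpow_mul]
    congr 1
    refine neg_one_zpow_congr ?_
    push_cast
    exact ⟨q * l.length, by ring⟩
  · obtain ⟨S, U, hU, h⟩ := C.exists_jj_eq_zero u
    refine ⟨S, U, hU.mem_nhds U.zero_mem, fun l _ ⟨a, ha, hv⟩ => ?_⟩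
    obtain ⟨l₁, l₂, rfl⟩ := List.append_of_mem ha
    exact C.expand_middle_eq_zero l₁ l₂ (h a.1 a.2 hv) n
  · obtain ⟨m, hm⟩ := C.exists_mem_killed u
    exact ⟨m, fun l hl => C.expand_eq_zero l n hm hl⟩

theorem expand_const [CharZero k] (b : D.𝔟) (l : List D.HomA) (n : ℤ) (u : Y) :
    C.expand (D.const b :: l) n u = -C.expand l (n - 1) (C.ii b u) := by
  rw [expand_cons, jj_const]
  change (-1 : k) ^ (((0 : ℕ) : ℤ) * (n - 1) + 1) • C.expand l (n + ((0 : ℕ) : ℤ) - 1) _ = _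
  rw [Nat.cast_zero, zero_mul, zero_add, zpow_one, neg_one_smul, add_zero]

theorem eq_zero_of_expand_eq_zero [CharZero k] {u : Y} {n : ℤ} (h : ∀ l, C.expand l n u = 0) :
    u = 0 := by
  refine C.annihilator_induction (P := fun u => ∀ n, (∀ l, C.expand l n u = 0) → u = 0)
    (fun _ _ => rfl) (fun u hu n h => ?_) u n h
  have h1 : ∀ b : D.𝔟, C.ii b u = 0 := fun b => by
    have := hu (b, 0) (n - 1)
    have h2 : C.ann (b, 0) u = C.ii b u := by
      change C.ii b u + C.ee (D.annDual 0) u = _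
      rw [map_zero, map_zero, LinearMap.zero_apply, add_zero]
    rw [h2] at this
    refine this fun l => ?_
    rw [← neg_eq_zero, ← C.expand_const, h]
  have h2 : C.ev u = 0 := h []
  rw [C.eq_jmap_of_ii_eq_zero h1, h2, map_zero]

end CliffordModule

end SplitTate

end SemiInf

namespace SemiInf

namespace SplitTate

variable {k : Type*} [Field k] {𝔤 : Type*} [LieRing 𝔤] [LieAlgebra k 𝔤] [UniformSpace 𝔤]
  [IsUniformAddGroup 𝔤] {D : SplitTate k 𝔤}
variable {M Y : Type*} [AddCommGroup M] [Module k M] [AddCommGroup Y] [Module k Y] [CharZero k]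

/-- The element `b` of `𝔟`, as a form of degree `0`. -/
abbrev constA (D : SplitTate k 𝔤) (b : D.𝔟) : D.A 0 := AlternatingMap.constOfIsEmpty k D.𝔠 (Fin 0) b

theorem smulA_const {p : ℕ} (r : D.R p) (b : D.𝔟) :
    D.smulA r (D.constA b) = (LinearMap.toSpanSingleton k D.𝔟 b).compAlternatingMap r := by
  have h : conv (LinearMap.lsmul k D.𝔟) (extendForm r) (extendForm (D.constA b)) =
      (extendForm r).smulRight b := by
    refine LinearMap.ext fun w => ?_
    have h1 := rid_counit_comul w
    rw [extendForm_const, conv_apply, LinearMap.smulRight_apply]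
    conv_rhs => rw [← h1]
    generalize comul k D.𝔠 w = t
    induction t with
    | zero => simp only [map_zero, zero_smul]
    | add a b ha hb => simp only [map_add, add_smul, ha, hb]
    | tmul u v =>
      simp only [TensorProduct.map_tmul, TensorProduct.lift.tmul, LinearMap.lTensor_tmul,
        TensorProduct.rid_tmul, map_smul, LinearMap.smulRight_apply, LinearMap.lsmul_apply,
        smul_eq_mul, smul_smul]
  rw [smulA, h]
  refine AlternatingMap.ext fun v => ?_
  change extendForm r (ExteriorAlgebra.ιMulti k p v) • b = r v • b
  rw [extendForm_ιMulti]

theorem contractN_const (t : k) (n : D.N M) :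
    D.contractN M (extendForm (AlternatingMap.constOfIsEmpty k D.𝔠 (Fin 0) t)) n = t • n := by
  have h : contr ((counit k D.𝔠).toLinearMap.smulRight t) = t • LinearMap.id := LinearMap.ext fun w => by
    have : (counit k D.𝔠).toLinearMap.smulRight t = t • (counit k D.𝔠).toLinearMap :=
      LinearMap.ext fun w => mul_comm _ _
    rw [this, contr_smul, contr_counit]
    rfl
  rw [extendForm_const, contractN_eq, h, LinearMap.lTensor_smul, LinearMap.lTensor_id]
  rfl

/-- Forms can be approximated by finite sums of decomposable forms. -/
theorem exists_sum_smulA {p : ℕ} (S : Finset (Fin p → D.𝔠)) (a : D.A p) :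
    ∃ (n : ℕ) (r : Fin n → D.R p) (b : Fin n → D.𝔟),
      ∀ v ∈ S, (a - ∑ i, (D.smulA (r i) (D.constA (b i)) : D.A p)) v = 0 := by
  classical
  let W : Submodule k D.Λ𝔠 := Submodule.span k (S.image (ExteriorAlgebra.ιMulti k p) : Finset D.Λ𝔠)
  have : FiniteDimensional k W := FiniteDimensional.span_finset k _
  obtain ⟨pr, hpr⟩ := W.subtype.exists_leftInverse_of_injective W.ker_subtype
  let e := Module.finBasis k W
  refine ⟨_, fun i => formPart p (e.coord i ∘ₗ pr), fun i => extendForm a (e i), fun v hv => ?_⟩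
  have hw : ExteriorAlgebra.ιMulti k p v ∈ W := Submodule.subset_span
    (Finset.mem_coe.2 (Finset.mem_image_of_mem _ hv))
  have h1 : pr (ExteriorAlgebra.ιMulti k p v) = ⟨_, hw⟩ := LinearMap.congr_fun hpr ⟨_, hw⟩
  have h2 := congrArg (extendForm a ∘ₗ W.subtype) (e.sum_repr ⟨_, hw⟩)
  rw [map_sum, LinearMap.comp_apply, Submodule.subtype_apply, extendForm_ιMulti] at h2
  rw [AlternatingMap.sub_apply]
  rw [← h2, sub_eq_zero]
  refine Eq.trans ?_ (map_sum (AddMonoidHom.mk' (fun a : D.A p => a v) fun _ _ => rfl) _ _).symm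
  refine Finset.sum_congr rfl fun i _ => ?_
  rw [smulA_const]
  change _ = e.repr (pr (ExteriorAlgebra.ιMulti k p v)) i • extendForm a (e i)
  rw [h1, map_smul]
  rfl

section Interior

variable {n : ℤ} {φ : D.PreCochain M}

/-- Interior multiplication of a cochain by an element of `𝔟`. -/
theorem interior_mem_cochains (hφ : φ ∈ D.cochains M n) (b : D.𝔟) :
    (fun l => φ (D.const b :: l)) ∈ D.cochains M (n - 1) := by
  obtain ⟨h1, h2, h3, h4, h5, m, h6⟩ := hφ
  refine ⟨fun l₁ l₂ p a a' => h1 (D.const b :: l₁) l₂ p a a', fun l₁ l₂ => h2 (D.const b :: l₁) l₂,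
    fun l q p r a => ?_, fun ps => ?_, fun l => ?_, m, fun l hl => h6 _ (hl.trans (Nat.le_succ _))⟩
  · have e1 := h2 [] l (D.const b) ⟨q + p, D.smulA r a⟩
    have e2 := h2 [] l (D.const b) ⟨p, a⟩
    simp only [List.nil_append, const, zero_mul, pow_zero, neg_smul, one_smul] at e1 e2
    change φ (D.const b :: _ :: l) = _ • D.contractN M _ (φ (D.const b :: _ :: l))
    rw [const, e1, e2, h3 _ q p r a, map_neg, smul_neg, List.length_cons]
    congr 3
    push_cast
    ring
  · obtain ⟨S, U, hU, h⟩ := h4 (0 :: ps)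
    refine ⟨S, U, hU, fun l hl ⟨a, ha, hv⟩ => ?_⟩
    exact h _ (by rw [List.map_cons, hl]; rfl) ⟨a, List.mem_cons_of_mem _ ha, hv⟩
  · have := h5 (D.const b :: l)
    rw [degSum_cons, List.length_cons] at this
    convert this using 2
    change n - 1 - _ + _ = n - _ + (((0 : ℕ) : ℤ) + _)
    push_cast
    ring

theorem map_add_const (hφ : φ ∈ D.cochains M n) (b b' : D.𝔟) (l : List D.HomA) :
    φ (D.const (b + b') :: l) = φ (D.const b :: l) + φ (D.const b' :: l) :=
  hφ.1 [] l 0 (D.constA b) (D.constA b')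

theorem map_smul_const (hφ : φ ∈ D.cochains M n) (t : k) (b : D.𝔟) (l : List D.HomA) :
    φ (D.const (t • b) :: l) = t • φ (D.const b :: l) := by
  have h := hφ.2.2.1 l 0 0 (AlternatingMap.constOfIsEmpty k D.𝔠 (Fin 0) t) (D.constA b)
  rw [contractN_const, smulA_const, Nat.cast_zero, zero_mul, zpow_zero, one_smul] at h
  exact h

theorem apply_cons_eq_zero (hφ : φ ∈ D.cochains M n) (h : ∀ b l, φ (D.const b :: l) = 0)
    (a : D.HomA) (l : List D.HomA) : φ (a :: l) = 0 := by
  obtain ⟨p, a⟩ := a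
  obtain ⟨h1, -, h3, h4, -⟩ := hφ
  obtain ⟨S, U, hU, h4⟩ := h4 (p :: l.map Sigma.fst)
  obtain ⟨m, r, b, hb⟩ := exists_sum_smulA (S p) a
  let f : D.A p →+ D.N M := AddMonoidHom.mk' (fun a => φ (⟨p, a⟩ :: l)) fun a b => h1 [] l p a b
  have e1 : f (∑ i, (D.smulA (r i) (D.constA (b i)) : D.A p)) = 0 := by
    rw [map_sum]
    refine Finset.sum_eq_zero fun i _ => ?_
    have := h3 l p 0 (r i) (D.constA (b i))
    rw [show (⟨0, (D.constA (b i))⟩ : D.HomA) = D.const (b i) from rfl, h, map_zero, smul_zero] at this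
    exact this
  have e2 : f (a - ∑ i, (D.smulA (r i) (D.constA (b i)) : D.A p)) = 0 :=
    h4 _ rfl ⟨_, List.mem_cons_self, fun v hv => by
      rw [hb v hv]
      exact mem_of_mem_nhds hU⟩
  rwa [map_sub, e1, sub_zero] at e2

theorem eq_zero_of_apply_const (hφ : φ ∈ D.cochains M n)
    (h : ∀ bs : List D.𝔟, φ (bs.map D.const) = 0) : φ = 0 := by
  obtain ⟨m, hm⟩ := hφ.2.2.2.2.2
  induction m generalizing n φ with
  | zero => exact funext fun l => hm l (Nat.zero_le _)
  | succ m ih =>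
    have h0 : ∀ b, (fun l => φ (D.const b :: l)) = 0 := fun b =>
      ih (interior_mem_cochains hφ b) (fun bs => h (b :: bs)) fun l hl => hm _ (Nat.succ_le_succ hl)
    funext l
    cases l with
    | nil => exact h []
    | cons a l => exact apply_cons_eq_zero hφ (fun b l => congrFun (h0 b) l) a l

end Interior

namespace CliffordModule

variable (C : D.CliffordModule M Y)

/-- The Koszul complex of a Clifford module is exact in the second term. -/
theorem exists_ii_eq {n : ℤ} {lam : D.𝔟 →ₗ[k] Y} (h0 : lam ∈ D.openKer Y)
    (hn : ∀ b, lam b ∈ C.grade (n - 1)) (h : ∀ b b' : D.𝔟, C.ii b (lam b') = -C.ii b' (lam b)) :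
    ∃ u ∈ C.grade n, ∀ b : D.𝔟, C.ii b u = lam b := by
  classical
  obtain ⟨U, hU, h0⟩ := h0
  obtain ⟨R⟩ := D.nonempty_resolution hU
  have key : ∀ (s : Finset (Fin R.n)) (lam : D.𝔟 →ₗ[k] Y), (∀ b, lam b ∈ C.grade (n - 1)) →
      (∀ b b' : D.𝔟, C.ii b (lam b') = -C.ii b' (lam b)) →
      (∀ x, lam x = ∑ i ∈ s, (R.β i).1 x • lam (R.b i)) →
      ∃ u ∈ C.grade n, ∀ b : D.𝔟, C.ii b u = lam b := by
    intro s
    induction s using Finset.induction_on with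
    | empty =>
      intro lam _ _ hx
      exact ⟨0, Submodule.zero_mem _, fun b => by rw [map_zero, hx, Finset.sum_empty]⟩
    | insert j s hj ih =>
      intro lam hn h hx
      let u₀ := C.ee (D.extDual (R.β j)) (lam (R.b j))
      have hu₀ : u₀ ∈ C.grade n := by
        have := (C.deg_ee (D.extDual (R.β j))).mem_grade (hn (R.b j))
        rwa [sub_add_cancel] at this
      have hself : C.ii (R.b j) (lam (R.b j)) = 0 := by
        have := h (R.b j) (R.b j)
        have h2 : (2 : k) • C.ii (R.b j) (lam (R.b j)) = 0 := by
          rw [two_smul]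
          nth_rewrite 2 [this]
          exact add_neg_cancel _
        exact (smul_eq_zero.1 h2).resolve_left two_ne_zero
      let μ : D.𝔟 →ₗ[k] Y := lam - LinearMap.applyₗ u₀ ∘ₗ C.ii ∘ₗ D.in𝔟
      have hμ : ∀ x, μ x = (lam x - (R.β j).1 x • lam (R.b j)) -
          C.ee (D.extDual (R.β j)) (C.ii (R.b j) (lam x)) := fun x => by
        change lam x - C.ii x (C.ee (D.extDual (R.β j)) (lam (R.b j))) = _
        rw [C.ii_ee, extDual_apply, pr𝔟_coe, h, map_neg]
        abel
      have h1 : ∀ b, μ b ∈ C.grade (n - 1) := fun b =>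
        Submodule.sub_mem _ (hn b) ((C.deg_ii _).mem_grade hu₀)
      have h2 : ∀ b b' : D.𝔟, C.ii b (μ b') = -C.ii b' (μ b) := fun b b' => by
        change C.ii b (lam b' - C.ii b' u₀) = -C.ii b' (lam b - C.ii b u₀)
        rw [map_sub, map_sub, h, C.ii_ii]
        abel
      have h3 : ∀ x, μ x = ∑ i ∈ s, (R.β i).1 x • μ (R.b i) := fun x => by
        have e : lam x - (R.β j).1 x • lam (R.b j) = ∑ i ∈ s, (R.β i).1 x • lam (R.b i) := by
          nth_rewrite 1 [hx x]
          rw [Finset.sum_insert hj, add_sub_cancel_left]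
        have e' : C.ii (R.b j) (lam x) = C.ii (R.b j) (∑ i ∈ s, (R.β i).1 x • lam (R.b i)) := by
          rw [← e, map_sub, map_smul, hself, smul_zero, sub_zero]
        have e3 : ∑ i ∈ s, (R.β i).1 x • (R.β j).1 (R.b i) • lam (R.b j) = 0 := by
          refine Finset.sum_eq_zero fun i hi => ?_
          rw [R.dual, if_neg (fun hji : j = i => hj (hji ▸ hi)), zero_smul, smul_zero]
        simp only [hμ, smul_sub, Finset.sum_sub_distrib, e3, sub_zero]
        rw [e, e', map_sum, map_sum]
        simp only [map_smul]
      obtain ⟨u, hu, hu'⟩ := ih μ h1 h2 h3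
      refine ⟨u + u₀, Submodule.add_mem _ hu hu₀, fun b => ?_⟩
      rw [map_add, hu']
      exact sub_add_cancel _ _
  refine key Finset.univ lam hn h fun x => ?_
  have := h0 _ (R.sub_mem x)
  rw [map_sub, sub_eq_zero, map_sum] at this
  rw [this]
  exact Finset.sum_congr rfl fun i _ => map_smul _ _ _

theorem exists_expand_eq {n : ℤ} {φ : D.PreCochain M} (hφ : φ ∈ D.cochains M n) :
    ∃ u ∈ C.grade n, ∀ l, C.expand l n u = φ l := by
  obtain ⟨m, hm⟩ := hφ.2.2.2.2.2
  induction m generalizing n φ with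
  | zero => exact ⟨0, Submodule.zero_mem _, fun l => by rw [map_zero, hm l (Nat.zero_le _)]⟩
  | succ m ih =>
    have huniq : ∀ {u u' : Y} {n : ℤ}, (∀ l, C.expand l n u = C.expand l n u') → u = u' :=
      fun h => sub_eq_zero.1 (C.eq_zero_of_expand_eq_zero fun l => by rw [map_sub, h, sub_self])
    choose f hf hf' using fun b => ih (interior_mem_cochains hφ b) fun l hl =>
      hm _ (Nat.succ_le_succ hl)
    let lam : D.𝔟 →ₗ[k] Y :=
      { toFun := f
        map_add' := fun b b' => huniq fun l => by
          rw [hf', map_add, hf', hf', map_add_const hφ]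
        map_smul' := fun t b => huniq fun l => by
          rw [hf', map_smul, hf', map_smul_const hφ, RingHom.id_apply] }
    have hopen : lam ∈ D.openKer Y := by
      have hU : ∀ j : ℕ, ∃ U : Submodule k 𝔤, IsOpen (U : Set 𝔤) ∧ ∀ b : D.𝔟, (b : 𝔤) ∈ U →
          ∀ bs : List D.𝔟, bs.length = j → φ (D.const b :: bs.map D.const) = 0 := fun j => by
        obtain ⟨S, U, hU, h⟩ := hφ.2.2.2.1 (List.replicate (j + 1) 0)
        obtain ⟨W, hW, hWU⟩ := D.exists_open_subspace hU
        refine ⟨W, hW, fun b hb bs hbs => h _ ?_ ⟨D.const b, List.mem_cons_self, fun v _ => hWU hb⟩⟩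
        rw [List.eq_replicate_iff, List.length_map, List.length_cons, List.length_map, hbs]
        refine ⟨rfl, fun p hp => ?_⟩
        obtain ⟨a, ha, rfl⟩ := List.mem_map.1 hp
        rcases List.mem_cons.1 ha with rfl | ha
        · rfl
        · obtain ⟨b', -, rfl⟩ := List.mem_map.1 ha
          rfl
      choose U hU h using hU
      refine ⟨⨅ j : Fin m, U j, ?_, fun b hb => huniq (n := n - 1) fun l => ?_⟩
      · rw [Submodule.coe_iInf]
        exact isOpen_iInter_of_finite fun j => hU j
      · change C.expand l _ (f b) = _
        rw [hf', map_zero]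
        refine congrFun (eq_zero_of_apply_const (interior_mem_cochains hφ b) fun bs => ?_) l
        rcases lt_or_ge bs.length m with hlt | hge
        · exact h _ b (Submodule.mem_iInf _ |>.1 hb ⟨_, hlt⟩) bs rfl
        · refine hm _ ?_
          rw [List.length_cons, List.length_map]
          exact Nat.succ_le_succ hge
    obtain ⟨u, hu, hu'⟩ := C.exists_ii_eq hopen hf fun b b' => huniq (n := n - 1 - 1) fun l => by
      have h1 := C.expand_const b l (n - 1) (f b')
      have h2 := C.expand_const b' l (n - 1) (f b)
      have h3 := hφ.2.1 [] l (D.const b') (D.const b)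
      simp only [List.nil_append, const, zero_mul, pow_zero, neg_smul, one_smul] at h3
      rw [hf'] at h1 h2
      change C.expand l _ (C.ii b (f b')) = C.expand l _ (-C.ii b' (f b))
      have h4 : φ (D.const b' :: D.const b :: l) = -φ (D.const b :: D.const b' :: l) := h3
      rw [h1, h2] at h4
      rw [map_neg, h4.symm.trans (neg_neg _).symm |> neg_inj.1, neg_neg]
    have hψ := Submodule.add_mem _ hφ (C.expand_mem_cochains hu)
    have hj : C.jmap (φ [] + C.expand [] n u) ∈ C.grade n := by
      have := hψ.2.2.2.2.1 []
      refine C.jmap_mem_grade ?_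
      refine Eq.subst (motive := fun z => _ ∈ D.gradeN M z) ?_ this
      change n - (0 : ℕ) + 0 = n
      rw [Nat.cast_zero, sub_zero, add_zero]
    refine ⟨C.jmap (φ [] + C.expand [] n u) - u, Submodule.sub_mem _ hj hu, fun l => ?_⟩
    rw [map_sub, sub_eq_iff_eq_add]
    cases l with
    | nil => exact C.ev_jmap _
    | cons a l =>
      rw [expand_cons, C.jj_eq_zero (fun b => C.ii_jmap b _) (homDeg_extendForm a.2).par, map_zero,
        smul_zero]
      refine (apply_cons_eq_zero hψ (fun b l => ?_) a l).symm
      change φ _ + C.expand _ n u = 0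
      rw [C.expand_const, hu']
      change φ _ + -C.expand l (n - 1) (f b) = 0
      rw [hf', add_neg_cancel]

/-- The isomorphism of a component of a Clifford module with a component of the standard semiinfinite
complex. -/
noncomputable def cochainEquiv (n : ℤ) : C.grade n ≃ₗ[k] D.cochains M n :=
  LinearEquiv.ofBijective
    (LinearMap.codRestrict (D.cochains M n)
      (LinearMap.pi (fun l => C.expand l n) ∘ₗ (C.grade n).subtype)
      fun u => C.expand_mem_cochains u.2)
    ⟨(injective_iff_map_eq_zero _).2 fun u hu => Subtype.ext (C.eq_zero_of_expand_eq_zero fun l =>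
      congrFun (congrArg Subtype.val hu) l),
    fun φ => by
      obtain ⟨u, hu, h⟩ := C.exists_expand_eq φ.2
      exact ⟨⟨u, hu⟩, Subtype.ext (funext h)⟩⟩

end CliffordModule

end SplitTate

end SemiInf

namespace SemiInf

section Scale

variable {k : Type*} [Field k] {B C : Type*} [AddCommGroup B] [Module k B] [AddCommGroup C]
  [Module k C]

theorem scale_parity (t : k) (w : ExteriorAlgebra k B) :
    scale B t (parity k B w) = parity k B (scale B t w) := by
  have : (scale B t).toLinearMap ∘ₗ parity k B = parity k B ∘ₗ (scale B t).toLinearMap := by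
    refine exterior_ext_left (by simp) fun x w h => ?_
    change scale B t (parity k B w) = parity k B (scale B t w) at h
    change scale B t (parity k B (_ * w)) = parity k B (scale B t (_ * w))
    rw [parity_ι_mul, map_neg, map_mul, map_mul, scale_ι, smul_mul_assoc, smul_mul_assoc, map_smul,
      parity_ι_mul, h, smul_neg]
  exact LinearMap.congr_fun this w

theorem scale_pairOp_left (s t : k) (β : B) (x : ExteriorAlgebra k B ⊗[k] ExteriorAlgebra k C) :
    TensorProduct.map (scale B s).toLinearMap (scale C t).toLinearMap (SplitTate.pairOp ((β, 0), (0, 0)) x) =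
      s • SplitTate.pairOp ((β, 0), (0, 0))
        (TensorProduct.map (scale B s).toLinearMap (scale C t).toLinearMap x) := by
  induction x with
  | zero => simp only [map_zero, smul_zero]
  | add a b ha hb => simp only [map_add, ha, hb, smul_add]
  | tmul u w =>
    simp only [SplitTate.pairOp_left, TensorProduct.map_tmul, AlgHom.toLinearMap_apply, map_mul, scale_ι,
      smul_mul_assoc, TensorProduct.smul_tmul']

theorem scale_pairOp_right (s t : k) (c : C) (x : ExteriorAlgebra k B ⊗[k] ExteriorAlgebra k C) :
    TensorProduct.map (scale B s).toLinearMap (scale C t).toLinearMap (SplitTate.pairOp ((0, 0), (0, c)) x) =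
      t • SplitTate.pairOp ((0, 0), (0, c))
        (TensorProduct.map (scale B s).toLinearMap (scale C t).toLinearMap x) := by
  induction x with
  | zero => simp only [map_zero, smul_zero]
  | add a b ha hb => simp only [map_add, ha, hb, smul_add]
  | tmul u w =>
    rw [SplitTate.pairOp_right, TensorProduct.map_tmul, TensorProduct.map_tmul, SplitTate.pairOp_right]
    change scale B s (parity k B u) ⊗ₜ scale C t (w * _) =
      t • parity k B (scale B s u) ⊗ₜ (scale C t w * _)
    rw [scale_parity, map_mul, scale_ι, mul_smul_comm, TensorProduct.tmul_smul]

theorem eq_top_of_exteriorPower_tmul {M : Type*} [AddCommGroup M] [Module k M]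
    {S : Submodule k (ExteriorAlgebra k B ⊗[k] (ExteriorAlgebra k C ⊗[k] M))}
    (h : ∀ (p q : ℕ) (ξ : ExteriorAlgebra k B) (w : ExteriorAlgebra k C) (m : M), ξ ∈ ⋀[k]^p B →
      w ∈ ⋀[k]^q C → ξ ⊗ₜ (w ⊗ₜ m) ∈ S) : S = ⊤ := by
  have h1 : ∀ (p : ℕ) (ξ : ExteriorAlgebra k B) (w : ExteriorAlgebra k C) (m : M), ξ ∈ ⋀[k]^p B →
      ξ ⊗ₜ (w ⊗ₜ m) ∈ S := fun p ξ w m hξ =>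
    (iSup_exteriorPower k C).ge.trans (iSup_le fun q w hw => h p q ξ w m hξ hw :
      _ ≤ S.comap (TensorProduct.mk k _ _ ξ ∘ₗ (TensorProduct.mk k _ _).flip m)) trivial
  have h2 : ∀ (ξ : ExteriorAlgebra k B) (w : ExteriorAlgebra k C) (m : M), ξ ⊗ₜ (w ⊗ₜ m) ∈ S :=
    fun ξ w m => (iSup_exteriorPower k B).ge.trans (iSup_le fun p ξ hξ => h1 p ξ w m hξ :
      _ ≤ S.comap ((TensorProduct.mk k _ _).flip (w ⊗ₜ m))) trivial
  rw [eq_top_iff, ← TensorProduct.span_tmul_eq_top, Submodule.span_le]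
  rintro _ ⟨ξ, z, rfl⟩
  exact (TensorProduct.span_tmul_eq_top k (ExteriorAlgebra k C) M).ge.trans (Submodule.span_le.2 (by
    rintro _ ⟨w, m, rfl⟩
    exact h2 ξ w m) : _ ≤ S.comap (TensorProduct.mk k _ _ ξ)) trivial

end Scale

namespace SplitTate

variable {k : Type*} [Field k] {𝔤 : Type*} [LieRing 𝔤] [LieAlgebra k 𝔤] [UniformSpace 𝔤]
  [IsUniformAddGroup 𝔤] {D : SplitTate k 𝔤}
variable {M Y : Type*} [AddCommGroup M] [Module k M] [AddCommGroup Y] [Module k Y] [CharZero k]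

/-- The action of `Λ(𝔟*)` on a Clifford module. -/
noncomputable def CliffordModule.extHom (C : D.CliffordModule M Y) :
    ExteriorAlgebra k (tateDual k D.𝔟) →ₐ[k] Module.End k Y :=
  ExteriorAlgebra.lift k ⟨C.ee ∘ₗ D.extDual, fun _ => LinearMap.ext fun u => C.ee_self _ u⟩

theorem CliffordModule.extHom_ι_mul (C : D.CliffordModule M Y) (β : tateDual k D.𝔟)
    (ξ : ExteriorAlgebra k (tateDual k D.𝔟)) (u : Y) :
    C.extHom (ExteriorAlgebra.ι k β * ξ) u = C.ee (D.extDual β) (C.extHom ξ u) := by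
  rw [map_mul, extHom, ExteriorAlgebra.lift_ι_apply]
  rfl

theorem CliffordModule.ii_sec_extHom (C : D.CliffordModule M Y) (c : D.𝔠)
    (ξ : ExteriorAlgebra k (tateDual k D.𝔟)) (u : Y) :
    C.ii (D.sec c) (C.extHom ξ u) = C.extHom (parity k _ ξ) (C.ii (D.sec c) u) := by
  have : C.ii (D.sec c) ∘ₗ C.extHom.toLinearMap.flip u =
      C.extHom.toLinearMap.flip (C.ii (D.sec c) u) ∘ₗ parity k _ := by
    refine exterior_ext_left ?_ fun β ξ h => ?_
    · change C.ii _ (C.extHom 1 u) = C.extHom (parity k _ 1) _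
      rw [parity_one, map_one]
      rfl
    · change C.ii _ (C.extHom ξ u) = C.extHom (parity k _ ξ) _ at h
      change C.ii _ (C.extHom (_ * ξ) u) = C.extHom (parity k _ (_ * ξ)) _
      have h1 := C.ee_ii (D.extDual β) (D.sec c) (C.extHom ξ u)
      rw [extDual_sec, zero_smul, zero_sub] at h1
      rw [parity_ι_mul, map_neg, LinearMap.neg_apply, extHom_ι_mul, extHom_ι_mul, ← h, h1, neg_neg]
  exact LinearMap.congr_fun this ξ

variable (D)

/-- The map from the model of the Clifford module to the Clifford module. -/
noncomputable def fromModel : D.FockModel →ₗ[k] D.FockSpace :=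
  TensorProduct.lift (D.fockModule.extHom.toLinearMap.compl₂
    (D.fockModule.jmap ∘ₗ TensorProduct.mk k k D.Λ𝔠 1))

theorem fromModel_tmul (ξ : ExteriorAlgebra k (tateDual k D.𝔟)) (w : D.Λ𝔠) :
    D.fromModel (ξ ⊗ₜ w) = D.fockModule.extHom ξ (D.fockModule.jmap (1 ⊗ₜ w)) := rfl

theorem toModel_fromModel (t : D.FockModel) : D.toModel (D.fromModel t) = t := by
  have h : D.toModel ∘ₗ D.fockModule.jmap ∘ₗ TensorProduct.mk k k D.Λ𝔠 1 =
      TensorProduct.mk k _ D.Λ𝔠 1 := by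
    refine exterior_ext_right ?_ fun c w h => ?_
    · change D.toModel (D.fockModule.jmap (1 ⊗ₜ 1)) = 1 ⊗ₜ 1
      rw [CliffordModule.jmap_one]
      change D.toModel ((1 : k) • D.vacuum) = _
      rw [one_smul, toModel_vacuum]
    · change D.toModel (D.fockModule.jmap (1 ⊗ₜ w)) = 1 ⊗ₜ w at h
      change D.toModel (D.fockModule.jmap (1 ⊗ₜ (w * _))) = 1 ⊗ₜ (w * _)
      rw [CliffordModule.jmap_mul_ι]
      refine (D.toModel_interL _ _).trans ?_
      rw [h, modelAct_sec, parity_one]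
  have : D.toModel ∘ₗ D.fromModel = LinearMap.id := by
    refine TensorProduct.ext (LinearMap.ext₂ fun ξ w => ?_)
    refine LinearMap.congr_fun (f := D.toModel ∘ₗ D.fromModel ∘ₗ (TensorProduct.mk k _ _).flip w)
      (g := (TensorProduct.mk k _ _).flip w) ?_ ξ
    refine exterior_ext_left ?_ fun β ξ h' => ?_
    · change D.toModel (D.fromModel (1 ⊗ₜ w)) = 1 ⊗ₜ w
      rw [fromModel_tmul, map_one]
      exact LinearMap.congr_fun h w
    · change D.toModel (D.fromModel (ξ ⊗ₜ w)) = ξ ⊗ₜ w at h'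
      change D.toModel (D.fromModel ((_ * ξ) ⊗ₜ w)) = (_ * ξ) ⊗ₜ w
      rw [fromModel_tmul, CliffordModule.extHom_ι_mul]
      refine (D.toModel_exterL _ _).trans ?_
      rw [← fromModel_tmul, h', modelAct_ext]
  exact LinearMap.congr_fun this t

theorem fromModel_toModel (u : D.FockSpace) : D.fromModel (D.toModel u) = u := by
  have : D.fromModel ∘ₗ D.toModel = LinearMap.id := by
    refine D.fockModule.hom_ext (fun m => ?_) (fun c u h => ?_) fun β u h => ?_
    · change D.fromModel (D.toModel (m • D.vacuum)) = m • D.vacuum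
      rw [map_smul, map_smul, toModel_vacuum, fromModel_tmul, map_one, CliffordModule.jmap_one]
      change m • (1 : k) • D.vacuum = _
      rw [one_smul]
    · change D.fromModel (D.toModel u) = u at h
      change D.fromModel (D.toModel (D.interL _ u)) = D.interL _ u
      rw [toModel_interL]
      conv_rhs => rw [← h]
      generalize D.toModel u = t
      induction t using TensorProduct.induction_on with
      | zero => simp only [map_zero]
      | add a b ha hb => simp only [map_add, ha, hb]
      | tmul ξ w =>
        rw [modelAct_sec, fromModel_tmul, fromModel_tmul, CliffordModule.jmap_mul_ι]
        exact (CliffordModule.ii_sec_extHom _ _ _ _).symm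
    · change D.fromModel (D.toModel u) = u at h
      change D.fromModel (D.toModel (D.exterL _ u)) = D.exterL _ u
      rw [toModel_exterL]
      conv_rhs => rw [← h]
      generalize D.toModel u = t
      induction t using TensorProduct.induction_on with
      | zero => simp only [map_zero]
      | add a b ha hb => simp only [map_add, ha, hb]
      | tmul ξ w =>
        rw [modelAct_ext, fromModel_tmul, fromModel_tmul]
        exact CliffordModule.extHom_ι_mul _ _ _ _
  exact LinearMap.congr_fun this u

theorem toModel_sec (c : D.𝔠) (u : D.FockSpace) :
    D.toModel (D.interL (D.sec c) u) = pairOp ((0, 0), (0, c)) (D.toModel u) := by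
  rw [toModel_interL, modelAct_secL]

theorem toModel_ext (β : tateDual k D.𝔟) (u : D.FockSpace) :
    D.toModel (D.exterL (D.extDual β) u) = pairOp ((β, 0), (0, 0)) (D.toModel u) := by
  rw [toModel_exterL, modelAct_extDual]

theorem G_fromModel (t : D.FockModel) : D.fockModule.G (D.fromModel t) =
    D.fromModel (TensorProduct.map (scale _ (2⁻¹ : k)).toLinearMap (scale _ (2 : k)).toLinearMap t) := by
  let S : Module.End k D.FockModel :=
    TensorProduct.map (scale _ (2⁻¹ : k)).toLinearMap (scale _ (2 : k)).toLinearMap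
  have : D.toModel ∘ₗ D.fockModule.G = S ∘ₗ D.toModel := by
    refine D.fockModule.hom_ext (fun m => ?_) (fun c u h => ?_) fun β u h => ?_
    · simp only [LinearMap.comp_apply]
      rw [CliffordModule.G_vac]
      change D.toModel (m • D.vacuum) = S (D.toModel (m • D.vacuum))
      rw [map_smul, map_smul, toModel_vacuum]
      change _ = m • scale _ (2⁻¹ : k) 1 ⊗ₜ scale _ (2 : k) 1
      rw [map_one, map_one]
    · simp only [LinearMap.comp_apply] at h ⊢
      rw [CliffordModule.G_ii, map_smul]
      exact (congrArg ((2 : k) • ·) ((D.toModel_sec c _).trans (congrArg _ h))).trans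
        ((scale_pairOp_right _ _ c _).symm.trans (congrArg S (D.toModel_sec c u).symm))
    · simp only [LinearMap.comp_apply] at h ⊢
      rw [CliffordModule.G_ee, map_smul]
      exact (congrArg ((2⁻¹ : k) • ·) ((D.toModel_ext β _).trans (congrArg _ h))).trans
        ((scale_pairOp_left _ _ β _).symm.trans (congrArg S (D.toModel_ext β u).symm))
  rw [← D.fromModel_toModel (D.fockModule.G _)]
  refine congrArg _ ((LinearMap.congr_fun this _).trans ?_)
  rw [LinearMap.comp_apply, toModel_fromModel]

theorem fromModel_mem_grade {p q : ℕ} {ξ : ExteriorAlgebra k (tateDual k D.𝔟)} {w : D.Λ𝔠}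
    (hξ : ξ ∈ ⋀[k]^p (tateDual k D.𝔟)) (hw : w ∈ ⋀[k]^q D.𝔠) :
    D.fromModel (ξ ⊗ₜ w) ∈ D.fockModule.grade (p - q) := by
  rw [CliffordModule.mem_grade, G_fromModel, TensorProduct.map_tmul, AlgHom.toLinearMap_apply,
    AlgHom.toLinearMap_apply, scale_of_mem _ hξ, scale_of_mem _ hw, TensorProduct.smul_tmul_smul,
    map_smul, neg_sub, zpow_sub₀ two_ne_zero, zpow_natCast, zpow_natCast, inv_pow, div_eq_inv_mul]

variable (M)

/-- The isomorphism of `Λ(𝔟*) ⊗ Λ(𝔠) ⊗ M` with the tensor product of `M` and the Clifford module. -/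
noncomputable def tripleEquiv : (ExteriorAlgebra k (tateDual k D.𝔟) ⊗[k] (D.Λ𝔠 ⊗[k] M)) ≃ₗ[k]
    M ⊗[k] D.FockSpace :=
  (TensorProduct.assoc k _ _ _).symm ≪≫ₗ TensorProduct.comm k _ _ ≪≫ₗ
    TensorProduct.congr (LinearEquiv.refl k M) (LinearEquiv.ofLinearMap D.fromModel D.toModel
      (LinearMap.ext D.fromModel_toModel) (LinearMap.ext D.toModel_fromModel))

theorem iSup_gradedPiece : ⨆ n : ℤ, D.gradedPiece M n = ⊤ :=
  eq_top_of_exteriorPower_tmul fun p q ξ w m hξ hw => Submodule.mem_iSup_of_mem (p - q : ℤ)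
    (Submodule.subset_span ⟨p, q, ξ, w, m, rfl, hξ, hw, rfl⟩)

theorem map_gradedPiece (n : ℤ) : (D.gradedPiece M n).map (D.tripleEquiv M).toLinearMap =
    (D.fockModule.tensor M).grade n := by
  refine (D.fockModule.tensor M).grade_eq_of_le (W := fun n =>
    (D.gradedPiece M n).map (D.tripleEquiv M).toLinearMap) (fun n => ?_) ?_ n
  · rw [Submodule.map_le_iff_le_comap, gradedPiece, Submodule.span_le]
    rintro _ ⟨p, q, ξ, w, m, rfl, hξ, hw, rfl⟩
    change m ⊗ₜ D.fromModel (ξ ⊗ₜ w) ∈ (D.fockModule.tensor M).grade (p - q)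
    rw [CliffordModule.mem_grade]
    refine (congrArg (m ⊗ₜ ·) ((CliffordModule.mem_grade _).1
      (D.fromModel_mem_grade hξ hw))).trans ?_
    exact TensorProduct.tmul_smul _ _ _
  · rw [← Submodule.map_iSup, iSup_gradedPiece, Submodule.map_top, LinearEquiv.range]

end SplitTate

end SemiInf

namespace SemiInf

namespace SplitTate

variable {k : Type*} [Field k] {𝔤 : Type*} [LieRing 𝔤] [LieAlgebra k 𝔤] [UniformSpace 𝔤]
  [IsUniformAddGroup 𝔤] (D : SplitTate k 𝔤) [CharZero k]

theorem CliffordModule.deg_of_mem_grade {D : SplitTate k 𝔤} {M Y : Type*} [AddCommGroup M]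
    [Module k M] [AddCommGroup Y] [Module k Y] {C : D.CliffordModule M Y} {p : ℤ} {T : Module.End k Y}
    (h : ∀ n, ∀ u ∈ C.grade n, T u ∈ C.grade (n + p)) : C.Deg p T := by
  have htop : LinearMap.eqLocus (C.G * T) ((2 : k) ^ (-p) • (T * C.G)) = ⊤ := by
    rw [eq_top_iff, ← C.iSup_grade]
    refine iSup_le fun n u hu => ?_
    rw [LinearMap.mem_eqLocus, Module.End.mul_apply, LinearMap.smul_apply, Module.End.mul_apply,
      C.mem_grade.1 (h n u hu), C.mem_grade.1 hu, map_smul, smul_smul, ← zpow_add₀ two_ne_zero,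
      neg_add_rev]
  exact LinearMap.ext fun u => (htop.ge trivial : u ∈ LinearMap.eqLocus _ _)

theorem isNormallyOrdered_iff {x : 𝔤} {θ : Module.End k D.Fock} :
    D.IsNormallyOrdered x θ ↔ θ = D.fockModule.theta x := by
  constructor
  · intro h
    refine D.fockModule.theta_unique h.comm_inter h.comm_exter fun m =>
      D.fockModule.vev_eq_zero_of_mem ?_
    have := Submodule.smul_mem _ m h.vac_mem
    rw [← map_smul] at this
    exact this
  · rintro rfl
    refine ⟨D.fockModule.theta_comm_ii x, D.fockModule.theta_comm_ee x, ?_⟩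
    have h := D.fockModule.theta_vac_mem x 1
    change D.fockModule.theta x ((1 : k) • D.vacuum) ∈ _ at h
    rw [one_smul] at h
    exact h

theorem gradeFock_le (n : ℤ) : (D.gradeFock n : Submodule k D.FockSpace) ≤ D.fockModule.grade n := by
  refine Submodule.span_le.2 ?_
  rintro _ ⟨xs, fs, rfl, rfl⟩
  have h0 : D.vacuum ∈ D.fockModule.grade 0 := by
    have := D.fockModule.vac_mem_grade 1
    change (1 : k) • D.vacuum ∈ _ at this
    rwa [one_smul] at this
  have h1 : ∀ fs : List (tateDual k 𝔤), (((fs.map D.exter).prod D.vac : D.Fock) : D.FockSpace) ∈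
      D.fockModule.grade fs.length := fun fs => by
    induction fs with
    | nil => exact h0
    | cons f fs ih =>
      have := (D.fockModule.deg_ee f).mem_grade ih
      rw [List.length_cons, Nat.cast_succ]
      exact this
  have h2 : ∀ xs : List 𝔤, (((xs.map D.inter).prod ((fs.map D.exter).prod D.vac) : D.Fock) :
      D.FockSpace) ∈ D.fockModule.grade (fs.length - xs.length) := fun xs => by
    induction xs with
    | nil =>
      rw [List.length_nil, Nat.cast_zero, sub_zero]
      exact h1 fs
    | cons x xs ih =>
      have := (D.fockModule.deg_ii x).mem_grade ih
      rw [List.length_cons, Nat.cast_succ, sub_add_eq_sub_sub, sub_eq_add_neg _ (1 : ℤ)]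
      exact this
  exact h2 xs

theorem iSup_gradeFock : ⨆ n : ℤ, (D.gradeFock n : Submodule k D.FockSpace) = ⊤ := by
  let S : Submodule k D.FockSpace := ⨆ n : ℤ, D.gradeFock n
  let word : List 𝔤 → List (tateDual k 𝔤) → D.FockSpace := fun xs fs =>
    (xs.map D.inter).prod ((fs.map D.exter).prod D.vac)
  have hword : ∀ xs fs, word xs fs ∈ S := fun xs fs =>
    have h : (xs.map D.inter).prod ((fs.map D.exter).prod D.vac) ∈
        D.gradeFock (fs.length - xs.length) := Submodule.subset_span ⟨xs, fs, rfl, rfl⟩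
    Submodule.mem_iSup_of_mem (p := fun n => (D.gradeFock n : Submodule k D.FockSpace)) _ h
  have hind : ∀ (T : Module.End k D.FockSpace), (∀ xs fs, T (word xs fs) ∈ S) → ∀ u ∈ S, T u ∈ S := by
    intro T hT u hu
    have : S ≤ S.comap T := iSup_le fun n => (Submodule.span_le.2 (by
      rintro _ ⟨xs, fs, -, rfl⟩
      exact hT xs fs) : D.gradeFock n ≤ (S.comap T : Submodule k D.FockSpace))
    exact this hu
  have hi : ∀ x, ∀ u ∈ S, D.interL x u ∈ S := fun x => hind _ fun xs fs => hword (x :: xs) fs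
  refine D.fockSpace_eq_top (hword [] []) hi fun f => hind _ fun xs fs => ?_
  induction xs with
  | nil => exact hword [] (f :: fs)
  | cons x xs ih =>
    change D.exterL f (D.interL x (word xs fs)) ∈ S
    rw [exterL_interL]
    exact Submodule.sub_mem _ (Submodule.smul_mem _ _ (hword xs fs)) (hi x _ ih)

theorem gradeFock_eq (n : ℤ) : (D.gradeFock n : Submodule k D.FockSpace) = D.fockModule.grade n :=
  D.fockModule.grade_eq_of_le (W := fun n => D.gradeFock n) D.gradeFock_le D.iSup_gradeFock n

variable (M : Type*) [AddCommGroup M] [Module k M]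

/-- The tensor product of `M` and the Clifford module. -/
noncomputable abbrev matterModule : D.CliffordModule M (M ⊗[k] D.FockSpace) := D.fockModule.tensor M

theorem range_lTensor_grade (n : ℤ) :
    LinearMap.range (LinearMap.lTensor M (D.fockModule.grade n).subtype) =
      (D.matterModule M).grade n := by
  refine (D.matterModule M).grade_eq_of_le (W := fun n =>
    LinearMap.range (LinearMap.lTensor M (D.fockModule.grade n).subtype)) (fun n => ?_) ?_ n
  · rintro _ ⟨t, rfl⟩
    induction t using TensorProduct.induction_on with
    | zero => rw [map_zero]; exact Submodule.zero_mem _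
    | add a b ha hb => rw [map_add]; exact Submodule.add_mem _ ha hb
    | tmul m u =>
      rw [CliffordModule.mem_grade]
      exact (congrArg (m ⊗ₜ ·) ((CliffordModule.mem_grade _).1 u.2)).trans
        (TensorProduct.tmul_smul _ _ _)
  · rw [eq_top_iff, ← TensorProduct.span_tmul_eq_top, Submodule.span_le]
    rintro _ ⟨m, u, rfl⟩
    have h : (⊤ : Submodule k D.FockSpace) ≤ (⨆ n : ℤ, LinearMap.range
        (LinearMap.lTensor M (D.fockModule.grade n).subtype)).comap (TensorProduct.mk k M _ m) := by
      rw [← D.fockModule.iSup_grade]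
      exact iSup_le fun n u hu => Submodule.mem_iSup_of_mem n ⟨m ⊗ₜ ⟨u, hu⟩, rfl⟩
    exact h (Submodule.mem_top (x := u))

theorem lTensor_theta (x : 𝔤) :
    LinearMap.lTensor M (D.fockModule.theta x) = (D.matterModule M).theta x := by
  refine (D.matterModule M).theta_unique (fun y => ?_) (fun f => ?_) fun m => ?_
  · change LinearMap.lTensor M _ * LinearMap.lTensor M _ -
      LinearMap.lTensor M _ * LinearMap.lTensor M _ = LinearMap.lTensor M (D.fockModule.ii ⁅x, y⁆)
    rw [← D.fockModule.theta_comm_ii, LinearMap.lTensor_sub, LinearMap.lTensor_mul,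
      LinearMap.lTensor_mul]
  · change LinearMap.lTensor M _ * LinearMap.lTensor M _ -
      LinearMap.lTensor M _ * LinearMap.lTensor M _ =
        LinearMap.lTensor M (D.fockModule.ee (D.coad x f))
    rw [← D.fockModule.theta_comm_ee, LinearMap.lTensor_sub, LinearMap.lTensor_mul,
      LinearMap.lTensor_mul]
  · refine (D.matterModule M).vev_eq_zero_of_mem ?_
    have h := D.fockModule.theta_vac_mem x 1
    change m ⊗ₜ D.fockModule.theta x (D.fockModule.vac 1) ∈ _
    refine (Submodule.span_le.2 ?_ : _ ≤ (Submodule.span k _).comap (TensorProduct.mk k M _ m)) h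
    rintro _ ⟨z, u, rfl⟩
    exact Submodule.subset_span ⟨z, m ⊗ₜ u, rfl⟩

variable [LieRingModule D.Sharp M] [LieModule k D.Sharp M]

theorem bdCochains_eq (n : ℤ) :
    (D.bdCochains M n : Submodule k (M ⊗[k] D.FockSpace)) = (D.matterModule M).grade n := by
  rw [← range_lTensor_grade]
  have h := D.gradeFock_eq n
  change LinearMap.range (LinearMap.lTensor M (Submodule.subtype
    (D.gradeFock n : Submodule k D.FockSpace))) = _
  rw [h]
  rfl

/-- The action of `𝔤` on `M`, extended to the tensor product with the Clifford module. -/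
noncomputable abbrev matterAction : MatterAction (D.matterModule M) := D.fockModule.tensorAction

variable {M}

theorem tot_eq (x : 𝔤) : (D.matterAction M).tot x =
    LinearMap.rTensor D.FockSpace (D.actM M x) + LinearMap.lTensor M (D.fockModule.theta x) := by
  rw [lTensor_theta]
  rfl

theorem isBRST_iff (hM : D.IsDiscreteLevelOne M) {d : Module.End k (M ⊗[k] D.Fock)} :
    D.IsBRST M d ↔ d = (D.matterAction M).brst := by
  constructor
  · rintro ⟨h1, h2⟩
    refine (D.matterAction M).brst_unique hM ?_ fun x u => ?_
    · refine (D.matterModule M).deg_of_mem_grade fun n u hu => ?_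
      rw [← bdCochains_eq] at hu ⊢
      exact h1 n u hu
    · obtain ⟨θ, hθ, h⟩ := h2 x
      rw [isNormallyOrdered_iff] at hθ
      subst hθ
      have := LinearMap.congr_fun (h.trans (D.tot_eq x).symm) u
      exact eq_sub_of_add_eq this
  · rintro rfl
    refine ⟨fun n c hc => ?_, fun x => ⟨_, D.isNormallyOrdered_iff.2 rfl, ?_⟩⟩
    · have h := ((D.matterAction M).deg_brst hM).mem_grade (n := n) (u := c)
        (D.bdCochains_eq M n ▸ hc)
      rw [← bdCochains_eq] at h
      exact h
    · exact ((D.matterAction M).brst_cartan hM x).trans (D.tot_eq x)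

end SplitTate

end SemiInf

namespace SemiInf

section Quotient

variable {k V W : Type*} [Field k] [AddCommGroup V] [Module k V] [AddCommGroup W] [Module k W]
  {A Z B : Submodule k V} {A' Z' B' : Submodule k W} (e : A ≃ₗ[k] A') (hZ : Z ≤ A) (hZ' : Z' ≤ A')
  (h : ∀ a : A, (a : V) ∈ Z ↔ (e a : W) ∈ Z')

/-- The restriction of an isomorphism of subspaces to smaller subspaces. -/
def restrictEquiv : Z ≃ₗ[k] Z' where
  toFun z := ⟨e ⟨z, hZ z.2⟩, (h _).1 z.2⟩
  map_add' x y := by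
    have := congrArg Subtype.val (map_add e ⟨x, hZ x.2⟩ ⟨y, hZ y.2⟩)
    exact Subtype.ext this
  map_smul' t x := by
    have := congrArg Subtype.val (map_smul e t ⟨x, hZ x.2⟩)
    exact Subtype.ext this
  invFun z := ⟨e.symm ⟨z, hZ' z.2⟩, (h _).2 (by rw [e.apply_symm_apply]; exact z.2)⟩
  left_inv z := by
    have := congrArg Subtype.val (e.symm_apply_apply ⟨z, hZ z.2⟩)
    exact Subtype.ext this
  right_inv z := by
    have := congrArg Subtype.val (e.apply_symm_apply ⟨z, hZ' z.2⟩)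
    exact Subtype.ext this

/-- The isomorphism of subquotients induced by an isomorphism of subspaces. -/
noncomputable def subquotientEquiv (hB : ∀ a : A, (a : V) ∈ B ↔ (e a : W) ∈ B') :
    (Z ⧸ B.submoduleOf Z) ≃ₗ[k] Z' ⧸ B'.submoduleOf Z' :=
  Submodule.Quotient.equiv _ _ (restrictEquiv e hZ hZ' h) (by
    ext z
    rw [Submodule.mem_map_equiv]
    refine (hB _).trans ?_
    rw [show e _ = ⟨z, hZ' z.2⟩ from e.apply_symm_apply ⟨z, hZ' z.2⟩]
    rfl)

end Quotient

namespace SplitTate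

variable {k : Type*} [Field k] {𝔤 : Type*} [LieRing 𝔤] [LieAlgebra k 𝔤] [UniformSpace 𝔤]
  [IsUniformAddGroup 𝔤] (D : SplitTate k 𝔤) [CharZero k]
variable (M : Type*) [AddCommGroup M] [Module k M] [LieRingModule D.Sharp M] [LieModule k D.Sharp M]

/-- The isomorphism of a component of the standard semiinfinite complex with a component of the
Beilinson–Drinfeld complex. -/
noncomputable def bdEquiv (n : ℤ) : D.cochains M n ≃ₗ[k] D.bdCochains M n :=
  ((D.matterModule M).cochainEquiv n).symm ≪≫ₗ LinearEquiv.ofEq _ _ (D.bdCochains_eq M n).symm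

/-- The BRST differential of the Beilinson–Drinfeld complex. -/
noncomputable def bdDifferential : Module.End k (M ⊗[k] D.Fock) := (D.matterAction M).brst

variable {M}

theorem expand_bdEquiv {n : ℤ} (φ : D.cochains M n) :
    (fun l => (D.matterModule M).expand l n (D.bdEquiv M n φ).1) = φ.1 :=
  congrArg Subtype.val (((D.matterModule M).cochainEquiv n).apply_symm_apply φ)

theorem differential_eq (hM : D.IsDiscreteLevelOne M) {n : ℤ} (φ : D.cochains M n) :
    D.differential M n φ.1 = fun l =>
      (D.matterModule M).expand l (n + 1) (D.bdDifferential M (D.bdEquiv M n φ).1) := by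
  conv_lhs => rw [← D.expand_bdEquiv φ]
  exact funext fun l => (D.matterAction M).differential_expand hM l n _

theorem bdDifferential_mem (hM : D.IsDiscreteLevelOne M) {n : ℤ} {u : M ⊗[k] D.Fock}
    (hu : u ∈ D.bdCochains M n) : D.bdDifferential M u ∈ D.bdCochains M (n + 1) :=
  ((D.isBRST_iff hM).2 rfl).map_mem n u hu

theorem bdDifferential_bdDifferential (hM : D.IsDiscreteLevelOne M) (u : M ⊗[k] D.Fock) :
    D.bdDifferential M (D.bdDifferential M u) = 0 :=
  LinearMap.congr_fun ((D.matterAction M).brst_brst hM) u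

theorem differential_mem_cochains (hM : D.IsDiscreteLevelOne M) {n m : ℤ} (hm : n + 1 = m)
    (φ : D.cochains M n) : D.differential M n φ.1 ∈ D.cochains M m := by
  subst hm
  rw [D.differential_eq hM]
  refine (D.matterModule M).expand_mem_cochains ?_
  rw [← bdCochains_eq]
  exact D.bdDifferential_mem hM (D.bdEquiv M n φ).2

theorem bdEquiv_differential (hM : D.IsDiscreteLevelOne M) {n m : ℤ} (hm : n + 1 = m)
    (φ : D.cochains M n) : (D.bdEquiv M m ⟨_, D.differential_mem_cochains hM hm φ⟩ : M ⊗[k] D.Fock) =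
      D.bdDifferential M (D.bdEquiv M n φ) := by
  subst hm
  let u : D.bdCochains M (n + 1) := ⟨_, D.bdDifferential_mem hM (D.bdEquiv M n φ).2⟩
  refine congrArg Subtype.val (?_ : D.bdEquiv M (n + 1) _ = u)
  rw [← LinearEquiv.eq_symm_apply]
  exact Subtype.ext (D.differential_eq hM φ)

theorem differential_differential (hM : D.IsDiscreteLevelOne M) {n : ℤ} (φ : D.cochains M n) :
    D.differential M (n + 1) (D.differential M n φ.1) = 0 := by
  have h := D.differential_eq hM ⟨_, D.differential_mem_cochains hM rfl φ⟩
  rw [D.bdEquiv_differential hM rfl, D.bdDifferential_bdDifferential hM] at h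
  exact h.trans (funext fun l => map_zero _)

theorem mem_cocycles_iff (hM : D.IsDiscreteLevelOne M) {n : ℤ} (φ : D.cochains M n) :
    φ.1 ∈ D.cocycles M n ↔ (D.bdEquiv M n φ : M ⊗[k] D.Fock) ∈ D.bdCocycles (D.bdDifferential M) n := by
  have h : D.differential M n φ.1 = 0 ↔ D.bdDifferential M (D.bdEquiv M n φ) = 0 := by
    rw [← D.bdEquiv_differential hM rfl, ZeroMemClass.coe_eq_zero, LinearEquiv.map_eq_zero_iff,
      Subtype.ext_iff]
    rfl
  exact ⟨fun hφ => ⟨Subtype.property _, h.1 hφ.2⟩, fun hφ => ⟨φ.2, h.2 hφ.2⟩⟩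

theorem mem_coboundaries_iff (hM : D.IsDiscreteLevelOne M) {n : ℤ} (φ : D.cochains M n) :
    φ.1 ∈ D.coboundaries M n ↔
      (D.bdEquiv M n φ : M ⊗[k] D.Fock) ∈ D.bdCoboundaries (D.bdDifferential M) n := by
  have hn : n - 1 + 1 = n := sub_add_cancel n 1
  constructor
  · rintro ⟨ψ, hψ, h⟩
    refine ⟨_, (D.bdEquiv M (n - 1) ⟨ψ, hψ⟩).2, ?_⟩
    have e : (⟨_, D.differential_mem_cochains hM hn ⟨ψ, hψ⟩⟩ : D.cochains M n) = φ := Subtype.ext h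
    rw [← D.bdEquiv_differential hM hn, e]
  · rintro ⟨u, hu, h⟩
    refine ⟨_, ((D.bdEquiv M (n - 1)).symm ⟨u, hu⟩).2, ?_⟩
    have h1 := D.bdEquiv_differential hM hn ((D.bdEquiv M (n - 1)).symm ⟨u, hu⟩)
    have h2 : D.bdEquiv M n ⟨_, D.differential_mem_cochains hM hn _⟩ = D.bdEquiv M n φ :=
      Subtype.ext (h1.trans ((congrArg (fun v : D.bdCochains M (n - 1) => D.bdDifferential M v.1)
        ((D.bdEquiv M (n - 1)).apply_symm_apply ⟨u, hu⟩)).trans h))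
    exact congrArg Subtype.val ((D.bdEquiv M n).injective h2)

/-- The isomorphism of the cohomology of the standard semiinfinite complex with the
Beilinson–Drinfeld semiinfinite cohomology. -/
noncomputable def cohomologyEquiv (hM : D.IsDiscreteLevelOne M) (n : ℤ) :
    D.Cohomology M n ≃ₗ[k] D.BDCohomology (D.bdDifferential M) n :=
  subquotientEquiv (D.bdEquiv M n) inf_le_left inf_le_left (D.mem_cocycles_iff hM)
    (D.mem_coboundaries_iff hM)

variable (M) in
/-- The underlying graded space of the standard semiinfinite complex. -/
noncomputable def gradedEquiv (n : ℤ) : D.cochains M n ≃ₗ[k] D.gradedPiece M n :=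
  ((D.matterModule M).cochainEquiv n).symm ≪≫ₗ
    LinearEquiv.ofEq _ _ (D.map_gradedPiece M n).symm ≪≫ₗ
      ((D.tripleEquiv M).submoduleMap (D.gradedPiece M n)).symm

end SplitTate

end SemiInf

theorem mainTheorem1 {k : Type*} [Field k] [CharZero k] {𝔤 : Type*} [LieRing 𝔤] [LieAlgebra k 𝔤]
    [UniformSpace 𝔤] [IsUniformAddGroup 𝔤] (D : SemiInf.SplitTate k 𝔤)
    (M : Type*) [AddCommGroup M] [Module k M] [LieRingModule D.Sharp M] [LieModule k D.Sharp M]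
    (hM : D.IsDiscreteLevelOne M) :
    -- the standard semiinfinite complex is a complex
    (∀ n : ℤ, ∀ φ ∈ D.cochains M n, D.differential M n φ ∈ D.cochains M (n + 1) ∧
      D.differential M (n + 1) (D.differential M n φ) = 0) ∧
    -- (i)
    (∀ n : ℤ, Nonempty (D.cochains M n ≃ₗ[k] D.gradedPiece M n)) ∧
    -- (ii): the Beilinson–Drinfeld complex is well defined, and has the same cohomology
    (∀ x : 𝔤, ∃! θ : Module.End k D.Fock, D.IsNormallyOrdered x θ) ∧
    ∃ d : Module.End k (M ⊗[k] D.Fock), D.IsBRST M d ∧ (∀ d', D.IsBRST M d' → d' = d) ∧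
      d * d = 0 ∧
      ∃ (e : ∀ n : ℤ, D.cochains M n ≃ₗ[k] D.bdCochains M n)
        (E : ∀ n : ℤ, D.Cohomology M n ≃ₗ[k] D.BDCohomology d n),
        (∀ (n : ℤ) (φ : D.cochains M n),
          ∃ h : D.differential M n φ.1 ∈ D.cochains M (n + 1),
            (e (n + 1) ⟨D.differential M n φ.1, h⟩ : M ⊗[k] D.Fock) = d (e n φ)) ∧
        ∀ (n : ℤ) (z : D.cocycles M n),
          ∃ h : (e n ⟨z.1, z.2.1⟩ : M ⊗[k] D.Fock) ∈ D.bdCocycles d n,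
            E n (Submodule.Quotient.mk z) = Submodule.Quotient.mk ⟨_, h⟩ := by
  refine ⟨fun n φ hφ => ⟨D.differential_mem_cochains hM rfl ⟨φ, hφ⟩,
    D.differential_differential hM ⟨φ, hφ⟩⟩, fun n => ⟨D.gradedEquiv M n⟩,
    fun x => ⟨_, D.isNormallyOrdered_iff.2 rfl, fun _ => D.isNormallyOrdered_iff.1⟩,
    D.bdDifferential M, (D.isBRST_iff hM).2 rfl, fun _ => (D.isBRST_iff hM).1,
    LinearMap.ext (D.bdDifferential_bdDifferential hM), D.bdEquiv M, D.cohomologyEquiv hM,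
    fun n φ => ⟨D.differential_mem_cochains hM rfl φ, D.bdEquiv_differential hM rfl φ⟩,
    fun n z => ⟨(D.mem_cocycles_iff hM ⟨z.1, z.2.1⟩).1 z.2, rfl⟩⟩
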